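/- **Setting.** Let $d\in\{2,3\}$, let $\Omega\subset\mathbb R^d$ be a nonempty open bounded convex polygon ($d=2$) or polyhedron ($d=3$), and let $k\ge 0$ be an integer. Let $\mathcal T_h$ be a matching simplicial mesh of $\Omega$ with set of faces $\mathcal F_h$ and regularity parameter at most $\varrho$ (each $T\in\mathcal T_h$ contains a ball of diameter at least $h_T/\varrho$, where $h_T$ is the diameter of $T$). $\mathcal F_T$ is the set of faces of $T$ and $n_{TF}$ the unit normal to $F$ pointing out of $T$. $\mathcal P^\ell(Y)$ is the space of polynomials of total degree at most $\ell$ restricted to $Y$ ($\mathcal P^{-1}(Y)=\{0\}$), $\pi^\ell_Y$ is the $L^2$-orthogonal projector on it (componentwise for vector fields), and $\mathcal{RTN}^{k+1}(T)=\mathcal P^k(T)^d+x\,\mathcal P^k(T)$. The space $\underline U_h^k$ consists of the $\underline v_h=((v_T)_{T\in\mathcal T_h},(v_F)_{F\in\mathcal F_h})$ with $v_T\in\mathcal{RTN}^{k+1}(T)$ and $v_F\in\mathcal P^k(F)^d$; $\underline U_{h,0}^k$ is its subspace with $v_F=0$ whenever $F\subset\partial\Omega$; and $v_h$ is the function with $(v_h)_{|T}=v_T$.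 The space $\underline P_{h,0}^k$ consists of the $\underline q_h=((q_T)_T,(q_F)_F)$ with $q_T\in\mathcal P^k(T)$, $q_F\in\mathcal P^k(F)$ and $\int_\Omega q_h=0$. With $G_T^k\underline q_T\in\mathcal{RTN}^{k+1}(T)$ defined by $\int_T G_T^k\underline q_T\cdot\omega=-\int_T q_T\,\nabla\cdot \omega+\sum_{F\in\mathcal F_T}\int_F q_F\,\omega\cdot n_{TF}$ for all $\omega\in\mathcal{RTN}^{k+1}(T)$, let $$\underline Z_{h,0}^k=\Big\{\underline v_h\in\underline U_{h,0}^k:\ \sum_{T\in\mathcal T_h}\int_T v_T\cdot G_T^k\underline q_T=0\ \text{ for all }\underline q_h\in\underline P_{h,0}^k\Big\}.$$ The interpolator is $\underline I_{U,h}^k v=((I_T v)_T,(\pi_F^k v)_F)$ for $v\in H^1(\Omega)^d$ (traces being used on faces), where $I_Tv\in\mathcal{RTN}^{k+1}(T)$ is such that $\pi_T^{k-1}I_Tv=\pi_T^{k-1}v$ and $I_Tv\cdot n_{TF}=\pi_F^k(v\cdot n_{TF})$ for all $F\in\mathcal F_T$. For a family $\alpha=(\alpha_T)_{T\in\mathcal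 T_h}$ of strictly positive real numbers, set $$t_h(\underline w_h,\underline v_h,\underline z_h)=\sum_{T\in\mathcal T_h}\Big[\int_T (w_T\cdot\nabla)v_T\cdot z_T+\tfrac12\sum_{F\in\mathcal F_T}\int_F (w_T\cdot n_{TF})(v_F-v_T)\cdot(z_F+z_T)\Big],$$ $$j_{\alpha,h}(\underline w_h,\underline v_h)=\sum_{T\in\mathcal T_h}\alpha_T\sum_{F\in\mathcal F_T}\int_F(w_F-w_T)\cdot(v_F-v_T),\qquad |\underline v_h|_{\alpha,h}=j_{\alpha,h}(\underline v_h,\underline v_h)^{1/2},$$ $$\|\underline v_h\|_{1,h}^2=\sum_{T\in\mathcal T_h}\Big[\|\nabla v_T\|_{L^2(T)}^2+h_T^{-1}\sum_{F\in\mathcal F_T}\|v_F-v_T\|_{L^2(F)}^2\Big],$$ $$\mathcal E_{\rm conv}(w,v;\underline z_h)=\int_\Omega (w\cdot\nabla)v\cdot z_h-t_h(\underline I_{U,h}^kw,\underline I_{U,h}^kv,\underline z_h).$$ Finally, $H^{k+1}(\mathcal T_h)$ is the space of functions in $L^2(\Omega)$ whose restriction to each $T\in\mathcal T_h$ is in $H^{k+1}(T)$.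 **Statement.** There is a constant $C>0$, depending only on $d$, $\Omega$, $k$ and $\varrho$ (in particular independent of the mesh size and of $\eta$, $\alpha$, $v$, $w$), such that the following holds for every mesh as above. Let $\alpha=(\alpha_T)_{T\in\mathcal T_h}$ be strictly positive real numbers, let $\eta>0$, and let $v,w\in H^1_0(\Omega)^d\cap W^{1,\infty}(\Omega)^d\cap H^{k+1}(\mathcal T_h)^d$ be such that $\nabla\cdot v=\nabla\cdot w=0$. Set $$\mathrm{Pe}_T=\frac{(\alpha_T+\|w\|_{L^\infty(T)^d})\,h_T}{\eta},\qquad \chi=\max_{T\in\mathcal T_h,\ \mathrm{Pe}_T>1}\frac{\|w\|_{L^\infty(T)^d}}{\alpha_T},$$ with $\chi=0$ if the set over which the maximum is taken is empty. Then, for all $\underline z_h\in\underline Z_{h,0}^k$, $$\begin{aligned}|\mathcal E_{\rm conv}(w,v;\underline z_h)|\le{}& C\Big[\sum_{T\in\mathcal T_h}h_T^{2(k+1)}\big(|v|_{W^{1,\infty}(T)^d}|w|_{H^{k+1}(T)^d}+|w|_{W^{1,\infty}(T)^d}|v|_{H^{k+1}(T)^d}\big)^2\Big]^{1/2}\|z_h\|_{L^2(\Omega)^d}\\&+C(1+\chi)^{1/2}\Big[\sum_{T\in\mathcal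 T_h}h_T^{2k+1}\min(1,\mathrm{Pe}_T)\|w\|_{L^\infty(T)^d}|v|_{H^{k+1}(T)^d}^2\Big]^{1/2}\big(|\underline z_h|_{\alpha,h}^2+\eta\|\underline z_h\|_{1,h}^2\big)^{1/2}\end{aligned}$$ and $$|j_{\alpha,h}(\underline I_{U,h}^kv,\underline z_h)|\le C\Big[\sum_{T\in\mathcal T_h}h_T^{2k+1}\min(1,\mathrm{Pe}_T)\,\alpha_T\,|v|_{H^{k+1}(T)^d}^2\Big]^{1/2}\big(|\underline z_h|_{\alpha,h}^2+\eta\|\underline z_h\|_{1,h}^2\big)^{1/2}.$$ -/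

import Mathlib

open MeasureTheory Filter Topology
open scoped ENNReal ContDiff

namespace HybridFE

noncomputable section

/-- The Euclidean space `ℝᵈ`. -/
abbrev Vec (d : ℕ) := EuclideanSpace ℝ (Fin d)

/-- The `j`-th vector of the canonical basis of `ℝᵈ`. -/
def basisVec {d : ℕ} (j : Fin d) : Vec d := EuclideanSpace.single j 1

/-! ### Sobolev spaces on open sets, through weak derivatives -/

/-- `φ ∈ C_c^∞(U)`. -/
def IsTestFun {d : ℕ} {V : Type*} [NormedAddCommGroup V] [NormedSpace ℝ V]
    (U : Set (Vec d)) (φ : Vec d → V) : Prop :=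
  ContDiff ℝ ∞ φ ∧ HasCompactSupport φ ∧ tsupport φ ⊆ U

/-- `g` is the weak derivative `∂_{J 0} ⋯ ∂_{J (m-1)} f` of `f` on `U`. -/
def IsWeakDeriv {d m : ℕ} (U : Set (Vec d)) (J : Fin m → Fin d) (f g : Vec d → ℝ) : Prop :=
  LocallyIntegrableOn f U ∧ LocallyIntegrableOn g U ∧
    ∀ φ : Vec d → ℝ, IsTestFun U φ →
      ∫ x in U, f x * iteratedFDeriv ℝ m φ x (fun i => basisVec (J i)) =
        (-1) ^ m * ∫ x in U, g x * φ x

open Classical in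
/-- The weak derivative (unique almost everywhere on the open set `U`), zero if there is none. -/
def weakDeriv {d m : ℕ} (U : Set (Vec d)) (J : Fin m → Fin d) (f : Vec d → ℝ) : Vec d → ℝ :=
  if h : ∃ g, IsWeakDeriv U J f g then h.choose else 0

/-- The first order weak partial derivative `∂_j f` on `U`. -/
def weakPartial {d : ℕ} (U : Set (Vec d)) (j : Fin d) (f : Vec d → ℝ) : Vec d → ℝ :=
  weakDeriv U (fun _ : Fin 1 => j) f

/-- `v ∈ W^{m,p}(U)^d`: all weak derivatives of order at most `m` exist and are in `L^p(U)`. -/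
def MemSobolev {d : ℕ} (U : Set (Vec d)) (m : ℕ) (p : ℝ≥0∞) (v : Vec d → Vec d) : Prop :=
  ∀ i : Fin d, ∀ n ≤ m, ∀ J : Fin n → Fin d,
    ∃ g, IsWeakDeriv U J (fun x => v x i) g ∧ MemLp g p (volume.restrict U)

/-- All the weak derivatives of order `m` of all the components of `v`, with the Euclidean
(Frobenius) norm. -/
def weakJet {d : ℕ} (U : Set (Vec d)) (m : ℕ) (v : Vec d → Vec d) (x : Vec d) :
    EuclideanSpace ℝ (Fin d × (Fin m → Fin d)) :=
  WithLp.toLp 2 fun a => weakDeriv U a.2 (fun y => v y a.1) x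

/-- The seminorm `|v|_{W^{m,p}(U)^d}`, i.e. the `L^p(U)`-norm of the derivatives of order `m`. -/
def sobolevSeminorm {d : ℕ} (U : Set (Vec d)) (m : ℕ) (p : ℝ≥0∞) (v : Vec d → Vec d) : ℝ :=
  (eLpNorm (weakJet U m v) p (volume.restrict U)).toReal

/-- The norm `‖v‖_{L^p(U)^d}`. -/
def lebesgueNorm {d : ℕ} (U : Set (Vec d)) (p : ℝ≥0∞) (v : Vec d → Vec d) : ℝ :=
  (eLpNorm v p (volume.restrict U)).toReal

/-- The sequence of smooth functions `φ n` converges to `v` in `H¹(U)^d`. -/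
def TendstoH1 {d : ℕ} (U : Set (Vec d)) (φ : ℕ → Vec d → Vec d) (v : Vec d → Vec d) : Prop :=
  Tendsto (fun n => eLpNorm (fun x => φ n x - v x) 2 (volume.restrict U)) atTop (𝓝 0) ∧
    ∀ i j : Fin d, Tendsto (fun n => eLpNorm
      (fun x => fderiv ℝ (φ n) x (basisVec j) i - weakPartial U j (fun y => v y i) x)
      2 (volume.restrict U)) atTop (𝓝 0)

/-- `v ∈ H¹₀(U)^d`, the closure of `C_c^∞(U)^d` in `H¹(U)^d`. -/
def MemH10 {d : ℕ} (U : Set (Vec d)) (v : Vec d → Vec d) : Prop :=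
  MemSobolev U 1 2 v ∧ ∃ φ : ℕ → Vec d → Vec d, (∀ n, IsTestFun U (φ n)) ∧ TendstoH1 U φ v

/-- `∇ · v = 0` almost everywhere in `U`. -/
def IsDivFree {d : ℕ} (U : Set (Vec d)) (v : Vec d → Vec d) : Prop :=
  ∀ᵐ x ∂volume.restrict U, ∑ i, weakPartial U i (fun y => v y i) x = 0

/-! ### Domains and meshes -/

/-- A nonempty open bounded convex polytope (a polygon if `d = 2`, a polyhedron if `d = 3`). -/
def IsConvexPolyhedralDomain {d : ℕ} (Ω : Set (Vec d)) : Prop :=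
  Ω.Nonempty ∧ ∃ S : Finset (Vec d), Ω = interior (convexHull ℝ (S : Set (Vec d)))

/-- The closed simplex with set of vertices `s`. -/
def cell {d : ℕ} (s : Finset (Vec d)) : Set (Vec d) := convexHull ℝ (s : Set (Vec d))

/-- A matching simplicial mesh of `Ω`: a finite simplicial complex which covers the closure of `Ω`
and all of whose simplices are faces of `d`-dimensional ones. Mesh entities are represented by
their sets of vertices. -/
structure SimplicialMesh {d : ℕ} (Ω : Set (Vec d)) extends
    Geometry.SimplicialComplex ℝ (Vec d) where
  finite_faces : faces.Finite
  exists_element : ∀ s ∈ faces, ∃ t ∈ faces, s ⊆ t ∧ t.card = d + 1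
  space_eq : toSimplicialComplex.space = closure Ω

namespace SimplicialMesh

variable {d : ℕ} {Ω : Set (Vec d)}

/-- The mesh elements `𝒯_h`, i.e. the `d`-dimensional simplices. -/
def elements (M : SimplicialMesh Ω) : Finset (Finset (Vec d)) :=
  M.finite_faces.toFinset.filter fun t => t.card = d + 1

/-- The mesh faces `ℱ_h`, i.e. the `(d-1)`-dimensional simplices. -/
def meshFaces (M : SimplicialMesh Ω) : Finset (Finset (Vec d)) :=
  M.finite_faces.toFinset.filter fun f => f.card = d

end SimplicialMesh

/-- The set `ℱ_T` of the faces of a simplex `T`. -/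
def facesOf {d : ℕ} (t : Finset (Vec d)) : Finset (Finset (Vec d)) := t.powersetCard d

/-- The diameter `h_T`. -/
def cellDiam {d : ℕ} (t : Finset (Vec d)) : ℝ := Metric.diam (cell t)

/-- The mesh regularity parameter is at most `ϱ`: each element contains a ball whose diameter
is at least `h_T / ϱ`. -/
def SimplicialMesh.IsRegular {d : ℕ} {Ω : Set (Vec d)} (M : SimplicialMesh Ω) (ϱ : ℝ) : Prop :=
  ∀ t ∈ M.elements, ∃ (c : Vec d) (r : ℝ), 0 < r ∧ Metric.ball c r ⊆ cell t ∧
    cellDiam t ≤ ϱ * (2 * r)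

/-- The `(d-1)`-dimensional surface measure on a mesh face. -/
def faceMeasure {d : ℕ} (f : Finset (Vec d)) : Measure (Vec d) := (μHE[d - 1]).restrict (cell f)

/-- `n` is a unit vector, normal to the face `f` of the simplex `t`, and pointing out of `t`. -/
def IsOutwardNormal {d : ℕ} (t f : Finset (Vec d)) (n : Vec d) : Prop :=
  ‖n‖ = 1 ∧ (∀ x ∈ f, ∀ y ∈ f, inner ℝ n (x - y) = 0) ∧ ∀ x ∈ t, ∀ y ∈ f, inner ℝ n (x - y) ≤ 0

/-- The outward unit normal `n_{TF}`. -/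
def outwardNormal {d : ℕ} (t f : Finset (Vec d)) : Vec d :=
  Classical.epsilon (IsOutwardNormal t f)

/-! ### Polynomial spaces, projectors and interpolators -/

/-- The value at `x` of a polynomial in the spatial variables. -/
def evalAt {d : ℕ} (p : MvPolynomial (Fin d) ℝ) (x : Vec d) : ℝ :=
  MvPolynomial.eval (fun i => x i) p

/-- The polynomial `p` has total degree at most `ℓ`; for `ℓ < 0` this means `p = 0`. -/
def DegLE {d : ℕ} (ℓ : ℤ) (p : MvPolynomial (Fin d) ℝ) : Prop :=
  p = 0 ∨ (p.totalDegree : ℤ) ≤ ℓ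

/-- `f ∈ 𝒫^ℓ(Y)`: on `Y`, `f` is a polynomial of total degree at most `ℓ`. -/
def IsPolyOn {d : ℕ} (ℓ : ℤ) (Y : Set (Vec d)) (f : Vec d → ℝ) : Prop :=
  ∃ p, DegLE ℓ p ∧ ∀ x ∈ Y, f x = evalAt p x

/-- `g` is the `L²`-orthogonal projection of `f` on `𝒫^ℓ(Y)`, where `Y` carries the measure `μ`. -/
def IsL2Proj {d : ℕ} (ℓ : ℤ) (Y : Set (Vec d)) (μ : Measure (Vec d)) (f g : Vec d → ℝ) : Prop :=
  IsPolyOn ℓ Y g ∧ ∀ r, DegLE ℓ r → ∫ x, g x * evalAt r x ∂μ = ∫ x, f x * evalAt r x ∂μ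

/-- `v ∈ RTN^ℓ(T) = 𝒫^{ℓ-1}(T)^d + x 𝒫^{ℓ-1}(T)`. -/
def IsRTN {d : ℕ} (ℓ : ℕ) (T : Set (Vec d)) (v : Vec d → Vec d) : Prop :=
  ∃ (p : Fin d → MvPolynomial (Fin d) ℝ) (q : MvPolynomial (Fin d) ℝ),
    (∀ i, DegLE ((ℓ : ℤ) - 1) (p i)) ∧ DegLE ((ℓ : ℤ) - 1) q ∧
      ∀ x ∈ T, ∀ i, v x i = evalAt (p i) x + x i * evalAt q x

/-- `g` is the trace on the face `f` of the function `v ∈ H¹(Ω)^d`: some sequence of smooth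
functions converges to `v` in `H¹(Ω)^d` and to `g` in `L²(f)^d`. -/
def IsTrace {d : ℕ} (Ω : Set (Vec d)) (f : Finset (Vec d)) (v g : Vec d → Vec d) : Prop :=
  MemLp g 2 (faceMeasure f) ∧ ∃ φ : ℕ → Vec d → Vec d,
    (∀ n, ContDiff ℝ ∞ (φ n)) ∧ TendstoH1 Ω φ v ∧
      Tendsto (fun n => eLpNorm (fun x => φ n x - g x) 2 (faceMeasure f)) atTop (𝓝 0)

/-- `u` is the Raviart--Thomas--Nédélec interpolate of order `ℓ` of `v` on the element `t`: it
belongs to `RTN^ℓ(T)`, `u` and `v` have the same `L²`-projection on `𝒫^{ℓ-2}(T)^d`, and on each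
face the normal component of `u` is the `L²`-projection on `𝒫^{ℓ-1}(F)` of that of `v`. -/
def IsRTNInterp {d : ℕ} (Ω : Set (Vec d)) (ℓ : ℕ) (t : Finset (Vec d))
    (v u : Vec d → Vec d) : Prop :=
  IsRTN ℓ (cell t) u ∧
  (∀ i, ∃ p,
    IsL2Proj ((ℓ : ℤ) - 2) (cell t) (volume.restrict (cell t)) (fun x => u x i) p ∧
    IsL2Proj ((ℓ : ℤ) - 2) (cell t) (volume.restrict (cell t)) (fun x => v x i) p) ∧
  ∀ f ∈ facesOf t, ∃ g, IsTrace Ω f v g ∧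
    IsL2Proj ((ℓ : ℤ) - 1) (cell f) (faceMeasure f)
      (fun x => inner ℝ (g x) (outwardNormal t f)) (fun x => inner ℝ (u x) (outwardNormal t f))

/-- The Raviart--Thomas--Nédélec interpolator of order `ℓ` on the element `t`. -/
def rtnInterp {d : ℕ} (Ω : Set (Vec d)) (ℓ : ℕ) (t : Finset (Vec d)) (v : Vec d → Vec d) :
    Vec d → Vec d :=
  Classical.epsilon (IsRTNInterp Ω ℓ t v)

/-- The `L²`-projection on `𝒫^k(F)^d` of the trace of `v` on the face `f`. -/
def faceProj {d : ℕ} (Ω : Set (Vec d)) (k : ℕ) (f : Finset (Vec d)) (v : Vec d → Vec d) :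
    Vec d → Vec d :=
  Classical.epsilon fun u => ∃ g, IsTrace Ω f v g ∧
    ∀ i, IsL2Proj k (cell f) (faceMeasure f) (fun x => g x i) (fun x => u x i)

/-! ### Hybrid spaces -/

/-- A hybrid field `((v_T)_T, (v_F)_F)`; only the values of `v_T` on `T` and of `v_F` on `F` are
meaningful. -/
structure HybridField (d : ℕ) (V : Type) where
  elem : Finset (Vec d) → Vec d → V
  face : Finset (Vec d) → Vec d → V

section Discrete

variable {d : ℕ} {Ω : Set (Vec d)}

/-- The broken function `v_h` such that `(v_h)_{|T} = v_T` (inside each element `T`). -/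
def broken {V : Type} [AddCommMonoid V] (M : SimplicialMesh Ω) (v : HybridField d V) (x : Vec d) :
    V :=
  ∑ t ∈ M.elements, (interior (cell t)).indicator (v.elem t) x

/-- The space `U_h^k` of hybrid vector fields. -/
def MemU (M : SimplicialMesh Ω) (k : ℕ) (v : HybridField d (Vec d)) : Prop :=
  (∀ t ∈ M.elements, IsRTN (k + 1) (cell t) (v.elem t)) ∧
    ∀ f ∈ M.meshFaces, ∀ i, IsPolyOn k (cell f) (fun x => v.face f x i)

/-- The space `U_{h,0}^k`: moreover `v_F = 0` on each face contained in the boundary. -/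
def MemU0 (M : SimplicialMesh Ω) (k : ℕ) (v : HybridField d (Vec d)) : Prop :=
  MemU M k v ∧ ∀ f ∈ M.meshFaces, cell f ⊆ frontier Ω → ∀ x ∈ cell f, v.face f x = 0

/-- The space `P_h^k` of hybrid scalar fields. -/
def MemP (M : SimplicialMesh Ω) (k : ℕ) (q : HybridField d ℝ) : Prop :=
  (∀ t ∈ M.elements, IsPolyOn k (cell t) (q.elem t)) ∧
    ∀ f ∈ M.meshFaces, IsPolyOn k (cell f) (q.face f)

/-- The space `P_{h,0}^k`: moreover `q_h` has zero average. -/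
def MemP0 (M : SimplicialMesh Ω) (k : ℕ) (q : HybridField d ℝ) : Prop :=
  MemP M k q ∧ ∫ x in Ω, broken M q x = 0

/-- The interpolator on `U_h^k`. -/
def interp (Ω : Set (Vec d)) (k : ℕ) (v : Vec d → Vec d) : HybridField d (Vec d) where
  elem t := rtnInterp Ω (k + 1) t v
  face f := faceProj Ω k f v

/-- The classical divergence. -/
def divergence (w : Vec d → Vec d) (x : Vec d) : ℝ := ∑ i, fderiv ℝ w x (basisVec i) i

/-- `G` is the discrete pressure gradient of `q` on the element `t`. -/
def IsPressureGrad (k : ℕ) (t : Finset (Vec d)) (q : HybridField d ℝ) (G : Vec d → Vec d) : Prop :=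
  IsRTN (k + 1) (cell t) G ∧ ∀ w, IsRTN (k + 1) (cell t) w →
    ∫ x in cell t, inner ℝ (G x) (w x) =
      -(∫ x in cell t, q.elem t x * divergence w x) +
        ∑ f ∈ facesOf t,
          ∫ x, q.face f x * inner ℝ (w x) (outwardNormal t f) ∂faceMeasure f

/-- The discrete pressure gradient `G_T^k q_T`. -/
def pressureGrad (k : ℕ) (t : Finset (Vec d)) (q : HybridField d ℝ) : Vec d → Vec d :=
  Classical.epsilon (IsPressureGrad k t q)

/-- The bilinear form `B_h` of the solenoidal coupling. -/
def formB (M : SimplicialMesh Ω) (k : ℕ) (v : HybridField d (Vec d)) (q : HybridField d ℝ) : ℝ :=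
  ∑ t ∈ M.elements, ∫ x in cell t, inner ℝ (v.elem t x) (pressureGrad k t q x)

/-- The discrete divergence-free space `Z_{h,0}^k`. -/
def MemZ0 (M : SimplicialMesh Ω) (k : ℕ) (v : HybridField d (Vec d)) : Prop :=
  MemU0 M k v ∧ ∀ q, MemP0 M k q → formB M k v q = 0

/-- The local convective trilinear form `t_T`. -/
def convLocal (t : Finset (Vec d)) (w v z : HybridField d (Vec d)) : ℝ :=
  (∫ x in cell t, inner ℝ (fderiv ℝ (v.elem t) x (w.elem t x)) (z.elem t x)) +
    1 / 2 * ∑ f ∈ facesOf t, ∫ x, inner ℝ (w.elem t x) (outwardNormal t f) *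
      inner ℝ (v.face f x - v.elem t x) (z.face f x + z.elem t x) ∂faceMeasure f

/-- The convective trilinear form `t_h`. -/
def convForm (M : SimplicialMesh Ω) (w v z : HybridField d (Vec d)) : ℝ :=
  ∑ t ∈ M.elements, convLocal t w v z

/-- The convective consistency error `ℰ_conv(w, v; z_h)`. -/
def convError (M : SimplicialMesh Ω) (k : ℕ) (w v : Vec d → Vec d)
    (z : HybridField d (Vec d)) : ℝ :=
  (∫ x in Ω, ∑ j, (∑ i, w x i * weakPartial Ω i (fun y => v y j) x) * broken M z x j) -
    convForm M (interp Ω k w) (interp Ω k v) z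

/-- The convective stabilization bilinear form `j_{α,h}`. -/
def stabForm (M : SimplicialMesh Ω) (α : Finset (Vec d) → ℝ) (w v : HybridField d (Vec d)) : ℝ :=
  ∑ t ∈ M.elements, α t * ∑ f ∈ facesOf t,
    ∫ x, inner ℝ (w.face f x - w.elem t x) (v.face f x - v.elem t x) ∂faceMeasure f

/-- The seminorm `|·|_{α,h}`. -/
def stabSeminorm (M : SimplicialMesh Ω) (α : Finset (Vec d) → ℝ) (v : HybridField d (Vec d)) : ℝ :=
  √(stabForm M α v v)

/-- The square of the local norm `‖·‖_{1,T}`. -/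
def normOneLocalSq (t : Finset (Vec d)) (v : HybridField d (Vec d)) : ℝ :=
  (∫ x in cell t, ∑ j, ‖fderiv ℝ (v.elem t) x (basisVec j)‖ ^ 2) +
    (cellDiam t)⁻¹ * ∑ f ∈ facesOf t, ∫ x, ‖v.face f x - v.elem t x‖ ^ 2 ∂faceMeasure f

/-- The norm `‖·‖_{1,h}`. -/
def normOne (M : SimplicialMesh Ω) (v : HybridField d (Vec d)) : ℝ :=
  √(∑ t ∈ M.elements, normOneLocalSq t v)

/-- The local Péclet number `Pe_T(η, w, α_T)`. -/
def peclet (η : ℝ) (w : Vec d → Vec d) (α : Finset (Vec d) → ℝ) (t : Finset (Vec d)) : ℝ :=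
  (α t + lebesgueNorm (cell t) ∞ w) * cellDiam t / η

/-- The number `χ(η, w, α)`, a maximum over a finite set, which is zero if this set is empty. -/
def chi (M : SimplicialMesh Ω) (η : ℝ) (w : Vec d → Vec d) (α : Finset (Vec d) → ℝ) : ℝ :=
  sSup {c | ∃ t ∈ M.elements, 1 < peclet η w α t ∧ c = lebesgueNorm (cell t) ∞ w / α t}

/-- `v` is a divergence-free function in `H¹₀(Ω)^d ∩ W^{1,∞}(Ω)^d ∩ H^{k+1}(𝒯_h)^d`. -/
def IsAdmissible (M : SimplicialMesh Ω) (k : ℕ) (v : Vec d → Vec d) : Prop :=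
  MemH10 Ω v ∧ MemSobolev Ω 1 ∞ v ∧ (∀ t ∈ M.elements, MemSobolev (interior (cell t)) (k + 1) 2 v) ∧
    IsDivFree Ω v

end Discrete

end

end HybridFE

open HybridFE

/-! The theorem is a consistency estimate, and its proof has four ingredients.

**Passing to polynomials.** A `W^{1,∞}` function on a convex domain has a Lipschitz
representative (`exists_lipRep`). By the trace inequality a trace is determined almost everywhere
(`IsTrace.ae_eq`), so the traces on the faces are the restrictions of that representative. The
interpolators, which are given by choice, are therefore the Raviart–Thomas–Nédélec interpolate
and the `L²` projections of a Lipschitz field (`exists_isLocalInterp`).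

**Interpolation estimates.** The degrees of freedom of an `RTN` field control it with a constant
which depends only on the shape regularity (`exists_rtn_stability`). The Taylor polynomial at a
point where its error is at most the mean one gives a Bramble–Hilbert bound whose constant is
uniform over convex sets (`exists_polynomial_approx`). Together they give `exists_interp_approx`.

**Local consistency.** Testing the definition of the discrete kernel with suitable hybrid scalars
shows that a member `z` of it is divergence-free on each element (`MemZ0.divPoly_eq_zero`). The same
holds for the interpolate of a divergence-free field (`IsLocalInterp.divPoly_eq_zero`). A
divergence-free `RTN` field is of degree at most `k` rather than `k + 1`
(`IsRTNPoly.degLE_of_divPoly_eq_zero`), and this is what makes the orthogonality of `v - I v` to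
degree `k - 1` and of `v - π v` to degree `k` on the faces available in the error. Integration by
parts on one element, with a constant field `e` subtracted from the interpolate `R` of `w`, writes
the error as a sum of terms with a factor `w - R` or `R - e`, an interpolation error of `v` or its
gradient, and `z`, and of face terms with the jump of `z` (`convection_identity`). In the former the
factor `w - R` or `R - e` gains the power of the mesh size which the inverse and the trace
inequality for `z` cost; in the latter the size of `R` is bounded by `‖w‖` on the element
(`convection_estimate`, `exists_mesh_element_estimate`).

**Summation over the mesh.** The jump terms are weighted by `‖w‖` (or by `α` for the
stabilization), while the norm on the right-hand side offers the two weights `α` and `η / h`. If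
`Pe ≤ 1` the second weight is used: the coefficient is at most `α + ‖w‖ = Pe * (η / h)`. If
`Pe > 1` the first one is used: the coefficient is at most `(1 + χ) * α` (`le_peclet_mul`,
`sum_jumpSq_le`). The Cauchy–Schwarz inequality for sums over the elements
(`sum_le_sqrt_mul_sqrt`) concludes. -/
open MeasureTheory Filter Topology
open scoped ENNReal ContDiff

namespace HybridFE

noncomputable section

set_option linter.unusedSectionVars false

/-! ### Geometry of a simplex -/

section Simplex

variable {d : ℕ} {ι : Type*} [Fintype ι]

/-- The closed simplex whose vertices form the affine basis `b`. -/
def simplex (b : AffineBasis ι ℝ (Vec d)) : Set (Vec d) := convexHull ℝ (Set.range b)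

/-- The facet of `simplex b` opposite to the vertex `b i`. -/
def facet (b : AffineBasis ι ℝ (Vec d)) (i : ι) : Set (Vec d) := convexHull ℝ (b '' {i}ᶜ)

/-- The surface measure on a facet. -/
def facetMeasure (b : AffineBasis ι ℝ (Vec d)) (i : ι) : Measure (Vec d) :=
  (μHE[d - 1]).restrict (facet b i)

/-- The gradient of the `i`-th barycentric coordinate. -/
def baryGrad (b : AffineBasis ι ℝ (Vec d)) (i : ι) : Vec d :=
  (InnerProductSpace.toDual ℝ (Vec d)).symm (LinearMap.toContinuousLinearMap (b.coord i).linear)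

/-- The distance from the vertex `b i` to the hyperplane of the opposite facet. -/
def height (b : AffineBasis ι ℝ (Vec d)) (i : ι) : ℝ := ‖baryGrad b i‖⁻¹

/-- The unit outward normal to the facet opposite to `b i`. -/
def facetNormal (b : AffineBasis ι ℝ (Vec d)) (i : ι) : Vec d := -(height b i • baryGrad b i)

variable (b : AffineBasis ι ℝ (Vec d)) (i : ι)

lemma inner_baryGrad (ξ : Vec d) : inner ℝ (baryGrad b i) ξ = (b.coord i).linear ξ := by
  simp [baryGrad]

lemma coord_sub (x y : Vec d) : b.coord i x - b.coord i y = inner ℝ (baryGrad b i) (x - y) := by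
  rw [inner_baryGrad]
  have := (b.coord i).linearMap_vsub x y
  simpa using this.symm

lemma coord_add (x ξ : Vec d) : b.coord i (x + ξ) = b.coord i x + inner ℝ (baryGrad b i) ξ := by
  have := coord_sub b i (x + ξ) x
  rw [add_sub_cancel_left] at this
  linarith

lemma mem_simplex {x : Vec d} : x ∈ simplex b ↔ ∀ i, 0 ≤ b.coord i x := by
  unfold simplex
  rw [b.convexHull_eq_nonneg_coord]; rfl

lemma card_index (b : AffineBasis ι ℝ (Vec d)) : Fintype.card ι = d + 1 := by
  simpa using b.card_eq_finrank_add_one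

lemma coord_le_one {x : Vec d} (hx : x ∈ simplex b) : b.coord i x ≤ 1 := by
  rw [← b.sum_coord_apply_eq_one x]
  exact Finset.single_le_sum (f := fun j => b.coord j x) (fun j _ => (mem_simplex b).1 hx j)
    (Finset.mem_univ i)

lemma baryGrad_ne_zero (hd : 1 ≤ d) : baryGrad b i ≠ 0 := by
  intro h
  have hcard := card_index b
  obtain ⟨j, hj⟩ : ∃ j, j ≠ i := by
    have : 1 < Fintype.card ι := by omega
    have := Fintype.one_lt_card_iff_nontrivial.1 this
    exact exists_ne i
  have := coord_sub b i (b i) (b j)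
  rw [h, inner_zero_left, b.coord_apply_eq, b.coord_apply_ne hj.symm] at this
  norm_num at this

lemma height_pos (hd : 1 ≤ d) : 0 < height b i :=
  inv_pos.2 (norm_pos_iff.2 (baryGrad_ne_zero b i hd))

lemma norm_baryGrad : ‖baryGrad b i‖ = (height b i)⁻¹ := by simp [height]

lemma inner_facetNormal (ξ : Vec d) :
    inner ℝ ξ (facetNormal b i) = -(height b i * inner ℝ (baryGrad b i) ξ) := by
  simp [facetNormal, inner_neg_right, inner_smul_right, real_inner_comm]

lemma norm_facetNormal (hd : 1 ≤ d) : ‖facetNormal b i‖ = 1 := by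
  have := height_pos b i hd
  rw [facetNormal, norm_neg, norm_smul, norm_baryGrad, Real.norm_of_nonneg this.le]
  field_simp

lemma convex_simplex : Convex ℝ (simplex b) := convex_convexHull _ _

lemma isCompact_simplex : IsCompact (simplex b) :=
  (Set.finite_range b).isCompact_convexHull _

lemma isCompact_facet : IsCompact (facet b i) :=
  ((Set.toFinite _).image b).isCompact_convexHull _

lemma vertex_mem : b i ∈ simplex b := subset_convexHull _ _ ⟨i, rfl⟩

lemma facet_subset : facet b i ⊆ simplex b := convexHull_mono (Set.image_subset_range _ _)

lemma coord_facet {x : Vec d} (hx : x ∈ facet b i) : b.coord i x = 0 := by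
  have : facet b i ⊆ {x | b.coord i x = 0} := by
    refine convexHull_min ?_ ?_
    · rintro _ ⟨j, hj, rfl⟩
      exact b.coord_apply_ne (by simpa using Ne.symm hj)
    · have : {x | b.coord i x = 0} = (b.coord i) ⁻¹' {0} := rfl
      rw [this]
      exact (convex_singleton _).affine_preimage _
  exact this hx

lemma mem_facet {x : Vec d} : x ∈ facet b i ↔ x ∈ simplex b ∧ b.coord i x = 0 := by
  refine ⟨fun h => ⟨facet_subset b i h, coord_facet b i h⟩, fun ⟨h, h0⟩ => ?_⟩
  classical
  have hs := b.linear_combination_coord_eq_self x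
  have h1 := b.sum_coord_apply_eq_one x
  rw [← Finset.add_sum_erase _ _ (Finset.mem_univ i), h0] at hs h1
  rw [zero_smul, zero_add] at hs
  rw [zero_add] at h1
  rw [← hs]
  refine (convex_convexHull ℝ _).sum_mem (fun j _ => (mem_simplex b).1 h j) h1 fun j hj => ?_
  exact subset_convexHull _ _ ⟨j, by simpa using Finset.ne_of_mem_erase hj, rfl⟩

lemma coord_homothety (s : ℝ) (x : Vec d) (j : ι) :
    b.coord j (AffineMap.homothety (b i) s x)
      = s * b.coord j x + (1 - s) * b.coord j (b i) := by
  have h1 : AffineMap.homothety (b i) s x = b i + s • (x - b i) := by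
    rw [AffineMap.homothety_apply, vsub_eq_sub, vadd_eq_add, add_comm]
  rw [h1, coord_add, inner_smul_right, ← coord_sub]; ring

/-- The slices of a simplex parallel to a facet are homothetic to that facet. -/
lemma slice_eq {s : ℝ} (hs : 0 < s) (hs1 : s ≤ 1) :
    simplex b ∩ {x | 1 - b.coord i x = s} = AffineMap.homothety (b i) s '' facet b i := by
  ext x
  constructor
  · rintro ⟨hx, hxs⟩
    refine ⟨AffineMap.homothety (b i) s⁻¹ x, ?_, ?_⟩
    · have hxs' : b.coord i x = 1 - s := by simp only [Set.mem_ofPred_eq] at hxs; linarith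
      rw [mem_facet, mem_simplex]
      have key : ∀ j, j ≠ i → b.coord j (AffineMap.homothety (b i) s⁻¹ x) = s⁻¹ * b.coord j x := by
        intro j hj
        rw [coord_homothety, b.coord_apply_ne hj]; ring
      have key0 : b.coord i (AffineMap.homothety (b i) s⁻¹ x) = 0 := by
        rw [coord_homothety, b.coord_apply_eq, hxs']; field_simp; ring
      refine ⟨fun j => ?_, key0⟩
      by_cases hj : j = i
      · subst hj; rw [key0]
      · rw [key j hj]
        exact mul_nonneg (inv_nonneg.2 hs.le) ((mem_simplex b).1 hx j)
    · rw [AffineMap.homothety_apply, AffineMap.homothety_apply]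
      simp [smul_smul, hs.ne']
  · rintro ⟨y, hy, rfl⟩
    refine ⟨(mem_simplex b).2 fun j => ?_, ?_⟩
    · rw [coord_homothety]
      have := (mem_simplex b).1 (facet_subset b i hy) j
      have h2 := (mem_simplex b).1 (vertex_mem b i) j
      have : 0 ≤ 1 - s := by linarith
      positivity
    · simp only [Set.mem_ofPred_eq]
      rw [coord_homothety, coord_facet b i hy, b.coord_apply_eq]; ring

lemma measurableSet_simplex : MeasurableSet (simplex b) := (isCompact_simplex b).measurableSet

lemma measurableSet_facet : MeasurableSet (facet b i) := (isCompact_facet b i).measurableSet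

lemma continuous_coord : Continuous (b.coord i) := (b.coord i).continuous_of_finiteDimensional

/-- Volume as an integral of the areas of the slices parallel to a facet. Here `s = 1 - λᵢ`, and
the Jacobian is the height because `λᵢ` decreases from `1` to `0` over that distance. -/
lemma volume_eq_lintegral_slice (hd : 1 ≤ d) {A : Set (Vec d)} (hA : MeasurableSet A) :
    volume A = ENNReal.ofReal (height b i) *
      ∫⁻ s : ℝ, μHE[d - 1] (A ∩ {x | 1 - b.coord i x = s}) := by
  have hδ := height_pos b i hd
  set v : Vec d := -((height b i) ^ 2 • baryGrad b i) with hv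
  have hnv : ‖v‖ = height b i := by
    rw [hv, norm_neg, norm_smul, norm_baryGrad, Real.norm_of_nonneg (by positivity)]
    field_simp
  have hv0 : v ≠ 0 := by
    rw [← norm_pos_iff, hnv]; exact hδ
  have h := EuclideanGeometry.euclideanHausdorffMeasure_eq_lintegral (b i) hv0 hA
  have hE : (μHE[Module.finrank ℝ (Vec d)] : Measure (Vec d)) = volume :=
    InnerProductSpace.euclideanHausdorffMeasure_eq_volume
  rw [hE] at h
  rw [h]
  have hfr : Module.finrank ℝ (Vec d) = d := by simp
  congr 1
  · rw [← hnv, ← ofReal_norm]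
  · refine lintegral_congr fun s => ?_
    rw [hfr]
    congr 2
    ext x
    simp only [SetLike.mem_coe, AffineSubspace.mem_mk', Submodule.mem_orthogonal_singleton_iff_inner_right,
      vsub_eq_sub, vadd_eq_add, Set.mem_ofPred_eq]
    have e1 : inner ℝ v (x - (s • v + b i)) = inner ℝ v (x - b i) - s * ‖v‖ ^ 2 := by
      rw [show x - (s • v + b i) = (x - b i) - s • v by abel, inner_sub_right, inner_smul_right,
        real_inner_self_eq_norm_sq]
    have e2 : inner ℝ v (x - b i) = height b i ^ 2 * (1 - b.coord i x) := by
      rw [hv, inner_neg_left, inner_smul_left, ← coord_sub, b.coord_apply_eq]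
      simp; ring
    rw [e1, e2, hnv]
    have : height b i ^ 2 * (1 - b.coord i x) - s * height b i ^ 2
      = height b i ^ 2 * ((1 - b.coord i x) - s) := by ring
    rw [this]
    constructor
    · intro h
      rcases mul_eq_zero.1 h with h | h
      · exact absurd h (by positivity)
      · linarith
    · intro h; rw [h]; simp

/-- Volume in a simplex by slicing: the slice `s` is the facet scaled by `s` from the vertex `b i`,
so that its `(d - 1)`-dimensional measure carries the factor `s ^ (d - 1)`. -/
lemma volume_inter_simplex (hd : 1 ≤ d) {A : Set (Vec d)} (hA : MeasurableSet A) :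
    volume (A ∩ simplex b) = ENNReal.ofReal (height b i) *
      ∫⁻ s in Set.Ioc (0 : ℝ) 1, ENNReal.ofReal (s ^ (d - 1)) *
        facetMeasure b i (AffineMap.homothety (b i) s ⁻¹' A) := by
  rw [volume_eq_lintegral_slice b i hd (hA.inter (measurableSet_simplex b))]
  congr 1
  rw [← lintegral_indicator measurableSet_Ioc]
  refine lintegral_congr_ae ?_
  have h0 : ∀ᵐ s : ℝ, s ≠ 0 := by simp [ae_iff, measure_singleton]
  filter_upwards [h0] with s hs0
  by_cases hs : s ∈ Set.Ioc (0 : ℝ) 1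
  · rw [Set.indicator_of_mem hs, Set.inter_assoc, slice_eq b i hs.1 hs.2, facetMeasure,
      Measure.restrict_apply', ← Set.image_preimage_inter, euclideanHausdorffMeasure_homothety_image _ _ hs0]
    · rw [ENNReal.smul_def, smul_eq_mul]
      congr 1
      rw [ENNReal.ofReal_pow hs.1.le, ENNReal.coe_pow, Real.nnnorm_of_nonneg hs.1.le,
        ENNReal.ofReal, Real.toNNReal_of_nonneg hs.1.le]
    · exact measurableSet_facet b i
  · rw [Set.indicator_of_notMem hs]
    suffices he : A ∩ simplex b ∩ {x | 1 - b.coord i x = s} = ∅ by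
      rw [he, measure_empty]
    ext x
    simp only [Set.mem_inter_iff, Set.mem_ofPred_eq, Set.mem_empty_iff_false, iff_false, not_and]
    rintro ⟨-, hx⟩ hxs
    have h1 := (mem_simplex b).1 hx i
    have h2 := coord_le_one b i hx
    exact hs ⟨lt_of_le_of_ne (by linarith) (Ne.symm hs0), by linarith⟩

lemma volume_simplex_ne_top : volume (simplex b) ≠ ⊤ := (isCompact_simplex b).measure_lt_top.ne

/-- A facet has finite area: otherwise the slicing formula would give the simplex infinite volume. -/
lemma facetMeasure_univ_lt_top (hd : 1 ≤ d) : facetMeasure b i Set.univ < ⊤ := by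
  by_contra h
  have h : facetMeasure b i Set.univ = ⊤ := by simpa using h
  have := volume_inter_simplex b i hd MeasurableSet.univ
  simp only [Set.preimage_univ, h, Set.univ_inter] at this
  refine volume_simplex_ne_top b ?_
  rw [this]
  have hδ := height_pos b i hd
  refine ENNReal.mul_eq_top.2 (Or.inl ⟨by simpa using hδ, ?_⟩)
  have : ∫⁻ s in Set.Ioc (0 : ℝ) 1, ENNReal.ofReal (s ^ (d - 1)) * ⊤
      = ∫⁻ s in Set.Ioc (0 : ℝ) 1, ⊤ := by
    refine setLIntegral_congr_fun measurableSet_Ioc fun s hs => ?_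
    have : 0 < s ^ (d - 1) := pow_pos hs.1 _
    rw [ENNReal.mul_top]
    simpa using this
  rw [this]; simp

lemma isFiniteMeasure_facetMeasure (hd : 1 ≤ d) : IsFiniteMeasure (facetMeasure b i) :=
  ⟨facetMeasure_univ_lt_top b i hd⟩

/-- The parametrization `(s, y) ↦ b i + s (y - b i)` of the simplex by the cone over a facet. -/
def coneMap (p : ℝ × Vec d) : Vec d := b i + p.1 • (p.2 - b i)

lemma continuous_coneMap : Continuous (coneMap b i) := by unfold coneMap; fun_prop

/-- The weight `s^{d-1} ds` on `(0, 1]`. -/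
def coneWeight (d : ℕ) : Measure ℝ :=
  (volume.restrict (Set.Ioc (0 : ℝ) 1)).withDensity fun s => ENNReal.ofReal (s ^ (d - 1))

instance : SFinite (coneWeight d) := by unfold coneWeight; infer_instance

/-- The Lebesgue measure on a simplex in conical coordinates with respect to a vertex. -/
theorem volume_restrict_simplex (hd : 1 ≤ d) :
    volume.restrict (simplex b) = ENNReal.ofReal (height b i) •
      ((coneWeight d).prod (facetMeasure b i)).map (coneMap b i) := by
  have := isFiniteMeasure_facetMeasure b i hd
  ext A hA
  rw [Measure.restrict_apply hA, volume_inter_simplex b i hd hA, Measure.smul_apply, smul_eq_mul,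
    Measure.map_apply (continuous_coneMap b i).measurable hA,
    Measure.prod_apply ((continuous_coneMap b i).measurable hA)]
  congr 1
  rw [coneWeight, lintegral_withDensity_eq_lintegral_mul₀]
  · refine lintegral_congr fun s => ?_
    simp only [Pi.mul_apply]
    congr 2
    ext y
    simp [coneMap, AffineMap.homothety_apply, add_comm]
  · fun_prop
  · exact (measurable_measure_prodMk_left ((continuous_coneMap b i).measurable hA)).aemeasurable

/-- Integration of continuous functions in conical coordinates. -/
theorem integral_simplex_cone (hd : 1 ≤ d) {g : Vec d → ℝ} (hg : Continuous g) :
    ∫ x in simplex b, g x = height b i *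
      ∫ y, (∫ s in (0:ℝ)..1, s ^ (d - 1) * g (coneMap b i (s, y))) ∂facetMeasure b i := by
  have hfin := isFiniteMeasure_facetMeasure b i hd
  have hδ := height_pos b i hd
  have hint : Integrable g (volume.restrict (simplex b)) :=
    hg.continuousOn.integrableOn_compact (isCompact_simplex b)
  have hc := (continuous_coneMap b i)
  rw [volume_restrict_simplex b i hd] at hint ⊢
  rw [integral_smul_measure, ENNReal.toReal_ofReal hδ.le, smul_eq_mul]
  congr 1
  rw [integral_map hc.aemeasurable (hg.aestronglyMeasurable)]
  have hint2 : Integrable (fun p => g (coneMap b i p)) ((coneWeight d).prod (facetMeasure b i)) := by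
    have h3 := (integrable_smul_measure (by simpa using hδ) (by simp)).1 hint
    exact (integrable_map_measure hg.aestronglyMeasurable hc.aemeasurable).1 h3
  rw [integral_prod_symm _ hint2]
  refine integral_congr_ae (Eventually.of_forall fun y => ?_)
  change ∫ s, g (coneMap b i (s, y)) ∂coneWeight d = _
  rw [coneWeight, integral_withDensity_eq_integral_toReal_smul (by fun_prop) (by simp)]
  beta_reduce
  rw [intervalIntegral.integral_of_le zero_le_one]
  refine setIntegral_congr_fun measurableSet_Ioc fun s hs => ?_
  rw [smul_eq_mul, ENNReal.toReal_ofReal (pow_nonneg hs.1.le _)]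

/-- The divergence theorem for the fields `(x - b i) φ`, whose flux is concentrated on one facet. -/
theorem integral_facet_eq (hd : 1 ≤ d) {φ : Vec d → ℝ} (hφ : ContDiff ℝ 1 φ) :
    height b i * ∫ y, φ y ∂facetMeasure b i =
      ∫ x in simplex b, (d * φ x + fderiv ℝ φ x (x - b i)) := by
  have hcd : Continuous (fderiv ℝ φ) := hφ.continuous_fderiv (by simp)
  have hcφ := hφ.continuous
  rw [integral_simplex_cone b i hd (by fun_prop)]
  congr 1
  refine integral_congr_ae (Eventually.of_forall fun y => ?_)
  have hder : ∀ s ∈ Set.uIcc (0:ℝ) 1, HasDerivAt (fun s : ℝ => s ^ d * φ (coneMap b i (s, y)))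
      (s ^ (d - 1) * (d * φ (coneMap b i (s, y)) +
        fderiv ℝ φ (coneMap b i (s, y)) (coneMap b i (s, y) - b i))) s := by
    intro s _
    have h1 : HasDerivAt (fun s : ℝ => coneMap b i (s, y)) (y - b i) s := by
      simpa [coneMap] using ((hasDerivAt_id s).smul_const (y - b i)).const_add (b i)
    have h2 := ((hφ.differentiable (by simp)) (coneMap b i (s, y))).hasFDerivAt.comp_hasDerivAt s h1
    have h3 := (hasDerivAt_pow d s).mul h2
    refine HasDerivAt.congr_deriv (f := fun s : ℝ => s ^ d * φ (coneMap b i (s, y))) h3 ?_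
    simp only [coneMap, add_sub_cancel_left, map_smul, smul_eq_mul]
    obtain ⟨m, rfl⟩ : ∃ m, d = m + 1 := ⟨d - 1, by omega⟩
    simp only [Nat.add_sub_cancel, pow_succ, Function.comp]
    ring
  symm
  refine (intervalIntegral.integral_eq_sub_of_hasDerivAt hder ?_).trans ?_
  rotate_left
  · have : d ≠ 0 := by omega
    simp [this, coneMap]
  · apply Continuous.intervalIntegrable
    have hcc : Continuous fun s : ℝ => coneMap b i (s, y) := by unfold coneMap; fun_prop
    fun_prop

lemma sum_inner_baryGrad (ξ : Vec d) : ∑ j, inner ℝ (baryGrad b j) ξ = 0 := by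
  have h0 := b.sum_coord_apply_eq_one (0 : Vec d)
  have h1 := b.sum_coord_apply_eq_one (0 + ξ)
  simp only [coord_add, Finset.sum_add_distrib] at h1
  linarith

lemma sum_inner_baryGrad_smul (ξ : Vec d) : ∑ j, inner ℝ (baryGrad b j) ξ • b j = ξ := by
  have h0 := b.linear_combination_coord_eq_self (0 : Vec d)
  have h1 := b.linear_combination_coord_eq_self (0 + ξ)
  simp only [coord_add, add_smul, Finset.sum_add_distrib] at h1
  rw [h0] at h1
  simpa using h1

lemma integrableOn_simplex {g : Vec d → ℝ} (hg : Continuous g) :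
    Integrable g (volume.restrict (simplex b)) :=
  hg.continuousOn.integrableOn_compact (isCompact_simplex b)

lemma memLp_of_continuous {E : Type*} [NormedAddCommGroup E] {μ : Measure (Vec d)}
    [IsFiniteMeasure μ] {K : Set (Vec d)} (hK : IsCompact K) (hμ : ∀ᵐ x ∂μ, x ∈ K)
    {g : Vec d → E} (hg : Continuous g) (p : ℝ≥0∞) : MemLp g p μ := by
  obtain ⟨C, hC⟩ := hK.exists_bound_of_continuousOn hg.continuousOn
  exact MemLp.of_bound hg.aestronglyMeasurable C (hμ.mono fun x hx => hC x hx)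

lemma ae_mem_facet : ∀ᵐ x ∂facetMeasure b i, x ∈ facet b i :=
  ae_restrict_mem (measurableSet_facet b i)

lemma memLp_facetMeasure {E : Type*} [NormedAddCommGroup E] (hd : 1 ≤ d) {g : Vec d → E}
    (hg : Continuous g) (p : ℝ≥0∞) : MemLp g p (facetMeasure b i) :=
  have := isFiniteMeasure_facetMeasure b i hd
  memLp_of_continuous (isCompact_facet b i) (ae_mem_facet b i) hg p

lemma isFiniteMeasure_simplex : IsFiniteMeasure (volume.restrict (simplex b)) :=
  ⟨by simpa using (isCompact_simplex b).measure_lt_top⟩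

lemma memLp_simplex {E : Type*} [NormedAddCommGroup E] {g : Vec d → E}
    (hg : Continuous g) (p : ℝ≥0∞) : MemLp g p (volume.restrict (simplex b)) :=
  have := isFiniteMeasure_simplex b
  memLp_of_continuous (isCompact_simplex b) (ae_restrict_mem (measurableSet_simplex b)) hg p

lemma integrable_facetMeasure (hd : 1 ≤ d) {g : Vec d → ℝ} (hg : Continuous g) :
    Integrable g (facetMeasure b i) :=
  memLp_one_iff_integrable.1 (memLp_facetMeasure b i hd hg 1)

/-- The divergence theorem on a simplex. -/
theorem integral_fderiv_simplex (hd : 1 ≤ d) {φ : Vec d → ℝ} (hφ : ContDiff ℝ 1 φ) (ξ : Vec d) :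
    ∫ x in simplex b, fderiv ℝ φ x ξ =
      ∑ j, ∫ y, inner ℝ ξ (facetNormal b j) * φ y ∂facetMeasure b j := by
  have hcd : Continuous (fderiv ℝ φ) := hφ.continuous_fderiv (by simp)
  have hcφ := hφ.continuous
  have h1 : ∀ j, ∫ y, inner ℝ ξ (facetNormal b j) * φ y ∂facetMeasure b j =
      ∫ x in simplex b, -(inner ℝ (baryGrad b j) ξ * (d * φ x + fderiv ℝ φ x (x - b j))) := by
    intro j
    rw [integral_const_mul, inner_facetNormal, integral_neg, integral_const_mul,
      ← integral_facet_eq b j hd hφ]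
    ring
  simp_rw [h1]
  rw [← integral_finsetSum]
  · refine integral_congr_ae (Eventually.of_forall fun x => ?_)
    beta_reduce
    -- `∑ ⟨∇λⱼ, ξ⟩ = 0` and `∑ ⟨∇λⱼ, ξ⟩ bⱼ = ξ`: the formulas for the fields `(x - bⱼ) φ`, weighted
    -- by `-⟨∇λⱼ, ξ⟩`, add up to the one for `ξ φ`
    have e1 := sum_inner_baryGrad b ξ
    have e2 := congrArg (fderiv ℝ φ x) (sum_inner_baryGrad_smul b ξ)
    rw [map_sum] at e2
    simp only [map_smul, smul_eq_mul] at e2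
    rw [← e2, Finset.sum_neg_distrib]
    simp only [map_sub, mul_add, mul_sub, Finset.sum_add_distrib, Finset.sum_sub_distrib,
      ← Finset.sum_mul]
    rw [e1]; ring
  · intro j _
    exact integrableOn_simplex b (by fun_prop)

/-- The volume of a cone: height times area of the base is `d` times the volume. -/
lemma height_mul_area (hd : 1 ≤ d) :
    height b i * (facetMeasure b i).real Set.univ = d * volume.real (simplex b) := by
  have := integral_facet_eq b i hd (φ := fun _ => 1) contDiff_const
  simpa [Measure.real, mul_comm] using this

lemma dist_le_diam {x y : Vec d} (hx : x ∈ simplex b) (hy : y ∈ simplex b) :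
    ‖x - y‖ ≤ Metric.diam (simplex b) := by
  rw [← dist_eq_norm]
  exact Metric.dist_le_diam_of_mem (isCompact_simplex b).isBounded hx hy

/-- The trace inequality on a facet of a simplex. -/
theorem integral_facet_sq_le (hd : 1 ≤ d) {u : Vec d → ℝ} (hu : ContDiff ℝ 1 u) :
    height b i * ∫ y, u y ^ 2 ∂facetMeasure b i ≤
      (d + 1) * (∫ x in simplex b, u x ^ 2) +
        Metric.diam (simplex b) ^ 2 * ∫ x in simplex b, ‖fderiv ℝ u x‖ ^ 2 := by
  have hcd : Continuous (fderiv ℝ u) := hu.continuous_fderiv (by simp)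
  have hcu := hu.continuous
  rw [integral_facet_eq b i hd (φ := fun x => u x ^ 2) (hu.pow 2), ← integral_const_mul,
    ← integral_const_mul, ← integral_add (integrableOn_simplex b (by fun_prop))
      (integrableOn_simplex b (by fun_prop))]
  have hder : ∀ x, fderiv ℝ (fun x => u x ^ 2) x = (2 * u x) • fderiv ℝ u x := by
    intro x
    have := (((hu.differentiable (by simp)) x).hasFDerivAt.pow 2).fderiv
    simpa using this
  refine setIntegral_mono_on ?_ ?_ (measurableSet_simplex b) fun x hx => ?_
  · simp_rw [hder]
    exact integrableOn_simplex b (by fun_prop)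
  · exact integrableOn_simplex b (by fun_prop)
  · rw [hder]
    have h1 : |fderiv ℝ u x (x - b i)| ≤ Metric.diam (simplex b) * ‖fderiv ℝ u x‖ := by
      rw [← Real.norm_eq_abs, mul_comm]
      refine ((fderiv ℝ u x).le_opNorm _).trans ?_
      gcongr
      exact dist_le_diam b hx (vertex_mem b i)
    have h2 := abs_le.1 h1
    set D := fderiv ℝ u x (x - b i)
    set E := Metric.diam (simplex b) * ‖fderiv ℝ u x‖
    have hDE : D ^ 2 ≤ E ^ 2 := sq_le_sq' h2.1 h2.2
    have : 2 * u x * D ≤ u x ^ 2 + D ^ 2 := by nlinarith [sq_nonneg (u x - D)]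
    simp only [smul_apply, smul_eq_mul]
    have e : Metric.diam (simplex b) ^ 2 * ‖fderiv ℝ u x‖ ^ 2 = E ^ 2 := by ring
    rw [e]
    linarith

lemma height_le_diam (hd : 1 ≤ d) : height b i ≤ Metric.diam (simplex b) := by
  have hδ := height_pos b i hd
  have hcard := card_index b
  obtain ⟨j, hj⟩ : ∃ j, j ≠ i := by
    have : 1 < Fintype.card ι := by omega
    have := Fintype.one_lt_card_iff_nontrivial.1 this
    exact exists_ne i
  have h := coord_sub b i (b i) (b j)
  rw [b.coord_apply_eq, b.coord_apply_ne hj.symm] at h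
  have h1 := real_inner_le_norm (baryGrad b i) (b i - b j)
  have h2 := dist_le_diam b (vertex_mem b i) (vertex_mem b j)
  rw [← h, norm_baryGrad] at h1
  have : height b i ≤ ‖b i - b j‖ := by
    rw [sub_zero] at h1
    rwa [← div_eq_inv_mul, le_div_iff₀ hδ, one_mul] at h1
  linarith

/-- The simplex contains the ball `B(c, r)` and its diameter is at most `2 ϱ r`. -/
structure ShapeRegular (b : AffineBasis ι ℝ (Vec d)) (ϱ : ℝ) (c : Vec d) (r : ℝ) : Prop where
  pos : 0 < r
  ball_subset : Metric.ball c r ⊆ simplex b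
  diam_le : Metric.diam (simplex b) ≤ ϱ * (2 * r)

namespace ShapeRegular

variable {b} {ϱ : ℝ} {c : Vec d} {r : ℝ} (H : ShapeRegular b ϱ c r)
include H

lemma center_mem : c ∈ simplex b := H.ball_subset (Metric.mem_ball_self H.pos)

lemma closedBall_subset : Metric.closedBall c r ⊆ simplex b := by
  rw [← closure_ball c H.pos.ne']
  exact closure_minimal H.ball_subset (isCompact_simplex b).isClosed

/-- The points of the ball at distance `r` from `c` along the normal remain in the simplex, which
keeps the barycentric coordinates of `c` away from `0` and `1`. -/
lemma coord_center (hd : 1 ≤ d) :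
    r / height b i ≤ b.coord i c ∧ b.coord i c ≤ 1 - r / height b i := by
  have hδ := height_pos b i hd
  have hr := H.pos
  -- the two endpoints `c ± r n` of the diameter of the ball along the normal `n`
  have key : ∀ s : ℝ, |s| = 1 → c + (s * (r * height b i)) • baryGrad b i ∈ simplex b ∧
      b.coord i (c + (s * (r * height b i)) • baryGrad b i) = b.coord i c + s * (r / height b i) := by
    intro s hs
    constructor
    · apply H.closedBall_subset
      rw [Metric.mem_closedBall, dist_eq_norm, add_sub_cancel_left, norm_smul, norm_baryGrad,
        norm_mul, Real.norm_eq_abs, hs, one_mul, Real.norm_of_nonneg (by positivity)]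
      field_simp; rfl
    · rw [coord_add, inner_smul_right, real_inner_self_eq_norm_sq, norm_baryGrad]
      field_simp
  have h1 := key 1 (by simp)
  have h2 := key (-1) (by simp)
  have h3 := coord_le_one b i h1.1
  have h4 := (mem_simplex b).1 h2.1 i
  rw [h1.2] at h3
  rw [h2.2] at h4
  constructor <;> linarith

lemma two_mul_r_le_height (hd : 1 ≤ d) : 2 * r ≤ height b i := by
  have hδ := height_pos b i hd
  have := H.coord_center i hd
  have h : 2 * (r / height b i) ≤ 1 := by linarith
  rw [← mul_div_assoc, div_le_one hδ] at h
  exact h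

lemma two_mul_r_le_diam (hd : 1 ≤ d) : 2 * r ≤ Metric.diam (simplex b) := by
  obtain ⟨i⟩ : Nonempty ι := by
    have := card_index b
    exact Fintype.card_pos_iff.1 (by omega)
  exact (H.two_mul_r_le_height i hd).trans (height_le_diam b i hd)

lemma diam_pos (hd : 1 ≤ d) : 0 < Metric.diam (simplex b) :=
  lt_of_lt_of_le (by linarith [H.pos]) (H.two_mul_r_le_diam hd)

lemma one_le (hd : 1 ≤ d) : 1 ≤ ϱ := by
  have h := (H.two_mul_r_le_diam hd).trans H.diam_le
  have := H.pos
  nlinarith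

lemma subset_closedBall : simplex b ⊆ Metric.closedBall c (2 * ϱ * r) := by
  intro x hx
  rw [Metric.mem_closedBall, dist_eq_norm]
  have h1 := dist_le_diam b hx H.center_mem
  have := H.diam_le
  linarith

/-- On a shape-regular simplex a vector is controlled by its components along the normals. -/
lemma norm_le_sum (hd : 1 ≤ d) (ξ : Vec d) :
    ‖ξ‖ ≤ ϱ * ∑ j, |inner ℝ ξ (facetNormal b j)| := by
  -- any base point may be subtracted from the vertices, since the gradients `∇λⱼ` sum to zero
  have e1 : ξ = ∑ j, inner ℝ (baryGrad b j) ξ • (b j - c) := by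
    simp only [smul_sub, Finset.sum_sub_distrib, ← Finset.sum_smul]
    rw [sum_inner_baryGrad_smul, sum_inner_baryGrad]; simp
  have hr := H.pos
  calc ‖ξ‖ = ‖∑ j, inner ℝ (baryGrad b j) ξ • (b j - c)‖ := by rw [← e1]
    _ ≤ ∑ j, ϱ * |inner ℝ ξ (facetNormal b j)| := by
        refine norm_sum_le_of_le _ fun j _ => ?_
        have hδ := height_pos b j hd
        rw [norm_smul, inner_facetNormal, abs_neg, abs_mul, abs_of_pos hδ, Real.norm_eq_abs]
        have h1 := dist_le_diam b (vertex_mem b j) H.center_mem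
        have h2 := H.diam_le
        have h3 := H.two_mul_r_le_height j hd
        have h4 := H.one_le hd
        have : ‖b j - c‖ ≤ ϱ * height b j := by nlinarith
        calc _ ≤ |inner ℝ (baryGrad b j) ξ| * (ϱ * height b j) := by gcongr
          _ = _ := by ring
    _ = _ := by rw [Finset.mul_sum]

end ShapeRegular

/-- A unit vector which is orthogonal to a facet and points outwards is the outward normal. -/
lemma eq_facetNormal (hd : 1 ≤ d) {n : Vec d} (h1 : ‖n‖ = 1)
    (h2 : ∀ j, j ≠ i → ∀ l, l ≠ i → inner ℝ n (b j - b l) = 0)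
    (h3 : ∀ j, j ≠ i → inner ℝ n (b i - b j) ≤ 0) : n = facetNormal b i := by
  classical
  have hδ := height_pos b i hd
  have hcard := card_index b
  obtain ⟨l, hl⟩ : ∃ j, j ≠ i := by
    have : 1 < Fintype.card ι := by omega
    have := Fintype.one_lt_card_iff_nontrivial.1 this
    exact exists_ne i
  set α := inner ℝ n (b i - b l) with hα
  have hn : n = α • baryGrad b i := by
    refine ext_inner_right ℝ fun ξ => ?_
    have e1 : ξ = ∑ j, inner ℝ (baryGrad b j) ξ • (b j - b l) := by
      simp only [smul_sub, Finset.sum_sub_distrib, ← Finset.sum_smul]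
      rw [sum_inner_baryGrad_smul, sum_inner_baryGrad]; simp
    conv_lhs => rw [e1]
    rw [inner_sum, Finset.sum_eq_single i]
    · rw [inner_smul_right, inner_smul_left]; simp [hα]; ring
    · intro j _ hj
      rw [inner_smul_right, h2 j hj l hl, mul_zero]
    · simp
  have hα0 : α ≤ 0 := h3 l hl
  have h4 : |α| * (height b i)⁻¹ = 1 := by
    rw [← h1, hn, norm_smul, norm_baryGrad, Real.norm_eq_abs]
  rw [abs_of_nonpos hα0] at h4
  have h5 : α = - height b i := by
    field_simp at h4
    linarith
  rw [hn, h5, facetNormal, neg_smul]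

lemma inner_facetNormal_facet (x y : Vec d) (hx : x ∈ facet b i) (hy : y ∈ facet b i) :
    inner ℝ x (facetNormal b i) = inner ℝ y (facetNormal b i) := by
  have := coord_sub b i x y
  rw [coord_facet b i hx, coord_facet b i hy, inner_sub_right, sub_zero] at this
  rw [inner_facetNormal, inner_facetNormal]
  have h : inner ℝ (baryGrad b i) x = inner ℝ (baryGrad b i) y := by linarith
  rw [h]

end Simplex

/-! ### The `L²` norm as a real number -/

section L2

variable {X E : Type*} [MeasurableSpace X] [NormedAddCommGroup E] {μ : Measure X}

/-- The `L²` norm, as a real number; the value is `0` where the norm is infinite. -/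
def l2 (μ : Measure X) (f : X → E) : ℝ := (eLpNorm f 2 μ).toReal

lemma l2_nonneg (f : X → E) : 0 ≤ l2 μ f := ENNReal.toReal_nonneg

lemma l2_sq {f : X → E} (hf : MemLp f 2 μ) : l2 μ f ^ 2 = ∫ x, ‖f x‖ ^ 2 ∂μ := by
  have h := hf.eLpNorm_eq_integral_rpow_norm (by simp) (by simp)
  have h0 : 0 ≤ ∫ x, ‖f x‖ ^ 2 ∂μ := integral_nonneg fun x => by positivity
  simp only [ENNReal.toReal_ofNat, Real.rpow_ofNat] at h
  rw [l2, h, ENNReal.toReal_ofReal (by positivity), ← Real.rpow_natCast, ← Real.rpow_mul h0]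
  norm_num

lemma l2_eq_sqrt {f : X → E} (hf : MemLp f 2 μ) : l2 μ f = √(∫ x, ‖f x‖ ^ 2 ∂μ) := by
  rw [← l2_sq hf, Real.sqrt_sq (l2_nonneg f)]

lemma l2_sq_real {f : X → ℝ} (hf : MemLp f 2 μ) : l2 μ f ^ 2 = ∫ x, f x ^ 2 ∂μ := by
  rw [l2_sq hf]; simp

lemma l2_add_le {f g : X → E} (hf : MemLp f 2 μ) (hg : MemLp g 2 μ) :
    l2 μ (fun x => f x + g x) ≤ l2 μ f + l2 μ g := by
  unfold l2
  rw [← ENNReal.toReal_add hf.2.ne hg.2.ne]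
  exact ENNReal.toReal_mono (ENNReal.add_ne_top.2 ⟨hf.2.ne, hg.2.ne⟩)
    (eLpNorm_add_le hf.1 hg.1 (by norm_num))

lemma l2_sub_le {f g : X → E} (hf : MemLp f 2 μ) (hg : MemLp g 2 μ) :
    l2 μ (fun x => f x - g x) ≤ l2 μ f + l2 μ g := by
  unfold l2
  rw [← ENNReal.toReal_add hf.2.ne hg.2.ne]
  exact ENNReal.toReal_mono (ENNReal.add_ne_top.2 ⟨hf.2.ne, hg.2.ne⟩)
    (eLpNorm_sub_le hf.1 hg.1 (by norm_num))

lemma l2_sum_le {κ : Type*} (s : Finset κ) {f : κ → X → E} (hf : ∀ i ∈ s, MemLp (f i) 2 μ) :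
    l2 μ (fun x => ∑ i ∈ s, f i x) ≤ ∑ i ∈ s, l2 μ (f i) := by
  classical
  induction s using Finset.induction_on with
  | empty => simp [l2]
  | insert a s ha ih =>
    simp only [Finset.sum_insert ha]
    have h1 := hf a (Finset.mem_insert_self _ _)
    have h2 : ∀ i ∈ s, MemLp (f i) 2 μ := fun i hi => hf i (Finset.mem_insert_of_mem hi)
    exact (l2_add_le h1 (memLp_finsetSum s h2)).trans (by gcongr; exact ih h2)

lemma l2_mono_ae {F : Type*} [NormedAddCommGroup F] {f : X → E} {g : X → F} (hg : MemLp g 2 μ)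
    (h : ∀ᵐ x ∂μ, ‖f x‖ ≤ ‖g x‖) : l2 μ f ≤ l2 μ g :=
  ENNReal.toReal_mono hg.2.ne (eLpNorm_mono_ae h)

lemma l2_congr_ae {f g : X → E} (h : f =ᵐ[μ] g) : l2 μ f = l2 μ g := by
  unfold l2; rw [eLpNorm_congr_ae h]

lemma l2_norm (f : X → E) : l2 μ (fun x => ‖f x‖) = l2 μ f := by
  unfold l2; rw [eLpNorm_norm]

lemma l2_const_mul (c : ℝ) (f : X → ℝ) : l2 μ (fun x => c * f x) = |c| * l2 μ f := by
  unfold l2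
  have := eLpNorm_const_smul c f 2 μ
  have h2 : (c • f) = fun x => c * f x := rfl
  rw [h2] at this
  rw [this, ENNReal.toReal_mul]; simp

lemma l2_le_of_bound [IsFiniteMeasure μ] {f : X → E} {B : ℝ} (hB : 0 ≤ B)
    (h : ∀ᵐ x ∂μ, ‖f x‖ ≤ B) : l2 μ f ≤ B * √(μ.real Set.univ) := by
  have := eLpNorm_le_of_ae_bound (p := 2) h
  refine (ENNReal.toReal_mono ?_ this).trans (le_of_eq ?_)
  · refine ENNReal.mul_ne_top (ENNReal.rpow_ne_top_of_nonneg (by positivity) (measure_ne_top _ _))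
      (by simp)
  · rw [ENNReal.toReal_mul, ENNReal.toReal_ofReal hB, ← ENNReal.toReal_rpow, mul_comm, Real.sqrt_eq_rpow]
    simp [Measure.real]

lemma l2_mul_le {f : X → ℝ} {g : X → ℝ} {B : ℝ} (hB : 0 ≤ B)
    (hg : MemLp g 2 μ) (h : ∀ᵐ x ∂μ, |f x| ≤ B * |g x|) : l2 μ f ≤ B * l2 μ g := by
  have := l2_mono_ae (f := f) (g := fun x => B * g x) (hg.const_mul B)
    (h.mono fun x hx => by simpa [abs_mul, abs_of_nonneg hB] using hx)
  rwa [l2_const_mul, abs_of_nonneg hB] at this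

lemma abs_integral_inner_le {V : Type*} [NormedAddCommGroup V] [InnerProductSpace ℝ V]
    {f g : X → V} (hf : MemLp f 2 μ) (hg : MemLp g 2 μ) :
    |∫ x, inner ℝ (f x) (g x) ∂μ| ≤ l2 μ f * l2 μ g := by
  have h1 : ∫ x, inner ℝ (f x) (g x) ∂μ = inner ℝ (hf.toLp f) (hg.toLp g) := by
    rw [L2.inner_def]
    refine integral_congr_ae ?_
    filter_upwards [hf.coeFn_toLp, hg.coeFn_toLp] with x h1 h2
    rw [h1, h2]
  rw [h1]
  refine (abs_real_inner_le_norm _ _).trans (le_of_eq ?_)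
  rw [Lp.norm_toLp, Lp.norm_toLp]; rfl

lemma abs_integral_mul_le {f g : X → ℝ} (hf : MemLp f 2 μ) (hg : MemLp g 2 μ) :
    |∫ x, f x * g x ∂μ| ≤ l2 μ f * l2 μ g := by
  have := abs_integral_inner_le hg hf
  simpa [mul_comm] using this

lemma integrable_mul_of_memLp {f g : X → ℝ} (hf : MemLp f 2 μ) (hg : MemLp g 2 μ) :
    Integrable (fun x => f x * g x) μ := hf.integrable_mul hg

end L2

/-! ### Polynomials in several variables as functions on `ℝᵈ` -/

section Poly

open MvPolynomial

variable {d : ℕ}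

lemma degLE_iff {ℓ : ℤ} {p : MvPolynomial (Fin d) ℝ} :
    DegLE ℓ p ↔ ∀ α, coeff α p ≠ 0 → (α.degree : ℤ) ≤ ℓ := by
  constructor
  · rintro (rfl | h) α hα
    · simp at hα
    · have := le_totalDegree (mem_support_iff.2 hα)
      have h2 : α.degree = α.sum fun _ e => e := rfl
      rw [← h2] at this
      omega
  · intro h
    by_cases hp : p = 0
    · exact Or.inl hp
    · right
      obtain ⟨α, hα, hmax⟩ := Finset.exists_mem_eq_sup p.support (by
        rwa [Finset.nonempty_iff_ne_empty, Ne, support_eq_empty]) (fun s => s.sum fun _ e => e)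
      have : p.totalDegree = α.degree := hmax
      rw [this]
      exact h α (mem_support_iff.1 hα)

/-- The space `𝒫^ℓ` of polynomials of total degree at most `ℓ`. -/
def polySub (d : ℕ) (ℓ : ℤ) : Submodule ℝ (MvPolynomial (Fin d) ℝ) where
  carrier := {p | DegLE ℓ p}
  zero_mem' := Or.inl rfl
  add_mem' := by
    intro p q hp hq
    rw [Set.mem_ofPred_eq, degLE_iff] at *
    intro α hα
    rw [coeff_add] at hα
    by_cases h : coeff α p = 0
    · exact hq α (by intro h'; exact hα (by rw [h, h', add_zero]))
    · exact hp α h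
  smul_mem' := by
    intro c p hp
    rw [Set.mem_ofPred_eq, degLE_iff] at *
    intro α hα
    refine hp α fun h => hα (by simp [h])

lemma degLE_nat {k : ℕ} {p : MvPolynomial (Fin d) ℝ} : DegLE k p ↔ p.totalDegree ≤ k := by
  constructor
  · rintro (rfl | h)
    · simp
    · exact_mod_cast h
  · intro h; right; exact_mod_cast h

lemma DegLE.mono {ℓ m : ℤ} (h : ℓ ≤ m) {p : MvPolynomial (Fin d) ℝ} (hp : DegLE ℓ p) : DegLE m p :=
  hp.imp id fun h' => h'.trans h

lemma DegLE.mul {ℓ m : ℤ} {p q : MvPolynomial (Fin d) ℝ} (hp : DegLE ℓ p) (hq : DegLE m q) :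
    DegLE (ℓ + m) (p * q) := by
  rcases hp with rfl | hp
  · left; simp
  rcases hq with rfl | hq
  · left; simp
  right
  have := totalDegree_mul p q
  omega

lemma DegLE.pderiv {ℓ : ℤ} {p : MvPolynomial (Fin d) ℝ} (hp : DegLE ℓ p) (i : Fin d) :
    DegLE (ℓ - 1) (MvPolynomial.pderiv i p) := by
  rw [degLE_iff] at *
  intro α hα
  rw [coeff_pderiv] at hα
  have := hp (α + Finsupp.single i 1) (fun h => hα (by rw [h, zero_mul]))
  rw [map_add, Finsupp.degree_single] at this
  push_cast at this; omega

lemma degLE_C (a : ℝ) {ℓ : ℤ} (h : 0 ≤ ℓ) : DegLE ℓ (C a : MvPolynomial (Fin d) ℝ) := by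
  right; simpa using h

lemma degLE_X (i : Fin d) : DegLE 1 (X i : MvPolynomial (Fin d) ℝ) := by
  right; simp

lemma IsHomogeneous.degLE {k : ℕ} {p : MvPolynomial (Fin d) ℝ} (hp : p.IsHomogeneous k) :
    DegLE k p := degLE_nat.2 hp.totalDegree_le

instance (ℓ : ℤ) : FiniteDimensional ℝ (polySub d ℓ) := by
  have h : polySub d ℓ ≤ restrictTotalDegree (Fin d) ℝ ℓ.toNat := by
    intro p hp
    rw [mem_restrictTotalDegree]
    rcases hp with rfl | hp
    · simp
    · omega
  exact Submodule.finiteDimensional_of_le h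

@[simp] lemma evalAt_add (p q : MvPolynomial (Fin d) ℝ) (x : Vec d) :
    evalAt (p + q) x = evalAt p x + evalAt q x := by simp [evalAt]

@[simp] lemma evalAt_sub (p q : MvPolynomial (Fin d) ℝ) (x : Vec d) :
    evalAt (p - q) x = evalAt p x - evalAt q x := by simp [evalAt]

@[simp] lemma evalAt_mul (p q : MvPolynomial (Fin d) ℝ) (x : Vec d) :
    evalAt (p * q) x = evalAt p x * evalAt q x := by simp [evalAt]

@[simp] lemma evalAt_C (a : ℝ) (x : Vec d) : evalAt (C a) x = a := by simp [evalAt]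

@[simp] lemma evalAt_X (i : Fin d) (x : Vec d) : evalAt (X i) x = x i := by simp [evalAt]

@[simp] lemma evalAt_zero (x : Vec d) : evalAt 0 x = 0 := by simp [evalAt]

@[simp] lemma evalAt_one (x : Vec d) : evalAt 1 x = 1 := by simp [evalAt]

@[simp] lemma evalAt_pow (p : MvPolynomial (Fin d) ℝ) (n : ℕ) (x : Vec d) :
    evalAt (p ^ n) x = evalAt p x ^ n := by simp [evalAt]

@[simp] lemma evalAt_smul (a : ℝ) (p : MvPolynomial (Fin d) ℝ) (x : Vec d) :
    evalAt (a • p) x = a * evalAt p x := by simp [evalAt, MvPolynomial.smul_eval]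

@[simp] lemma evalAt_sum {κ : Type*} (s : Finset κ) (p : κ → MvPolynomial (Fin d) ℝ) (x : Vec d) :
    evalAt (∑ i ∈ s, p i) x = ∑ i ∈ s, evalAt (p i) x := by simp [evalAt]

lemma contDiff_evalAt (p : MvPolynomial (Fin d) ℝ) {n : WithTop ℕ∞} : ContDiff ℝ n (evalAt p) := by
  induction p using MvPolynomial.induction_on with
  | C a =>
    rw [show (evalAt (C a) : Vec d → ℝ) = fun _ => a from funext (evalAt_C a)]
    exact contDiff_const
  | add p q hp hq =>
    rw [show evalAt (p + q) = fun x : Vec d => evalAt p x + evalAt q x from funext (evalAt_add p q)]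
    exact hp.add hq
  | mul_X p i hp =>
    rw [show evalAt (p * X i) = fun x : Vec d => evalAt p x * x i by ext x; simp]
    exact hp.mul (EuclideanSpace.proj i : Vec d →L[ℝ] ℝ).contDiff

lemma continuous_evalAt (p : MvPolynomial (Fin d) ℝ) : Continuous (evalAt p) :=
  (contDiff_evalAt p (n := 0)).continuous

lemma hasFDerivAt_proj (i : Fin d) (x : Vec d) :
    HasFDerivAt (fun x : Vec d => x i) (EuclideanSpace.proj i : Vec d →L[ℝ] ℝ) x :=
  (EuclideanSpace.proj i : Vec d →L[ℝ] ℝ).hasFDerivAt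

lemma fderiv_evalAt (p : MvPolynomial (Fin d) ℝ) (x ξ : Vec d) :
    fderiv ℝ (evalAt p) x ξ = ∑ j, evalAt (pderiv j p) x * ξ j := by
  induction p using MvPolynomial.induction_on with
  | C a =>
    have : (evalAt (C a) : Vec d → ℝ) = fun _ => a := funext (evalAt_C a)
    rw [this]; simp
  | add p q hp hq =>
    have : evalAt (p + q) = fun x : Vec d => evalAt p x + evalAt q x := funext (evalAt_add p q)
    rw [this, fderiv_fun_add ((contDiff_evalAt p (n := 1)).differentiable (by simp) x)
      ((contDiff_evalAt q (n := 1)).differentiable (by simp) x), add_apply, hp, hq,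
      ← Finset.sum_add_distrib]
    refine Finset.sum_congr rfl fun j _ => ?_
    simp [add_mul]
  | mul_X p i hp =>
    have : evalAt (p * X i) = fun x : Vec d => evalAt p x * x i := by
      ext x; simp
    rw [this, fderiv_fun_mul ((contDiff_evalAt p (n := 1)).differentiable (by simp) x)
      (hasFDerivAt_proj i x).differentiableAt, (hasFDerivAt_proj i x).fderiv]
    simp only [add_apply, smul_apply, hp, smul_eq_mul, pderiv_mul, pderiv_X, evalAt_add,
      evalAt_mul, evalAt_X, add_mul, Finset.sum_add_distrib, Finset.mul_sum]
    rw [add_comm]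
    congr 1
    · refine Finset.sum_congr rfl fun j _ => by ring
    · rw [Finset.sum_eq_single i]
      · simp
      · intro j _ hj; simp [hj]
      · simp

lemma eq_zero_of_evalAt_eq_zero {p : MvPolynomial (Fin d) ℝ} {U : Set (Vec d)} (hU : IsOpen U)
    (hne : U.Nonempty) (h : ∀ x ∈ U, evalAt p x = 0) : p = 0 := by
  obtain ⟨c, hc⟩ := hne
  obtain ⟨V, hV, hVU⟩ : ∃ V : Set (Fin d → ℝ), V = (fun y : Fin d → ℝ => (WithLp.toLp 2 y : Vec d)) ⁻¹' U
    ∧ IsOpen V := ⟨_, rfl, hU.preimage (PiLp.continuous_toLp 2 _)⟩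
  have hcV : (fun i => c i) ∈ V := by rw [hV]; exact hc
  obtain ⟨ε, hε, hball⟩ := Metric.isOpen_iff.1 hVU _ hcV
  refine MvPolynomial.funext_set (fun i => Metric.ball (c i) ε) (fun i => ?_) fun x hx => ?_
  · rw [Real.ball_eq_Ioo]; exact Set.Ioo_infinite (by linarith)
  · have hxV : x ∈ V := by
      apply hball
      rw [ball_pi _ hε]
      exact hx
    rw [hV] at hxV
    simpa [evalAt] using h _ hxV

/-! #### Affine substitutions -/

/-- The polynomial `y ↦ p (a + s y)`. -/
def affSubst (a : Vec d) (s : ℝ) (p : MvPolynomial (Fin d) ℝ) : MvPolynomial (Fin d) ℝ :=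
  bind₁ (fun i => C (a i) + C s * X i) p

lemma evalAt_affSubst (a : Vec d) (s : ℝ) (p : MvPolynomial (Fin d) ℝ) (y : Vec d) :
    evalAt (affSubst a s p) y = evalAt p (a + s • y) := by
  unfold evalAt affSubst
  rw [show (eval fun i => y i) ((bind₁ fun i => C (a i) + C s * X i) p) =
    eval₂Hom (RingHom.id ℝ) (fun i => y i) (bind₁ (fun i => C (a i) + C s * X i) p) from rfl,
    eval₂Hom_bind₁]
  rw [show (eval fun i => (a + s • y) i) p = eval₂Hom (RingHom.id ℝ) (fun i => (a + s • y) i) p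
    from rfl]
  congr 2
  ext i; simp

lemma degLE_affSubst (a : Vec d) (s : ℝ) {ℓ : ℤ} {p : MvPolynomial (Fin d) ℝ} (hp : DegLE ℓ p) :
    DegLE ℓ (affSubst a s p) := by
  rw [degLE_iff] at hp
  unfold affSubst
  rw [p.as_sum, map_sum]
  refine (polySub d ℓ).sum_mem fun α hα => ?_
  have h := hp α (mem_support_iff.1 hα)
  refine DegLE.mono h ?_
  rw [bind₁_monomial]
  rw [degLE_nat]
  refine (totalDegree_mul _ _).trans ?_
  rw [totalDegree_C, zero_add]
  refine (totalDegree_finsetProd _ _).trans ?_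
  rw [Finsupp.degree]
  refine Finset.sum_le_sum fun i _ => ?_
  refine (totalDegree_pow _ _).trans ?_
  have : (C (a i) + C s * X i : MvPolynomial (Fin d) ℝ).totalDegree ≤ 1 := by
    refine (totalDegree_add _ _).trans (max_le (by simp) ?_)
    refine (totalDegree_mul _ _).trans (by simp)
  nlinarith

lemma evalAt_homogeneous {k : ℕ} {p : MvPolynomial (Fin d) ℝ} (hp : p.IsHomogeneous k) (s : ℝ)
    (y : Vec d) : evalAt p (s • y) = s ^ k * evalAt p y := by
  unfold evalAt
  rw [eval_eq, eval_eq, Finset.mul_sum]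
  refine Finset.sum_congr rfl fun α hα => ?_
  have hk : α.degree = k := by
    by_contra h; exact (mem_support_iff.1 hα) (hp.coeff_eq_zero h)
  simp only [PiLp.smul_apply, smul_eq_mul, mul_pow, Finset.prod_mul_distrib]
  rw [Finset.prod_pow_eq_pow_sum, ← hk]
  have : ∑ i ∈ α.support, α i = α.degree := rfl
  rw [this]; ring

end Poly

/-! ### Inverse inequalities for polynomials -/

/-- A pointwise bounded family of linear forms on a finite-dimensional space is uniformly bounded
by the norm induced by any injection into a normed space. -/
lemma exists_uniform_bound {V E Y : Type*} [AddCommGroup V] [Module ℝ V] [FiniteDimensional ℝ V]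
    [NormedAddCommGroup E] [NormedSpace ℝ E] (Φ : V →ₗ[ℝ] E) (hΦ : Function.Injective Φ)
    (L : Y → V →ₗ[ℝ] ℝ) (hL : ∀ v, ∃ B : ℝ, ∀ y, |L y v| ≤ B) :
    ∃ C : ℝ, 0 < C ∧ ∀ y v, |L y v| ≤ C * ‖Φ v‖ := by
  set e := LinearEquiv.ofInjective Φ hΦ
  set β := Module.finBasis ℝ V
  choose B hB using fun i => hL (β i)
  set f := fun i => LinearMap.toContinuousLinearMap ((β.coord i) ∘ₗ e.symm.toLinearMap)
  have hf : ∀ i v, |β.repr v i| ≤ ‖f i‖ * ‖Φ v‖ := by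
    intro i v
    have h1 : f i (e v) = β.repr v i := by simp [f]
    have h2 : ‖Φ v‖ = ‖e v‖ := rfl
    rw [← h1, h2, ← Real.norm_eq_abs]
    exact (f i).le_opNorm _
  refine ⟨∑ i, ‖f i‖ * |B i| + 1, by positivity, fun y v => ?_⟩
  calc |L y v| = |∑ i, β.repr v i * L y (β i)| := by
        conv_lhs => rw [← β.sum_repr v]
        rw [map_sum]; simp
    _ ≤ ∑ i, |β.repr v i * L y (β i)| := Finset.abs_sum_le_sum_abs _ _
    _ ≤ ∑ i, (‖f i‖ * ‖Φ v‖) * |B i| := by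
        refine Finset.sum_le_sum fun i _ => ?_
        rw [abs_mul]
        exact mul_le_mul (hf i v) ((hB i y).trans (le_abs_self _)) (abs_nonneg _) (by positivity)
    _ = (∑ i, ‖f i‖ * |B i|) * ‖Φ v‖ := by
        rw [Finset.sum_mul]; exact Finset.sum_congr rfl fun i _ => by ring
    _ ≤ _ := by gcongr; linarith

section

open MvPolynomial

variable {d : ℕ}

/-- The map sending a polynomial to its class in `L²(μ)`. -/
def polyToLp {μ : Measure (Vec d)} (hμ : ∀ p : MvPolynomial (Fin d) ℝ, MemLp (evalAt p) 2 μ) :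
    MvPolynomial (Fin d) ℝ →ₗ[ℝ] Lp ℝ 2 μ where
  toFun p := (hμ p).toLp _
  map_add' p q := by
    rw [← MemLp.toLp_add]
    exact MemLp.toLp_congr _ _ (Eventually.of_forall fun x => evalAt_add p q x)
  map_smul' a p := by
    rw [RingHom.id_apply, ← MemLp.toLp_const_smul]
    exact MemLp.toLp_congr _ _ (Eventually.of_forall fun x => evalAt_smul a p x)

lemma norm_polyToLp {μ : Measure (Vec d)} (hμ : ∀ p : MvPolynomial (Fin d) ℝ, MemLp (evalAt p) 2 μ)
    (p : MvPolynomial (Fin d) ℝ) : ‖polyToLp hμ p‖ = l2 μ (evalAt p) := Lp.norm_toLp (evalAt p) (hμ p)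

lemma isFiniteMeasure_ball (c : Vec d) (r : ℝ) :
    IsFiniteMeasure (volume.restrict (Metric.ball c r)) :=
  ⟨by simpa using measure_ball_lt_top⟩

lemma memLp_ball {E : Type*} [NormedAddCommGroup E] (c : Vec d) (r : ℝ) {g : Vec d → E}
    (hg : Continuous g) (p : ℝ≥0∞) : MemLp g p (volume.restrict (Metric.ball c r)) :=
  have := isFiniteMeasure_ball c r
  memLp_of_continuous (isCompact_closedBall c r)
    ((ae_restrict_mem Metric.isOpen_ball.measurableSet).mono fun _ h => Metric.ball_subset_closedBall h)
    hg p

lemma l2_eq_zero_iff_ball {c : Vec d} {r : ℝ} (hr : 0 < r) {p : MvPolynomial (Fin d) ℝ}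
    (h : l2 (volume.restrict (Metric.ball c r)) (evalAt p) = 0) : p = 0 := by
  have hm := memLp_ball c r (continuous_evalAt p) 2
  unfold l2 at h
  rw [ENNReal.toReal_eq_zero_iff] at h
  have h := h.resolve_right hm.2.ne
  rw [eLpNorm_eq_zero_iff hm.1 (by simp)] at h
  have h2 := Measure.eqOn_open_of_ae_eq h Metric.isOpen_ball (continuous_evalAt p).continuousOn
    continuousOn_const
  exact eq_zero_of_evalAt_eq_zero Metric.isOpen_ball ⟨c, Metric.mem_ball_self hr⟩ h2

open scoped Pointwise in
lemma setIntegral_ball_affine (c : Vec d) {r : ℝ} (hr : 0 < r) (f : Vec d → ℝ) :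
    ∫ y in Metric.ball (0 : Vec d) 1, f (c + r • y) = (r ^ d)⁻¹ * ∫ x in Metric.ball c r, f x := by
  rw [Measure.setIntegral_comp_smul_of_pos volume (fun y => f (c + y)) _ hr]
  simp only [finrank_euclideanSpace, Fintype.card_fin, smul_eq_mul]
  congr 1
  have h1 : r • Metric.ball (0 : Vec d) 1 = (fun x => c + x) ⁻¹' Metric.ball c r := by
    rw [smul_unitBall_of_pos hr]
    ext x; simp [dist_eq_norm]
  rw [h1]
  exact (measurePreserving_add_left volume c).setIntegral_preimage_emb
    (measurableEmbedding_addLeft c) f _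

/-- Scaling of the `L²` norm of a polynomial from a ball to the unit ball. -/
lemma l2_affSubst (c : Vec d) {r : ℝ} (hr : 0 < r) (p : MvPolynomial (Fin d) ℝ) :
    l2 (volume.restrict (Metric.ball c r)) (evalAt p) =
      √(r ^ d) * l2 (volume.restrict (Metric.ball (0 : Vec d) 1)) (evalAt (affSubst c r p)) := by
  rw [l2_eq_sqrt (memLp_ball _ _ (continuous_evalAt _) 2),
    l2_eq_sqrt (memLp_ball _ _ (continuous_evalAt _) 2), ← Real.sqrt_mul (by positivity)]
  congr 1
  simp_rw [evalAt_affSubst]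
  rw [setIntegral_ball_affine c hr (fun x => ‖evalAt p x‖ ^ 2)]
  field_simp

/-- Dilations commute with taking homogeneous components. -/
lemma homogeneousComponent_affSubst (c : Vec d) {r : ℝ} {m : ℕ} (p : MvPolynomial (Fin d) ℝ)
    (y : Vec d) : evalAt (homogeneousComponent m (affSubst c r p)) y =
      evalAt (homogeneousComponent m (affSubst c 1 p)) (r • y) := by
  set g := affSubst c 1 p
  have h1 : affSubst c r p = ∑ j ∈ Finset.range (g.totalDegree + 1),
      r ^ j • homogeneousComponent j g := by
    rw [← sub_eq_zero]
    refine eq_zero_of_evalAt_eq_zero isOpen_univ Set.univ_nonempty fun x _ => ?_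
    rw [evalAt_sub, evalAt_sum, sub_eq_zero, evalAt_affSubst]
    have h2 : evalAt g (r • x) = evalAt p (c + r • x) := by rw [evalAt_affSubst, one_smul]
    rw [← h2]
    conv_lhs => rw [← sum_homogeneousComponent g, evalAt_sum]
    refine Finset.sum_congr rfl fun j _ => ?_
    rw [evalAt_smul, evalAt_homogeneous (homogeneousComponent_isHomogeneous j g)]
  rw [evalAt_homogeneous (homogeneousComponent_isHomogeneous m g), h1, map_sum]
  simp only [map_smul]
  rw [evalAt_sum]
  have h3 : ∀ j, homogeneousComponent m (homogeneousComponent j g) =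
      if m = j then homogeneousComponent j g else 0 :=
    fun j => homogeneousComponent_of_mem (homogeneousComponent_isHomogeneous j g)
  simp_rw [h3]
  by_cases hm : m ∈ Finset.range (g.totalDegree + 1)
  · rw [Finset.sum_eq_single_of_mem m hm]
    · simp
    · intro j _ hj; simp [Ne.symm hj]
  · rw [Finset.sum_eq_zero, homogeneousComponent_eq_zero]
    · simp
    · simpa using hm
    · intro j hj
      have : m ≠ j := by rintro rfl; exact hm hj
      simp [this]

/-- Inverse inequalities on a ball and on its dilations: the values, the first derivatives and the
homogeneous component of highest degree of a polynomial are controlled by its `L²` norm. -/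
theorem exists_inverse_inequality_ball (d m : ℕ) (ϱ : ℝ) : ∃ C : ℝ, 0 < C ∧
    ∀ p : MvPolynomial (Fin d) ℝ, DegLE m p → ∀ (c : Vec d) (r : ℝ), 0 < r →
      ∀ x ∈ Metric.closedBall c (ϱ * r),
        |evalAt p x| * √(r ^ d) ≤ C * l2 (volume.restrict (Metric.ball c r)) (evalAt p) ∧
        ‖fderiv ℝ (evalAt p) x‖ * (r * √(r ^ d)) ≤
          C * l2 (volume.restrict (Metric.ball c r)) (evalAt p) ∧
        |evalAt (homogeneousComponent m (affSubst c 1 p)) (x - c)| * √(r ^ d) ≤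
          C * l2 (volume.restrict (Metric.ball c r)) (evalAt p) := by
  -- On the unit ball all the norms on the finite-dimensional space of polynomials are equivalent;
  -- the general case follows by the substitution `x = c + r y`.
  set Φ := (polyToLp (μ := volume.restrict (Metric.ball (0 : Vec d) 1))
    fun p => memLp_ball _ _ (continuous_evalAt p) 2) ∘ₗ (polySub d m).subtype with hΦ
  have hn : ∀ v : polySub d m, ‖Φ v‖ = l2 (volume.restrict (Metric.ball (0 : Vec d) 1)) (evalAt v.1) :=
    fun v => norm_polyToLp (fun p => memLp_ball _ _ (continuous_evalAt p) 2) v.1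
  have hinj : Function.Injective Φ := by
    rw [injective_iff_map_eq_zero]
    intro v hv
    have := hn v
    rw [hv, norm_zero] at this
    exact Subtype.ext (l2_eq_zero_iff_ball one_pos this.symm)
  have hK := isCompact_closedBall (0 : Vec d) ϱ
  let ev : Vec d → MvPolynomial (Fin d) ℝ →ₗ[ℝ] ℝ := fun y =>
    { toFun := fun p => evalAt p y, map_add' := fun p q => evalAt_add p q y,
      map_smul' := fun a p => by simp }
  obtain ⟨C1, hC1, h1⟩ := exists_uniform_bound Φ hinj
    (fun y : Metric.closedBall (0 : Vec d) ϱ => ev y ∘ₗ (polySub d m).subtype) (fun v => by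
      obtain ⟨B, hB⟩ := hK.exists_bound_of_continuousOn (continuous_evalAt v.1).continuousOn
      exact ⟨B, fun y => hB y y.2⟩)
  obtain ⟨C3, hC3, h3⟩ := exists_uniform_bound Φ hinj
    (fun y : Metric.closedBall (0 : Vec d) ϱ => ev y ∘ₗ homogeneousComponent m ∘ₗ
      (polySub d m).subtype) (fun v => by
      obtain ⟨B, hB⟩ := hK.exists_bound_of_continuousOn
        (continuous_evalAt (homogeneousComponent m v.1)).continuousOn
      exact ⟨B, fun y => hB y y.2⟩)
  let dv : Vec d → Vec d → MvPolynomial (Fin d) ℝ →ₗ[ℝ] ℝ := fun y ξ =>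
    { toFun := fun p => ∑ j, evalAt (pderiv j p) y * ξ j
      map_add' := fun p q => by simp [add_mul, Finset.sum_add_distrib]
      map_smul' := fun a p => by
        simp only [Derivation.map_smul, evalAt_smul, RingHom.id_apply, smul_eq_mul, Finset.mul_sum]
        exact Finset.sum_congr rfl fun j _ => by ring }
  obtain ⟨C2, hC2, h2⟩ := exists_uniform_bound Φ hinj
    (fun y : Metric.closedBall (0 : Vec d) ϱ × Metric.closedBall (0 : Vec d) 1 =>
      dv y.1 y.2 ∘ₗ (polySub d m).subtype) (fun v => by
      obtain ⟨B, hB⟩ := hK.exists_bound_of_continuousOn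
        ((contDiff_evalAt v.1 (n := 1)).continuous_fderiv (by simp)).continuousOn
      refine ⟨B, fun y => ?_⟩
      have e : (dv y.1 y.2 ∘ₗ (polySub d m).subtype) v = fderiv ℝ (evalAt v.1) y.1 y.2 :=
        (fderiv_evalAt v.1 y.1 y.2).symm
      rw [e, ← Real.norm_eq_abs]
      have hy2 : ‖(y.2 : Vec d)‖ ≤ 1 := mem_closedBall_zero_iff.1 y.2.2
      refine ((fderiv ℝ (evalAt v.1) y.1).le_opNorm _).trans ?_
      have := hB y.1 y.1.2
      have h0 := norm_nonneg (fderiv ℝ (evalAt v.1) (y.1 : Vec d))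
      nlinarith [norm_nonneg (y.2 : Vec d)])
  refine ⟨max C1 (max C2 C3), by positivity, fun p hp c r hr x hx => ?_⟩
  set q : polySub d m := ⟨affSubst c r p, degLE_affSubst c r hp⟩ with hq
  set y : Vec d := r⁻¹ • (x - c) with hy
  have hyK : y ∈ Metric.closedBall (0 : Vec d) ϱ := by
    rw [Metric.mem_closedBall, dist_eq_norm] at hx ⊢
    rw [sub_zero, hy, norm_smul, norm_inv, Real.norm_of_nonneg hr.le, inv_mul_le_iff₀ hr]
    linarith
  have hxy : c + r • y = x := by
    rw [hy, smul_smul, mul_inv_cancel₀ hr.ne', one_smul]; abel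
  have hry : r • y = x - c := by rw [← hxy]; abel
  have hs : 0 ≤ √(r ^ d) := Real.sqrt_nonneg _
  have hl := l2_affSubst c hr p
  have hΦ0 := norm_nonneg (Φ q)
  have hfin : ∀ (C' a : ℝ), C' ≤ max C1 (max C2 C3) → a ≤ C' * ‖Φ q‖ →
      a * √(r ^ d) ≤ max C1 (max C2 C3) * l2 (volume.restrict (Metric.ball c r)) (evalAt p) := by
    intro C' a hC' ha
    rw [hl]
    rw [hn] at ha
    have hl0 := l2_nonneg (μ := volume.restrict (Metric.ball (0 : Vec d) 1)) (evalAt (affSubst c r p))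
    calc a * √(r ^ d) ≤ (C' * l2 (volume.restrict (Metric.ball (0 : Vec d) 1))
          (evalAt (affSubst c r p))) * √(r ^ d) := by gcongr
      _ ≤ (max C1 (max C2 C3) * l2 (volume.restrict (Metric.ball (0 : Vec d) 1))
          (evalAt (affSubst c r p))) * √(r ^ d) := by gcongr
      _ = _ := by ring
  refine ⟨hfin C1 _ (le_max_left _ _) ?_, ?_, hfin C3 _ (by simp) ?_⟩
  · have := h1 ⟨y, hyK⟩ q
    have e : (ev y ∘ₗ (polySub d m).subtype) q = evalAt p x := by
      change evalAt (affSubst c r p) y = _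
      rw [evalAt_affSubst, hxy]
    rwa [e] at this
  · rw [← mul_assoc]
    refine hfin C2 _ (by simp) ?_
    have hder : ∀ ξ, fderiv ℝ (evalAt q.1) y ξ = r * fderiv ℝ (evalAt p) x ξ := by
      intro ξ
      have e : evalAt q.1 = evalAt p ∘ fun y => c + r • y := by
        ext y; exact evalAt_affSubst _ _ _ _
      have hd1 : HasFDerivAt (fun y : Vec d => c + r • y) (r • ContinuousLinearMap.id ℝ (Vec d)) y := by
        exact ((hasFDerivAt_id y).const_smul r).const_add c
      have hd2 : HasFDerivAt (evalAt p) (fderiv ℝ (evalAt p) x) (c + r • y) := by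
        rw [hxy]; exact ((contDiff_evalAt p (n := 1)).differentiable (by simp) x).hasFDerivAt
      rw [e, (hd2.comp y hd1).fderiv]
      simp
    rw [mul_comm, ← Real.norm_of_nonneg hr.le, ← norm_smul]
    refine ContinuousLinearMap.opNorm_le_of_unit_norm (by positivity) fun ξ hξ => ?_
    have := h2 (⟨y, hyK⟩, ⟨ξ, by simp [hξ]⟩) q
    have e : (dv y ξ ∘ₗ (polySub d m).subtype) q = fderiv ℝ (evalAt q.1) y ξ :=
      (fderiv_evalAt q.1 y ξ).symm
    rw [smul_apply, smul_eq_mul, ← hder, Real.norm_eq_abs, ← e]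
    exact this
  · have := h3 ⟨y, hyK⟩ q
    have e : (ev y ∘ₗ homogeneousComponent m ∘ₗ (polySub d m).subtype) q =
        evalAt (homogeneousComponent m (affSubst c 1 p)) (x - c) := by
      change evalAt (homogeneousComponent m (affSubst c r p)) y = _
      rw [homogeneousComponent_affSubst, hry]
    rwa [e] at this

end

/-! ### Polynomials on shape-regular simplices -/

section

open MvPolynomial

variable {d : ℕ}

lemma sqrt_volume_pos {ι : Type*} [Fintype ι] {b : AffineBasis ι ℝ (Vec d)} {ϱ : ℝ} {c : Vec d}
    {r : ℝ} (H : ShapeRegular b ϱ c r) : 0 < √(volume.real (simplex b)) := by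
  refine Real.sqrt_pos.2 (ENNReal.toReal_pos ?_ (volume_simplex_ne_top b))
  have h1 : 0 < volume (Metric.ball c r) := Metric.measure_ball_pos _ _ H.pos
  exact (h1.trans_le (measure_mono H.ball_subset)).ne'

/-- The volume of a shape-regular simplex is comparable to that of the ball `B(c, r / 2)`: the
simplex is contained in a ball of radius `2 ϱ r`. -/
lemma exists_sqrt_volume_le (d : ℕ) (ϱ : ℝ) : ∃ K : ℝ, 0 < K ∧ ∀ {ι : Type} [Fintype ι]
    (b : AffineBasis ι ℝ (Vec d)) (c : Vec d) (r : ℝ), 1 ≤ d → ShapeRegular b ϱ c r →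
      √(volume.real (simplex b)) ≤ K * √((r / 2) ^ d) := by
  refine ⟨√((4 * |ϱ|) ^ d * volume.real (Metric.ball (0 : Vec d) 1)) + 1, by positivity, ?_⟩
  intro ι _ b c r hd H
  have hr := H.pos
  have hϱ := H.one_le hd
  have h1 : volume.real (simplex b) ≤ ((4 * |ϱ|) ^ d * volume.real (Metric.ball (0 : Vec d) 1)) *
      (r / 2) ^ d := by
    calc volume.real (simplex b) ≤ volume.real (Metric.closedBall c (2 * ϱ * r)) :=
          ENNReal.toReal_mono measure_closedBall_lt_top.ne (measure_mono H.subset_closedBall)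
      _ = (2 * ϱ * r) ^ d * volume.real (Metric.ball (0 : Vec d) 1) := by
          rw [Measure.real, Measure.addHaar_closedBall _ _ (by positivity), ENNReal.toReal_mul,
            ENNReal.toReal_ofReal (by positivity)]
          simp [Measure.real]
      _ = _ := by
          rw [abs_of_nonneg (by linarith), show 2 * ϱ * r = 4 * ϱ * (r / 2) by ring, mul_pow]
          ring
  refine (Real.sqrt_le_sqrt h1).trans ?_
  rw [Real.sqrt_mul (by positivity)]
  gcongr
  linarith

lemma l2_ball_le {E : Type*} [NormedAddCommGroup E] {S : Set (Vec d)} {c : Vec d} {r : ℝ}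
    (h : Metric.ball c r ⊆ S) {f : Vec d → E} (hf : MemLp f 2 (volume.restrict S)) :
    l2 (volume.restrict (Metric.ball c r)) f ≤ l2 (volume.restrict S) f :=
  ENNReal.toReal_mono hf.2.ne (eLpNorm_mono_measure _ (Measure.restrict_mono h le_rfl))

lemma evalAt_pderiv (p : MvPolynomial (Fin d) ℝ) (x : Vec d) (j : Fin d) :
    evalAt (pderiv j p) x = fderiv ℝ (evalAt p) x (basisVec j) := by
  rw [fderiv_evalAt, Finset.sum_eq_single j]
  · simp [basisVec]
  · intro i _ hi; simp [basisVec, hi]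
  · simp

lemma norm_basisVec (j : Fin d) : ‖(basisVec j : Vec d)‖ = 1 := by simp [basisVec]

lemma abs_coord_le (x : Vec d) (j : Fin d) : |x j| ≤ ‖x‖ := by
  simpa using PiLp.norm_apply_le x j

/-- Inverse inequalities for polynomials on a shape-regular simplex. -/
theorem exists_inverse_inequality (d m : ℕ) (ϱ : ℝ) : ∃ C : ℝ, 0 < C ∧ ∀ {ι : Type} [Fintype ι]
    (b : AffineBasis ι ℝ (Vec d)) (c : Vec d) (r : ℝ), 1 ≤ d → ShapeRegular b ϱ c r →
      ∀ p : MvPolynomial (Fin d) ℝ, DegLE m p → ∀ x ∈ simplex b,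
        |evalAt p x| * √(volume.real (simplex b)) ≤
          C * l2 (volume.restrict (simplex b)) (evalAt p) ∧
        ‖fderiv ℝ (evalAt p) x‖ * (r * √(volume.real (simplex b))) ≤
          C * l2 (volume.restrict (simplex b)) (evalAt p) ∧
        |evalAt (homogeneousComponent m (affSubst c 1 p)) (x - c)| * √(volume.real (simplex b)) ≤
          C * l2 (volume.restrict (simplex b)) (evalAt p) := by
  obtain ⟨C, hC, h⟩ := exists_inverse_inequality_ball d m (2 * ϱ)
  obtain ⟨K, hK, hKb⟩ := exists_sqrt_volume_le d ϱ
  refine ⟨K * C, by positivity, ?_⟩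
  intro ι _ b c r hd H p hp x hx
  have hr := H.pos
  obtain ⟨h1, h2, h3⟩ := h p hp c r hr x (H.subset_closedBall hx)
  have hl := l2_ball_le H.ball_subset (memLp_simplex b (continuous_evalAt p) 2)
  have hA : √(volume.real (simplex b)) ≤ K * √(r ^ d) := by
    refine (hKb b c r hd H).trans ?_
    gcongr; linarith
  have key : ∀ a : ℝ, 0 ≤ a → a * √(r ^ d) ≤ C * l2 (volume.restrict (Metric.ball c r)) (evalAt p) →
      a * √(volume.real (simplex b)) ≤ K * C * l2 (volume.restrict (simplex b)) (evalAt p) := by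
    intro a ha h
    calc a * √(volume.real (simplex b)) ≤ a * (K * √(r ^ d)) := by gcongr
      _ = K * (a * √(r ^ d)) := by ring
      _ ≤ K * (C * l2 (volume.restrict (Metric.ball c r)) (evalAt p)) := by gcongr
      _ ≤ K * (C * l2 (volume.restrict (simplex b)) (evalAt p)) := by gcongr
      _ = _ := by ring
  refine ⟨key _ (abs_nonneg _) h1, ?_, key _ (abs_nonneg _) h3⟩
  rw [← mul_assoc] at h2 ⊢
  exact key _ (by positivity) h2

lemma l2_simplex_le_of_bound {ι : Type*} [Fintype ι] {E : Type*} [NormedAddCommGroup E]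
    (b : AffineBasis ι ℝ (Vec d)) {f : Vec d → E}
    {B : ℝ} (hB : 0 ≤ B) (h : ∀ x ∈ simplex b, ‖f x‖ ≤ B) :
    l2 (volume.restrict (simplex b)) f ≤ B * √(volume.real (simplex b)) := by
  have := isFiniteMeasure_simplex b
  refine (l2_le_of_bound hB ?_).trans (le_of_eq ?_)
  · exact (ae_restrict_mem (measurableSet_simplex b)).mono h
  · simp [Measure.real]

/-- A pointwise bound on a facet, integrated; the area of the facet is at most `d |T| / (2 r)`. -/
lemma l2_facet_le_of_bound {ι : Type*} [Fintype ι] {E : Type*} [NormedAddCommGroup E] (hd : 1 ≤ d)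
    {b : AffineBasis ι ℝ (Vec d)} {ϱ : ℝ} {c : Vec d} {r : ℝ} (H : ShapeRegular b ϱ c r) (i : ι)
    {f : Vec d → E} {B : ℝ} (hB : 0 ≤ B) (h : ∀ᵐ x ∂facetMeasure b i, ‖f x‖ ≤ B) :
    √r * l2 (facetMeasure b i) f ≤ B * (√d * √(volume.real (simplex b))) := by
  have := isFiniteMeasure_facetMeasure b i hd
  have hr := H.pos
  have h1 := l2_le_of_bound hB h
  have h2 : r * (facetMeasure b i).real Set.univ ≤ d * volume.real (simplex b) := by
    rw [← height_mul_area b i hd]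
    have := H.two_mul_r_le_height i hd
    gcongr; linarith
  calc √r * l2 (facetMeasure b i) f ≤ √r * (B * √((facetMeasure b i).real Set.univ)) := by gcongr
    _ = B * √(r * (facetMeasure b i).real Set.univ) := by
        rw [Real.sqrt_mul hr.le]; ring
    _ ≤ B * √(d * volume.real (simplex b)) := by gcongr
    _ = _ := by rw [Real.sqrt_mul (by positivity)]

/-- Discrete trace and gradient inequalities for polynomials on a shape-regular simplex. -/
theorem exists_discrete_trace (d m : ℕ) (ϱ : ℝ) : ∃ C : ℝ, 0 < C ∧ ∀ {ι : Type} [Fintype ι]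
    (b : AffineBasis ι ℝ (Vec d)) (c : Vec d) (r : ℝ), 1 ≤ d → ShapeRegular b ϱ c r →
      ∀ p : MvPolynomial (Fin d) ℝ, DegLE m p →
        (∀ i, √r * l2 (facetMeasure b i) (evalAt p) ≤
          C * l2 (volume.restrict (simplex b)) (evalAt p)) ∧
        (∀ j, r * l2 (volume.restrict (simplex b)) (evalAt (pderiv j p)) ≤
          C * l2 (volume.restrict (simplex b)) (evalAt p)) := by
  obtain ⟨C, hC, h⟩ := exists_inverse_inequality d m ϱ
  refine ⟨C * (√d + 1), by positivity, ?_⟩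
  intro ι _ b c r hd H p hp
  have hA := sqrt_volume_pos H
  have hr := H.pos
  have hl := l2_nonneg (μ := volume.restrict (simplex b)) (evalAt p)
  have hd0 := Real.sqrt_nonneg d
  constructor
  · intro i
    have := l2_facet_le_of_bound hd H i (f := evalAt p)
      (B := C * l2 (volume.restrict (simplex b)) (evalAt p) / √(volume.real (simplex b)))
      (by positivity) ((ae_mem_facet b i).mono fun x hx => by
        rw [le_div_iff₀ hA]
        exact (h b c r hd H p hp x (facet_subset b i hx)).1)
    refine this.trans ?_
    have e : C * l2 (volume.restrict (simplex b)) (evalAt p) / √(volume.real (simplex b)) *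
        (√d * √(volume.real (simplex b))) = C * √d * l2 (volume.restrict (simplex b)) (evalAt p) := by
      field_simp
    rw [e]
    gcongr
    linarith
  · intro j
    have := l2_simplex_le_of_bound b (f := evalAt (pderiv j p))
      (B := C * l2 (volume.restrict (simplex b)) (evalAt p) / (r * √(volume.real (simplex b))))
      (by positivity) (fun x hx => by
        rw [le_div_iff₀ (by positivity), evalAt_pderiv]
        refine le_trans ?_ (h b c r hd H p hp x hx).2.1
        gcongr
        refine ((fderiv ℝ (evalAt p) x).le_opNorm _).trans ?_
        rw [norm_basisVec, mul_one])
    calc _ ≤ r * _ := mul_le_mul_of_nonneg_left this hr.le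
      _ = C * l2 (volume.restrict (simplex b)) (evalAt p) := by field_simp
      _ ≤ _ := by
        gcongr
        nlinarith

lemma sum_homogeneousComponent_range {k : ℕ} {g : MvPolynomial (Fin d) ℝ} (hg : DegLE k g) :
    ∑ j ∈ Finset.range (k + 1), homogeneousComponent j g = g := by
  conv_rhs => rw [← sum_homogeneousComponent g]
  symm
  have := degLE_nat.1 hg
  refine Finset.sum_subset (fun j hj => ?_) fun j _ hj => ?_
  · simp only [Finset.mem_range] at hj ⊢; omega
  · exact homogeneousComponent_eq_zero _ _ (by simpa using hj)

/-- Decomposition of a polynomial with respect to a facet: `p = h(x - bᵢ) + λᵢ R`, where `λᵢ` is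
the barycentric coordinate vanishing on the facet, `bᵢ` the opposite vertex and `h` is homogeneous. -/
lemma exists_facet_decomposition {ι : Type*} [Fintype ι] (b : AffineBasis ι ℝ (Vec d)) (i : ι)
    {k : ℕ} {p : MvPolynomial (Fin d) ℝ} (hp : DegLE k p) :
    ∃ h R : MvPolynomial (Fin d) ℝ, h.IsHomogeneous k ∧ DegLE ((k : ℤ) - 1) R ∧
      ∀ x, evalAt p x = evalAt h (x - b i) + b.coord i x * evalAt R x := by
  set g := affSubst (b i) 1 p with hg
  have hgd : DegLE k g := degLE_affSubst _ _ hp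
  -- the linear form which takes the value `1` on the facet when `b i` is the origin
  set ℓ : MvPolynomial (Fin d) ℝ := ∑ j, C (-(baryGrad b i j)) * X j with hℓ
  have hℓe : ∀ y : Vec d, evalAt ℓ y = -inner ℝ (baryGrad b i) y := by
    intro y
    simp only [hℓ, evalAt_sum, evalAt_mul, evalAt_C, evalAt_X, PiLp.inner_apply]
    rw [← Finset.sum_neg_distrib]
    exact Finset.sum_congr rfl fun j _ => by simp [mul_comm]
  have hℓd : ℓ.IsHomogeneous 1 := IsHomogeneous.sum _ _ _ fun j _ => by
    simpa using (isHomogeneous_C (Fin d) (-(baryGrad b i j))).mul (isHomogeneous_X ℝ j)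
  have hpow : ∀ n : ℕ, (ℓ ^ n).IsHomogeneous n := fun n => by simpa using hℓd.pow n
  -- the component of degree `j` is made homogeneous of degree `k` by the factor `ℓ ^ (k - j)`, and
  -- `1 - ℓ ^ (k - j)` is divisible by `1 - ℓ = λᵢ`, with a geometric sum as quotient
  refine ⟨∑ j ∈ Finset.range (k + 1), homogeneousComponent j g * ℓ ^ (k - j),
    affSubst (-b i) 1 (∑ j ∈ Finset.range (k + 1), homogeneousComponent j g *
      ∑ l ∈ Finset.range (k - j), ℓ ^ l), ?_, ?_, ?_⟩
  · refine IsHomogeneous.sum _ _ _ fun j hj => ?_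
    have h1 := (homogeneousComponent_isHomogeneous j g).mul (hpow (k - j))
    rwa [show j + (k - j) = k by simp only [Finset.mem_range] at hj; omega] at h1
  · refine degLE_affSubst _ _ ((polySub d _).sum_mem fun j hj => ?_)
    rw [Finset.mul_sum]
    refine (polySub d _).sum_mem fun l hl => ?_
    have h1 := (IsHomogeneous.degLE (homogeneousComponent_isHomogeneous j g)).mul
      (IsHomogeneous.degLE (hpow l))
    refine DegLE.mono ?_ h1
    simp only [Finset.mem_range] at hj hl
    omega
  · intro x
    simp only [evalAt_affSubst, one_smul, evalAt_sum, evalAt_mul, evalAt_pow]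
    rw [show x - b i = -b i + x by abel]
    have h1 : evalAt p x = evalAt g (-b i + x) := by
      rw [hg, evalAt_affSubst]; congr 1; simp
    have h2 : evalAt ℓ (-b i + x) = 1 - b.coord i x := by
      have := coord_sub b i x (b i)
      rw [b.coord_apply_eq] at this
      rw [hℓe, show -b i + x = x - b i by abel, ← this]; ring
    rw [h1]
    conv_lhs => rw [← sum_homogeneousComponent_range hgd, evalAt_sum]
    rw [Finset.mul_sum, ← Finset.sum_add_distrib]
    refine Finset.sum_congr rfl fun j _ => ?_
    have h3 := mul_neg_geom_sum (evalAt ℓ (-b i + x)) (k - j)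
    have h4 : b.coord i x = 1 - evalAt ℓ (-b i + x) := by rw [h2]; ring
    rw [h4]
    linear_combination (-evalAt (homogeneousComponent j g) (-b i + x)) * h3

/-- The `L²` norm on a simplex of a function which is homogeneous with respect to a vertex is
controlled by its norm on the opposite facet. -/
lemma l2_simplex_le_of_homogeneous {ι : Type*} [Fintype ι] {b : AffineBasis ι ℝ (Vec d)} (hd : 1 ≤ d)
    {ϱ : ℝ} {c : Vec d} {r : ℝ} (H : ShapeRegular b ϱ c r) (i : ι) {k : ℕ}
    {G : MvPolynomial (Fin d) ℝ}
    (hG : ∀ (s : ℝ) (y : Vec d), evalAt G (b i + s • y) = s ^ k * evalAt G (b i + y)) :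
    l2 (volume.restrict (simplex b)) (evalAt G) ≤
      √(2 * ϱ) * (√r * l2 (facetMeasure b i) (evalAt G)) := by
  have hr := H.pos
  have hϱ := H.one_le hd
  have hcG := contDiff_evalAt G (n := 1)
  have h1 := integral_facet_eq b i hd (φ := fun x => evalAt G x ^ 2) (hcG.pow 2)
  -- the identity of Euler for `G ^ 2`, which is homogeneous of degree `2 k` about `b i`
  have heuler : ∀ x, fderiv ℝ (fun x => evalAt G x ^ 2) x (x - b i) = 2 * k * evalAt G x ^ 2 := by
    intro x
    have hd1 : HasDerivAt (fun s : ℝ => b i + s • (x - b i)) (x - b i) 1 := by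
      simpa using ((hasDerivAt_id (1 : ℝ)).smul_const (x - b i)).const_add (b i)
    have hφ : DifferentiableAt ℝ (fun x => evalAt G x ^ 2) (b i + (1 : ℝ) • (x - b i)) :=
      ((hcG.pow 2).differentiable (by simp)) _
    have h2 := hφ.hasFDerivAt.comp_hasDerivAt (1 : ℝ) hd1
    have h3 : HasDerivAt (fun s : ℝ => s ^ (2 * k) * evalAt G x ^ 2)
        ((2 * k : ℕ) * 1 ^ (2 * k - 1) * evalAt G x ^ 2) 1 := (hasDerivAt_pow (2 * k) 1).mul_const _
    have h4 : (fun x => evalAt G x ^ 2) ∘ (fun s : ℝ => b i + s • (x - b i)) =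
        fun s : ℝ => s ^ (2 * k) * evalAt G x ^ 2 := by
      ext s
      simp only [Function.comp, hG, add_sub_cancel, mul_pow]
      rw [← pow_mul, mul_comm k 2]
    rw [h4] at h2
    have h5 := h2.unique h3
    simp only [one_smul, add_sub_cancel, one_pow, mul_one] at h5
    rw [h5]; push_cast; ring
  simp_rw [heuler] at h1
  have h2 : ∫ x in simplex b, ((d : ℝ) * evalAt G x ^ 2 + 2 * k * evalAt G x ^ 2) =
      (d + 2 * k) * l2 (volume.restrict (simplex b)) (evalAt G) ^ 2 := by
    rw [l2_sq_real (memLp_simplex b (continuous_evalAt G) 2), ← integral_const_mul]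
    refine integral_congr_ae (Eventually.of_forall fun x => ?_)
    simp only; ring
  rw [h2, ← l2_sq_real (memLp_facetMeasure b i hd (continuous_evalAt G) 2)] at h1
  have hF := l2_nonneg (μ := facetMeasure b i) (evalAt G)
  have hT := l2_nonneg (μ := volume.restrict (simplex b)) (evalAt G)
  have hδ := (height_le_diam b i hd).trans H.diam_le
  refine le_of_sq_le_sq ?_ (by positivity)
  rw [mul_pow, mul_pow, Real.sq_sqrt (by positivity), Real.sq_sqrt hr.le]
  have hd' : (1 : ℝ) ≤ d := by exact_mod_cast hd
  have h3 : l2 (volume.restrict (simplex b)) (evalAt G) ^ 2 ≤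
      (d + 2 * k) * l2 (volume.restrict (simplex b)) (evalAt G) ^ 2 := by
    have : (1 : ℝ) ≤ d + 2 * k := by
      have : (0 : ℝ) ≤ k := by positivity
      linarith
    nlinarith [sq_nonneg (l2 (volume.restrict (simplex b)) (evalAt G))]
  rw [← h1] at h3
  calc _ ≤ _ := h3
    _ ≤ (ϱ * (2 * r)) * l2 (facetMeasure b i) (evalAt G) ^ 2 := by gcongr
    _ = _ := by ring

/-- A polynomial of degree at most `k` is controlled by its moments against polynomials of degree
at most `k - 1` and by its values on one facet. In the decomposition `p = G + λᵢ R`, the part `G`,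
homogeneous about `b i`, is controlled by the facet, and `R` by testing the moments with `R` itself,
the weight `λᵢ` being bounded from below on a ball. -/
theorem exists_bound_of_moments (d k : ℕ) (ϱ : ℝ) : ∃ C : ℝ, 0 < C ∧ ∀ {ι : Type} [Fintype ι]
    (b : AffineBasis ι ℝ (Vec d)) (c : Vec d) (r : ℝ), 1 ≤ d → ShapeRegular b ϱ c r → ∀ i : ι,
      ∀ p : MvPolynomial (Fin d) ℝ, DegLE k p → ∀ m : Vec d → ℝ,
        MemLp m 2 (volume.restrict (simplex b)) →
        (∀ R, DegLE ((k : ℤ) - 1) R →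
          ∫ x in simplex b, evalAt p x * evalAt R x = ∫ x in simplex b, m x * evalAt R x) →
        l2 (volume.restrict (simplex b)) (evalAt p) ≤
          C * (l2 (volume.restrict (simplex b)) m + √r * l2 (facetMeasure b i) (evalAt p)) := by
  obtain ⟨C, hC, h⟩ := exists_inverse_inequality_ball d k (4 * ϱ)
  obtain ⟨K, hK, hKb⟩ := exists_sqrt_volume_le d ϱ
  set ρ := |ϱ| + 1 with hρ
  refine ⟨√(2 * ρ) + (K * C) ^ 2 * (4 * ρ) * (1 + √(2 * ρ)), by positivity, ?_⟩
  intro ι _ b c r hd H i p hp m hm hmom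
  obtain ⟨h₀, R, hh₀, hRd, hpGR'⟩ := exists_facet_decomposition b i hp
  obtain ⟨G, hGdef⟩ : ∃ G, G = affSubst (-b i) 1 h₀ := ⟨_, rfl⟩
  have hGe : ∀ x, evalAt G x = evalAt h₀ (x - b i) := fun x => by
    rw [hGdef, evalAt_affSubst, one_smul]; congr 1; abel
  have hpGR : ∀ x, evalAt p x = evalAt G x + b.coord i x * evalAt R x := fun x => by
    rw [hGe, hpGR']
  have hG : ∀ (s : ℝ) (y : Vec d), evalAt G (b i + s • y) = s ^ k * evalAt G (b i + y) :=
    fun s y => by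
      rw [hGe, hGe, add_sub_cancel_left, add_sub_cancel_left, evalAt_homogeneous hh₀]
  have hr := H.pos
  have hϱ := H.one_le hd
  have hϱρ : ϱ ≤ ρ := by rw [hρ]; linarith [le_abs_self ϱ]
  set μT := volume.restrict (simplex b)
  have hA := sqrt_volume_pos H
  have mp := memLp_simplex b (continuous_evalAt p) 2
  have mG := memLp_simplex b (continuous_evalAt G) 2
  have mR := memLp_simplex b (continuous_evalAt R) 2
  have hGp : l2 (facetMeasure b i) (evalAt G) = l2 (facetMeasure b i) (evalAt p) := by
    refine l2_congr_ae ((ae_mem_facet b i).mono fun x hx => ?_)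
    rw [hpGR, coord_facet b i hx]; ring
  have hF := l2_nonneg (μ := facetMeasure b i) (evalAt p)
  have hm0 := l2_nonneg (μ := μT) m
  have hR0 := l2_nonneg (μ := μT) (evalAt R)
  have hG1 : l2 μT (evalAt G) ≤ √(2 * ρ) * (√r * l2 (facetMeasure b i) (evalAt p)) := by
    rw [← hGp]
    rw [← hGp] at hF
    refine (l2_simplex_le_of_homogeneous hd H i hG).trans ?_
    gcongr
  have hc1 := continuous_coord b i
  have hcR := continuous_evalAt R
  have hcG := continuous_evalAt G
  -- the norm of `R` is controlled by its norm on a smaller ball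
  have hball : l2 μT (evalAt R) ≤ K * C * l2 (volume.restrict (Metric.ball c (r / 2))) (evalAt R) := by
    have hRk : DegLE k R := hRd.mono (by omega)
    set N := l2 (volume.restrict (Metric.ball c (r / 2))) (evalAt R)
    have hN : 0 ≤ N := l2_nonneg _
    have hs : 0 < √((r / 2) ^ d) := Real.sqrt_pos.2 (by positivity)
    have := l2_simplex_le_of_bound b (f := evalAt R) (B := C * N / √((r / 2) ^ d)) (by positivity)
      (fun x hx => by
        rw [le_div_iff₀ hs]
        refine (h R hRk c (r / 2) (by positivity) x ?_).1
        have := H.subset_closedBall hx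
        rwa [show 4 * ϱ * (r / 2) = 2 * ϱ * r by ring])
    refine this.trans ?_
    calc C * N / √((r / 2) ^ d) * √(volume.real (simplex b))
        ≤ C * N / √((r / 2) ^ d) * (K * √((r / 2) ^ d)) := by
          gcongr; exact hKb b c r hd H
      _ = _ := by field_simp
  -- on that ball the barycentric coordinate is bounded from below
  have hlow : 1 / (4 * ρ) * l2 (volume.restrict (Metric.ball c (r / 2))) (evalAt R) ^ 2 ≤
      ∫ x in simplex b, b.coord i x * evalAt R x ^ 2 := by
    rw [l2_sq_real (memLp_ball _ _ (continuous_evalAt R) 2), ← integral_const_mul]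
    have hsub : Metric.ball c (r / 2) ⊆ simplex b :=
      (Metric.ball_subset_ball (by linarith)).trans H.ball_subset
    calc ∫ x in Metric.ball c (r / 2), 1 / (4 * ρ) * evalAt R x ^ 2
        ≤ ∫ x in Metric.ball c (r / 2), b.coord i x * evalAt R x ^ 2 := by
          refine setIntegral_mono_on ?_ ?_ Metric.isOpen_ball.measurableSet fun x hx => ?_
          · exact memLp_one_iff_integrable.1 (memLp_ball _ _ (by fun_prop) 1)
          · exact memLp_one_iff_integrable.1 (memLp_ball _ _ (by fun_prop) 1)
          · gcongr
            have hδ := height_pos b i hd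
            have h1 := (H.coord_center i hd).1
            have h2 := coord_sub b i x c
            have h3 : |inner ℝ (baryGrad b i) (x - c)| ≤ (height b i)⁻¹ * (r / 2) := by
              refine (abs_real_inner_le_norm _ _).trans ?_
              rw [norm_baryGrad]
              gcongr
              rw [← dist_eq_norm]; exact (Metric.mem_ball.1 hx).le
            have h4 := (abs_le.1 h3).1
            have h5 : height b i ≤ 2 * ρ * r := by
              have := (height_le_diam b i hd).trans H.diam_le
              nlinarith
            have h6 : 1 / (4 * ρ) ≤ r / (2 * height b i) := by
              rw [div_le_div_iff₀ (by positivity) (by positivity)]; nlinarith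
            have h7 : r / (2 * height b i) = r / height b i - (height b i)⁻¹ * (r / 2) := by
              field_simp; ring
            linarith
      _ ≤ _ := by
          refine setIntegral_mono_set (integrableOn_simplex b (by fun_prop)) ?_
            (LE.le.eventuallyLE hsub)
          refine (ae_restrict_mem (measurableSet_simplex b)).mono fun x hx => ?_
          exact mul_nonneg ((mem_simplex b).1 hx i) (sq_nonneg _)
  -- the moments of `p = G + λᵢ R`, tested with `R`
  have hmain : ∫ x in simplex b, b.coord i x * evalAt R x ^ 2 ≤
      (l2 μT m + l2 μT (evalAt G)) * l2 μT (evalAt R) := by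
    have e1 : ∫ x in simplex b, b.coord i x * evalAt R x ^ 2 =
        (∫ x in simplex b, m x * evalAt R x) - ∫ x in simplex b, evalAt G x * evalAt R x := by
      rw [← hmom R hRd, ← integral_sub (integrable_mul_of_memLp mp mR) (integrable_mul_of_memLp mG mR)]
      refine integral_congr_ae (Eventually.of_forall fun x => ?_)
      simp only [hpGR]; ring
    rw [e1, add_mul]
    have h1 := abs_integral_mul_le hm mR
    have h2 := abs_integral_mul_le mG mR
    have h3 := (abs_le.1 h1).2
    have h4 := (abs_le.1 h2).1
    linarith
  have hR1 : l2 μT (evalAt R) ≤ (K * C) ^ 2 * (4 * ρ) * (l2 μT m + l2 μT (evalAt G)) := by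
    set N := l2 (volume.restrict (Metric.ball c (r / 2))) (evalAt R) with hNdef
    have hN : 0 ≤ N := l2_nonneg _
    set S := l2 μT m + l2 μT (evalAt G)
    have hS : 0 ≤ S := add_nonneg hm0 (l2_nonneg _)
    have h1 : N ^ 2 ≤ 4 * ρ * (S * l2 μT (evalAt R)) := by
      have := hlow.trans hmain
      rw [div_mul_eq_mul_div, one_mul, div_le_iff₀ (by positivity)] at this
      linarith
    by_cases hR : l2 μT (evalAt R) = 0
    · rw [hR]; positivity
    · have hRpos := lt_of_le_of_ne hR0 (Ne.symm hR)
      have h2 : l2 μT (evalAt R) ^ 2 ≤ (K * C) ^ 2 * N ^ 2 := by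
        rw [← mul_pow]; gcongr
      have h3 : l2 μT (evalAt R) * l2 μT (evalAt R) ≤
          ((K * C) ^ 2 * (4 * ρ) * S) * l2 μT (evalAt R) := by
        calc _ = l2 μT (evalAt R) ^ 2 := by ring
          _ ≤ (K * C) ^ 2 * N ^ 2 := h2
          _ ≤ (K * C) ^ 2 * (4 * ρ * (S * l2 μT (evalAt R))) := by gcongr
          _ = _ := by ring
      exact le_of_mul_le_mul_right h3 hRpos
  have hp1 : l2 μT (evalAt p) ≤ l2 μT (evalAt G) + l2 μT (evalAt R) := by
    have e : evalAt p = fun x => evalAt G x + b.coord i x * evalAt R x := funext hpGR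
    rw [e]
    refine (l2_add_le mG (memLp_simplex b (by fun_prop) 2)).trans ?_
    gcongr
    refine l2_mono_ae mR ((ae_restrict_mem (measurableSet_simplex b)).mono fun x hx => ?_)
    rw [norm_mul]
    have h1 := (mem_simplex b).1 hx i
    have h2 := coord_le_one b i hx
    rw [Real.norm_of_nonneg h1]
    exact mul_le_of_le_one_left (norm_nonneg _) h2
  set M := √r * l2 (facetMeasure b i) (evalAt p)
  have hM : 0 ≤ M := by positivity
  calc l2 μT (evalAt p) ≤ l2 μT (evalAt G) + (K * C) ^ 2 * (4 * ρ) * (l2 μT m + l2 μT (evalAt G)) := by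
        linarith
    _ ≤ √(2 * ρ) * M + (K * C) ^ 2 * (4 * ρ) * (l2 μT m + √(2 * ρ) * M) := by gcongr
    _ ≤ _ := by
      have h0 : 0 ≤ √(2 * ρ) := by positivity
      have h1 : 0 ≤ (K * C) ^ 2 * (4 * ρ) := by positivity
      set α := (K * C) ^ 2 * (4 * ρ)
      set β := √(2 * ρ)
      have : (β + α * (1 + β)) * (l2 μT m + M) - (β * M + α * (l2 μT m + β * M)) =
        β * l2 μT m + α * β * l2 μT m + α * M := by ring
      have : 0 ≤ β * l2 μT m + α * β * l2 μT m + α * M := by positivity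
      linarith

end

/-! ### Raviart–Thomas–Nédélec fields -/

section

open MvPolynomial

variable {d : ℕ}

/-- The vector field with polynomial components `P`. -/
def polyField (P : Fin d → MvPolynomial (Fin d) ℝ) (x : Vec d) : Vec d :=
  WithLp.toLp 2 fun i => evalAt (P i) x

/-- The polynomials `P` are the components of a field in `RTN^{k+1}`. -/
def IsRTNPoly (k : ℕ) (P : Fin d → MvPolynomial (Fin d) ℝ) : Prop :=
  ∃ (p : Fin d → MvPolynomial (Fin d) ℝ) (q : MvPolynomial (Fin d) ℝ),
    (∀ i, DegLE k (p i)) ∧ DegLE k q ∧ ∀ i, P i = p i + X i * q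

/-- The divergence of a polynomial vector field. -/
def divPoly (P : Fin d → MvPolynomial (Fin d) ℝ) : MvPolynomial (Fin d) ℝ := ∑ i, pderiv i (P i)

@[simp] lemma polyField_apply (P : Fin d → MvPolynomial (Fin d) ℝ) (x : Vec d) (i : Fin d) :
    polyField P x i = evalAt (P i) x := rfl

lemma continuous_polyField (P : Fin d → MvPolynomial (Fin d) ℝ) : Continuous (polyField P) := by
  unfold polyField
  exact (PiLp.continuous_toLp 2 _).comp (continuous_pi fun i => continuous_evalAt (P i))

lemma inner_eq_sum (x y : Vec d) : inner ℝ x y = ∑ i, x i * y i := by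
  rw [PiLp.inner_apply]
  exact Finset.sum_congr rfl fun i _ => by simp [mul_comm]

lemma inner_basisVec_left (x : Vec d) (i : Fin d) : inner ℝ (basisVec i) x = x i := by
  rw [basisVec, EuclideanSpace.inner_single_left]; simp

lemma vec_eq_sum (x : Vec d) : x = ∑ i, x i • basisVec i := by
  ext j
  simp [basisVec, Finset.sum_apply, Pi.single_apply]

/-- The divergence theorem for a polynomial vector field multiplied by a polynomial. -/
lemma integral_divPoly_mul {ι : Type*} [Fintype ι] (b : AffineBasis ι ℝ (Vec d)) (hd : 1 ≤ d)
    (P : Fin d → MvPolynomial (Fin d) ℝ) (q : MvPolynomial (Fin d) ℝ) :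
    ∫ x in simplex b, evalAt (divPoly P) x * evalAt q x =
      (∑ j, ∫ y, inner ℝ (polyField P y) (facetNormal b j) * evalAt q y ∂facetMeasure b j) -
        ∑ i, ∫ x in simplex b, evalAt (P i) x * evalAt (pderiv i q) x := by
  have h1 : ∀ i, ∫ x in simplex b, (evalAt (pderiv i (P i)) x * evalAt q x +
      evalAt (P i) x * evalAt (pderiv i q) x) =
      ∑ j, ∫ y, facetNormal b j i * (evalAt (P i) y * evalAt q y) ∂facetMeasure b j := by
    intro i
    have := integral_fderiv_simplex b hd (contDiff_evalAt (P i * q)) (basisVec i)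
    simp_rw [inner_basisVec_left, evalAt_mul] at this
    rw [← this]
    refine integral_congr_ae (Eventually.of_forall fun x => ?_)
    simp only
    rw [← evalAt_pderiv, pderiv_mul, evalAt_add, evalAt_mul, evalAt_mul]
  have c := fun p : MvPolynomial (Fin d) ℝ => continuous_evalAt p
  have h2 := Finset.sum_congr (rfl : (Finset.univ : Finset (Fin d)) = _) fun i _ => h1 i
  have e1 : ∀ i, ∫ x in simplex b, (evalAt (pderiv i (P i)) x * evalAt q x +
      evalAt (P i) x * evalAt (pderiv i q) x) = (∫ x in simplex b, evalAt (pderiv i (P i)) x * evalAt q x)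
      + ∫ x in simplex b, evalAt (P i) x * evalAt (pderiv i q) x := fun i =>
    integral_add (integrableOn_simplex b ((c _).mul (c _))) (integrableOn_simplex b ((c _).mul (c _)))
  simp_rw [e1, Finset.sum_add_distrib] at h2
  rw [Finset.sum_comm] at h2
  have e2 : ∀ j, ∑ i, ∫ y, facetNormal b j i * (evalAt (P i) y * evalAt q y) ∂facetMeasure b j =
      ∫ y, inner ℝ (polyField P y) (facetNormal b j) * evalAt q y ∂facetMeasure b j := by
    intro j
    rw [← integral_finsetSum]
    · refine integral_congr_ae (Eventually.of_forall fun x => ?_)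
      simp only [inner_eq_sum, polyField_apply, Finset.sum_mul]
      exact Finset.sum_congr rfl fun i _ => by ring
    · intro i _
      exact integrable_facetMeasure b j hd (((c _).mul (c _)).const_mul _)
  simp_rw [e2] at h2
  have e3 : ∫ x in simplex b, evalAt (divPoly P) x * evalAt q x =
      ∑ i, ∫ x in simplex b, evalAt (pderiv i (P i)) x * evalAt q x := by
    rw [← integral_finsetSum]
    · refine integral_congr_ae (Eventually.of_forall fun x => ?_)
      simp only [divPoly, evalAt_sum, Finset.sum_mul]
    · intro i _
      exact integrableOn_simplex b ((c _).mul (c _))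
  rw [e3]; linarith

lemma pderiv_affSubst (c : Vec d) (p : MvPolynomial (Fin d) ℝ) (i : Fin d) :
    pderiv i (affSubst c 1 p) = affSubst c 1 (pderiv i p) := by
  rw [← sub_eq_zero]
  refine eq_zero_of_evalAt_eq_zero isOpen_univ Set.univ_nonempty fun x _ => ?_
  rw [evalAt_sub, evalAt_affSubst, evalAt_pderiv, evalAt_pderiv, one_smul]
  have e : evalAt (affSubst c 1 p) = fun y => evalAt p (c + y) := by
    ext y; rw [evalAt_affSubst, one_smul]
  rw [e, fderiv_comp_add_left, sub_self]

lemma affSubst_affSubst_neg (c : Vec d) (p : MvPolynomial (Fin d) ℝ) (x : Vec d) :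
    evalAt (affSubst (-c) 1 p) x = evalAt p (x - c) := by
  rw [evalAt_affSubst, one_smul]; congr 1; abel

lemma DegLE.add {ℓ : ℤ} {p q : MvPolynomial (Fin d) ℝ} (hp : DegLE ℓ p) (hq : DegLE ℓ q) :
    DegLE ℓ (p + q) := (polySub d ℓ).add_mem hp hq

lemma DegLE.sum {ℓ : ℤ} {κ : Type*} {s : Finset κ} {p : κ → MvPolynomial (Fin d) ℝ}
    (hp : ∀ i ∈ s, DegLE ℓ (p i)) : DegLE ℓ (∑ i ∈ s, p i) := (polySub d ℓ).sum_mem hp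

lemma DegLE.C_mul {ℓ : ℤ} {p : MvPolynomial (Fin d) ℝ} (a : ℝ) (hp : DegLE ℓ p) :
    DegLE ℓ (C a * p) := by
  rw [← smul_eq_C_mul]; exact (polySub d ℓ).smul_mem a hp

/-- Normal form of an RTN field: up to a field with components of degree at most `k`, it is
`(x - c) Q(x - c)` with `Q` homogeneous of degree `k`, and `Q` is determined by the divergence. -/
lemma IsRTNPoly.normal_form {k : ℕ} {P : Fin d → MvPolynomial (Fin d) ℝ} (hP : IsRTNPoly k P)
    (c : Vec d) : ∃ (w : Fin d → MvPolynomial (Fin d) ℝ) (Q : MvPolynomial (Fin d) ℝ),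
      (∀ i, DegLE k (w i)) ∧ DegLE k Q ∧
      (∀ i x, evalAt (P i) x = evalAt (w i) x + (x i - c i) * evalAt Q x) ∧
      ∀ x, (d + k : ℝ) * evalAt Q x =
        evalAt (homogeneousComponent k (affSubst c 1 (divPoly P))) (x - c) := by
  obtain ⟨p, q, hp, hq, hPq⟩ := hP
  set q' := affSubst c 1 q with hq'
  have hq'd : DegLE k q' := degLE_affSubst _ _ hq
  set Q := homogeneousComponent k q' with hQ
  have hQh : Q.IsHomogeneous k := homogeneousComponent_isHomogeneous k q'
  have hlow : DegLE ((k : ℤ) - 1) (q' - Q) := by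
    have h1 := sum_homogeneousComponent_range hq'd
    rw [Finset.sum_range_succ] at h1
    have h2 : q' - Q = ∑ j ∈ Finset.range k, homogeneousComponent j q' := by
      rw [hQ]; exact (eq_sub_of_add_eq h1).symm
    rw [h2]
    refine DegLE.sum fun j hj => ?_
    refine DegLE.mono ?_ (IsHomogeneous.degLE (homogeneousComponent_isHomogeneous j q'))
    simp only [Finset.mem_range] at hj; omega
  set w' : Fin d → MvPolynomial (Fin d) ℝ := fun i =>
    affSubst c 1 (p i) + C (c i) * q' + X i * (q' - Q) with hw'
  have hw'd : ∀ i, DegLE k (w' i) := fun i =>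
    ((degLE_affSubst _ _ (hp i)).add (hq'd.C_mul _)).add
      (by simpa using (degLE_X i).mul hlow)
  have hP' : ∀ i, affSubst c 1 (P i) = w' i + X i * Q := by
    intro i
    rw [hPq i]
    have : affSubst c 1 (p i + X i * q) = affSubst c 1 (p i) + (C (c i) + X i) * q' := by
      simp [affSubst, hq']
    rw [this, hw']; ring
  refine ⟨fun i => affSubst (-c) 1 (w' i), affSubst (-c) 1 Q, fun i => degLE_affSubst _ _ (hw'd i),
    degLE_affSubst _ _ (IsHomogeneous.degLE hQh), fun i x => ?_, fun x => ?_⟩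
  · rw [affSubst_affSubst_neg, affSubst_affSubst_neg]
    have h1 : evalAt (P i) x = evalAt (affSubst c 1 (P i)) (x - c) := by
      rw [evalAt_affSubst, one_smul]; congr 1; abel
    rw [h1, hP' i]; simp
  · rw [affSubst_affSubst_neg]
    have h1 : affSubst c 1 (divPoly P) = (∑ i, pderiv i (w' i)) + (d + k : ℝ) • Q := by
      have e1 : affSubst c 1 (divPoly P) = ∑ i, pderiv i (affSubst c 1 (P i)) := by
        simp_rw [pderiv_affSubst, divPoly]
        exact map_sum (bind₁ _) _ _
      rw [e1]
      simp_rw [hP', map_add, Finset.sum_add_distrib, pderiv_mul, pderiv_X_self, one_mul,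
        Finset.sum_add_distrib]
      -- the identity of Euler: `div (x Q) = (d + k) Q`
      have h2 := hQh.sum_X_mul_pderiv
      rw [h2, add_smul]
      simp [smul_eq_C_mul]
    have hlow2 : homogeneousComponent k (∑ i, pderiv i (w' i)) = 0 := by
      have h3 : DegLE ((k : ℤ) - 1) (∑ i, pderiv i (w' i)) :=
        DegLE.sum fun i _ => (hw'd i).pderiv i
      rcases h3 with h3 | h3
      · rw [h3, map_zero]
      · exact homogeneousComponent_eq_zero _ _ (by omega)
    rw [h1, map_add, hlow2, zero_add, map_smul, evalAt_smul,
      homogeneousComponent_of_mem hQh, if_pos rfl]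

/-- A divergence-free RTN field has components of degree at most `k`. -/
lemma IsRTNPoly.degLE_of_divPoly_eq_zero {k : ℕ} (hd : 1 ≤ d) {P : Fin d → MvPolynomial (Fin d) ℝ}
    (hP : IsRTNPoly k P) (h0 : divPoly P = 0) (i : Fin d) : DegLE k (P i) := by
  obtain ⟨w, Q, hw, hQ, hPw, hdiv⟩ := hP.normal_form 0
  have hQ0 : ∀ x, evalAt Q x = 0 := by
    intro x
    have h1 := hdiv x
    have h2 : affSubst (0 : Vec d) 1 (divPoly P) = 0 := by rw [h0]; simp [affSubst]
    rw [h2, map_zero, evalAt_zero] at h1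
    have : (0 : ℝ) < d + k := by
      have : (1 : ℝ) ≤ d := by exact_mod_cast hd
      positivity
    exact (mul_eq_zero.1 h1).resolve_left this.ne'
  have : P i = w i := by
    rw [← sub_eq_zero]
    refine eq_zero_of_evalAt_eq_zero isOpen_univ Set.univ_nonempty fun x _ => ?_
    rw [evalAt_sub, hPw, hQ0]; ring
  rw [this]; exact hw i

/-- On a facet the normal component of an RTN field is a polynomial of degree at most `k`. -/
lemma IsRTNPoly.exists_normal_component {ι : Type*} [Fintype ι] (b : AffineBasis ι ℝ (Vec d)) (j : ι)
    {k : ℕ} {P : Fin d → MvPolynomial (Fin d) ℝ} (hP : IsRTNPoly k P) :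
    ∃ s, DegLE k s ∧ ∀ x ∈ facet b j, inner ℝ (polyField P x) (facetNormal b j) = evalAt s x := by
  obtain ⟨p, q, hp, hq, hPq⟩ := hP
  by_cases hne : (facet b j).Nonempty
  · obtain ⟨y, hy⟩ := hne
    refine ⟨(∑ i, C (facetNormal b j i) * p i) + C (inner ℝ y (facetNormal b j)) * q,
      (DegLE.sum fun i _ => (hp i).C_mul _).add (hq.C_mul _), fun x hx => ?_⟩
    -- `x ↦ ⟨x, n⟩` is constant on the facet, which removes the term of degree `k + 1`
    rw [← inner_facetNormal_facet b j x y hx hy]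
    simp only [inner_eq_sum, polyField_apply, hPq, evalAt_add, evalAt_mul, evalAt_X, evalAt_sum,
      evalAt_C, Finset.sum_mul]
    rw [← Finset.sum_add_distrib]
    exact Finset.sum_congr rfl fun i _ => by ring
  · exact ⟨0, Or.inl rfl, fun x hx => absurd ⟨x, hx⟩ hne⟩

lemma memLp_apply {μ : Measure (Vec d)} {m : Vec d → Vec d} (hm : MemLp m 2 μ) (i : Fin d) :
    MemLp (fun x => m x i) 2 μ :=
  hm.mono ((EuclideanSpace.proj i : Vec d →L[ℝ] ℝ).continuous.comp_aestronglyMeasurable hm.1)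
    (Eventually.of_forall fun x => by simpa using PiLp.norm_apply_le (m x) i)

lemma l2_apply_le {μ : Measure (Vec d)} {m : Vec d → Vec d} (hm : MemLp m 2 μ) (i : Fin d) :
    l2 μ (fun x => m x i) ≤ l2 μ m :=
  l2_mono_ae hm (Eventually.of_forall fun x => by simpa using PiLp.norm_apply_le (m x) i)

lemma memLp_inner_const {μ : Measure (Vec d)} {m : Vec d → Vec d} (hm : MemLp m 2 μ) (n : Vec d) :
    MemLp (fun x => inner ℝ (m x) n) 2 μ := by
  have := hm.const_inner (𝕜 := ℝ) n
  simpa [real_inner_comm] using this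

set_option maxHeartbeats 1000000 in
/-- Stability of the degrees of freedom of the Raviart–Thomas–Nédélec element. The divergence of `P`
is a polynomial of degree at most `k`, so that testing the divergence theorem with it involves only
degrees of freedom. It controls the part `(x - c) Q` of the normal form, and each normal component of
the remaining part, of degree at most `k`, is controlled by `exists_bound_of_moments`. The normals
span the space, by `ShapeRegular.norm_le_sum`. -/
theorem exists_rtn_stability (d k : ℕ) (ϱ : ℝ) : ∃ C : ℝ, 0 < C ∧ ∀ {ι : Type} [Fintype ι]
    (b : AffineBasis ι ℝ (Vec d)) (c : Vec d) (r : ℝ), 1 ≤ d → ShapeRegular b ϱ c r →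
      ∀ P : Fin d → MvPolynomial (Fin d) ℝ, IsRTNPoly k P →
      ∀ (m : Vec d → Vec d) (g : ι → Vec d → ℝ), MemLp m 2 (volume.restrict (simplex b)) →
        (∀ j, MemLp (g j) 2 (facetMeasure b j)) →
        (∀ i R, DegLE ((k : ℤ) - 1) R →
          ∫ x in simplex b, evalAt (P i) x * evalAt R x = ∫ x in simplex b, m x i * evalAt R x) →
        (∀ j s, DegLE k s →
          ∫ x, inner ℝ (polyField P x) (facetNormal b j) * evalAt s x ∂facetMeasure b j =
            ∫ x, g j x * evalAt s x ∂facetMeasure b j) →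
        l2 (volume.restrict (simplex b)) (polyField P) ≤
          C * (l2 (volume.restrict (simplex b)) m + √r * ∑ j, l2 (facetMeasure b j) (g j)) := by
  obtain ⟨C0, hC0, hinv⟩ := exists_inverse_inequality d k ϱ
  obtain ⟨C1, hC1, htr⟩ := exists_discrete_trace d k ϱ
  obtain ⟨C2, hC2, hmom⟩ := exists_bound_of_moments d k ϱ
  obtain ⟨ρ, hρ⟩ : ∃ x : ℝ, x = |ϱ| := ⟨_, rfl⟩
  have hρ0 : 0 ≤ ρ := by rw [hρ]; exact abs_nonneg _
  -- the constants for the divergence, the top degree part and the normal components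
  obtain ⟨CD, hCD⟩ : ∃ x : ℝ, x = C1 * (1 + d) := ⟨_, rfl⟩
  have hCD0 : 0 ≤ CD := by rw [hCD]; positivity
  obtain ⟨CQ, hCQ⟩ : ∃ x : ℝ, x = C0 * CD := ⟨_, rfl⟩
  have hCQ0 : 0 ≤ CQ := by rw [hCQ]; positivity
  obtain ⟨CW, hCW⟩ : ∃ x : ℝ, x = C2 * (1 + 2 * ρ * CQ + 1 + 2 * ρ * C1 * CQ) := ⟨_, rfl⟩
  have hCW0 : 0 ≤ CW := by rw [hCW]; positivity
  refine ⟨ρ * ((d + 1) * CW) + 2 * ρ * CQ + 1, by positivity, ?_⟩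
  intro ι _ b c r hd H P hP m g hm hg hPm hPg
  have hr := H.pos
  have hϱ := H.one_le hd
  have hϱρ : ϱ = ρ := by rw [hρ, abs_of_nonneg (by linarith)]
  set μT := volume.restrict (simplex b) with hμT
  have hA := sqrt_volume_pos H
  obtain ⟨S, hS⟩ : ∃ x : ℝ, x = l2 μT m + √r * ∑ j, l2 (facetMeasure b j) (g j) := ⟨_, rfl⟩
  rw [← hS]
  have hm0 := l2_nonneg (μ := μT) m
  have hg0 : ∀ j, 0 ≤ l2 (facetMeasure b j) (g j) := fun j => l2_nonneg _
  have hgs : 0 ≤ √r * ∑ j, l2 (facetMeasure b j) (g j) :=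
    mul_nonneg (Real.sqrt_nonneg _) (Finset.sum_nonneg fun j _ => hg0 j)
  have hS0 : 0 ≤ S := hS ▸ add_nonneg hm0 hgs
  have mT : ∀ p : MvPolynomial (Fin d) ℝ, MemLp (evalAt p) 2 μT := fun p =>
    memLp_simplex b (continuous_evalAt p) 2
  have mF : ∀ j, ∀ p : MvPolynomial (Fin d) ℝ, MemLp (evalAt p) 2 (facetMeasure b j) := fun j p =>
    memLp_facetMeasure b j hd (continuous_evalAt p) 2
  obtain ⟨w, Q, hw, hQ, hPw, hQdiv⟩ := hP.normal_form c
  have hq : DegLE k (divPoly P) := by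
    obtain ⟨p, q, hp, hq, hPq⟩ := hP
    refine DegLE.sum fun i _ => ?_
    have h1 : DegLE (k + 1) (P i) := by
      rw [hPq i]
      refine ((hp i).mono (by omega)).add ?_
      have := (degLE_X i).mul hq
      exact this.mono (by omega)
    simpa using h1.pderiv i
  obtain ⟨q, hqdef⟩ : ∃ q, q = divPoly P := ⟨_, rfl⟩
  rw [← hqdef] at hq
  simp only [← hqdef] at hQdiv
  obtain ⟨D, hD⟩ : ∃ x : ℝ, x = l2 μT (evalAt q) := ⟨_, rfl⟩
  have hD0 : 0 ≤ D := hD ▸ l2_nonneg _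
  -- control of the divergence
  have hDle : r * D ≤ CD * S := by
    have h1 : D ^ 2 ≤ (∑ j, l2 (facetMeasure b j) (g j) * l2 (facetMeasure b j) (evalAt q)) +
        ∑ i, l2 μT m * l2 μT (evalAt (pderiv i q)) := by
      have e1 : D ^ 2 = ∫ x in simplex b, evalAt q x * evalAt q x := by
        rw [hD, l2_sq_real (mT q)]; simp only [sq]; rfl
      have e2 := integral_divPoly_mul b hd P q
      rw [← hqdef, ← e1] at e2
      rw [e2, sub_eq_add_neg, ← Finset.sum_neg_distrib]
      gcongr with j _ i _
      · rw [hPg j q hq]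
        exact (le_abs_self _).trans (abs_integral_mul_le (hg j) (mF j q))
      · rw [hPm i _ (hq.pderiv i)]
        refine (neg_le_abs _).trans ((abs_integral_mul_le (memLp_apply hm i) (mT _)).trans ?_)
        gcongr
        · exact l2_nonneg _
        · exact l2_apply_le hm i
    have h2 : r * D ^ 2 ≤ (CD * S) * D := by
      have hrr : r = √r * √r := (Real.mul_self_sqrt hr.le).symm
      calc r * D ^ 2 ≤ r * ((∑ j, l2 (facetMeasure b j) (g j) * l2 (facetMeasure b j) (evalAt q)) +
            ∑ i, l2 μT m * l2 μT (evalAt (pderiv i q))) := by gcongr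
        _ = √r * (∑ j, l2 (facetMeasure b j) (g j) * (√r * l2 (facetMeasure b j) (evalAt q))) +
            ∑ i, l2 μT m * (r * l2 μT (evalAt (pderiv i q))) := by
            rw [mul_add, Finset.mul_sum, Finset.mul_sum, Finset.mul_sum]
            congr 1
            · refine Finset.sum_congr rfl fun j _ => ?_
              conv_lhs => rw [hrr]
              ring
            · exact Finset.sum_congr rfl fun j _ => by ring
        _ ≤ √r * (∑ j, l2 (facetMeasure b j) (g j) * (C1 * D)) + ∑ i : Fin d, l2 μT m * (C1 * D) := by
            refine add_le_add (mul_le_mul_of_nonneg_left (Finset.sum_le_sum fun j _ => ?_)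
              (Real.sqrt_nonneg r)) (Finset.sum_le_sum fun i _ => ?_)
            · rw [hD]; exact mul_le_mul_of_nonneg_left ((htr b c r hd H q hq).1 j) (hg0 j)
            · rw [hD]; exact mul_le_mul_of_nonneg_left ((htr b c r hd H q hq).2 i) hm0
        _ = C1 * (√r * ∑ j, l2 (facetMeasure b j) (g j) + d * l2 μT m) * D := by
            rw [← Finset.sum_mul, Finset.sum_const, Finset.card_univ, Fintype.card_fin, nsmul_eq_mul]
            ring
        _ ≤ _ := by
            have h0 : (0 : ℝ) ≤ d := by positivity
            refine mul_le_mul_of_nonneg_right ?_ hD0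
            rw [hCD, mul_assoc]
            refine mul_le_mul_of_nonneg_left ?_ hC1.le
            have h3 := mul_nonneg h0 hgs
            rw [hS]
            linarith
    by_cases hD' : D = 0
    · rw [hD']; simp; positivity
    · have hDpos := lt_of_le_of_ne hD0 (Ne.symm hD')
      refine le_of_mul_le_mul_right ?_ hDpos
      calc r * D * D = r * D ^ 2 := by ring
        _ ≤ _ := h2
  -- control of the part of top degree
  have hd1 : (1 : ℝ) ≤ d := by exact_mod_cast hd
  have hQle : r * l2 μT (evalAt Q) ≤ CQ * S := by
    have h1 : l2 μT (evalAt Q) ≤ C0 * D := by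
      have := l2_simplex_le_of_bound b (f := evalAt Q) (B := C0 * D / √(volume.real (simplex b)))
        (by positivity) (fun x hx => by
          rw [le_div_iff₀ hA]
          rw [hD]
          refine le_trans ?_ (hinv b c r hd H q hq x hx).2.2
          rw [← hQdiv x, abs_mul]
          gcongr
          rw [abs_of_nonneg (by positivity), Real.norm_eq_abs]
          have hk0 : (0 : ℝ) ≤ k := by positivity
          nlinarith [abs_nonneg (evalAt Q x)])
      refine this.trans (le_of_eq ?_)
      field_simp
    calc _ ≤ r * (C0 * D) := by gcongr
      _ = C0 * (r * D) := by ring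
      _ ≤ C0 * (CD * S) := by gcongr
      _ = _ := by rw [hCQ]; ring
  have hxc : ∀ x ∈ simplex b, ‖x - c‖ ≤ 2 * ρ * r := by
    intro x hx
    have := H.subset_closedBall hx
    rwa [Metric.mem_closedBall, dist_eq_norm, hϱρ] at this
  have hQ0 := l2_nonneg (μ := μT) (evalAt Q)
  -- control of the normal components of the remaining part
  set W : ι → MvPolynomial (Fin d) ℝ := fun j => ∑ i, C (facetNormal b j i) * w i with hW
  have hWd : ∀ j, DegLE k (W j) := fun j => DegLE.sum fun i _ => (hw i).C_mul _
  have hWe : ∀ j x, evalAt (W j) x = inner ℝ (polyField w x) (facetNormal b j) := by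
    intro j x
    simp only [hW, evalAt_sum, evalAt_mul, evalAt_C, inner_eq_sum, polyField_apply]
    exact Finset.sum_congr rfl fun i _ => by ring
  have hPwv : ∀ x, polyField P x = polyField w x + evalAt Q x • (x - c) := by
    intro x
    ext i
    simp only [polyField_apply, PiLp.add_apply, PiLp.smul_apply, PiLp.sub_apply, smul_eq_mul, hPw]
    ring
  have hWe2 : ∀ j x, evalAt (W j) x = inner ℝ (polyField P x) (facetNormal b j) -
      inner ℝ (x - c) (facetNormal b j) * evalAt Q x := by
    intro j x
    rw [hWe, hPwv, inner_add_left, inner_smul_left]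
    simp; ring
  have hnx : ∀ j, ∀ x ∈ simplex b, |inner ℝ (x - c) (facetNormal b j) * evalAt Q x| ≤
      2 * ρ * r * |evalAt Q x| := by
    intro j x hx
    rw [abs_mul]
    gcongr
    refine (abs_real_inner_le_norm _ _).trans ?_
    rw [norm_facetNormal b j hd, mul_one]
    exact hxc x hx
  have hcn : ∀ j, Continuous fun x : Vec d => inner ℝ (x - c) (facetNormal b j) * evalAt Q x :=
    fun j => by
      have := continuous_evalAt Q
      fun_prop
  have hWle : ∀ j, l2 μT (evalAt (W j)) ≤ CW * S := by
    intro j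
    have m1 : MemLp (fun x => inner ℝ (m x) (facetNormal b j)) 2 μT := memLp_inner_const hm _
    have m2 : MemLp (fun x => inner ℝ (x - c) (facetNormal b j) * evalAt Q x) 2 μT :=
      memLp_simplex b (hcn j) 2
    have hb := hmom b c r hd H j (W j) (hWd j)
      (fun x => inner ℝ (m x) (facetNormal b j) - inner ℝ (x - c) (facetNormal b j) * evalAt Q x)
      (m1.sub m2) (fun R hR => by
        have mPR : ∀ i, Integrable (fun x => facetNormal b j i * (evalAt (P i) x * evalAt R x)) μT :=
          fun i => (integrable_mul_of_memLp (mT _) (mT R)).const_mul _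
        have mmR : ∀ i, Integrable (fun x => facetNormal b j i * (m x i * evalAt R x)) μT :=
          fun i => (integrable_mul_of_memLp (memLp_apply hm i) (mT R)).const_mul _
        have e1 : ∫ x, inner ℝ (polyField P x) (facetNormal b j) * evalAt R x ∂μT =
            ∫ x, inner ℝ (m x) (facetNormal b j) * evalAt R x ∂μT := by
          simp only [inner_eq_sum, polyField_apply, Finset.sum_mul]
          have e2 : ∀ a c' : ℝ, ∀ e : ℝ, a * c' * e = c' * (a * e) := fun a c' e => by ring
          simp_rw [e2]
          rw [integral_finsetSum _ fun i _ => mPR i, integral_finsetSum _ fun i _ => mmR i]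
          refine Finset.sum_congr rfl fun i _ => ?_
          rw [integral_const_mul, integral_const_mul, hPm i R hR]
        have mPn : MemLp (fun x => inner ℝ (polyField P x) (facetNormal b j)) 2 μT :=
          memLp_inner_const (memLp_simplex b (continuous_polyField P) 2) _
        simp_rw [hWe2, sub_mul]
        rw [integral_sub (integrable_mul_of_memLp mPn (mT R)) (integrable_mul_of_memLp m2 (mT R)),
          integral_sub (integrable_mul_of_memLp m1 (mT R)) (integrable_mul_of_memLp m2 (mT R)), e1])
    have h1 : l2 μT (fun x => inner ℝ (m x) (facetNormal b j) -
        inner ℝ (x - c) (facetNormal b j) * evalAt Q x) ≤ l2 μT m + 2 * ρ * r * l2 μT (evalAt Q) := by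
      refine (l2_sub_le m1 m2).trans ?_
      gcongr
      · refine l2_mono_ae hm (Eventually.of_forall fun x => ?_)
        refine (norm_inner_le_norm _ _).trans ?_
        rw [norm_facetNormal b j hd, mul_one]
      · refine l2_mul_le (by positivity) (mT Q) ?_
        exact (ae_restrict_mem (measurableSet_simplex b)).mono (hnx j)
    have h2 : l2 (facetMeasure b j) (fun x => inner ℝ (polyField P x) (facetNormal b j)) ≤
        l2 (facetMeasure b j) (g j) := by
      obtain ⟨s, hs, hse⟩ := hP.exists_normal_component b j
      have hae : (fun x => inner ℝ (polyField P x) (facetNormal b j)) =ᵐ[facetMeasure b j] evalAt s :=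
        (ae_mem_facet b j).mono hse
      rw [l2_congr_ae hae]
      have e1 : l2 (facetMeasure b j) (evalAt s) ^ 2 = ∫ x, g j x * evalAt s x ∂facetMeasure b j := by
        rw [← hPg j s hs, l2_sq_real (mF j s)]
        refine integral_congr_ae (hae.mono fun x hx => ?_)
        simp only at hx ⊢
        rw [hx]; ring
      have e2 := (le_abs_self _).trans (abs_integral_mul_le (hg j) (mF j s))
      rw [← e1, sq] at e2
      by_cases hs0 : l2 (facetMeasure b j) (evalAt s) = 0
      · rw [hs0]; exact l2_nonneg _
      · exact le_of_mul_le_mul_right e2 (lt_of_le_of_ne (l2_nonneg _) (Ne.symm hs0))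
    have h3 : √r * l2 (facetMeasure b j) (evalAt (W j)) ≤ √r * l2 (facetMeasure b j) (g j) +
        2 * ρ * r * (C1 * l2 μT (evalAt Q)) := by
      have h4 : l2 (facetMeasure b j) (evalAt (W j)) ≤ l2 (facetMeasure b j) (g j) +
          2 * ρ * r * l2 (facetMeasure b j) (evalAt Q) := by
        rw [show evalAt (W j) = fun x => inner ℝ (polyField P x) (facetNormal b j) -
          inner ℝ (x - c) (facetNormal b j) * evalAt Q x from funext (hWe2 j)]
        refine (l2_sub_le (memLp_inner_const (memLp_facetMeasure b j hd (continuous_polyField P) 2) _)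
          (memLp_facetMeasure b j hd (hcn j) 2)).trans ?_
        gcongr
        refine l2_mul_le (by positivity) (mF j Q) ?_
        exact (ae_mem_facet b j).mono fun x hx => hnx j x (facet_subset b j hx)
      calc _ ≤ √r * (l2 (facetMeasure b j) (g j) +
          2 * ρ * r * l2 (facetMeasure b j) (evalAt Q)) := by gcongr
        _ = √r * l2 (facetMeasure b j) (g j) +
          2 * ρ * r * (√r * l2 (facetMeasure b j) (evalAt Q)) := by ring
        _ ≤ _ := by
          exact add_le_add le_rfl (mul_le_mul_of_nonneg_left ((htr b c r hd H Q hQ).1 j)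
            (by positivity))
    have h5 : √r * l2 (facetMeasure b j) (g j) ≤ √r * ∑ j, l2 (facetMeasure b j) (g j) := by
      gcongr
      exact Finset.single_le_sum (f := fun j => l2 (facetMeasure b j) (g j)) (fun j _ => hg0 j)
        (Finset.mem_univ j)
    refine hb.trans ?_
    rw [hCW, mul_assoc]
    gcongr
    have h6 : 2 * ρ * r * l2 μT (evalAt Q) ≤ 2 * ρ * (CQ * S) := by
      calc _ = 2 * ρ * (r * l2 μT (evalAt Q)) := by ring
        _ ≤ _ := by gcongr
    have h7 : 2 * ρ * r * (C1 * l2 μT (evalAt Q)) ≤ 2 * ρ * C1 * (CQ * S) := by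
      calc _ = 2 * ρ * C1 * (r * l2 μT (evalAt Q)) := by ring
        _ ≤ _ := by gcongr
    have h8 : l2 μT m + √r * l2 (facetMeasure b j) (g j) ≤ S := by rw [hS]; linarith
    have e : (1 + 2 * ρ * CQ + 1 + 2 * ρ * C1 * CQ) * S =
      S + 2 * ρ * (CQ * S) + 2 * ρ * C1 * (CQ * S) + S := by ring
    rw [e]
    linarith
  -- conclusion
  have hfin : l2 μT (polyField P) ≤ ρ * ∑ j, l2 μT (evalAt (W j)) + 2 * ρ * r * l2 μT (evalAt Q) := by
    have m1 : ∀ j, MemLp (fun x => ρ * |evalAt (W j) x|) 2 μT := fun j => ((mT (W j)).abs).const_mul ρ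
    have m2 : MemLp (fun x => 2 * ρ * r * evalAt Q x) 2 μT := (mT Q).const_mul _
    have m3 : MemLp (fun x => ∑ j, ρ * |evalAt (W j) x|) 2 μT :=
      memLp_finsetSum Finset.univ fun j _ => m1 j
    have m4 : MemLp (fun x => |2 * ρ * r * evalAt Q x|) 2 μT := m2.abs
    have hle : l2 μT (polyField P) ≤
        l2 μT (fun x => (∑ j, ρ * |evalAt (W j) x|) + |2 * ρ * r * evalAt Q x|) := by
      refine l2_mono_ae (m3.add m4)
        ((ae_restrict_mem (measurableSet_simplex b)).mono fun x hx => ?_)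
      refine le_trans ?_ (le_abs_self _)
      rw [hPwv]
      refine (norm_add_le _ _).trans ?_
      gcongr
      · rw [← Finset.mul_sum, ← hϱρ]
        simp_rw [hWe]
        exact H.norm_le_sum hd _
      · rw [norm_smul, abs_mul, abs_of_nonneg (by positivity : 0 ≤ 2 * ρ * r), mul_comm,
          Real.norm_eq_abs]
        gcongr
        exact hxc x hx
    refine hle.trans ((l2_add_le m3 m4).trans ?_)
    gcongr
    · refine (l2_sum_le Finset.univ fun j _ => m1 j).trans ?_
      rw [Finset.mul_sum]
      refine Finset.sum_le_sum fun j _ => ?_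
      rw [l2_const_mul, abs_of_nonneg hρ0]
      gcongr
      exact (l2_norm (evalAt (W j))).le
    · have e := l2_norm (μ := μT) (fun x => 2 * ρ * r * evalAt Q x)
      simp only [Real.norm_eq_abs] at e
      rw [e, l2_const_mul, abs_of_nonneg (by positivity)]
  calc _ ≤ _ := hfin
    _ ≤ ρ * ∑ j : ι, CW * S + 2 * ρ * (CQ * S) := by
        gcongr ρ * ?_ + ?_
        · exact Finset.sum_le_sum fun j _ => hWle j
        · calc _ = 2 * ρ * (r * l2 μT (evalAt Q)) := by ring
            _ ≤ _ := by gcongr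
    _ = (ρ * ((d + 1) * CW) + 2 * ρ * CQ) * S := by
        rw [Finset.sum_const, Finset.card_univ, card_index b]; simp; ring
    _ ≤ _ := mul_le_mul_of_nonneg_right (by linarith) hS0

end

/-! ### Existence of projections, interpolates and discrete gradients -/

section

open MvPolynomial

variable {d : ℕ}

/-- The moments of a function against polynomials. -/
def momentMap {μ : Measure (Vec d)} (hμ : ∀ p : MvPolynomial (Fin d) ℝ, MemLp (evalAt p) 2 μ)
    {f : Vec d → ℝ} (hf : MemLp f 2 μ) : MvPolynomial (Fin d) ℝ →ₗ[ℝ] ℝ where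
  toFun p := ∫ x, f x * evalAt p x ∂μ
  map_add' p q := by
    simp only [evalAt_add, mul_add]
    exact integral_add (integrable_mul_of_memLp hf (hμ p)) (integrable_mul_of_memLp hf (hμ q))
  map_smul' a p := by
    simp only [evalAt_smul, RingHom.id_apply, smul_eq_mul]
    rw [← integral_const_mul]
    exact integral_congr_ae (Eventually.of_forall fun x => by simp only; ring)

/-- The `L²` bilinear form on polynomials. -/
def momentForm {μ : Measure (Vec d)} (hμ : ∀ p : MvPolynomial (Fin d) ℝ, MemLp (evalAt p) 2 μ) :
    MvPolynomial (Fin d) ℝ →ₗ[ℝ] MvPolynomial (Fin d) ℝ →ₗ[ℝ] ℝ where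
  toFun p := momentMap hμ (hμ p)
  map_add' p q := by
    refine LinearMap.ext fun r => ?_
    show ∫ x, evalAt (p + q) x * evalAt r x ∂μ = _
    simp only [evalAt_add, add_mul]
    exact integral_add (integrable_mul_of_memLp (hμ p) (hμ r)) (integrable_mul_of_memLp (hμ q) (hμ r))
  map_smul' a p := by
    refine LinearMap.ext fun r => ?_
    show ∫ x, evalAt (a • p) x * evalAt r x ∂μ = a * ∫ x, evalAt p x * evalAt r x ∂μ
    simp only [evalAt_smul, mul_assoc]
    rw [← integral_const_mul]

lemma momentForm_apply {μ : Measure (Vec d)}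
    (hμ : ∀ p : MvPolynomial (Fin d) ℝ, MemLp (evalAt p) 2 μ) (p q : MvPolynomial (Fin d) ℝ) :
    momentForm hμ p q = ∫ x, evalAt p x * evalAt q x ∂μ := rfl

/-- Existence of the `L²`-orthogonal projection on polynomials of degree at most `ℓ`. -/
lemma exists_polynomial_projection {μ : Measure (Vec d)}
    (hμ : ∀ p : MvPolynomial (Fin d) ℝ, MemLp (evalAt p) 2 μ) {f : Vec d → ℝ} (hf : MemLp f 2 μ)
    (ℓ : ℤ) : ∃ p, DegLE ℓ p ∧
      ∀ r, DegLE ℓ r → ∫ x, evalAt p x * evalAt r x ∂μ = ∫ x, f x * evalAt r x ∂μ := by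
  set K := (polySub d ℓ).map (polyToLp hμ) with hK
  obtain ⟨p, hp, hpe⟩ := Submodule.mem_map.1 (Submodule.starProjection_apply_mem K (hf.toLp f))
  refine ⟨p, hp, fun r hr => ?_⟩
  have h1 := Submodule.starProjection_inner_eq_zero (K := K) (hf.toLp f) (polyToLp hμ r)
    (Submodule.mem_map_of_mem hr)
  rw [← hpe, inner_sub_left, sub_eq_zero] at h1
  have h2 : ∀ {g : Vec d → ℝ} (hg : MemLp g 2 μ), inner ℝ (hg.toLp g) (polyToLp hμ r) =
      ∫ x, g x * evalAt r x ∂μ := by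
    intro g hg
    rw [L2.inner_def]
    refine integral_congr_ae ?_
    filter_upwards [hg.coeFn_toLp, (hμ r).coeFn_toLp] with x h1 h2
    have h3 : (polyToLp hμ r : Vec d → ℝ) x = evalAt r x := h2
    rw [h1, h3]
    simp [mul_comm]
  rw [h2 hf] at h1
  rw [h1]
  exact (h2 (hμ p)).symm

instance (k : ℕ) : FiniteDimensional ℝ (homogeneousSubmodule (Fin d) ℝ k) :=
  Submodule.finiteDimensional_of_le (S₂ := polySub d k) fun _ hp => IsHomogeneous.degLE hp

/-- Parametrization of `RTN^{k+1}` by the fields with components in `𝒫^k` and the homogeneous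
polynomials of degree `k`. -/
def rtnParam (d k : ℕ) : ((Fin d → polySub d k) × homogeneousSubmodule (Fin d) ℝ k) →ₗ[ℝ]
    (Fin d → MvPolynomial (Fin d) ℝ) where
  toFun a i := (a.1 i : MvPolynomial (Fin d) ℝ) + X i * (a.2 : MvPolynomial (Fin d) ℝ)
  map_add' a a' := by ext1 i; simp; ring
  map_smul' t a := by ext1 i; simp

lemma rtnParam_apply {k : ℕ} (a : (Fin d → polySub d k) × homogeneousSubmodule (Fin d) ℝ k)
    (i : Fin d) : rtnParam d k a i =
      (a.1 i : MvPolynomial (Fin d) ℝ) + X i * (a.2 : MvPolynomial (Fin d) ℝ) := rfl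

lemma isRTNPoly_rtnParam {k : ℕ} (a : (Fin d → polySub d k) × homogeneousSubmodule (Fin d) ℝ k) :
    IsRTNPoly k (rtnParam d k a) :=
  ⟨fun i => a.1 i, a.2, fun i => (a.1 i).2, IsHomogeneous.degLE a.2.2, fun _ => rfl⟩

lemma IsRTNPoly.exists_rtnParam {k : ℕ} {P : Fin d → MvPolynomial (Fin d) ℝ} (hP : IsRTNPoly k P) :
    ∃ a, rtnParam d k a = P := by
  obtain ⟨p, q, hp, hq, hPq⟩ := hP
  have hlow : DegLE ((k : ℤ) - 1) (q - homogeneousComponent k q) := by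
    have h1 := sum_homogeneousComponent_range hq
    rw [Finset.sum_range_succ] at h1
    rw [← eq_sub_of_add_eq h1]
    refine DegLE.sum fun j hj => ?_
    refine DegLE.mono ?_ (IsHomogeneous.degLE (homogeneousComponent_isHomogeneous j q))
    simp only [Finset.mem_range] at hj; omega
  refine ⟨⟨fun i => ⟨p i + X i * (q - homogeneousComponent k q), (hp i).add
    (by simpa using (degLE_X i).mul hlow)⟩, ⟨homogeneousComponent k q,
      homogeneousComponent_isHomogeneous k q⟩⟩, ?_⟩
  ext1 i
  rw [rtnParam_apply, hPq]
  simp only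
  ring

lemma rtnParam_injective (hd : 1 ≤ d) (k : ℕ) : Function.Injective (rtnParam d k) := by
  rw [injective_iff_map_eq_zero]
  intro a ha
  have h : ∀ i, (a.1 i : MvPolynomial (Fin d) ℝ) + X i * (a.2 : MvPolynomial (Fin d) ℝ) = 0 :=
    fun i => congrFun ha i
  have h2 : (a.2 : MvPolynomial (Fin d) ℝ) = 0 := by
    by_contra hne
    have h3 := h ⟨0, hd⟩
    have hX : ((X ⟨0, hd⟩ : MvPolynomial (Fin d) ℝ) * (a.2 : MvPolynomial (Fin d) ℝ)).IsHomogeneous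
      (1 + k) := (isHomogeneous_X ℝ _).mul a.2.2
    have hne' : (X ⟨0, hd⟩ : MvPolynomial (Fin d) ℝ) * (a.2 : MvPolynomial (Fin d) ℝ) ≠ 0 :=
      mul_ne_zero (X_ne_zero _) hne
    have h4 := hX.totalDegree hne'
    have h5 : ((X ⟨0, hd⟩ : MvPolynomial (Fin d) ℝ) * (a.2 : MvPolynomial (Fin d) ℝ)) =
      -(a.1 ⟨0, hd⟩ : MvPolynomial (Fin d) ℝ) := by linear_combination h3
    rw [h5, totalDegree_neg] at h4
    have h6 := degLE_nat.1 (a.1 ⟨0, hd⟩).2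
    omega
  refine Prod.ext (funext fun i => Subtype.ext ?_) (Subtype.ext h2)
  have := h i
  rw [h2, mul_zero, add_zero] at this
  exact this

/-- Polynomials of degree at most `k - 1` and homogeneous ones of degree `k` are in direct sum. -/
lemma finrank_polySub_le (d k : ℕ) : Module.finrank ℝ (polySub d ((k : ℤ) - 1)) +
    Module.finrank ℝ (homogeneousSubmodule (Fin d) ℝ k) ≤ Module.finrank ℝ (polySub d k) := by
  rw [← Module.finrank_prod]
  let L : (polySub d ((k : ℤ) - 1) × homogeneousSubmodule (Fin d) ℝ k) →ₗ[ℝ] polySub d k :=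
    LinearMap.coprod (Submodule.inclusion fun p hp => DegLE.mono (by omega) hp)
      (Submodule.inclusion fun p hp => IsHomogeneous.degLE hp)
  refine LinearMap.finrank_le_finrank_of_injective (f := L) ?_
  rw [injective_iff_map_eq_zero]
  intro a ha
  have h1 : (a.1 : MvPolynomial (Fin d) ℝ) + (a.2 : MvPolynomial (Fin d) ℝ) = 0 :=
    congrArg Subtype.val ha
  have h2 : (a.2 : MvPolynomial (Fin d) ℝ) = 0 := by
    by_contra hne
    have h4 := a.2.2.totalDegree hne
    have h5 : (a.2 : MvPolynomial (Fin d) ℝ) = -(a.1 : MvPolynomial (Fin d) ℝ) := by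
      linear_combination h1
    rcases a.1.2 with h6 | h6
    · rw [h6, neg_zero] at h5; exact hne h5
    · rw [h5, totalDegree_neg] at h4; omega
  refine Prod.ext (Subtype.ext ?_) (Subtype.ext h2)
  rw [h2, add_zero] at h1
  exact h1

lemma eq_zero_of_l2_polyField {ι : Type*} [Fintype ι] {b : AffineBasis ι ℝ (Vec d)} {ϱ : ℝ}
    {c : Vec d} {r : ℝ} (H : ShapeRegular b ϱ c r) {P : Fin d → MvPolynomial (Fin d) ℝ}
    (h : l2 (volume.restrict (simplex b)) (polyField P) = 0) : P = 0 := by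
  ext1 i
  have h1 := l2_apply_le (memLp_simplex b (continuous_polyField P) 2) i
  have h2 := l2_ball_le H.ball_subset (memLp_simplex b (continuous_evalAt (P i)) 2)
  exact l2_eq_zero_iff_ball H.pos (le_antisymm (h2.trans (h1.trans h.le)) (l2_nonneg _))

/-- Existence of the Raviart–Thomas–Nédélec interpolate with given moments: the degrees of freedom
are injective by stability, and there are at least as many parameters as degrees of freedom. -/
theorem exists_rtn_interpolate {ι : Type} [Fintype ι] (b : AffineBasis ι ℝ (Vec d)) {ϱ : ℝ}
    {c : Vec d} {r : ℝ} (hd : 1 ≤ d) (H : ShapeRegular b ϱ c r) (k : ℕ) {m : Vec d → Vec d}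
    {g : ι → Vec d → ℝ} (hm : MemLp m 2 (volume.restrict (simplex b)))
    (hg : ∀ j, MemLp (g j) 2 (facetMeasure b j)) :
    ∃ P, IsRTNPoly k P ∧
        (∀ i R, DegLE ((k : ℤ) - 1) R →
          ∫ x in simplex b, evalAt (P i) x * evalAt R x = ∫ x in simplex b, m x i * evalAt R x) ∧
        (∀ j s, DegLE k s →
          ∫ x, inner ℝ (polyField P x) (facetNormal b j) * evalAt s x ∂facetMeasure b j =
            ∫ x, g j x * evalAt s x ∂facetMeasure b j) := by
  have mT : ∀ p : MvPolynomial (Fin d) ℝ, MemLp (evalAt p) 2 (volume.restrict (simplex b)) :=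
    fun p => memLp_simplex b (continuous_evalAt p) 2
  have mF : ∀ j, ∀ p : MvPolynomial (Fin d) ℝ, MemLp (evalAt p) 2 (facetMeasure b j) := fun j p =>
    memLp_facetMeasure b j hd (continuous_evalAt p) 2
  let nrm : ι → (Fin d → MvPolynomial (Fin d) ℝ) →ₗ[ℝ] MvPolynomial (Fin d) ℝ := fun j =>
    ∑ i, facetNormal b j i • LinearMap.proj i
  let τ : ι → homogeneousSubmodule (Fin d) ℝ k →ₗ[ℝ] MvPolynomial (Fin d) ℝ := fun j =>
    (bind₁ fun i => C ((-b j) i) + C 1 * X i).toLinearMap ∘ₗ Submodule.subtype _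
  have hτ : ∀ j s x, evalAt (τ j s) x = evalAt (s : MvPolynomial (Fin d) ℝ) (x - b j) :=
    fun j s x => affSubst_affSubst_neg (b j) s x
  have hnrm : ∀ j P x, evalAt (nrm j P) x = inner ℝ (polyField P x) (facetNormal b j) := by
    intro j P x
    simp only [nrm, LinearMap.sum_apply, LinearMap.smul_apply, LinearMap.proj_apply, evalAt_sum,
      evalAt_smul, inner_eq_sum, polyField_apply]
    exact Finset.sum_congr rfl fun i _ => by ring
  -- the degrees of freedom; on a facet, polynomials of degree at most `k` are represented by the
  -- homogeneous ones about the opposite vertex, whose dimension is known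
  let D : (Fin d → MvPolynomial (Fin d) ℝ) →ₗ[ℝ]
      (Fin d → Module.Dual ℝ (polySub d ((k : ℤ) - 1))) ×
        (ι → Module.Dual ℝ (homogeneousSubmodule (Fin d) ℝ k)) :=
    (LinearMap.pi fun i => ((momentForm mT).comp (LinearMap.proj i)).compl₂
      (Submodule.subtype _)).prod
    (LinearMap.pi fun j => ((momentForm (mF j)).comp (nrm j)).compl₂ (τ j))
  -- moments against homogeneous polynomials determine all the moments on a facet
  have hface : ∀ (P : Fin d → MvPolynomial (Fin d) ℝ) (g : ι → Vec d → ℝ),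
      (∀ j (s : homogeneousSubmodule (Fin d) ℝ k), ∫ x, evalAt (nrm j P) x * evalAt (τ j s) x
        ∂facetMeasure b j = ∫ x, g j x * evalAt (τ j s) x ∂facetMeasure b j) →
      ∀ j s, DegLE k s →
          ∫ x, inner ℝ (polyField P x) (facetNormal b j) * evalAt s x ∂facetMeasure b j =
            ∫ x, g j x * evalAt s x ∂facetMeasure b j := by
    intro P g hPg j s hs
    obtain ⟨h₀, R, hh₀, -, hsR⟩ := exists_facet_decomposition b j hs
    have h1 : ∀ᵐ x ∂facetMeasure b j, evalAt s x = evalAt (τ j ⟨h₀, hh₀⟩) x :=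
      (ae_mem_facet b j).mono fun x hx => by
        rw [hτ, hsR, coord_facet b j hx, zero_mul, add_zero]
    have h2 := hPg j ⟨h₀, hh₀⟩
    simp only [hnrm] at h2
    refine Eq.trans (integral_congr_ae (h1.mono fun x hx => ?_))
      (h2.trans (integral_congr_ae (h1.mono fun x hx => ?_)))
    · simp only [hx]
    · simp only [hx]
  -- stability with vanishing data
  have hinj : Function.Injective (D ∘ₗ rtnParam d k) := by
    rw [injective_iff_map_eq_zero]
    intro a ha
    set P := rtnParam d k a with hP
    have hDP : D P = 0 := ha
    obtain ⟨C, hC, hst⟩ := exists_rtn_stability d k ϱ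
    have h0 := hst b c r hd H P (isRTNPoly_rtnParam a) (fun _ => 0) (fun _ _ => 0) MemLp.zero
      (fun _ => MemLp.zero) (fun i R hR => by
        have : momentForm mT (P i) R = 0 :=
          LinearMap.congr_fun (congrFun (congrArg Prod.fst hDP) i) ⟨R, hR⟩
        rw [momentForm_apply] at this
        rw [this]; simp)
      (hface P _ fun j s => by
        have : momentForm (mF j) (nrm j P) (τ j s) = 0 :=
          LinearMap.congr_fun (congrFun (congrArg Prod.snd hDP) j) s
        rw [momentForm_apply] at this
        rw [this]; simp)
    have h1 : l2 (volume.restrict (simplex b)) (polyField P) = 0 := by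
      refine le_antisymm (h0.trans (le_of_eq ?_)) (l2_nonneg _)
      simp [l2]
    have h2 := eq_zero_of_l2_polyField H h1
    exact (injective_iff_map_eq_zero _).1 (rtnParam_injective hd k) a h2
  -- injectivity gives one inequality, and a count of dimensions, with `d + 1` facets, the other
  have hfr : Module.finrank ℝ ((Fin d → polySub d k) × homogeneousSubmodule (Fin d) ℝ k) =
      Module.finrank ℝ ((Fin d → Module.Dual ℝ (polySub d ((k : ℤ) - 1))) ×
        (ι → Module.Dual ℝ (homogeneousSubmodule (Fin d) ℝ k))) := by
    refine le_antisymm (LinearMap.finrank_le_finrank_of_injective hinj) ?_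
    rw [Module.finrank_prod, Module.finrank_prod, Module.finrank_pi_fintype,
      Module.finrank_pi_fintype, Module.finrank_pi_fintype]
    simp only [Subspace.dual_finrank_eq, Finset.sum_const, Finset.card_univ, Fintype.card_fin,
      card_index b, smul_eq_mul]
    have := finrank_polySub_le d k
    nlinarith
  obtain ⟨a, ha⟩ := (LinearMap.injective_iff_surjective_of_finrank_eq_finrank hfr).1 hinj
    ⟨fun i => (momentMap mT (memLp_apply hm i)).comp (Submodule.subtype _),
      fun j => (momentMap (mF j) (hg j)).comp (τ j)⟩
  refine ⟨rtnParam d k a, isRTNPoly_rtnParam a, fun i R hR => ?_, hface _ g fun j s => ?_⟩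
  · exact LinearMap.congr_fun (congrFun (congrArg Prod.fst ha) i) ⟨R, hR⟩
  · exact LinearMap.congr_fun (congrFun (congrArg Prod.snd ha) j) s

/-- Riesz representation in the Raviart–Thomas–Nédélec space. -/
theorem exists_rtn_representative {ι : Type*} [Fintype ι] (b : AffineBasis ι ℝ (Vec d)) {ϱ : ℝ}
    {c : Vec d} {r : ℝ} (hd : 1 ≤ d) (H : ShapeRegular b ϱ c r) (k : ℕ)
    (Λ : (Fin d → MvPolynomial (Fin d) ℝ) →ₗ[ℝ] ℝ) :
    ∃ P, IsRTNPoly k P ∧ ∀ W, IsRTNPoly k W →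
      ∫ x in simplex b, inner ℝ (polyField P x) (polyField W x) = Λ W := by
  have mT : ∀ p : MvPolynomial (Fin d) ℝ, MemLp (evalAt p) 2 (volume.restrict (simplex b)) :=
    fun p => memLp_simplex b (continuous_evalAt p) 2
  let A := (Fin d → polySub d k) × homogeneousSubmodule (Fin d) ℝ k
  let B : A →ₗ[ℝ] Module.Dual ℝ A := ∑ i, (momentForm mT).compl₁₂
    ((LinearMap.proj i).comp (rtnParam d k)) ((LinearMap.proj i).comp (rtnParam d k))
  have hB : ∀ a a', B a a' = ∫ x in simplex b,
      inner ℝ (polyField (rtnParam d k a) x) (polyField (rtnParam d k a') x) := by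
    intro a a'
    simp only [inner_eq_sum, polyField_apply]
    rw [integral_finsetSum _ fun i _ => integrable_mul_of_memLp (mT _) (mT _)]
    simp only [B, LinearMap.sum_apply]
    rfl
  have hinj : Function.Injective B := by
    rw [injective_iff_map_eq_zero]
    intro a ha
    have h1 : l2 (volume.restrict (simplex b)) (polyField (rtnParam d k a)) ^ 2 = 0 := by
      rw [l2_sq (memLp_simplex b (continuous_polyField _) 2)]
      simp_rw [← real_inner_self_eq_norm_sq]
      rw [← hB, ha]; rfl
    have h2 := eq_zero_of_l2_polyField H (pow_eq_zero_iff two_ne_zero |>.1 h1)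
    exact (injective_iff_map_eq_zero _).1 (rtnParam_injective hd k) a h2
  obtain ⟨a, ha⟩ := (LinearMap.injective_iff_surjective_of_finrank_eq_finrank
    (Subspace.dual_finrank_eq (K := ℝ) (V := A)).symm).1 hinj (Λ.comp (rtnParam d k))
  refine ⟨rtnParam d k a, isRTNPoly_rtnParam a, fun W hW => ?_⟩
  obtain ⟨a', rfl⟩ := hW.exists_rtnParam
  rw [← hB, ha]; rfl

end

/-! ### Weak derivatives and mollification -/

section

variable {d : ℕ}

/-- The iterated partial derivative `∂_{J 0} ⋯ ∂_{J (m-1)} φ`. -/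
def iterPartial {m : ℕ} (J : Fin m → Fin d) (φ : Vec d → ℝ) (x : Vec d) : ℝ :=
  iteratedFDeriv ℝ m φ x fun i => basisVec (J i)

lemma iterPartial_zero (J : Fin 0 → Fin d) (φ : Vec d → ℝ) : iterPartial J φ = φ := by
  ext x; simp [iterPartial]

lemma contDiff_iterPartial {m : ℕ} (J : Fin m → Fin d) {φ : Vec d → ℝ} (hφ : ContDiff ℝ ∞ φ) :
    ContDiff ℝ ∞ (iterPartial J φ) := by
  have h : ContDiff ℝ ∞ (iteratedFDeriv ℝ m φ) := hφ.iteratedFDeriv_right (by exact_mod_cast le_top)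
  exact (ContinuousMultilinearMap.apply ℝ (fun _ : Fin m => Vec d) ℝ
    (fun i => basisVec (J i))).contDiff.comp h

lemma iterPartial_succ {m : ℕ} (J : Fin (m + 1) → Fin d) {φ : Vec d → ℝ} (hφ : ContDiff ℝ ∞ φ)
    (x : Vec d) : iterPartial J φ x = fderiv ℝ (iterPartial (Fin.tail J) φ) x (basisVec (J 0)) := by
  have h : ContDiff ℝ 1 (iteratedFDeriv ℝ m φ) := hφ.iteratedFDeriv_right (by norm_cast; exact le_top)
  unfold iterPartial
  rw [iteratedFDeriv_succ_apply_left]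
  exact (fderiv_continuousMultilinear_apply_const_apply ((h.differentiable (by simp)) x) _ _).symm

lemma iterPartial_one (j : Fin d) {φ : Vec d → ℝ} (hφ : ContDiff ℝ ∞ φ) (x : Vec d) :
    iterPartial (fun _ : Fin 1 => j) φ x = fderiv ℝ φ x (basisVec j) := by
  rw [iterPartial_succ _ hφ, iterPartial_zero]

lemma hasCompactSupport_iterPartial {m : ℕ} (J : Fin m → Fin d) {φ : Vec d → ℝ}
    (hφ : HasCompactSupport φ) : HasCompactSupport (iterPartial J φ) :=
  (hφ.iteratedFDeriv (𝕜 := ℝ) m).comp_left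
    (g := fun A : ContinuousMultilinearMap ℝ (fun _ : Fin m => Vec d) ℝ => A fun i => basisVec (J i))
    (by simp)

lemma iterPartial_comp_sub {m : ℕ} (J : Fin m → Fin d) {φ : Vec d → ℝ} (hφ : ContDiff ℝ ∞ φ)
    (x t : Vec d) :
    iterPartial J (fun t => φ (x - t)) t = (-1) ^ m * iterPartial J φ (x - t) := by
  induction m generalizing t with
  | zero => simp [iterPartial_zero]
  | succ m ih =>
    have h1 : ContDiff ℝ ∞ fun t => φ (x - t) := hφ.comp (contDiff_const.sub contDiff_id)
    rw [iterPartial_succ _ h1, iterPartial_succ _ hφ]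
    have h2 : iterPartial (Fin.tail J) (fun t => φ (x - t)) =
        fun t => (-1) ^ m * iterPartial (Fin.tail J) φ (x - t) := funext fun t => ih _ t
    rw [h2]
    have h3 : HasFDerivAt (fun t => iterPartial (Fin.tail J) φ (x - t))
        ((fderiv ℝ (iterPartial (Fin.tail J) φ) (x - t)).comp (-ContinuousLinearMap.id ℝ (Vec d))) t :=
      (((contDiff_iterPartial _ hφ).differentiable (by simp)) (x - t)).hasFDerivAt.comp t
        ((hasFDerivAt_id t).const_sub x)
    rw [(h3.const_mul ((-1) ^ m)).fderiv]
    simp [pow_succ]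

/-- The convolution of `F` with `φ`. -/
def conv (F φ : Vec d → ℝ) : Vec d → ℝ := convolution F φ (ContinuousLinearMap.mul ℝ ℝ) volume

lemma conv_apply (F φ : Vec d → ℝ) (x : Vec d) : conv F φ x = ∫ t, F t * φ (x - t) := by
  simp [conv, convolution_def]

lemma contDiff_conv {F φ : Vec d → ℝ} (hF : LocallyIntegrable F) (hφ : ContDiff ℝ ∞ φ)
    (hc : HasCompactSupport φ) : ContDiff ℝ ∞ (conv F φ) :=
  hc.contDiff_convolution_right _ hF hφ

lemma iterPartial_conv {m : ℕ} (J : Fin m → Fin d) {F φ : Vec d → ℝ} (hF : LocallyIntegrable F)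
    (hφ : ContDiff ℝ ∞ φ) (hc : HasCompactSupport φ) :
    iterPartial J (conv F φ) = conv F (iterPartial J φ) := by
  induction m with
  | zero => simp [iterPartial_zero]
  | succ m ih =>
    ext x
    have h1 := contDiff_iterPartial (Fin.tail J) hφ
    have h2 := hasCompactSupport_iterPartial (Fin.tail J) hc
    rw [iterPartial_succ _ (contDiff_conv hF hφ hc), ih]
    have h3 := h2.hasFDerivAt_convolution_right (ContinuousLinearMap.mul ℝ ℝ) hF
      (h1.of_le (by norm_cast)) x
    rw [conv, h3.fderiv, convolution_precompR_apply _ hF (h2.fderiv (𝕜 := ℝ))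
      (h1.continuous_fderiv (by simp))]
    unfold conv
    rw [show iterPartial J φ = fun y => fderiv ℝ (iterPartial (Fin.tail J) φ) y (basisVec (J 0)) from
      funext fun y => iterPartial_succ J hφ y]

/-- Away from the boundary, the derivatives of a mollification are the mollifications of the weak
derivatives. -/
lemma IsWeakDeriv.iterPartial_conv {m : ℕ} {J : Fin m → Fin d} {U : Set (Vec d)}
    (hU : MeasurableSet U) {f g φ : Vec d → ℝ} (h : IsWeakDeriv U J f g)
    (hF : LocallyIntegrable (U.indicator f)) (hφ : ContDiff ℝ ∞ φ) {ε : ℝ}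
    (hs : tsupport φ ⊆ Metric.closedBall 0 ε) {x : Vec d} (hx : Metric.closedBall x ε ⊆ U) :
    iterPartial J (conv (U.indicator f) φ) x = conv (U.indicator g) φ x := by
  have hc : HasCompactSupport φ := HasCompactSupport.of_support_subset_isCompact
    (isCompact_closedBall 0 ε) ((subset_tsupport φ).trans hs)
  have hφx : ContDiff ℝ ∞ fun t => φ (x - t) := hφ.comp (contDiff_const.sub contDiff_id)
  have hsx : tsupport (fun t => φ (x - t)) ⊆ Metric.closedBall x ε := by
    refine closure_minimal (fun t ht => ?_) Metric.isClosed_closedBall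
    have := hs (subset_tsupport φ ht)
    rw [Metric.mem_closedBall, dist_zero_right] at this
    rwa [Metric.mem_closedBall, dist_comm, dist_eq_norm]
  have htest : IsTestFun U fun t => φ (x - t) :=
    ⟨hφx, HasCompactSupport.of_support_subset_isCompact (isCompact_closedBall x ε)
      ((subset_tsupport _).trans hsx), hsx.trans hx⟩
  have h1 := h.2.2 _ htest
  have h2 : ∀ t, iteratedFDeriv ℝ m (fun t => φ (x - t)) t (fun i => basisVec (J i)) =
      (-1) ^ m * iterPartial J φ (x - t) := fun t => iterPartial_comp_sub J hφ x t
  have hind : ∀ (u : Vec d → ℝ) (w : Vec d → ℝ), ∫ t, U.indicator u t * w t = ∫ t in U, u t * w t := by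
    intro u w
    rw [← integral_indicator hU]
    refine integral_congr_ae (Eventually.of_forall fun t => ?_)
    by_cases ht : t ∈ U <;> simp [ht]
  rw [HybridFE.iterPartial_conv J hF hφ hc, conv_apply, conv_apply, hind, hind]
  simp_rw [h2] at h1
  have h3 : ∫ t in U, f t * ((-1) ^ m * iterPartial J φ (x - t)) =
      (-1) ^ m * ∫ t in U, f t * iterPartial J φ (x - t) := by
    rw [← integral_const_mul]
    exact integral_congr_ae (Eventually.of_forall fun t => by simp only; ring)
  rw [h3] at h1
  exact mul_left_cancel₀ (by positivity) h1

lemma integrableOn_mul_testFun {U : Set (Vec d)} {g φ : Vec d → ℝ} (hg : LocallyIntegrableOn g U)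
    (hφ : IsTestFun U φ) : IntegrableOn (fun x => g x * φ x) U := by
  have h1 : IntegrableOn (fun x => g x * φ x) (tsupport φ) :=
    (hg.integrableOn_compact_subset hφ.2.2 hφ.2.1.isCompact).mul_continuousOn
      hφ.1.continuous.continuousOn hφ.2.1.isCompact
  have h2 : Function.support (fun x => g x * φ x) ⊆ tsupport φ := fun x hx =>
    subset_tsupport φ fun h => hx (by simp only [h, mul_zero])
  exact ((integrableOn_iff_integrable_of_support_subset h2).1 h1).integrableOn

/-- The fundamental lemma of the calculus of variations. -/
lemma ae_eq_of_forall_testFun {U : Set (Vec d)} (hU : IsOpen U) {g₁ g₂ : Vec d → ℝ}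
    (h₁ : LocallyIntegrableOn g₁ U) (h₂ : LocallyIntegrableOn g₂ U)
    (h : ∀ φ, IsTestFun U φ → ∫ x in U, g₁ x * φ x = ∫ x in U, g₂ x * φ x) :
    g₁ =ᵐ[volume.restrict U] g₂ := by
  have := hU.ae_eq_zero_of_integral_contDiff_smul_eq_zero (h₁.sub h₂) (μ := volume) ?_
  · rw [EventuallyEq, ae_restrict_iff' hU.measurableSet]
    exact this.mono fun x hx hxU => sub_eq_zero.1 (hx hxU)
  · intro φ hφ hc hs
    have ht : IsTestFun U φ := ⟨hφ, hc, hs⟩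
    have h3 : Function.support (fun x => φ x • (g₁ - g₂) x) ⊆ U := fun x hx =>
      hs (subset_tsupport φ fun h => hx (by simp only [h, zero_smul]))
    rw [← setIntegral_eq_integral_of_forall_compl_eq_zero (s := U)
      (fun x hx => by by_contra hne; exact hx (h3 hne))]
    have h4 := h φ ht
    rw [← sub_eq_zero, ← integral_sub (integrableOn_mul_testFun h₁ ht)
      (integrableOn_mul_testFun h₂ ht)] at h4
    rw [← h4]
    refine integral_congr_ae (Eventually.of_forall fun x => ?_)
    simp only [Pi.sub_apply, smul_eq_mul]; ring

lemma IsWeakDeriv.ae_eq {m : ℕ} {J : Fin m → Fin d} {U : Set (Vec d)} (hU : IsOpen U)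
    {f g₁ g₂ : Vec d → ℝ} (h₁ : IsWeakDeriv U J f g₁) (h₂ : IsWeakDeriv U J f g₂) :
    g₁ =ᵐ[volume.restrict U] g₂ :=
  ae_eq_of_forall_testFun hU h₁.2.1 h₂.2.1 fun φ hφ => by
    have h := (h₁.2.2 φ hφ).symm.trans (h₂.2.2 φ hφ)
    exact mul_left_cancel₀ (by positivity) h

lemma isWeakDeriv_weakDeriv {m : ℕ} {J : Fin m → Fin d} {U : Set (Vec d)} {f g : Vec d → ℝ}
    (h : IsWeakDeriv U J f g) : IsWeakDeriv U J f (weakDeriv U J f) := by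
  have h' : ∃ g, IsWeakDeriv U J f g := ⟨g, h⟩
  rw [weakDeriv, dif_pos h']
  exact h'.choose_spec

lemma IsWeakDeriv.weakDeriv_ae_eq {m : ℕ} {J : Fin m → Fin d} {U : Set (Vec d)} (hU : IsOpen U)
    {f g : Vec d → ℝ} (h : IsWeakDeriv U J f g) : weakDeriv U J f =ᵐ[volume.restrict U] g :=
  (isWeakDeriv_weakDeriv h).ae_eq hU h

/-- A weak derivative of order zero is the function itself. -/
lemma IsWeakDeriv.ae_eq_of_order_zero {J : Fin 0 → Fin d} {U : Set (Vec d)} (hU : IsOpen U)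
    {f g : Vec d → ℝ} (h : IsWeakDeriv U J f g) : f =ᵐ[volume.restrict U] g :=
  ae_eq_of_forall_testFun hU h.1 h.2.1 fun φ hφ => by simpa using h.2.2 φ hφ

lemma IsWeakDeriv.mono {m : ℕ} {J : Fin m → Fin d} {U V : Set (Vec d)} (hU : MeasurableSet U)
    (hVU : V ⊆ U)
    {f g : Vec d → ℝ} (h : IsWeakDeriv U J f g) : IsWeakDeriv V J f g := by
  refine ⟨h.1.mono_set hVU, h.2.1.mono_set hVU, fun φ hφ => ?_⟩
  have h1 := h.2.2 φ ⟨hφ.1, hφ.2.1, hφ.2.2.trans hVU⟩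
  have key : ∀ u w : Vec d → ℝ, (∀ x, x ∉ V → w x = 0) → ∫ x in V, u x * w x = ∫ x in U, u x * w x := by
    intro u w hw
    refine (setIntegral_eq_of_subset_of_forall_sdiff_eq_zero hU hVU fun x hx => ?_).symm
    rw [hw x hx.2, mul_zero]
  rw [key, key, h1]
  · exact fun x hx => image_eq_zero_of_notMem_tsupport fun h => hx (hφ.2.2 h)
  · intro x hx
    have : iteratedFDeriv ℝ m φ x = 0 := image_eq_zero_of_notMem_tsupport fun h =>
      hx (hφ.2.2 (tsupport_iteratedFDeriv_subset m h))
    rw [this]; rfl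

/-- The bump function used for mollification at scale `2 / (n + 1)`. -/
def bump (d n : ℕ) : ContDiffBump (0 : Vec d) where
  rIn := 1 / (n + 1)
  rOut := 2 / (n + 1)
  rIn_pos := by positivity
  rIn_lt_rOut := by gcongr; norm_num

/-- A sequence of mollifiers. -/
def mollifier (d n : ℕ) : Vec d → ℝ := (bump d n).normed volume

lemma contDiff_mollifier (d n : ℕ) : ContDiff ℝ ∞ (mollifier d n) := (bump d n).contDiff_normed

lemma hasCompactSupport_mollifier (d n : ℕ) : HasCompactSupport (mollifier d n) :=
  (bump d n).hasCompactSupport_normed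

lemma mollifier_nonneg {d n : ℕ} (x : Vec d) : 0 ≤ mollifier d n x := (bump d n).nonneg_normed x

lemma integral_mollifier (d n : ℕ) : ∫ x, mollifier d n x = 1 := (bump d n).integral_normed

lemma tsupport_mollifier (d n : ℕ) : tsupport (mollifier d n) ⊆ Metric.closedBall 0 (2 / (n + 1)) :=
  ((bump d n).tsupport_normed_eq).le

lemma integrable_mollifier (d n : ℕ) : Integrable (mollifier d n) :=
  (contDiff_mollifier d n).continuous.integrable_of_hasCompactSupport (hasCompactSupport_mollifier d n)

lemma tendsto_two_div : Tendsto (fun n : ℕ => (2 : ℝ) / (n + 1)) atTop (𝓝 0) := by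
  have := tendsto_one_div_add_atTop_nhds_zero_nat (𝕜 := ℝ)
  simpa [div_eq_mul_inv] using this.const_mul 2

lemma conv_mollifier (G : Vec d → ℝ) (n : ℕ) (x : Vec d) : conv G (mollifier d n) x =
    convolution ((bump d n).normed volume) G (ContinuousLinearMap.lsmul ℝ ℝ) volume x := by
  rw [← convolution_flip]
  simp only [conv, convolution_def, mollifier]
  refine integral_congr_ae (Eventually.of_forall fun t => ?_)
  simp [mul_comm]

lemma ae_tendsto_conv {G : Vec d → ℝ} (hG : LocallyIntegrable G) :
    ∀ᵐ x, Tendsto (fun n => conv G (mollifier d n) x) atTop (𝓝 (G x)) := by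
  simp_rw [conv_mollifier]
  refine ContDiffBump.ae_convolution_tendsto_right_of_locallyIntegrable (K := 2) ?_ ?_ hG
  · exact tendsto_two_div
  · refine Eventually.of_forall fun n => ?_
    simp only [bump]; rw [mul_one_div]

lemma integrable_mul_mollifier {G : Vec d → ℝ} (hG : LocallyIntegrable G) (n : ℕ) (x : Vec d) :
    Integrable fun t => G t * mollifier d n (x - t) := by
  have h := hG.integrable_smul_left_of_hasCompactSupport
    (g := fun t => mollifier d n (x - t))
    ((contDiff_mollifier d n).continuous.comp (continuous_const.sub continuous_id))
    ((hasCompactSupport_mollifier d n).comp_homeomorph (Homeomorph.subLeft x))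
  simpa [mul_comm] using h

lemma integrable_mollifier_sub (n : ℕ) (x : Vec d) : Integrable fun t => mollifier d n (x - t) :=
  (integrable_mollifier d n).comp_sub_left x

lemma integral_mollifier_sub (n : ℕ) (x : Vec d) : ∫ t, mollifier d n (x - t) = 1 := by
  rw [integral_sub_left_eq_self (mollifier d n) volume x, integral_mollifier]

lemma abs_conv_mollifier_le {G : Vec d → ℝ} {B : ℝ} (h : ∀ᵐ x, |G x| ≤ B) (n : ℕ) (x : Vec d) :
    |conv G (mollifier d n) x| ≤ B := by
  rw [conv_apply]
  have h1 := norm_integral_le_of_norm_le (f := fun t => G t * mollifier d n (x - t))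
    ((integrable_mollifier_sub n x).const_mul B) (h.mono fun t ht => by
      rw [norm_mul, Real.norm_eq_abs, Real.norm_eq_abs, abs_of_nonneg (mollifier_nonneg (x - t))]
      exact mul_le_mul_of_nonneg_right ht (mollifier_nonneg _))
  rwa [integral_const_mul, integral_mollifier_sub, mul_one] at h1

/-- Mollification is a contraction of `L²`. -/
lemma integral_conv_mollifier_sq_le {G : Vec d → ℝ} (hG : LocallyIntegrable G) (hG2 : MemLp G 2)
    (n : ℕ) : ∫⁻ x, ENNReal.ofReal (conv G (mollifier d n) x ^ 2) ≤
      ENNReal.ofReal (∫ x, G x ^ 2) := by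
  have hsq : Integrable fun x => G x ^ 2 := hG2.integrable_sq
  have h1 : ∀ x, conv G (mollifier d n) x ^ 2 ≤ conv (fun t => G t ^ 2) (mollifier d n) x := by
    intro x
    set c := conv G (mollifier d n) x with hc
    have i1 := integrable_mul_mollifier hsq.locallyIntegrable n x
    have i2 := integrable_mul_mollifier hG n x
    have i3 := integrable_mollifier_sub n x
    -- the variance with respect to the probability density `mollifier d n (x - ·)` is nonnegative
    have h2 : 0 ≤ ∫ t, (G t - c) ^ 2 * mollifier d n (x - t) :=
      integral_nonneg fun t => mul_nonneg (sq_nonneg _) (mollifier_nonneg _)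
    have h3 : ∀ t, (G t - c) ^ 2 * mollifier d n (x - t) = G t ^ 2 * mollifier d n (x - t) -
        (2 * c) * (G t * mollifier d n (x - t)) + c ^ 2 * mollifier d n (x - t) := fun t => by ring
    simp_rw [h3] at h2
    have i4 : Integrable fun t => G t ^ 2 * mollifier d n (x - t) -
        (2 * c) * (G t * mollifier d n (x - t)) := i1.sub (i2.const_mul _)
    rw [integral_add i4 (i3.const_mul _), integral_sub i1 (i2.const_mul _),
      integral_const_mul, integral_const_mul, integral_mollifier_sub, ← conv_apply, ← conv_apply,
      ← hc] at h2
    nlinarith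
  have h4 : Integrable (conv (fun t => G t ^ 2) (mollifier d n)) :=
    hsq.integrable_convolution _ (integrable_mollifier d n)
  have h5 : ∫ x, conv (fun t => G t ^ 2) (mollifier d n) x = ∫ x, G x ^ 2 := by
    unfold conv
    rw [integral_convolution _ hsq (integrable_mollifier d n), integral_mollifier]
    simp
  rw [← h5, ofReal_integral_eq_lintegral_ofReal h4
    (Eventually.of_forall fun x => (sq_nonneg _).trans (h1 x))]
  exact lintegral_mono fun x => ENNReal.ofReal_le_ofReal (h1 x)

end

/-! ### Functions with bounded weak gradient are Lipschitz continuous -/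

section

variable {d : ℕ}

/-- The points of `U` at distance more than `r` from the complement. -/
def innerSet (U : Set (Vec d)) (r : ℝ) : Set (Vec d) :=
  {x | ENNReal.ofReal r < Metric.infEDist x Uᶜ}

lemma isOpen_innerSet (U : Set (Vec d)) (r : ℝ) : IsOpen (innerSet U r) :=
  isOpen_lt continuous_const Metric.continuous_infEDist

lemma closedBall_subset_of_mem_innerSet {U : Set (Vec d)} {r : ℝ} {x : Vec d}
    (hx : x ∈ innerSet U r) : Metric.closedBall x r ⊆ U := by
  intro z hz
  by_contra hne
  have h1 := Metric.infEDist_le_edist_of_mem (x := x) (show z ∈ Uᶜ from hne)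
  rw [Metric.mem_closedBall, dist_comm] at hz
  have h2 : edist x z ≤ ENNReal.ofReal r := by
    rw [edist_dist]; exact ENNReal.ofReal_le_ofReal hz
  exact absurd (lt_of_lt_of_le hx h1) (not_lt.2 h2)

lemma innerSet_subset {U : Set (Vec d)} {r : ℝ} (hr : 0 ≤ r) : innerSet U r ⊆ U := fun _ hx =>
  closedBall_subset_of_mem_innerSet hx (Metric.mem_closedBall_self hr)

lemma convex_innerSet {U : Set (Vec d)} (hU : Convex ℝ U) (r : ℝ) : Convex ℝ (innerSet U r) := by
  intro x hx y hy s t hs ht hst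
  refine lt_of_lt_of_le (lt_min hx hy) (Metric.le_infEDist.2 fun z hz => ?_)
  by_contra hlt
  rw [not_le, lt_min_iff] at hlt
  have key : ∀ p : Vec d, edist (s • x + t • y) z < Metric.infEDist p Uᶜ →
      p + (z - (s • x + t • y)) ∈ U := by
    intro p hp
    by_contra hne
    have h1 := Metric.infEDist_le_edist_of_mem (x := p)
      (show p + (z - (s • x + t • y)) ∈ Uᶜ from hne)
    have h2 : edist p (p + (z - (s • x + t • y))) = edist (s • x + t • y) z := by
      rw [edist_dist, edist_dist, dist_eq_norm, dist_eq_norm]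
      congr 2; abel
    rw [h2] at h1
    exact absurd hp (not_lt.2 h1)
  have h3 := hU (key x hlt.1) (key y hlt.2) hs ht hst
  have h4 : s • (x + (z - (s • x + t • y))) + t • (y + (z - (s • x + t • y))) = z := by
    have : s • (z - (s • x + t • y)) + t • (z - (s • x + t • y)) = z - (s • x + t • y) := by
      rw [← add_smul, hst, one_smul]
    rw [smul_add, smul_add, add_add_add_comm, this]; abel
  rw [h4] at h3
  exact hz h3

lemma eventually_mem_innerSet {U : Set (Vec d)} (hU : IsOpen U) {x : Vec d} (hx : x ∈ U) :
    ∀ᶠ n : ℕ in atTop, x ∈ innerSet U (2 / (n + 1)) := by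
  have h1 : 0 < Metric.infEDist x Uᶜ := by
    rw [Metric.infEDist_pos_iff_notMem_closure, hU.isClosed_compl.closure_eq]
    exact fun h => h hx
  have h2 := ENNReal.tendsto_ofReal tendsto_two_div
  rw [ENNReal.ofReal_zero] at h2
  exact h2.eventually (gt_mem_nhds h1)

lemma norm_le_sum_abs_apply (A : Vec d →L[ℝ] ℝ) : ‖A‖ ≤ ∑ j, |A (basisVec j)| := by
  refine A.opNorm_le_bound (Finset.sum_nonneg fun j _ => abs_nonneg _) fun x => ?_
  conv_lhs => rw [vec_eq_sum x, map_sum]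
  rw [Finset.sum_mul]
  refine norm_sum_le_of_le _ fun j _ => ?_
  rw [map_smul, norm_smul, mul_comm, Real.norm_eq_abs, Real.norm_eq_abs]
  exact mul_le_mul_of_nonneg_left (abs_coord_le x j) (abs_nonneg _)

/-- A function with bounded weak gradient on a convex open set is Lipschitz continuous on a subset
of full measure. -/
lemma exists_lipschitzOnWith_of_isWeakDeriv {U : Set (Vec d)} (hU : IsOpen U) (hc : Convex ℝ U)
    {f : Vec d → ℝ} (hf : IntegrableOn f U) {g : Fin d → Vec d → ℝ} {B : ℝ}
    (hg : ∀ j, IsWeakDeriv U (fun _ : Fin 1 => j) f (g j))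
    (hB : ∀ j, ∀ᵐ x ∂volume.restrict U, |g j x| ≤ B) :
    ∃ S ⊆ U, volume (U \ S) = 0 ∧ LipschitzOnWith (d * B).toNNReal f S := by
  rcases Set.eq_empty_or_nonempty U with rfl | hne
  · exact ⟨∅, subset_rfl, by simp, by simp⟩
  have hF : LocallyIntegrable (U.indicator f) :=
    ((integrable_indicator_iff hU.measurableSet).2 hf).locallyIntegrable
  -- the points at which the mollifications converge; these have gradients bounded by `B` on the
  -- convex sets `innerSet U _`, so that the mean value inequality passes to the limit
  set S := {x ∈ U | Tendsto (fun n => conv (U.indicator f) (mollifier d n) x) atTop (𝓝 (f x))} with hS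
  refine ⟨S, fun x hx => hx.1, ?_, ?_⟩
  · have h1 := ae_tendsto_conv hF
    rw [ae_iff] at h1
    refine measure_mono_null (fun x hx => ?_) h1
    intro h
    rw [Set.indicator_of_mem hx.1] at h
    exact hx.2 ⟨hx.1, h⟩
  · have hgB : ∀ j, ∀ᵐ x, |U.indicator (g j) x| ≤ |B| := by
      intro j
      have := hB j
      rw [ae_restrict_iff' hU.measurableSet] at this
      filter_upwards [this] with x hx
      by_cases hxU : x ∈ U
      · rw [Set.indicator_of_mem hxU]; exact (hx hxU).trans (le_abs_self B)
      · rw [Set.indicator_of_notMem hxU, abs_zero]; exact abs_nonneg B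
    have hLd : d * |B| = ((d * B).toNNReal : ℝ) := by
      rcases Nat.eq_zero_or_pos d with h0 | hpos
      · simp [h0]
      · have hB0 : 0 ≤ B := by
          have := hB ⟨0, hpos⟩
          have hne0 : volume.restrict U ≠ 0 := by
            rw [Ne, Measure.restrict_eq_zero]; exact (hU.measure_pos _ hne).ne'
          have : (ae (volume.restrict U)).NeBot := ae_neBot.2 hne0
          obtain ⟨x, hx⟩ := (hB ⟨0, hpos⟩).exists
          exact (abs_nonneg _).trans hx
        rw [abs_of_nonneg hB0, Real.coe_toNNReal _ (by positivity)]
    rw [lipschitzOnWith_iff_dist_le_mul]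
    intro x hx y hy
    rw [← hLd, dist_eq_norm, dist_eq_norm]
    refine le_of_tendsto ((hx.2.sub hy.2).norm) ?_
    filter_upwards [eventually_mem_innerSet hU hx.1, eventually_mem_innerSet hU hy.1] with n hn1 hn2
    have hs := contDiff_conv hF (contDiff_mollifier d n) (hasCompactSupport_mollifier d n)
    refine Convex.norm_image_sub_le_of_norm_fderiv_le (𝕜 := ℝ) (s := innerSet U (2 / (n + 1)))
      (fun z _ => hs.differentiable (by simp) z) (fun z hz => ?_) (convex_innerSet hc _) hn2 hn1
    refine (norm_le_sum_abs_apply _).trans ?_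
    have h3 : ∀ j ∈ Finset.univ, |fderiv ℝ (conv (U.indicator f) (mollifier d n)) z (basisVec j)| ≤
        |B| := by
      intro j _
      rw [← iterPartial_one j hs, (hg j).iterPartial_conv hU.measurableSet hF
        (contDiff_mollifier d n) (tsupport_mollifier d n) (closedBall_subset_of_mem_innerSet hz)]
      exact abs_conv_mollifier_le (hgB j) n z
    refine (Finset.sum_le_sum h3).trans (le_of_eq ?_)
    simp

/-- A function with bounded weak gradient on a convex open set has a Lipschitz continuous
representative, defined on the whole space. -/
lemma exists_lipschitz_representative {U : Set (Vec d)} (hU : IsOpen U) (hc : Convex ℝ U)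
    {f : Vec d → ℝ} (hf : IntegrableOn f U) {g : Fin d → Vec d → ℝ} {B : ℝ}
    (hg : ∀ j, IsWeakDeriv U (fun _ : Fin 1 => j) f (g j))
    (hB : ∀ j, ∀ᵐ x ∂volume.restrict U, |g j x| ≤ B) :
    ∃ (K : NNReal) (f' : Vec d → ℝ), LipschitzWith K f' ∧ f =ᵐ[volume.restrict U] f' := by
  obtain ⟨S, hSU, hS0, hS⟩ := exists_lipschitzOnWith_of_isWeakDeriv hU hc hf hg hB
  obtain ⟨f', hf', he⟩ := hS.extend_real
  refine ⟨_, f', hf', ?_⟩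
  rw [EventuallyEq, ae_restrict_iff' hU.measurableSet, ae_iff]
  refine measure_mono_null (fun x hx => ?_) hS0
  simp only [Set.mem_ofPred_eq, Classical.not_imp] at hx
  exact ⟨hx.1, fun hxS => hx.2 (he hxS)⟩

/-- A continuous function with bounded weak gradient on a convex open set is Lipschitz continuous
on its closure. -/
lemma lipschitzOnWith_closure_of_isWeakDeriv {U : Set (Vec d)} (hU : IsOpen U) (hc : Convex ℝ U)
    {f : Vec d → ℝ} (hfc : Continuous f) (hf : IntegrableOn f U) {g : Fin d → Vec d → ℝ} {B : ℝ}
    (hg : ∀ j, IsWeakDeriv U (fun _ : Fin 1 => j) f (g j))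
    (hB : ∀ j, ∀ᵐ x ∂volume.restrict U, |g j x| ≤ B) :
    LipschitzOnWith (d * B).toNNReal f (closure U) := by
  obtain ⟨S, hSU, hS0, hS⟩ := exists_lipschitzOnWith_of_isWeakDeriv hU hc hf hg hB
  refine (hS.closure hfc.continuousOn).mono (closure_minimal (fun x hx => ?_) isClosed_closure)
  by_contra hne
  have hopen : IsOpen (U ∩ (closure S)ᶜ) := hU.inter isClosed_closure.isOpen_compl
  have h1 := hopen.measure_pos volume (show (U ∩ (closure S)ᶜ).Nonempty from ⟨x, hx, hne⟩)
  have h2 : volume (U ∩ (closure S)ᶜ) = 0 :=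
    measure_mono_null (Set.inter_subset_inter_right U (Set.compl_subset_compl.2 subset_closure)) hS0
  exact h1.ne' h2

/-- The almost everywhere gradient of a Lipschitz function is its weak gradient. -/
lemma isWeakDeriv_lineDeriv {U : Set (Vec d)} {K : NNReal} {f' f : Vec d → ℝ}
    (hf' : LipschitzWith K f') (hf : f =ᵐ[volume.restrict U] f') (j : Fin d) :
    IsWeakDeriv U (fun _ : Fin 1 => j) f (fun x => lineDeriv ℝ f' x (basisVec j)) := by
  refine ⟨(hf'.continuous.locallyIntegrable.locallyIntegrableOn U).congr hf.symm,
    (hf'.locallyIntegrable_lineDeriv _).locallyIntegrableOn U, fun φ hφ => ?_⟩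
  obtain ⟨L, hL⟩ := hφ.1.lipschitzWith_of_hasCompactSupport hφ.2.1 (by simp)
  have h1 := hf'.integral_lineDeriv_mul_eq hL hφ.2.1 (basisVec j) (μ := volume)
  have hd : ∀ x, iteratedFDeriv ℝ 1 φ x (fun _ => basisVec j) = fderiv ℝ φ x (basisVec j) :=
    fun x => iterPartial_one j hφ.1 x
  have hl : ∀ x, lineDeriv ℝ φ x (-basisVec j) = -fderiv ℝ φ x (basisVec j) := by
    intro x
    rw [(hφ.1.differentiable (by simp) x).lineDeriv_eq_fderiv, map_neg]
  simp_rw [hd]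
  simp_rw [hl] at h1
  have e1 : ∫ x in U, f x * fderiv ℝ φ x (basisVec j) = ∫ x in U, f' x * fderiv ℝ φ x (basisVec j) :=
    integral_congr_ae (hf.mono fun x hx => by simp only [hx])
  have e2 : ∫ x in U, f' x * fderiv ℝ φ x (basisVec j) = ∫ x, f' x * fderiv ℝ φ x (basisVec j) := by
    refine setIntegral_eq_integral_of_forall_compl_eq_zero fun x hx => ?_
    have : fderiv ℝ φ x = 0 := image_eq_zero_of_notMem_tsupport fun h =>
      hx (hφ.2.2 (tsupport_fderiv_subset ℝ h))
    rw [this]; simp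
  have e3 : ∫ x in U, lineDeriv ℝ f' x (basisVec j) * φ x = ∫ x, lineDeriv ℝ f' x (basisVec j) * φ x :=
    setIntegral_eq_integral_of_forall_compl_eq_zero fun x hx => by
      rw [image_eq_zero_of_notMem_tsupport fun h => hx (hφ.2.2 h), mul_zero]
  rw [e1, e2, e3, h1, pow_one, neg_one_mul, ← integral_neg]
  exact integral_congr_ae (Eventually.of_forall fun x => by simp only; ring)

/-! ### Functions which are limits of smooth functions -/

/-- The smooth functions `ψ n` converge to `u` everywhere on `K` and their gradients converge to
`G` almost everywhere on `K`, everything being uniformly bounded. -/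
structure SmoothApprox (K : Set (Vec d)) (u : Vec d → ℝ) (G : Fin d → Vec d → ℝ)
    (ψ : ℕ → Vec d → ℝ) : Prop where
  contDiff : ∀ n, ContDiff ℝ ∞ (ψ n)
  tendsto : ∀ x ∈ K, Tendsto (fun n => ψ n x) atTop (𝓝 (u x))
  bound : ∃ B, ∀ n, ∀ x ∈ K, |ψ n x| ≤ B
  tendsto_grad : ∀ j, ∀ᵐ x ∂volume.restrict K,
    Tendsto (fun n => fderiv ℝ (ψ n) x (basisVec j)) atTop (𝓝 (G j x))
  bound_grad : ∃ B, ∀ n j, ∀ x ∈ K, |fderiv ℝ (ψ n) x (basisVec j)| ≤ B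

/-- The mollifications of a Lipschitz function converge uniformly; their gradients are the
mollifications of the almost everywhere gradient, hence bounded and convergent almost everywhere. -/
lemma LipschitzWith.smoothApprox {C : NNReal} {f : Vec d → ℝ} (hf : LipschitzWith C f)
    {K : Set (Vec d)} (hK : IsCompact K) :
    SmoothApprox K f (fun j x => lineDeriv ℝ f x (basisVec j)) (fun n => conv f (mollifier d n)) := by
  have hl := hf.continuous.locallyIntegrable (μ := (volume : Measure (Vec d)))
  have hs : ∀ n, ContDiff ℝ ∞ (conv f (mollifier d n)) := fun n =>
    contDiff_conv hl (contDiff_mollifier d n) (hasCompactSupport_mollifier d n)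
  have hdist : ∀ n x, |conv f (mollifier d n) x - f x| ≤ C * (2 / (n + 1)) := by
    intro n x
    rw [← Real.dist_eq, conv_mollifier]
    refine ContDiffBump.dist_normed_convolution_le hf.continuous.aestronglyMeasurable fun y hy => ?_
    refine (hf.dist_le_mul y x).trans ?_
    exact mul_le_mul_of_nonneg_left (Metric.mem_ball.1 hy).le C.2
  have hder : ∀ n j x, fderiv ℝ (conv f (mollifier d n)) x (basisVec j) =
      conv (fun x => lineDeriv ℝ f x (basisVec j)) (mollifier d n) x := by
    intro n j x
    have h1 := isWeakDeriv_lineDeriv (U := Set.univ) hf (EventuallyEq.refl _ f) j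
    have h2 := h1.iterPartial_conv MeasurableSet.univ (by simpa using hl) (contDiff_mollifier d n)
      (tsupport_mollifier d n) (x := x) (Set.subset_univ _)
    simp only [Set.indicator_univ] at h2
    rw [← iterPartial_one j (hs n), h2]
  refine ⟨hs, fun x _ => ?_, ?_, fun j => ?_, ?_⟩
  · rw [tendsto_iff_norm_sub_tendsto_zero]
    refine squeeze_zero (fun n => norm_nonneg _) (fun n => hdist n x) ?_
    simpa using tendsto_two_div.const_mul (C : ℝ)
  · obtain ⟨B, hB⟩ := hK.exists_bound_of_continuousOn hf.continuous.continuousOn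
    refine ⟨C * 2 + B, fun n x hx => ?_⟩
    have h1 := hdist n x
    have h2 := hB x hx
    have h3 : (C : ℝ) * (2 / (n + 1)) ≤ C * 2 := by
      refine mul_le_mul_of_nonneg_left ?_ C.2
      rw [div_le_iff₀ (by positivity)]
      have : (0 : ℝ) ≤ n := by positivity
      linarith
    calc |conv f (mollifier d n) x| = |(conv f (mollifier d n) x - f x) + f x| := by congr 1; ring
      _ ≤ |conv f (mollifier d n) x - f x| + |f x| := abs_add_le _ _
      _ ≤ _ := by rw [Real.norm_eq_abs] at h2; linarith
  · simp_rw [hder]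
    exact ae_restrict_of_ae (ae_tendsto_conv (hf.locallyIntegrable_lineDeriv _))
  · refine ⟨C * 1, fun n j x _ => ?_⟩
    rw [hder]
    refine abs_conv_mollifier_le (Eventually.of_forall fun y => ?_) n x
    have := norm_lineDeriv_le_of_lipschitz ℝ (v := basisVec j) (x₀ := y) hf
    rwa [norm_basisVec, Real.norm_eq_abs] at this

lemma SmoothApprox.const {K : Set (Vec d)} (hK : IsCompact K) {f : Vec d → ℝ} (hf : ContDiff ℝ ∞ f) :
    SmoothApprox K f (fun j x => fderiv ℝ f x (basisVec j)) (fun _ => f) := by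
  have hcd : Continuous (fderiv ℝ f) := hf.continuous_fderiv (by simp)
  obtain ⟨B, hB⟩ := hK.exists_bound_of_continuousOn hf.continuous.continuousOn
  obtain ⟨B', hB'⟩ := hK.exists_bound_of_continuousOn hcd.continuousOn
  refine ⟨fun _ => hf, fun x _ => tendsto_const_nhds, ⟨B, fun _ x hx => hB x hx⟩,
    fun j => Eventually.of_forall fun x => tendsto_const_nhds, ⟨B', fun _ j x hx => ?_⟩⟩
  refine ((fderiv ℝ f x).le_opNorm _).trans ?_
  rw [norm_basisVec, mul_one]
  exact hB' x hx

lemma SmoothApprox.sub {K : Set (Vec d)} {u₁ u₂ : Vec d → ℝ} {G₁ G₂ : Fin d → Vec d → ℝ}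
    {ψ₁ ψ₂ : ℕ → Vec d → ℝ} (h₁ : SmoothApprox K u₁ G₁ ψ₁) (h₂ : SmoothApprox K u₂ G₂ ψ₂) :
    SmoothApprox K (fun x => u₁ x - u₂ x) (fun j x => G₁ j x - G₂ j x)
      (fun n x => ψ₁ n x - ψ₂ n x) := by
  have hder : ∀ n x j, fderiv ℝ (fun x => ψ₁ n x - ψ₂ n x) x (basisVec j) =
      fderiv ℝ (ψ₁ n) x (basisVec j) - fderiv ℝ (ψ₂ n) x (basisVec j) := by
    intro n x j
    rw [fderiv_fun_sub ((h₁.contDiff n).differentiable (by simp) x)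
      ((h₂.contDiff n).differentiable (by simp) x)]
    rfl
  obtain ⟨B₁, hB₁⟩ := h₁.bound
  obtain ⟨B₂, hB₂⟩ := h₂.bound
  obtain ⟨D₁, hD₁⟩ := h₁.bound_grad
  obtain ⟨D₂, hD₂⟩ := h₂.bound_grad
  refine ⟨fun n => (h₁.contDiff n).sub (h₂.contDiff n),
    fun x hx => (h₁.tendsto x hx).sub (h₂.tendsto x hx), ⟨B₁ + B₂, fun n x hx => ?_⟩, fun j => ?_,
    ⟨D₁ + D₂, fun n j x hx => ?_⟩⟩
  · exact (abs_sub _ _).trans (add_le_add (hB₁ n x hx) (hB₂ n x hx))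
  · filter_upwards [h₁.tendsto_grad j, h₂.tendsto_grad j] with x hx1 hx2
    simp_rw [hder]
    exact hx1.sub hx2
  · rw [hder]
    exact (abs_sub _ _).trans (add_le_add (hD₁ n j x hx) (hD₂ n j x hx))

lemma SmoothApprox.mul {K : Set (Vec d)} (hK : MeasurableSet K) {u₁ u₂ : Vec d → ℝ}
    {G₁ G₂ : Fin d → Vec d → ℝ}
    {ψ₁ ψ₂ : ℕ → Vec d → ℝ} (h₁ : SmoothApprox K u₁ G₁ ψ₁) (h₂ : SmoothApprox K u₂ G₂ ψ₂) :
    SmoothApprox K (fun x => u₁ x * u₂ x) (fun j x => u₁ x * G₂ j x + G₁ j x * u₂ x)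
      (fun n x => ψ₁ n x * ψ₂ n x) := by
  have hder : ∀ n x j, fderiv ℝ (fun x => ψ₁ n x * ψ₂ n x) x (basisVec j) =
      ψ₁ n x * fderiv ℝ (ψ₂ n) x (basisVec j) + fderiv ℝ (ψ₁ n) x (basisVec j) * ψ₂ n x := by
    intro n x j
    rw [fderiv_fun_mul ((h₁.contDiff n).differentiable (by simp) x)
      ((h₂.contDiff n).differentiable (by simp) x)]
    simp [mul_comm]
  obtain ⟨B₁, hB₁⟩ := h₁.bound
  obtain ⟨B₂, hB₂⟩ := h₂.bound
  obtain ⟨D₁, hD₁⟩ := h₁.bound_grad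
  obtain ⟨D₂, hD₂⟩ := h₂.bound_grad
  refine ⟨fun n => (h₁.contDiff n).mul (h₂.contDiff n),
    fun x hx => (h₁.tendsto x hx).mul (h₂.tendsto x hx), ⟨B₁ * B₂, fun n x hx => ?_⟩, fun j => ?_,
    ⟨B₁ * D₂ + D₁ * B₂, fun n j x hx => ?_⟩⟩
  · rw [abs_mul]
    exact mul_le_mul (hB₁ n x hx) (hB₂ n x hx) (abs_nonneg _) ((abs_nonneg _).trans (hB₁ n x hx))
  · filter_upwards [h₁.tendsto_grad j, h₂.tendsto_grad j, ae_restrict_mem hK] with x hx1 hx2 hx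
    simp_rw [hder]
    exact ((h₁.tendsto x hx).mul hx2).add (hx1.mul (h₂.tendsto x hx))
  · rw [hder]
    refine (abs_add_le _ _).trans ?_
    rw [abs_mul, abs_mul]
    exact add_le_add
      (mul_le_mul (hB₁ n x hx) (hD₂ n j x hx) (abs_nonneg _) ((abs_nonneg _).trans (hB₁ n x hx)))
      (mul_le_mul (hD₁ n j x hx) (hB₂ n x hx) (abs_nonneg _) ((abs_nonneg _).trans (hD₁ n j x hx)))

section Simplex

variable {ι : Type*} [Fintype ι] (b : AffineBasis ι ℝ (Vec d)) {u : Vec d → ℝ}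
  {G : Fin d → Vec d → ℝ} {ψ : ℕ → Vec d → ℝ}

lemma SmoothApprox.memLp_grad (h : SmoothApprox (simplex b) u G ψ) (j : Fin d) :
    MemLp (G j) 2 (volume.restrict (simplex b)) := by
  have := isFiniteMeasure_simplex b
  obtain ⟨B, hB⟩ := h.bound_grad
  have hm := measurableSet_simplex b
  refine MemLp.of_bound (aestronglyMeasurable_of_tendsto_ae atTop
    (fun n => (((h.contDiff n).continuous_fderiv (by simp)).clm_apply
      continuous_const).aestronglyMeasurable)
    (h.tendsto_grad j)) B ?_
  filter_upwards [ae_restrict_mem hm, h.tendsto_grad j] with x hx hx2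
  exact le_of_tendsto hx2.norm (Eventually.of_forall fun n => hB n j x hx)

/-- The divergence theorem, by passage to the limit from the smooth case. -/
lemma SmoothApprox.integral_grad (hd : 1 ≤ d) (h : SmoothApprox (simplex b) u G ψ) (j : Fin d) :
    ∫ x in simplex b, G j x = ∑ i, ∫ y, facetNormal b i j * u y ∂facetMeasure b i := by
  have := isFiniteMeasure_simplex b
  obtain ⟨B, hB⟩ := h.bound
  obtain ⟨D, hD⟩ := h.bound_grad
  have h1 : Tendsto (fun n => ∫ x in simplex b, fderiv ℝ (ψ n) x (basisVec j)) atTop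
      (𝓝 (∫ x in simplex b, G j x)) := by
    refine tendsto_integral_of_dominated_convergence (fun _ => D) (fun n =>
      (((h.contDiff n).continuous_fderiv (by simp)).clm_apply
      continuous_const).aestronglyMeasurable) (integrable_const D) (fun n => ?_) (h.tendsto_grad j)
    exact (ae_restrict_mem (measurableSet_simplex b)).mono fun x hx => hD n j x hx
  have h2 : ∀ i, Tendsto (fun n => ∫ y, inner ℝ (basisVec j) (facetNormal b i) * ψ n y
      ∂facetMeasure b i) atTop (𝓝 (∫ y, inner ℝ (basisVec j) (facetNormal b i) * u y
      ∂facetMeasure b i)) := by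
    intro i
    have := isFiniteMeasure_facetMeasure b i hd
    have hm := (ae_mem_facet b i).mono fun x hx => facet_subset b i hx
    refine tendsto_integral_of_dominated_convergence
      (fun _ => |inner ℝ (basisVec j) (facetNormal b i)| * B) (fun n =>
      ((h.contDiff n).continuous.const_mul _).aestronglyMeasurable) (integrable_const _)
      (fun n => ?_) (hm.mono fun x hx => (h.tendsto x hx).const_mul _)
    exact hm.mono fun x hx => by
      rw [norm_mul]; exact mul_le_mul_of_nonneg_left (hB n x hx) (abs_nonneg _)
  have h3 := tendsto_finsetSum Finset.univ fun i _ => h2 i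
  have h4 : ∀ n, ∫ x in simplex b, fderiv ℝ (ψ n) x (basisVec j) =
      ∑ i, ∫ y, inner ℝ (basisVec j) (facetNormal b i) * ψ n y ∂facetMeasure b i := fun n =>
    integral_fderiv_simplex b hd ((h.contDiff n).of_le (by norm_cast)) (basisVec j)
  simp_rw [h4] at h1
  have h5 := tendsto_nhds_unique h1 h3
  simp_rw [inner_basisVec_left] at h5
  exact h5

lemma l2_facet_smooth_le (hd : 1 ≤ d) (i : ι) {f : Vec d → ℝ} (hf : ContDiff ℝ 1 f) :
    √(height b i) * l2 (facetMeasure b i) f ≤ (d + 1) * l2 (volume.restrict (simplex b)) f +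
      Metric.diam (simplex b) *
        ∑ j, l2 (volume.restrict (simplex b)) (fun x => fderiv ℝ f x (basisVec j)) := by
  have hcd : Continuous (fderiv ℝ f) := hf.continuous_fderiv (by simp)
  have h0 := integral_facet_sq_le b i hd hf
  have m1 := memLp_facetMeasure b i hd hf.continuous 2
  have m2 := HybridFE.memLp_simplex b hf.continuous 2
  have m3 := HybridFE.memLp_simplex b hcd 2
  have m4 : ∀ j, MemLp (fun x => fderiv ℝ f x (basisVec j)) 2 (volume.restrict (simplex b)) := fun j =>
    HybridFE.memLp_simplex b (hcd.clm_apply continuous_const) 2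
  rw [← l2_sq_real m1, ← l2_sq_real m2, ← l2_sq m3] at h0
  have h1 : l2 (volume.restrict (simplex b)) (fderiv ℝ f) ≤
      ∑ j, l2 (volume.restrict (simplex b)) (fun x => fderiv ℝ f x (basisVec j)) := by
    have m5 : ∀ j, MemLp (fun x => ‖fderiv ℝ f x (basisVec j)‖) 2 (volume.restrict (simplex b)) :=
      fun j => (m4 j).norm
    have m6 : MemLp (fun x => ∑ j, ‖fderiv ℝ f x (basisVec j)‖) 2 (volume.restrict (simplex b)) :=
      memLp_finsetSum Finset.univ fun j _ => m5 j
    refine (l2_mono_ae m6 (Eventually.of_forall fun x => ?_)).trans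
      ((l2_sum_le Finset.univ fun j _ => m5 j).trans (le_of_eq ?_))
    · exact (norm_le_sum_abs_apply _).trans (le_abs_self _)
    · exact Finset.sum_congr rfl fun j _ => l2_norm _
  have hA := l2_nonneg (μ := volume.restrict (simplex b)) f
  have hB := l2_nonneg (μ := volume.restrict (simplex b)) (fderiv ℝ f)
  have hdiam : 0 ≤ Metric.diam (simplex b) := Metric.diam_nonneg
  have h2 : √(height b i) * l2 (facetMeasure b i) f ≤ (d + 1) * l2 (volume.restrict (simplex b)) f +
      Metric.diam (simplex b) * l2 (volume.restrict (simplex b)) (fderiv ℝ f) := by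
    refine abs_le_of_sq_le_sq' ?_ (by positivity) |>.2
    rw [mul_pow, Real.sq_sqrt (height_pos b i hd).le]
    refine h0.trans ?_
    have hd0 : (0 : ℝ) ≤ d := by positivity
    have e : 0 ≤ (d + 1 : ℝ) * l2 (volume.restrict (simplex b)) f * (Metric.diam (simplex b) *
      l2 (volume.restrict (simplex b)) (fderiv ℝ f)) := by positivity
    have e2 : (d + 1 : ℝ) * l2 (volume.restrict (simplex b)) f ^ 2 ≤
      ((d + 1) * l2 (volume.restrict (simplex b)) f) ^ 2 := by
      rw [mul_pow]
      exact mul_le_mul_of_nonneg_right (by nlinarith) (sq_nonneg _)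
    nlinarith
  exact h2.trans (add_le_add le_rfl (mul_le_mul_of_nonneg_left h1 hdiam))

lemma tendsto_l2_of_bound {X E : Type*} [MeasurableSpace X] [NormedAddCommGroup E] {μ : Measure X}
    [IsFiniteMeasure μ] {f : ℕ → X → E} {g : X → E} {B : ℝ}
    (hf : ∀ n, AEStronglyMeasurable (f n) μ) (hB : ∀ n, ∀ᵐ x ∂μ, ‖f n x‖ ≤ B)
    (h : ∀ᵐ x ∂μ, Tendsto (fun n => f n x) atTop (𝓝 (g x))) :
    Tendsto (fun n => l2 μ (f n)) atTop (𝓝 (l2 μ g)) := by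
  have hg : MemLp g 2 μ := by
    refine MemLp.of_bound (aestronglyMeasurable_of_tendsto_ae atTop hf h) B ?_
    filter_upwards [ae_all_iff.2 hB, h] with x hx1 hx2
    exact le_of_tendsto hx2.norm (Eventually.of_forall hx1)
  have e : ∀ n, l2 μ (f n) = √(∫ x, ‖f n x‖ ^ 2 ∂μ) := fun n =>
    l2_eq_sqrt (MemLp.of_bound (hf n) B (hB n))
  simp_rw [e]
  rw [l2_eq_sqrt hg]
  refine (Real.continuous_sqrt.tendsto _).comp ?_
  refine tendsto_integral_of_dominated_convergence (fun _ => B ^ 2) (fun n => (hf n).norm.pow 2)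
    (integrable_const _) (fun n => ?_) (h.mono fun x hx => (hx.norm).pow 2)
  filter_upwards [hB n] with x hx
  rw [Real.norm_eq_abs, abs_of_nonneg (by positivity)]
  gcongr

/-- The trace inequality, by passage to the limit from the smooth case. -/
lemma SmoothApprox.l2_facet_le (hd : 1 ≤ d) (h : SmoothApprox (simplex b) u G ψ) (i : ι) :
    √(height b i) * l2 (facetMeasure b i) u ≤ (d + 1) * l2 (volume.restrict (simplex b)) u +
      Metric.diam (simplex b) * ∑ j, l2 (volume.restrict (simplex b)) (G j) := by
  have := isFiniteMeasure_simplex b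
  have := isFiniteMeasure_facetMeasure b i hd
  obtain ⟨B, hB⟩ := h.bound
  obtain ⟨D, hD⟩ := h.bound_grad
  have hmT := ae_restrict_mem (μ := volume) (measurableSet_simplex b)
  have hmF := (ae_mem_facet b i).mono fun x hx => facet_subset b i hx
  have t1 : Tendsto (fun n => l2 (facetMeasure b i) (ψ n)) atTop (𝓝 (l2 (facetMeasure b i) u)) :=
    tendsto_l2_of_bound (fun n => (h.contDiff n).continuous.aestronglyMeasurable)
      (fun n => hmF.mono fun x hx => hB n x hx) (hmF.mono fun x hx => h.tendsto x hx)
  have t2 : Tendsto (fun n => l2 (volume.restrict (simplex b)) (ψ n)) atTop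
      (𝓝 (l2 (volume.restrict (simplex b)) u)) :=
    tendsto_l2_of_bound (fun n => (h.contDiff n).continuous.aestronglyMeasurable)
      (fun n => hmT.mono fun x hx => hB n x hx) (hmT.mono fun x hx => h.tendsto x hx)
  have t3 : ∀ j, Tendsto (fun n => l2 (volume.restrict (simplex b))
      (fun x => fderiv ℝ (ψ n) x (basisVec j))) atTop
      (𝓝 (l2 (volume.restrict (simplex b)) (G j))) := fun j =>
    tendsto_l2_of_bound (fun n => (((h.contDiff n).continuous_fderiv (by simp)).clm_apply
      continuous_const).aestronglyMeasurable)
      (fun n => hmT.mono fun x hx => hD n j x hx) (h.tendsto_grad j)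
  exact le_of_tendsto_of_tendsto' (t1.const_mul _)
    ((t2.const_mul _).add ((tendsto_finsetSum Finset.univ fun j _ => t3 j).const_mul _))
    fun n => l2_facet_smooth_le b hd i ((h.contDiff n).of_le (by norm_cast))

end Simplex

end

/-! ### Taylor polynomials -/

section

open MvPolynomial

variable {d : ℕ}

/-- The polynomial of degree `k` whose partial derivatives at the origin are `a`. -/
def jetPoly (k : ℕ) (a : ∀ m : ℕ, (Fin m → Fin d) → ℝ) : MvPolynomial (Fin d) ℝ :=
  ∑ m ∈ Finset.range (k + 1), ∑ J, C ((m.factorial : ℝ)⁻¹ * a m J) * ∏ i, X (J i)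

lemma degLE_jetPoly (k : ℕ) (a : ∀ m : ℕ, (Fin m → Fin d) → ℝ) : DegLE k (jetPoly k a) := by
  refine DegLE.sum fun m hm => DegLE.sum fun J _ => DegLE.C_mul _ ?_
  rw [degLE_nat]
  refine (totalDegree_finsetProd _ _).trans ?_
  simp only [totalDegree_X, Finset.sum_const, Finset.card_univ, Fintype.card_fin, smul_eq_mul, mul_one]
  simp only [Finset.mem_range] at hm
  omega

lemma evalAt_jetPoly (k : ℕ) (a : ∀ m : ℕ, (Fin m → Fin d) → ℝ) (z : Vec d) :
    evalAt (jetPoly k a) z =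
      ∑ m ∈ Finset.range (k + 1), ∑ J, (m.factorial : ℝ)⁻¹ * a m J * ∏ i, z (J i) := by
  simp only [jetPoly, evalAt_sum, evalAt_mul, evalAt_C]
  simp only [evalAt, map_prod, eval_X]

lemma evalAt_pderiv_jetPoly (k : ℕ) (a : ∀ m : ℕ, (Fin m → Fin d) → ℝ) (j : Fin d) (z : Vec d) :
    evalAt (pderiv j (jetPoly k a)) z =
      ∑ m ∈ Finset.range (k + 1), ∑ J, (m.factorial : ℝ)⁻¹ * a m J *
        evalAt (pderiv j (∏ i, X (J i))) z := by
  simp only [jetPoly, map_sum, evalAt_sum, pderiv_C_mul, evalAt_mul, evalAt_C]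

lemma iteratedFDeriv_apply_eq_sum {m : ℕ} (g : Vec d → ℝ) (y : Vec d) (v : Fin m → Vec d) :
    iteratedFDeriv ℝ m g y v = ∑ J, iterPartial J g y * ∏ i, v i (J i) := by
  have h1 : v = fun i => ∑ j, v i j • basisVec j := funext fun i => vec_eq_sum (v i)
  conv_lhs => rw [h1]
  rw [ContinuousMultilinearMap.map_sum]
  refine Finset.sum_congr rfl fun J _ => ?_
  rw [ContinuousMultilinearMap.map_smul_univ, smul_eq_mul, mul_comm]
  rfl

/-- The sum of the absolute values of the partial derivatives of order `m`. -/
def jetNorm (m : ℕ) (g : Vec d → ℝ) (z : Vec d) : ℝ := ∑ J : Fin m → Fin d, |iterPartial J g z|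

lemma jetNorm_nonneg (m : ℕ) (g : Vec d → ℝ) (z : Vec d) : 0 ≤ jetNorm m g z :=
  Finset.sum_nonneg fun _ _ => abs_nonneg _

lemma continuous_jetNorm (m : ℕ) {g : Vec d → ℝ} (hg : ContDiff ℝ ∞ g) : Continuous (jetNorm m g) :=
  continuous_finsetSum _ fun J _ => (contDiff_iterPartial J hg).continuous.abs

lemma norm_iteratedFDeriv_apply_le {m : ℕ} (g : Vec d → ℝ) (y : Vec d) (v : Fin m → Vec d) :
    ‖iteratedFDeriv ℝ m g y v‖ ≤ jetNorm m g y * ∏ i, ‖v i‖ := by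
  rw [iteratedFDeriv_apply_eq_sum, jetNorm, Finset.sum_mul]
  refine norm_sum_le_of_le _ fun J _ => ?_
  rw [norm_mul, Real.norm_eq_abs, norm_prod]
  exact mul_le_mul_of_nonneg_left (Finset.prod_le_prod (fun i _ => norm_nonneg _)
    fun i _ => abs_coord_le (v i) (J i)) (abs_nonneg _)

/-- The Taylor polynomial of order `k` of `g` at `y`. -/
def taylorPoly (k : ℕ) (g : Vec d → ℝ) (y : Vec d) : MvPolynomial (Fin d) ℝ :=
  jetPoly k fun _ J => iterPartial J g y

lemma evalAt_taylorPoly (k : ℕ) (g : Vec d → ℝ) (y z : Vec d) :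
    evalAt (taylorPoly k g y) z = ∑ m ∈ Finset.range (k + 1),
      (m.factorial : ℝ)⁻¹ * iteratedFDeriv ℝ m g y fun _ => z := by
  rw [taylorPoly, evalAt_jetPoly]
  refine Finset.sum_congr rfl fun m _ => ?_
  rw [iteratedFDeriv_apply_eq_sum, Finset.mul_sum]
  exact Finset.sum_congr rfl fun J _ => by ring

lemma iteratedFDeriv_succ_apply {m : ℕ} {g : Vec d → ℝ} (hg : ContDiff ℝ ∞ g) (y : Vec d)
    (v : Fin (m + 1) → Vec d) : iteratedFDeriv ℝ (m + 1) g y v =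
      fderiv ℝ (fun x => iteratedFDeriv ℝ m g x (Fin.tail v)) y (v 0) := by
  have h : ContDiff ℝ 1 (iteratedFDeriv ℝ m g) := hg.iteratedFDeriv_right (by exact_mod_cast le_top)
  rw [iteratedFDeriv_succ_apply_left]
  exact (fderiv_continuousMultilinear_apply_const_apply ((h.differentiable (by simp)) y) _ _).symm

lemma contDiff_fderiv_apply {g : Vec d → ℝ} (hg : ContDiff ℝ ∞ g) (e : Vec d) :
    ContDiff ℝ ∞ fun x => fderiv ℝ g x e :=
  (hg.fderiv_right (m := ∞) (by norm_cast)).clm_apply contDiff_const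

lemma contDiff_iteratedFDeriv_apply {m : ℕ} {g : Vec d → ℝ} (hg : ContDiff ℝ ∞ g)
    (v : Fin m → Vec d) : ContDiff ℝ ∞ fun x => iteratedFDeriv ℝ m g x v := by
  have h : ContDiff ℝ ∞ (iteratedFDeriv ℝ m g) := hg.iteratedFDeriv_right (by exact_mod_cast le_top)
  exact (ContinuousMultilinearMap.apply ℝ (fun _ : Fin m => Vec d) ℝ v).contDiff.comp h

lemma fderiv_fderiv_comm {g : Vec d → ℝ} (hg : ContDiff ℝ ∞ g) (y a e : Vec d) :
    fderiv ℝ (fun x => fderiv ℝ g x e) y a = fderiv ℝ (fun x => fderiv ℝ g x a) y e := by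
  have h1 : DifferentiableAt ℝ (fderiv ℝ g) y :=
    (hg.fderiv_right (m := ∞) (by norm_cast)).differentiable (by simp) y
  have h2 := (hg.contDiffAt (x := y)).isSymmSndFDerivAt
    (by rw [minSmoothness_of_isRCLikeNormedField]
        exact WithTop.coe_le_coe.2 (le_top : (2 : ℕ∞) ≤ ⊤))
  rw [fderiv_clm_apply h1 (differentiableAt_const _), fderiv_clm_apply h1 (differentiableAt_const _)]
  simpa using h2 a e

lemma iteratedFDeriv_fderiv_apply {m : ℕ} {g : Vec d → ℝ} (hg : ContDiff ℝ ∞ g) (y e : Vec d)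
    (w : Fin m → Vec d) : iteratedFDeriv ℝ m (fun x => fderiv ℝ g x e) y w =
      fderiv ℝ (fun x => iteratedFDeriv ℝ m g x w) y e := by
  induction m generalizing y with
  | zero => simp
  | succ m ih =>
    rw [iteratedFDeriv_succ_apply (contDiff_fderiv_apply hg e)]
    simp_rw [ih, iteratedFDeriv_succ_apply hg]
    exact fderiv_fderiv_comm (contDiff_iteratedFDeriv_apply hg _) _ _ _

/-- The value of a derivative of a smooth function at `(z, …, z, e, z, …, z)` does not depend on
the position of `e`. -/
lemma iteratedFDeriv_update {m : ℕ} {g : Vec d → ℝ} (hg : ContDiff ℝ ∞ g) (y z e : Vec d)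
    (i : Fin (m + 1)) : iteratedFDeriv ℝ (m + 1) g y (Function.update (fun _ => z) i e) =
      iteratedFDeriv ℝ m (fun x => fderiv ℝ g x e) y fun _ => z := by
  induction m generalizing y with
  | zero =>
    obtain rfl : i = 0 := Fin.fin_one_eq_zero i
    rw [iteratedFDeriv_succ_apply hg]
    simp
  | succ m ih =>
    rw [iteratedFDeriv_succ_apply hg]
    refine Fin.cases ?_ (fun i => ?_) i
    · have h1 : Fin.tail (Function.update (fun _ : Fin (m + 1 + 1) => z) 0 e) = fun _ => z := by
        ext1 l; simp [Fin.tail]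
      rw [h1, Function.update_self]
      exact (iteratedFDeriv_fderiv_apply hg y e _).symm
    · have h1 : Fin.tail (Function.update (fun _ : Fin (m + 1 + 1) => z) i.succ e) =
          Function.update (fun _ => z) i e := by
        ext1 l; simp [Fin.tail, Function.update_apply]
      rw [h1, Function.update_of_ne (Fin.succ_ne_zero i).symm]
      simp_rw [ih]
      rw [iteratedFDeriv_succ_apply (contDiff_fderiv_apply hg e)]
      rfl

lemma hasFDerivAt_iteratedFDeriv_diagonal (m : ℕ) {g : Vec d → ℝ} (hg : ContDiff ℝ ∞ g)
    (y z : Vec d) : HasFDerivAt (fun z : Vec d => iteratedFDeriv ℝ (m + 1) g y fun _ => z)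
      ((m + 1 : ℝ) • iteratedFDeriv ℝ m (fderiv ℝ g) y fun _ => z) z := by
  have h1 := (iteratedFDeriv ℝ (m + 1) g y).hasFDerivAt (fun _ => z)
  have h2 := h1.comp z (ContinuousLinearMap.pi fun _ : Fin (m + 1) =>
    ContinuousLinearMap.id ℝ (Vec d)).hasFDerivAt
  refine HasFDerivAt.congr_fderiv (f := fun z : Vec d => iteratedFDeriv ℝ (m + 1) g y fun _ => z) h2 ?_
  refine ContinuousLinearMap.ext fun e => ?_
  have h3 : ∀ i : Fin (m + 1), iteratedFDeriv ℝ (m + 1) g y (Function.update (fun _ => z) i e) =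
      (iteratedFDeriv ℝ m (fderiv ℝ g) y fun _ => z) e := by
    intro i
    rw [iteratedFDeriv_update hg]
    have h4 : ContDiffAt ℝ ∞ (fderiv ℝ g) y :=
      (hg.fderiv_right (m := ∞) (by norm_cast)).contDiffAt
    have h5 := (ContinuousLinearMap.apply ℝ ℝ e).iteratedFDeriv_comp_left h4 (i := m)
      (by exact_mod_cast le_top)
    exact DFunLike.congr_fun h5 fun _ => z
  rw [ContinuousLinearMap.comp_apply, ContinuousMultilinearMap.linearDeriv_apply]
  refine (Finset.sum_congr rfl fun i _ => h3 i).trans ?_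
  rw [Finset.sum_const, Finset.card_univ, Fintype.card_fin, nsmul_eq_mul, smul_apply, smul_eq_mul]
  push_cast
  rfl

/-- The derivative of the Taylor polynomial is the Taylor polynomial of the derivative. -/
lemma fderiv_taylorPoly (k : ℕ) {g : Vec d → ℝ} (hg : ContDiff ℝ ∞ g) (y z : Vec d) :
    fderiv ℝ (evalAt (taylorPoly k g y)) z = ∑ m ∈ Finset.range k,
      (m.factorial : ℝ)⁻¹ • iteratedFDeriv ℝ m (fderiv ℝ g) y fun _ => z := by
  have h0 : evalAt (taylorPoly k g y) = fun z => (∑ m ∈ Finset.range k,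
      ((m + 1).factorial : ℝ)⁻¹ * iteratedFDeriv ℝ (m + 1) g y fun _ => z) + g y := by
    ext1 z
    rw [evalAt_taylorPoly, Finset.sum_range_succ' _ k]
    simp
  rw [h0]
  have h1 : HasFDerivAt (fun z : Vec d => (∑ m ∈ Finset.range k, ((m + 1).factorial : ℝ)⁻¹ *
      iteratedFDeriv ℝ (m + 1) g y fun _ => z) + g y)
      (∑ m ∈ Finset.range k, ((m + 1).factorial : ℝ)⁻¹ •
        ((m + 1 : ℝ) • iteratedFDeriv ℝ m (fderiv ℝ g) y fun _ => z)) z :=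
    (HasFDerivAt.fun_sum fun m _ =>
      (hasFDerivAt_iteratedFDeriv_diagonal m hg y z).const_mul _).add_const _
  rw [h1.fderiv]
  refine Finset.sum_congr rfl fun m _ => ?_
  rw [smul_smul]
  congr 1
  have h2 : ((m.factorial : ℕ) : ℝ) ≠ 0 := by exact_mod_cast m.factorial_ne_zero
  rw [Nat.factorial_succ]
  push_cast
  field_simp

/-- Taylor's formula with integral remainder, for a function and its gradient. -/
lemma taylor_estimate (k : ℕ) {g : Vec d → ℝ} (hg : ContDiff ℝ ∞ g) (x y : Vec d) :
    |g x - evalAt (taylorPoly k g y) (x - y)| ≤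
        ‖x - y‖ ^ (k + 1) * ∫ t in (0 : ℝ)..1, jetNorm (k + 1) g (y + t • (x - y)) ∧
      ∀ j, |fderiv ℝ g x (basisVec j) - evalAt (pderiv j (taylorPoly k g y)) (x - y)| ≤
        ‖x - y‖ ^ k * (jetNorm (k + 1) g x +
          ∫ t in (0 : ℝ)..1, jetNorm (k + 1) g (y + t • (x - y))) := by
  have hcont : Continuous fun t : ℝ => jetNorm (k + 1) g (y + t • (x - y)) :=
    (continuous_jetNorm _ hg).comp (by fun_prop)
  have hI : 0 ≤ ∫ t in (0 : ℝ)..1, jetNorm (k + 1) g (y + t • (x - y)) :=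
    intervalIntegral.integral_nonneg zero_le_one fun t _ => jetNorm_nonneg _ _ _
  have hxy : y + (x - y) = x := by abel
  have hrem : ∀ {F : Type} [NormedAddCommGroup F] [NormedSpace ℝ F] (n m : ℕ) (A : ℝ → F),
      (∀ t ∈ Set.Icc (0 : ℝ) 1, ‖A t‖ ≤ jetNorm (k + 1) g (y + t • (x - y)) * ‖x - y‖ ^ m) →
      ‖(n.factorial : ℝ)⁻¹ • ∫ t in (0 : ℝ)..1, (1 - t) ^ n • A t‖ ≤
        ‖x - y‖ ^ m * ∫ t in (0 : ℝ)..1, jetNorm (k + 1) g (y + t • (x - y)) := by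
    intro F _ _ n m A hA
    rw [norm_smul, norm_inv, Real.norm_natCast]
    have h1 : (n.factorial : ℝ)⁻¹ ≤ 1 := inv_le_one_of_one_le₀ (by
      exact_mod_cast Nat.one_le_iff_ne_zero.2 (Nat.factorial_ne_zero n))
    have h2 : ‖∫ t in (0 : ℝ)..1, (1 - t) ^ n • A t‖ ≤
        ∫ t in (0 : ℝ)..1, jetNorm (k + 1) g (y + t • (x - y)) * ‖x - y‖ ^ m := by
      refine intervalIntegral.norm_integral_le_of_norm_le zero_le_one
        (Eventually.of_forall fun t ht => ?_)
        ((hcont.mul continuous_const).intervalIntegrable _ _)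
      have ht' : t ∈ Set.Icc (0 : ℝ) 1 := Set.Ioc_subset_Icc_self ht
      rw [norm_smul, norm_pow, Real.norm_eq_abs, abs_of_nonneg (by linarith [ht'.2])]
      have h3 : (1 - t) ^ n ≤ 1 := pow_le_one₀ (by linarith [ht'.2]) (by linarith [ht'.1])
      calc _ ≤ 1 * ‖A t‖ := by gcongr
        _ ≤ _ := by rw [one_mul]; exact hA t ht'
    rw [intervalIntegral.integral_mul_const, mul_comm (∫ t in (0 : ℝ)..1, _)] at h2
    calc _ ≤ 1 * ‖∫ t in (0 : ℝ)..1, (1 - t) ^ n • A t‖ := by gcongr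
      _ ≤ _ := by rw [one_mul]; exact h2
  refine ⟨?_, fun j => ?_⟩
  · have h1 := map_add_eq_sum_add_integral_iteratedFDeriv (f := g) (x := y) (y := x - y) (n := k)
      fun t _ => hg.contDiffAt.of_le (by norm_cast; exact le_top)
    rw [hxy] at h1
    rw [evalAt_taylorPoly, h1]
    simp only [smul_eq_mul, add_sub_cancel_left]
    rw [← Real.norm_eq_abs]
    refine hrem k (k + 1) (fun t => iteratedFDeriv ℝ (k + 1) g (y + t • (x - y)) fun _ => x - y)
      fun t _ => ?_
    refine (norm_iteratedFDeriv_apply_le _ _ _).trans (le_of_eq ?_)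
    simp
  · rw [evalAt_pderiv, fderiv_taylorPoly k hg, ← Real.norm_eq_abs, ← sub_apply]
    refine ((_ : Vec d →L[ℝ] ℝ).le_opNorm _).trans ?_
    rw [norm_basisVec, mul_one]
    rcases Nat.eq_zero_or_pos k with rfl | hk
    · simp only [Finset.range_zero, Finset.sum_empty, sub_zero, pow_zero, one_mul]
      refine le_trans ?_ (le_add_of_nonneg_right hI)
      refine ContinuousLinearMap.opNorm_le_bound _ (jetNorm_nonneg _ _ _) fun e => ?_
      have h1 := norm_iteratedFDeriv_apply_le (m := 1) g x (fun _ => e)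
      rw [iteratedFDeriv_one_apply] at h1
      simpa using h1
    · obtain ⟨n, rfl⟩ : ∃ n, k = n + 1 := ⟨k - 1, by omega⟩
      have h1 := map_add_eq_sum_add_integral_iteratedFDeriv (f := fderiv ℝ g) (x := y) (y := x - y)
        (n := n) fun t _ => ((hg.fderiv_right (m := ∞) (by norm_cast)).contDiffAt).of_le
          (by norm_cast; exact le_top)
      rw [hxy] at h1
      rw [h1, add_sub_cancel_left]
      refine (hrem n (n + 1) (fun t => iteratedFDeriv ℝ (n + 1) (fderiv ℝ g) (y + t • (x - y))
        fun _ => x - y) fun t _ => ?_).trans ?_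
      · refine ContinuousLinearMap.opNorm_le_bound _
          (mul_nonneg (jetNorm_nonneg _ _ _) (by positivity)) fun e => ?_
        have h2 := norm_iteratedFDeriv_apply_le (m := n + 1 + 1) g (y + t • (x - y))
          (Fin.snoc (fun _ => x - y) e)
        rw [iteratedFDeriv_succ_apply_right, Fin.prod_univ_castSucc] at h2
        simp only [Fin.init_snoc, Fin.snoc_last, Fin.snoc_castSucc, Finset.prod_const,
          Finset.card_univ, Fintype.card_fin] at h2
        rw [mul_assoc]
        exact h2
      · refine mul_le_mul_of_nonneg_left ?_ (by positivity)
        exact le_add_of_nonneg_left (jetNorm_nonneg _ _ _)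

end

/-! ### Polynomial approximation in Sobolev spaces -/

section

open MvPolynomial

variable {d : ℕ}

/-- Change of variables in a homothety about a point of `K` with ratio at least `1 / 2`. -/
lemma lintegral_homothety_le {K : Set (Vec d)} (hK : Convex ℝ K) (hKm : MeasurableSet K)
    {N : Vec d → ℝ≥0∞} (hN : Measurable N) {y : Vec d} (hy : y ∈ K) {s : ℝ} (hs : 1 / 2 ≤ s)
    (hs1 : s ≤ 1) : ∫⁻ x in K, N (y + s • (x - y)) ≤ 2 ^ d * ∫⁻ z in K, N z := by
  have hs0 : 0 < s := by linarith
  have h1 : ∫⁻ x in K, N (y + s • (x - y)) ≤ ∫⁻ x, K.indicator N (s • x + (1 - s) • y) := by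
    rw [← lintegral_indicator hKm]
    refine lintegral_mono fun x => ?_
    by_cases hx : x ∈ K
    · have hmem : s • x + (1 - s) • y ∈ K := hK hx hy hs0.le (by linarith) (by ring)
      rw [Set.indicator_of_mem hx, Set.indicator_of_mem hmem]
      refine le_of_eq ?_
      congr 1
      rw [smul_sub, sub_smul, one_smul]; abel
    · rw [Set.indicator_of_notMem hx]; exact bot_le
  have hNm : Measurable (K.indicator N) := hN.indicator hKm
  have h2 : ∫⁻ x, K.indicator N (s • x + (1 - s) • y) =
      ENNReal.ofReal |(s ^ d)⁻¹| * ∫⁻ z, K.indicator N z := by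
    have h3 := Measure.map_addHaar_smul (volume : Measure (Vec d)) hs0.ne'
    rw [finrank_euclideanSpace_fin] at h3
    have h4 : ∫⁻ x, K.indicator N (s • x + (1 - s) • y) =
        ∫⁻ z, K.indicator N (z + (1 - s) • y) ∂(Measure.map (fun x : Vec d => s • x) volume) := by
      exact (lintegral_map (f := fun z => K.indicator N (z + (1 - s) • y))
        (hNm.comp (measurable_add_const _)) (measurable_const_smul s)).symm
    rw [h4, h3, lintegral_smul_measure, lintegral_add_right_eq_self (μ := volume) (K.indicator N),
      smul_eq_mul]
  have h5 : ENNReal.ofReal |(s ^ d)⁻¹| ≤ 2 ^ d := by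
    have : |(s ^ d)⁻¹| ≤ 2 ^ d := by
      rw [abs_of_nonneg (by positivity), ← inv_pow]
      gcongr
      rw [inv_le_comm₀ hs0 (by norm_num)]
      linarith
    calc _ ≤ ENNReal.ofReal (2 ^ d) := ENNReal.ofReal_le_ofReal this
      _ = 2 ^ d := by rw [ENNReal.ofReal_pow (by norm_num)]; simp
  refine h1.trans ?_
  rw [h2, lintegral_indicator hKm]
  gcongr

/-- Averaging over all the segments of a convex set. -/
lemma lintegral_segment_le {K : Set (Vec d)} (hK : Convex ℝ K) (hKm : MeasurableSet K)
    {N : Vec d → ℝ≥0∞} (hN : Measurable N) :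
    ∫⁻ y in K, ∫⁻ x in K, ∫⁻ t in Set.Icc (0 : ℝ) 1, N (y + t • (x - y)) ≤
      2 ^ d * volume K * ∫⁻ z in K, N z := by
  have m3 : Measurable fun q : (Vec d × Vec d) × ℝ => N (q.1.1 + q.2 • (q.1.2 - q.1.1)) :=
    hN.comp (by fun_prop : Continuous fun q : (Vec d × Vec d) × ℝ =>
      q.1.1 + q.2 • (q.1.2 - q.1.1)).measurable
  have s1 : ∀ y : Vec d, ∫⁻ x in K, ∫⁻ t in Set.Icc (0 : ℝ) 1, N (y + t • (x - y)) =
      ∫⁻ t in Set.Icc (0 : ℝ) 1, ∫⁻ x in K, N (y + t • (x - y)) := by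
    intro y
    refine lintegral_lintegral_swap (Measurable.aemeasurable ?_)
    exact hN.comp (by fun_prop : Continuous fun q : Vec d × ℝ => y + q.2 • (q.1 - y)).measurable
  simp_rw [s1]
  have s2 : ∫⁻ y in K, ∫⁻ t in Set.Icc (0 : ℝ) 1, ∫⁻ x in K, N (y + t • (x - y)) =
      ∫⁻ t in Set.Icc (0 : ℝ) 1, ∫⁻ y in K, ∫⁻ x in K, N (y + t • (x - y)) := by
    refine lintegral_lintegral_swap (Measurable.aemeasurable ?_)
    have : Measurable fun q : (Vec d × ℝ) × Vec d => N (q.1.1 + q.1.2 • (q.2 - q.1.1)) :=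
      hN.comp (by fun_prop : Continuous fun q : (Vec d × ℝ) × Vec d =>
        q.1.1 + q.1.2 • (q.2 - q.1.1)).measurable
    exact this.lintegral_prod_right'
  rw [s2]
  have key : ∀ t ∈ Set.Icc (0 : ℝ) 1, ∫⁻ y in K, ∫⁻ x in K, N (y + t • (x - y)) ≤
      2 ^ d * volume K * ∫⁻ z in K, N z := by
    intro t ht
    have hc : ∫⁻ _ in K, (2 ^ d * ∫⁻ z in K, N z) = 2 ^ d * volume K * ∫⁻ z in K, N z := by
      rw [setLIntegral_const]; ring
    rw [← hc]
    -- For `t ≥ 1 / 2` the inner integral over `x` is a homothety about `y`; for `t ≤ 1 / 2` the roles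
    -- of `x` and `y` are exchanged. No singularity arises at either end of the segment.
    rcases le_total (1 / 2) t with h | h
    · exact setLIntegral_mono' hKm fun y hy => lintegral_homothety_le hK hKm hN hy h ht.2
    · have s3 : ∫⁻ y in K, ∫⁻ x in K, N (y + t • (x - y)) =
          ∫⁻ x in K, ∫⁻ y in K, N (x + (1 - t) • (y - x)) := by
        rw [lintegral_lintegral_swap (Measurable.aemeasurable ?_)]
        · refine lintegral_congr fun x => lintegral_congr fun y => ?_
          congr 1
          simp only [smul_sub, sub_smul, one_smul]; abel
        · exact hN.comp (by fun_prop : Continuous fun q : Vec d × Vec d =>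
            q.1 + t • (q.2 - q.1)).measurable
      rw [s3]
      exact setLIntegral_mono' hKm fun y hy =>
        lintegral_homothety_le hK hKm hN hy (by linarith) (by linarith [ht.1])
  refine (setLIntegral_mono' measurableSet_Icc key).trans ?_
  rw [setLIntegral_const]
  simp

/-- The squared error of Taylor's approximation, with its gradient. -/
def taylorError (k : ℕ) (h : ℝ) (g : Vec d → ℝ) (x y : Vec d) : ℝ :=
  (g x - evalAt (taylorPoly k g y) (x - y)) ^ 2 + h ^ 2 * ∑ j,
    (fderiv ℝ g x (basisVec j) - evalAt (pderiv j (taylorPoly k g y)) (x - y)) ^ 2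

lemma continuous_taylorError (k : ℕ) (h : ℝ) {g : Vec d → ℝ} (hg : ContDiff ℝ ∞ g) :
    Continuous fun q : Vec d × Vec d => taylorError k h g q.2 q.1 := by
  have h1 := hg.continuous
  have h2 : ∀ j, Continuous fun x => fderiv ℝ g x (basisVec j) := fun j =>
    (contDiff_fderiv_apply hg _).continuous
  have h3 : ∀ m (J : Fin m → Fin d), Continuous (iterPartial J g) := fun m J =>
    (contDiff_iterPartial J hg).continuous
  have h4 : ∀ p : MvPolynomial (Fin d) ℝ, Continuous (evalAt p) := fun p => continuous_evalAt p
  simp only [taylorError, taylorPoly, evalAt_jetPoly, evalAt_pderiv_jetPoly]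
  fun_prop

lemma sq_integral_le {N : ℝ → ℝ} (hN : Continuous N) :
    (∫ t in (0 : ℝ)..1, N t) ^ 2 ≤ ∫ t in Set.Icc (0 : ℝ) 1, N t ^ 2 := by
  rw [intervalIntegral.integral_of_le zero_le_one, ← integral_Icc_eq_integral_Ioc]
  obtain ⟨c, hc⟩ := isCompact_Icc.exists_bound_of_continuousOn (s := Set.Icc (0 : ℝ) 1) hN.continuousOn
  have m1 : MemLp N 2 (volume.restrict (Set.Icc (0 : ℝ) 1)) :=
    MemLp.of_bound hN.aestronglyMeasurable c <| by
      filter_upwards [ae_restrict_mem measurableSet_Icc] with t ht using hc t ht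
  have h1 := abs_integral_mul_le m1 (memLp_const (1 : ℝ))
  have h2 : l2 (volume.restrict (Set.Icc (0 : ℝ) 1)) (fun _ => (1 : ℝ)) = 1 := by
    rw [l2_eq_sqrt (memLp_const _)]; simp
  rw [h2] at h1
  simp only [mul_one] at h1
  rw [← l2_sq_real m1, ← sq_abs]
  gcongr

/-- The integral form of the remainder, with Jensen on the segment: it bounds the error by the
derivatives of order `k + 1` at `x` and along the segment from `y` to `x`. -/
lemma ofReal_taylorError_le (k : ℕ) {h : ℝ} {g : Vec d → ℝ} (hg : ContDiff ℝ ∞ g) {x y : Vec d}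
    (hxy : ‖x - y‖ ≤ h) : ENNReal.ofReal (taylorError k h g x y) ≤
      ENNReal.ofReal ((1 + 2 * d) * h ^ (2 * k + 2)) * (ENNReal.ofReal (jetNorm (k + 1) g x ^ 2) +
        ∫⁻ t in Set.Icc (0 : ℝ) 1, ENNReal.ofReal (jetNorm (k + 1) g (y + t • (x - y)) ^ 2)) := by
  have hcont : Continuous fun t : ℝ => jetNorm (k + 1) g (y + t • (x - y)) :=
    (continuous_jetNorm _ hg).comp (by fun_prop)
  have h0 : 0 ≤ h := (norm_nonneg _).trans hxy
  set I := ∫ t in (0 : ℝ)..1, jetNorm (k + 1) g (y + t • (x - y)) with hI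
  have hI0 : 0 ≤ I := intervalIntegral.integral_nonneg zero_le_one fun t _ => jetNorm_nonneg _ _ _
  set Q := ∫ t in Set.Icc (0 : ℝ) 1, jetNorm (k + 1) g (y + t • (x - y)) ^ 2 with hQ
  have hIQ : I ^ 2 ≤ Q := sq_integral_le hcont
  set A := jetNorm (k + 1) g x with hA
  have hA0 : 0 ≤ A := jetNorm_nonneg _ _ _
  have hQe : ∫⁻ t in Set.Icc (0 : ℝ) 1, ENNReal.ofReal (jetNorm (k + 1) g (y + t • (x - y)) ^ 2) =
      ENNReal.ofReal Q := by
    rw [hQ, ofReal_integral_eq_lintegral_ofReal]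
    · exact (hcont.pow 2).continuousOn.integrableOn_compact isCompact_Icc
    · exact Eventually.of_forall fun t => sq_nonneg _
  rw [hQe, ← ENNReal.ofReal_add (sq_nonneg _) ((sq_nonneg _).trans hIQ),
    ← ENNReal.ofReal_mul (by positivity)]
  refine ENNReal.ofReal_le_ofReal ?_
  obtain ⟨h1, h2⟩ := taylor_estimate k hg x y
  rw [← hI] at h1
  simp only [← hI, ← hA] at h2
  have e1 : (g x - evalAt (taylorPoly k g y) (x - y)) ^ 2 ≤ h ^ (2 * k + 2) * Q := by
    calc _ ≤ (h ^ (k + 1) * I) ^ 2 := by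
          rw [← sq_abs]
          gcongr
          exact h1.trans (by gcongr)
      _ = h ^ (2 * k + 2) * I ^ 2 := by rw [mul_pow, ← pow_mul]; congr 2; ring
      _ ≤ _ := by gcongr
  have e2 : ∀ j ∈ Finset.univ, (fderiv ℝ g x (basisVec j) -
      evalAt (pderiv j (taylorPoly k g y)) (x - y)) ^ 2 ≤ h ^ (2 * k) * (2 * (A ^ 2 + Q)) := by
    intro j _
    calc _ ≤ (h ^ k * (A + I)) ^ 2 := by
          rw [← sq_abs]
          gcongr
          exact (h2 j).trans (by gcongr)
      _ = h ^ (2 * k) * (A + I) ^ 2 := by rw [mul_pow, ← pow_mul]; congr 2; ring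
      _ ≤ _ := by
        gcongr
        nlinarith [sq_nonneg (A - I)]
  have e3 := Finset.sum_le_sum e2
  rw [Finset.sum_const, Finset.card_univ, Fintype.card_fin, nsmul_eq_mul] at e3
  have e4 : h ^ 2 * (d * (h ^ (2 * k) * (2 * (A ^ 2 + Q)))) =
    2 * d * h ^ (2 * k + 2) * (A ^ 2 + Q) := by ring
  have e5 := mul_le_mul_of_nonneg_left e3 (sq_nonneg h)
  rw [e4] at e5
  have e6 : 0 ≤ h ^ (2 * k + 2) * A ^ 2 := by positivity
  unfold taylorError
  nlinarith

/-- The mean over a convex set of the error of Taylor's approximation. -/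
lemma lintegral_taylorError_le (k : ℕ) {h : ℝ} {g : Vec d → ℝ} (hg : ContDiff ℝ ∞ g)
    {K : Set (Vec d)} (hK : Convex ℝ K) (hKm : MeasurableSet K)
    (hh : ∀ x ∈ K, ∀ y ∈ K, ‖x - y‖ ≤ h) :
    ∫⁻ y in K, ∫⁻ x in K, ENNReal.ofReal (taylorError k h g x y) ≤
      ENNReal.ofReal ((1 + 2 * d) * h ^ (2 * k + 2)) * ((1 + 2 ^ d) * volume K *
        ∫⁻ z in K, ENNReal.ofReal (jetNorm (k + 1) g z ^ 2)) := by
  set N : Vec d → ℝ≥0∞ := fun z => ENNReal.ofReal (jetNorm (k + 1) g z ^ 2) with hN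
  have hNm : Measurable N := (((continuous_jetNorm _ hg).pow 2).measurable).ennreal_ofReal
  set c := ENNReal.ofReal ((1 + 2 * d) * h ^ (2 * k + 2)) with hc
  have m1 : ∀ y : Vec d, Measurable fun x : Vec d =>
      ∫⁻ t in Set.Icc (0 : ℝ) 1, N (y + t • (x - y)) := by
    intro y
    have : Measurable fun q : Vec d × ℝ => N (y + q.2 • (q.1 - y)) :=
      hNm.comp (by fun_prop : Continuous fun q : Vec d × ℝ => y + q.2 • (q.1 - y)).measurable
    exact this.lintegral_prod_right'
  have m2 : Measurable fun y : Vec d => ∫⁻ x in K, ∫⁻ t in Set.Icc (0 : ℝ) 1, N (y + t • (x - y)) := by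
    have : Measurable fun q : (Vec d × Vec d) × ℝ => N (q.1.1 + q.2 • (q.1.2 - q.1.1)) :=
      hNm.comp (by fun_prop : Continuous fun q : (Vec d × Vec d) × ℝ =>
        q.1.1 + q.2 • (q.1.2 - q.1.1)).measurable
    have h2 := this.lintegral_prod_right' (ν := volume.restrict (Set.Icc (0 : ℝ) 1))
    exact h2.lintegral_prod_right'
  calc ∫⁻ y in K, ∫⁻ x in K, ENNReal.ofReal (taylorError k h g x y)
      ≤ ∫⁻ y in K, ∫⁻ x in K, c * (N x + ∫⁻ t in Set.Icc (0 : ℝ) 1, N (y + t • (x - y))) :=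
        setLIntegral_mono' hKm fun y hy => setLIntegral_mono' hKm fun x hx =>
          ofReal_taylorError_le k hg (hh x hx y hy)
    _ = c * (∫⁻ y in K, ((∫⁻ x in K, N x) +
          ∫⁻ x in K, ∫⁻ t in Set.Icc (0 : ℝ) 1, N (y + t • (x - y)))) := by
        have m3 : Measurable fun y : Vec d => (∫⁻ x in K, N x) +
            ∫⁻ x in K, ∫⁻ t in Set.Icc (0 : ℝ) 1, N (y + t • (x - y)) := measurable_const.add m2
        rw [← lintegral_const_mul _ m3]
        refine lintegral_congr fun y => ?_
        have m4 : Measurable fun x : Vec d =>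
            N x + ∫⁻ t in Set.Icc (0 : ℝ) 1, N (y + t • (x - y)) := hNm.add (m1 y)
        rw [lintegral_const_mul _ m4, lintegral_add_left hNm]
    _ ≤ _ := by
        rw [lintegral_add_left measurable_const, setLIntegral_const]
        gcongr
        have h3 := lintegral_segment_le hK hKm hNm
        calc _ ≤ (∫⁻ x in K, N x) * volume K + 2 ^ d * volume K * ∫⁻ z in K, N z := by gcongr
          _ = _ := by ring

end

section

open MvPolynomial

variable {d : ℕ}

/-- The weak derivatives `a m J` of `f` of orders `m ≤ M` exist in `L²(U)`. -/
structure HasWeakJet (U : Set (Vec d)) (M : ℕ) (f : Vec d → ℝ)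
    (a : ∀ m, (Fin m → Fin d) → Vec d → ℝ) : Prop where
  weakDeriv : ∀ m ≤ M, ∀ J : Fin m → Fin d, IsWeakDeriv U J f (a m J)
  memLp : ∀ m ≤ M, ∀ J : Fin m → Fin d, MemLp (a m J) 2 (volume.restrict U)

namespace HasWeakJet

variable {U : Set (Vec d)} {M : ℕ} {f : Vec d → ℝ} {a : ∀ m, (Fin m → Fin d) → Vec d → ℝ}

lemma ae_eq (H : HasWeakJet U M f a) (hU : IsOpen U) (J : Fin 0 → Fin d) :
    f =ᵐ[volume.restrict U] a 0 J :=
  (H.weakDeriv 0 (Nat.zero_le _) J).ae_eq_of_order_zero hU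

lemma memLp_self (H : HasWeakJet U M f a) (hU : IsOpen U) : MemLp f 2 (volume.restrict U) :=
  (memLp_congr_ae (H.ae_eq hU Fin.elim0)).2 (H.memLp 0 (Nat.zero_le _) _)

lemma locallyIntegrable_indicator (hU : IsOpen U) (hv : volume U ≠ ⊤) {g : Vec d → ℝ}
    (hg : MemLp g 2 (volume.restrict U)) : LocallyIntegrable (U.indicator g) := by
  have : IsFiniteMeasure (volume.restrict U) := isFiniteMeasure_restrict.2 hv
  exact ((integrable_indicator_iff hU.measurableSet).2
    (hg.integrable one_le_two)).locallyIntegrable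

lemma iterPartial_eq (H : HasWeakJet U M f a) (hU : IsOpen U) (hv : volume U ≠ ⊤) {m : ℕ}
    (hm : m ≤ M) (J : Fin m → Fin d) {n : ℕ} {x : Vec d} (hx : x ∈ innerSet U (2 / (n + 1))) :
    iterPartial J (conv (U.indicator f) (mollifier d n)) x =
      conv (U.indicator (a m J)) (mollifier d n) x :=
  (H.weakDeriv m hm J).iterPartial_conv hU.measurableSet
    (locallyIntegrable_indicator hU hv (H.memLp_self hU)) (contDiff_mollifier d n)
    (tsupport_mollifier d n) (closedBall_subset_of_mem_innerSet hx)

/-- The derivatives of the mollifications of `f` are bounded in `L²` by the weak derivatives. -/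
lemma lintegral_jetNorm_le (H : HasWeakJet U M f a) (hU : IsOpen U) (hv : volume U ≠ ⊤) {m : ℕ}
    (hm : m ≤ M) {S : ℝ} (hS : ∀ J : Fin m → Fin d, l2 (volume.restrict U) (a m J) ≤ S) (n : ℕ) :
    ∫⁻ z in innerSet U (2 / (n + 1)),
      ENNReal.ofReal (jetNorm m (conv (U.indicator f) (mollifier d n)) z ^ 2) ≤
      ENNReal.ofReal ((Fintype.card (Fin m → Fin d) : ℝ) ^ 2 * S ^ 2) := by
  set N : ℝ := (Fintype.card (Fin m → Fin d) : ℝ) with hN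
  have hN0 : 0 ≤ N := Nat.cast_nonneg _
  have hmeas : ∀ J : Fin m → Fin d,
      Measurable fun z => ENNReal.ofReal (conv (U.indicator (a m J)) (mollifier d n) z ^ 2) :=
    fun J => ((contDiff_conv (locallyIntegrable_indicator hU hv (H.memLp m hm J))
      (contDiff_mollifier d n) (hasCompactSupport_mollifier d n)).continuous.pow
        2).measurable.ennreal_ofReal
  calc _ ≤ ∫⁻ z in innerSet U (2 / (n + 1)), ENNReal.ofReal N *
        ∑ J : Fin m → Fin d, ENNReal.ofReal (conv (U.indicator (a m J)) (mollifier d n) z ^ 2) := by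
        refine setLIntegral_mono' (isOpen_innerSet ..).measurableSet fun z hz => ?_
        rw [← ENNReal.ofReal_sum_of_nonneg fun _ _ => sq_nonneg _, ← ENNReal.ofReal_mul hN0]
        refine ENNReal.ofReal_le_ofReal ?_
        refine (sq_sum_le_card_mul_sum_sq).trans (le_of_eq ?_)
        rw [Finset.card_univ]
        congr 1
        refine Finset.sum_congr rfl fun J _ => ?_
        rw [sq_abs, H.iterPartial_eq hU hv hm J hz]
    _ ≤ ∫⁻ z, ENNReal.ofReal N *
        ∑ J : Fin m → Fin d, ENNReal.ofReal (conv (U.indicator (a m J)) (mollifier d n) z ^ 2) :=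
        setLIntegral_le_lintegral _ _
    _ = ENNReal.ofReal N * ∑ J : Fin m → Fin d,
        ∫⁻ z, ENNReal.ofReal (conv (U.indicator (a m J)) (mollifier d n) z ^ 2) := by
        rw [lintegral_const_mul _ (Finset.measurable_sum _ fun J _ => hmeas J),
          lintegral_finsetSum _ fun J _ => hmeas J]
    _ ≤ ENNReal.ofReal N * ∑ _J : Fin m → Fin d, ENNReal.ofReal (S ^ 2) := by
        refine mul_le_mul_right (Finset.sum_le_sum fun J _ => ?_) _
        have h1 : MemLp (U.indicator (a m J)) 2 volume :=
          (memLp_indicator_iff_restrict hU.measurableSet).2 (H.memLp m hm J)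
        refine (integral_conv_mollifier_sq_le
          (locallyIntegrable_indicator hU hv (H.memLp m hm J)) h1 n).trans ?_
        refine ENNReal.ofReal_le_ofReal ?_
        have h2 : ∫ x, U.indicator (a m J) x ^ 2 = l2 (volume.restrict U) (a m J) ^ 2 := by
          rw [l2_sq_real (H.memLp m hm J), ← integral_indicator hU.measurableSet]
          congr 1; ext x
          by_cases hx : x ∈ U <;> simp [hx]
        rw [h2]
        exact pow_le_pow_left₀ (l2_nonneg _) (hS J) 2
    _ = _ := by
        rw [Finset.sum_const, Finset.card_univ, nsmul_eq_mul, ← ENNReal.ofReal_natCast, ← hN,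
          ← ENNReal.ofReal_mul hN0, ← ENNReal.ofReal_mul hN0]
        congr 1; ring

lemma tendsto_taylorError {k : ℕ} {h : ℝ} {F : ℕ → Vec d → ℝ} {x y : Vec d}
    (hF : ∀ n, ContDiff ℝ ∞ (F n)) {u : ℝ} {g : Fin d → ℝ} {c : ∀ m, (Fin m → Fin d) → ℝ}
    (hx : Tendsto (fun n => F n x) atTop (𝓝 u))
    (hg : ∀ j, Tendsto (fun n => iterPartial (fun _ : Fin 1 => j) (F n) x) atTop (𝓝 (g j)))
    (hy : ∀ m ≤ k, ∀ J : Fin m → Fin d, Tendsto (fun n => iterPartial J (F n) y) atTop (𝓝 (c m J))) :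
    Tendsto (fun n => taylorError k h (F n) x y) atTop
      (𝓝 ((u - evalAt (jetPoly k c) (x - y)) ^ 2 + h ^ 2 * ∑ j,
        (g j - evalAt (pderiv j (jetPoly k c)) (x - y)) ^ 2)) := by
  have h1 : ∀ r : ∀ m, (Fin m → Fin d) → ℝ, Tendsto (fun n => ∑ m ∈ Finset.range (k + 1),
      ∑ J, (m.factorial : ℝ)⁻¹ * iterPartial J (F n) y * r m J) atTop
      (𝓝 (∑ m ∈ Finset.range (k + 1), ∑ J, (m.factorial : ℝ)⁻¹ * c m J * r m J)) := fun r =>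
    tendsto_finsetSum _ fun m hm => tendsto_finsetSum _ fun J _ =>
      ((hy m (by rw [Finset.mem_range] at hm; omega) J).const_mul _).mul_const _
  simp only [taylorError, taylorPoly, evalAt_jetPoly, evalAt_pderiv_jetPoly]
  refine ((hx.sub (h1 _)).pow 2).add (Tendsto.const_mul _ (tendsto_finsetSum _ fun j _ =>
    Tendsto.pow (Tendsto.sub ?_ (h1 fun m J => evalAt (pderiv j (∏ i, X (J i))) (x - y))) 2))
  refine (hg j).congr fun n => iterPartial_one j (hF n) x

/-- There is a point of expansion `y` for which the polynomial formed with the values at `y` of the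
weak derivatives has an error no larger than the mean one. -/
lemma exists_lintegral_le (k : ℕ) (hU : IsOpen U) (hc : Convex ℝ U) (hne : U.Nonempty)
    (hv : volume U ≠ ⊤) (H : HasWeakJet U (k + 1) f a) {h : ℝ}
    (hh : ∀ x ∈ U, ∀ y ∈ U, ‖x - y‖ ≤ h) {S : ℝ}
    (hS : ∀ J : Fin (k + 1) → Fin d, l2 (volume.restrict U) (a (k + 1) J) ≤ S) :
    ∃ (y : Vec d) (c : ∀ m, (Fin m → Fin d) → ℝ),
      ∫⁻ x in U, ENNReal.ofReal ((f x - evalAt (jetPoly k c) (x - y)) ^ 2 + h ^ 2 * ∑ j,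
        (a 1 (fun _ => j) x - evalAt (pderiv j (jetPoly k c)) (x - y)) ^ 2) ≤
      ENNReal.ofReal ((1 + 2 * d) * h ^ (2 * k + 2) * ((1 + 2 ^ d) *
        ((Fintype.card (Fin (k + 1) → Fin d) : ℝ) ^ 2 * S ^ 2))) := by
  have hpos : volume U ≠ 0 := (hU.measure_pos volume hne).ne'
  obtain ⟨R, hR⟩ : ∃ R : ℝ≥0∞, R = ENNReal.ofReal ((1 + 2 * d) * h ^ (2 * k + 2) * ((1 + 2 ^ d) *
    ((Fintype.card (Fin (k + 1) → Fin d) : ℝ) ^ 2 * S ^ 2))) := ⟨_, rfl⟩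
  rw [← hR]
  obtain ⟨F, hF⟩ : ∃ F : ℕ → Vec d → ℝ, ∀ n, F n = conv (U.indicator f) (mollifier d n) :=
    ⟨_, fun _ => rfl⟩
  obtain ⟨V, hV⟩ : ∃ V : ℕ → Set (Vec d), ∀ n : ℕ, V n = innerSet U (2 / (n + 1)) :=
    ⟨_, fun _ => rfl⟩
  have hVU : ∀ n, V n ⊆ U := fun n => by rw [hV]; exact innerSet_subset (by positivity)
  have hVo : ∀ n, IsOpen (V n) := fun n => by rw [hV]; exact isOpen_innerSet ..
  have hVc : ∀ n, Convex ℝ (V n) := fun n => by rw [hV]; exact convex_innerSet hc _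
  have hVe : ∀ x ∈ U, ∀ᶠ n in atTop, x ∈ V n := fun x hx => by
    simpa only [hV] using eventually_mem_innerSet hU hx
  have hFs : ∀ n, ContDiff ℝ ∞ (F n) := fun n => by
    rw [hF]
    exact contDiff_conv (locallyIntegrable_indicator hU hv (H.memLp_self hU))
      (contDiff_mollifier d n) (hasCompactSupport_mollifier d n)
  have hconv : ∀ᵐ x ∂volume.restrict U, x ∈ U ∧ Tendsto (fun n => F n x) atTop (𝓝 (f x)) ∧
      ∀ m ≤ k + 1, ∀ J : Fin m → Fin d,
        Tendsto (fun n => iterPartial J (F n) x) atTop (𝓝 (a m J x)) := by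
    have h1 := ae_tendsto_conv (locallyIntegrable_indicator hU hv (H.memLp_self hU))
    have h2 : ∀ᵐ x, ∀ m ≤ k + 1, ∀ J : Fin m → Fin d,
        Tendsto (fun n => conv (U.indicator (a m J)) (mollifier d n) x) atTop
          (𝓝 (U.indicator (a m J) x)) := by
      rw [ae_all_iff]; intro m
      by_cases hm : m ≤ k + 1
      · have : ∀ᵐ x, ∀ J : Fin m → Fin d,
            Tendsto (fun n => conv (U.indicator (a m J)) (mollifier d n) x) atTop
              (𝓝 (U.indicator (a m J) x)) := by
          rw [ae_all_iff]; intro J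
          exact ae_tendsto_conv (locallyIntegrable_indicator hU hv (H.memLp m hm J))
        exact this.mono fun x hx _ => hx
      · exact Eventually.of_forall fun x h => absurd h hm
    filter_upwards [ae_restrict_of_ae h1, ae_restrict_of_ae h2, ae_restrict_mem hU.measurableSet]
      with x hx1 hx2 hxU
    refine ⟨hxU, ?_, fun m hm J => ?_⟩
    · rw [Set.indicator_of_mem hxU] at hx1
      simpa only [hF] using hx1
    · have h3 := hx2 m hm J
      rw [Set.indicator_of_mem hxU] at h3
      refine h3.congr' ?_
      filter_upwards [hVe x hxU] with n hn
      rw [hV] at hn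
      rw [hF, H.iterPartial_eq hU hv hm J hn]
  -- the errors of Taylor's approximation of the mollified functions, averaged over the points of
  -- expansion `y`
  obtain ⟨Ψ, hΨ⟩ : ∃ Ψ : ℕ → Vec d → ℝ≥0∞, ∀ n, Ψ n = (V n).indicator fun y =>
    ∫⁻ x in V n, ENNReal.ofReal (taylorError k h (F n) x y) := ⟨_, fun _ => rfl⟩
  have hmE : ∀ n, Measurable fun q : Vec d × Vec d =>
      ENNReal.ofReal (taylorError k h (F n) q.2 q.1) := fun n =>
    (continuous_taylorError k h (hFs n)).measurable.ennreal_ofReal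
  have hΨm : ∀ n, Measurable (Ψ n) := fun n => by
    rw [hΨ]
    exact (Measurable.lintegral_prod_right' (hmE n)).indicator (hVo n).measurableSet
  have hΨi : ∀ n, ∫⁻ y in U, Ψ n y ≤ R * volume U := by
    intro n
    have hS' := H.lintegral_jetNorm_le hU hv le_rfl hS n
    rw [← hF, ← hV] at hS'
    calc ∫⁻ y in U, Ψ n y ≤ ∫⁻ y, Ψ n y := setLIntegral_le_lintegral _ _
      _ = ∫⁻ y in V n, ∫⁻ x in V n, ENNReal.ofReal (taylorError k h (F n) x y) := by
          rw [hΨ, lintegral_indicator (hVo n).measurableSet]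
      _ ≤ _ := lintegral_taylorError_le k (hFs n) (hVc n) (hVo n).measurableSet
          fun x hx y hy => hh x (hVU n hx) y (hVU n hy)
      _ ≤ ENNReal.ofReal ((1 + 2 * d) * h ^ (2 * k + 2)) * ((1 + 2 ^ d) * volume U *
          ENNReal.ofReal ((Fintype.card (Fin (k + 1) → Fin d) : ℝ) ^ 2 * S ^ 2)) := by
          have := measure_mono (μ := volume) (hVU n)
          gcongr
      _ = R * volume U := by
          have h1 : (0 : ℝ) ≤ h ^ (2 * k + 2) := by
            rw [show 2 * k + 2 = 2 * (k + 1) by ring, pow_mul]; positivity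
          rw [hR, ENNReal.ofReal_mul (p := (1 + 2 * d) * h ^ (2 * k + 2)) (by positivity),
            ENNReal.ofReal_mul (p := 1 + 2 ^ d) (by positivity)]
          have h2 : ENNReal.ofReal (1 + 2 ^ d) = 1 + 2 ^ d := by
            rw [ENNReal.ofReal_add zero_le_one (by positivity), ENNReal.ofReal_pow (by norm_num)]
            simp
          rw [h2]; ring
  -- first application of the lemma of Fatou, in `y`; then `y` is chosen so that the lower limit does
  -- not exceed its mean value and all the mollified derivatives converge at `y`
  have hlim : ∫⁻ y in U, liminf (fun n => Ψ n y) atTop ≤ R * volume U :=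
    (lintegral_liminf_le hΨm).trans
      ((liminf_le_liminf (Eventually.of_forall hΨi)).trans (by simp))
  have hres : volume.restrict U ≠ 0 := by rwa [Ne, Measure.restrict_eq_zero]
  have : IsFiniteMeasure (volume.restrict U) := isFiniteMeasure_restrict.2 hv
  obtain ⟨y, hyN, hy⟩ := exists_notMem_null_le_laverage hres
    (Measurable.liminf hΨm).aemeasurable (ae_iff.1 hconv)
  obtain ⟨hyU, -, hyc⟩ := not_not.1 hyN
  have hyR : liminf (fun n => Ψ n y) atTop ≤ R := by
    refine hy.trans ?_
    rw [setLAverage_eq]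
    exact ENNReal.div_le_of_le_mul hlim
  refine ⟨y, fun m J => a m J y, ?_⟩
  refine le_trans ?_ hyR
  obtain ⟨Φ, hΦ⟩ : ∃ Φ : ℕ → Vec d → ℝ≥0∞, ∀ n, Φ n = (V n).indicator fun x =>
    ENNReal.ofReal (taylorError k h (F n) x y) := ⟨_, fun _ => rfl⟩
  have hΦm : ∀ n, Measurable (Φ n) := fun n => by
    rw [hΦ]
    exact ((hmE n).comp measurable_prodMk_left).indicator (hVo n).measurableSet
  have hlimx : ∀ᵐ x ∂volume.restrict U, ENNReal.ofReal
      ((f x - evalAt (jetPoly k fun m J => a m J y) (x - y)) ^ 2 + h ^ 2 * ∑ j,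
        (a 1 (fun _ => j) x - evalAt (pderiv j (jetPoly k fun m J => a m J y)) (x - y)) ^ 2) =
      liminf (fun n => Φ n x) atTop := by
    filter_upwards [hconv] with x ⟨hxU, hx0, hx1⟩
    have h1 := tendsto_taylorError (k := k) (h := h) hFs hx0 (fun j => hx1 1 (by omega) fun _ => j)
      fun m hm J => hyc m (by omega) J
    refine (Tendsto.liminf_eq ?_).symm
    refine (ENNReal.tendsto_ofReal h1).congr' ?_
    filter_upwards [hVe x hxU] with n hn
    rw [hΦ, Set.indicator_of_mem hn]
  -- second application of the lemma of Fatou, in `x`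
  rw [lintegral_congr_ae hlimx]
  refine (lintegral_liminf_le hΦm).trans (liminf_le_liminf ?_)
  filter_upwards [hVe y hyU] with n hn
  rw [hΨ, Set.indicator_of_mem hn, hΦ, ← lintegral_indicator (hVo n).measurableSet]
  exact setLIntegral_le_lintegral _ _

end HasWeakJet

lemma l2_le_of_lintegral_le {μ : Measure (Vec d)} {g : Vec d → ℝ} (hg : MemLp g 2 μ) {B : ℝ}
    (hB : 0 ≤ B) (h : ∫⁻ x, ENNReal.ofReal (g x ^ 2) ∂μ ≤ ENNReal.ofReal (B ^ 2)) :
    l2 μ g ≤ B := by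
  rw [← ofReal_integral_eq_lintegral_ofReal hg.integrable_sq
    (Eventually.of_forall fun x => sq_nonneg _), ENNReal.ofReal_le_ofReal_iff (sq_nonneg _),
    ← l2_sq_real hg] at h
  exact (sq_le_sq₀ (l2_nonneg _) hB).1 h

/-- The Bramble--Hilbert lemma on convex sets, with a constant which does not depend on the set:
the Taylor polynomial at a point of expansion whose error is at most the mean one. -/
theorem exists_polynomial_approx (d k : ℕ) : ∃ C : ℝ, 0 < C ∧
    ∀ (U : Set (Vec d)) (h S : ℝ) (f : Vec d → ℝ) (a : ∀ m, (Fin m → Fin d) → Vec d → ℝ),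
      IsOpen U → Convex ℝ U → U.Nonempty → 0 < h → (∀ x ∈ U, ∀ y ∈ U, ‖x - y‖ ≤ h) →
      HasWeakJet U (k + 1) f a →
      (∀ J : Fin (k + 1) → Fin d, l2 (volume.restrict U) (a (k + 1) J) ≤ S) →
      0 ≤ S →
      ∃ p : MvPolynomial (Fin d) ℝ, DegLE k p ∧
        l2 (volume.restrict U) (fun x => f x - evalAt p x) ≤ C * h ^ (k + 1) * S ∧
        ∀ j, h * l2 (volume.restrict U) (fun x => a 1 (fun _ => j) x - evalAt (pderiv j p) x) ≤
          C * h ^ (k + 1) * S := by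
  obtain ⟨C, hC⟩ : ∃ C : ℝ, C = (1 + 2 * d) * ((1 + 2 ^ d) *
    (Fintype.card (Fin (k + 1) → Fin d) : ℝ) ^ 2) := ⟨_, rfl⟩
  have hC0 : 0 ≤ C := by rw [hC]; positivity
  refine ⟨√C + 1, by positivity, fun U h S f a hU hc hne hh hd H hS hS0 => ?_⟩
  have hb : Bornology.IsBounded U := by
    obtain ⟨y, hy⟩ := hne
    refine (Metric.isBounded_closedBall (x := y) (r := h)).subset fun x hx => ?_
    rw [Metric.mem_closedBall, dist_eq_norm]; exact hd x hx y hy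
  have hv : volume U ≠ ⊤ := hb.measure_lt_top.ne
  obtain ⟨y, c, hyc⟩ := H.exists_lintegral_le k hU hc hne hv hd hS
  have hm : ∀ q : MvPolynomial (Fin d) ℝ, MemLp (evalAt q) 2 (volume.restrict U) := by
    intro q
    have : IsFiniteMeasure (volume.restrict U) := isFiniteMeasure_restrict.2 hv
    obtain ⟨B, hB⟩ := hb.isCompact_closure.exists_bound_of_continuousOn (continuous_evalAt q).continuousOn
    refine MemLp.of_bound (continuous_evalAt q).aestronglyMeasurable B ?_
    filter_upwards [ae_restrict_mem hU.measurableSet] with x hx using hB x (subset_closure hx)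
  have hsq : ENNReal.ofReal ((1 + 2 * d) * h ^ (2 * k + 2) * ((1 + 2 ^ d) *
        ((Fintype.card (Fin (k + 1) → Fin d) : ℝ) ^ 2 * S ^ 2))) ≤
      ENNReal.ofReal (((√C + 1) * h ^ (k + 1) * S) ^ 2) := by
    refine ENNReal.ofReal_le_ofReal ?_
    calc _ = C * (h ^ (k + 1) * S) ^ 2 := by rw [hC]; ring
      _ ≤ (√C + 1) ^ 2 * (h ^ (k + 1) * S) ^ 2 := by
        refine mul_le_mul_of_nonneg_right ?_ (sq_nonneg _)
        nlinarith [Real.sq_sqrt hC0, Real.sqrt_nonneg C]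
      _ = _ := by ring
  have hB0 : 0 ≤ (√C + 1) * h ^ (k + 1) * S := by positivity
  have he : ∀ q x, evalAt (affSubst (-y) 1 q) x = evalAt q (x - y) := fun q x => by
    rw [evalAt_affSubst]; congr 1; rw [one_smul]; abel
  refine ⟨affSubst (-y) 1 (jetPoly k c), degLE_affSubst _ _ (degLE_jetPoly k c), ?_, fun j => ?_⟩
  · refine l2_le_of_lintegral_le ((H.memLp_self hU).sub (hm _)) hB0 ((lintegral_mono fun x => ?_).trans
      (hyc.trans hsq))
    refine ENNReal.ofReal_le_ofReal ?_
    rw [Pi.sub_apply, he]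
    exact le_add_of_nonneg_right (by positivity)
  · have h1 : h * l2 (volume.restrict U)
        (fun x => a 1 (fun _ => j) x - evalAt (pderiv j (affSubst (-y) 1 (jetPoly k c))) x) =
      l2 (volume.restrict U)
        (fun x => h * (a 1 (fun _ => j) x - evalAt (pderiv j (affSubst (-y) 1 (jetPoly k c))) x)) := by
      rw [l2_const_mul, abs_of_pos hh]
    rw [h1]
    refine l2_le_of_lintegral_le (((H.memLp 1 (by omega) _).sub (hm _)).const_mul h) hB0
      ((lintegral_mono fun x => ?_).trans (hyc.trans hsq))
    refine ENNReal.ofReal_le_ofReal ?_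
    rw [Pi.sub_apply, pderiv_affSubst, he, mul_pow]
    refine le_add_of_nonneg_of_le (sq_nonneg _) (mul_le_mul_of_nonneg_left ?_ (sq_nonneg h))
    exact Finset.single_le_sum (f := fun j => (a 1 (fun _ => j) x -
      evalAt (pderiv j (jetPoly k c)) (x - y)) ^ 2) (fun j _ => sq_nonneg _) (Finset.mem_univ j)

end

/-! ### Lipschitz representatives and traces -/

section

variable {d : ℕ}

lemma tendsto_eLpNorm_zero_of_bound {X E : Type*} [MeasurableSpace X] [NormedAddCommGroup E]
    {μ : Measure X} [IsFiniteMeasure μ] {f : ℕ → X → E} {B : ℝ}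
    (hf : ∀ n, AEStronglyMeasurable (f n) μ) (hB : ∀ n, ∀ᵐ x ∂μ, ‖f n x‖ ≤ B)
    (h : ∀ᵐ x ∂μ, Tendsto (fun n => f n x) atTop (𝓝 0)) :
    Tendsto (fun n => eLpNorm (f n) 2 μ) atTop (𝓝 0) := by
  have h1 := tendsto_l2_of_bound hf hB h
  rw [← ENNReal.tendsto_toReal_iff (fun n => (MemLp.of_bound (hf n) B (hB n)).2.ne) ENNReal.zero_ne_top]
  simpa [l2] using h1

/-- The field `u`, all of whose components are Lipschitz continuous, represents `v` on `Ω`. -/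
structure LipRep (Ω : Set (Vec d)) (v u : Vec d → Vec d) : Prop where
  lip : ∀ i, ∃ K : NNReal, LipschitzWith K fun x => u x i
  ae_eq : v =ᵐ[volume.restrict Ω] u

/-- The smooth approximations of a field by mollification. -/
def mollify (u : Vec d → Vec d) (n : ℕ) (x : Vec d) : Vec d :=
  WithLp.toLp 2 fun i => conv (fun y => u y i) (mollifier d n) x

lemma mollify_apply (u : Vec d → Vec d) (n : ℕ) (x : Vec d) (i : Fin d) :
    mollify u n x i = conv (fun y => u y i) (mollifier d n) x := rfl

lemma fderiv_apply_coord {φ : Vec d → Vec d} (hφ : ContDiff ℝ ∞ φ) (x ξ : Vec d) (i : Fin d) :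
    fderiv ℝ φ x ξ i = fderiv ℝ (fun y => φ y i) x ξ := by
  have h := ((EuclideanSpace.proj i : Vec d →L[ℝ] ℝ).hasFDerivAt.comp x
    (hφ.differentiable (by simp) x).hasFDerivAt).fderiv
  have h2 : (fun y => φ y i) = (EuclideanSpace.proj i : Vec d →L[ℝ] ℝ) ∘ φ := rfl
  rw [h2, h]; rfl

lemma contDiff_coord {φ : Vec d → Vec d} (hφ : ContDiff ℝ ∞ φ) (i : Fin d) :
    ContDiff ℝ ∞ fun x => φ x i :=
  (EuclideanSpace.proj i : Vec d →L[ℝ] ℝ).contDiff.comp hφ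

lemma norm_le_sum_abs_coord (x : Vec d) : ‖x‖ ≤ ∑ i, |x i| := by
  conv_lhs => rw [vec_eq_sum x]
  refine norm_sum_le_of_le _ fun i _ => ?_
  rw [norm_smul, norm_basisVec, mul_one, Real.norm_eq_abs]

lemma ae_abs_le_eLpNorm_top {X E : Type*} [MeasurableSpace X] [NormedAddCommGroup E]
    {μ : Measure X} {g : X → E} (hg : MemLp g ∞ μ) : ∀ᵐ x ∂μ, ‖g x‖ ≤ (eLpNorm g ∞ μ).toReal := by
  rw [eLpNorm_exponent_top]
  filter_upwards [enorm_ae_le_eLpNormEssSup g μ] with x hx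
  have h := hg.2.ne
  rw [eLpNorm_exponent_top] at h
  simpa using ENNReal.toReal_mono h hx

lemma tendsto_vec {φ : ℕ → Vec d} {v : Vec d} (h : ∀ i, Tendsto (fun n => φ n i) atTop (𝓝 (v i))) :
    Tendsto φ atTop (𝓝 v) := by
  have h1 : Tendsto (fun n => (φ n).ofLp) atTop (𝓝 v.ofLp) := tendsto_pi_nhds.2 h
  exact ((PiLp.continuous_toLp 2 _).tendsto _).comp h1

/-- On a convex domain every field in `W^{1,∞}` has a Lipschitz continuous representative. -/
lemma exists_lipRep {Ω : Set (Vec d)} (hΩ : IsOpen Ω) (hc : Convex ℝ Ω) (hv : volume Ω ≠ ⊤)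
    {v : Vec d → Vec d} (h : MemSobolev Ω 1 ∞ v) : ∃ u, LipRep Ω v u := by
  have : IsFiniteMeasure (volume.restrict Ω) := isFiniteMeasure_restrict.2 hv
  have key : ∀ i, ∃ (K : NNReal) (f' : Vec d → ℝ), LipschitzWith K f' ∧
      (fun x => v x i) =ᵐ[volume.restrict Ω] f' := by
    intro i
    obtain ⟨g0, hg0, hm0⟩ := h i 0 (by omega) Fin.elim0
    have e0 := hg0.ae_eq_of_order_zero hΩ
    have hi : IntegrableOn (fun x => v x i) Ω :=
      (integrable_congr e0).2 (hm0.integrable (by simp))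
    choose g hg hm using fun j : Fin d => h i 1 le_rfl (fun _ => j)
    have hb : ∀ j, ∀ᵐ x ∂volume.restrict Ω,
        |g j x| ≤ (eLpNorm (g j) ∞ (volume.restrict Ω)).toReal := fun j =>
      ae_abs_le_eLpNorm_top (hm j)
    refine exists_lipschitz_representative hΩ hc hi hg (B := ∑ j, (eLpNorm (g j) ∞
      (volume.restrict Ω)).toReal) fun j => (hb j).mono fun x hx => hx.trans ?_
    exact Finset.single_le_sum (f := fun j => (eLpNorm (g j) ∞ (volume.restrict Ω)).toReal)
      (fun _ _ => ENNReal.toReal_nonneg) (Finset.mem_univ j)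
  choose K f hf he using key
  refine ⟨fun x => WithLp.toLp 2 fun i => f i x, fun i => ⟨K i, hf i⟩, ?_⟩
  filter_upwards [ae_all_iff.2 he] with x hx
  ext i
  exact hx i

namespace LipRep

variable {Ω : Set (Vec d)} {v u : Vec d → Vec d}

lemma continuous (h : LipRep Ω v u) : Continuous u := by
  have : Continuous fun x => (u x).ofLp := continuous_pi fun i => by
    obtain ⟨K, hK⟩ := h.lip i
    exact hK.continuous
  exact (PiLp.continuous_toLp 2 _).comp this

lemma ae_eq_coord (h : LipRep Ω v u) (i : Fin d) :
    (fun x => v x i) =ᵐ[volume.restrict Ω] fun x => u x i :=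
  h.ae_eq.mono fun x hx => by simp only [hx]

lemma mono (h : LipRep Ω v u) {U : Set (Vec d)} (hU : U ⊆ Ω) : LipRep U v u :=
  ⟨h.lip, ae_restrict_of_ae_restrict_of_subset hU h.ae_eq⟩

lemma isWeakDeriv (h : LipRep Ω v u) (i j : Fin d) :
    IsWeakDeriv Ω (fun _ : Fin 1 => j) (fun x => v x i)
      (fun x => lineDeriv ℝ (fun y => u y i) x (basisVec j)) := by
  obtain ⟨K, hK⟩ := h.lip i
  exact isWeakDeriv_lineDeriv hK (h.ae_eq_coord i) j

lemma weakPartial_ae_eq (h : LipRep Ω v u) (hΩ : IsOpen Ω) (i j : Fin d) :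
    weakPartial Ω j (fun y => v y i) =ᵐ[volume.restrict Ω]
      fun x => lineDeriv ℝ (fun y => u y i) x (basisVec j) :=
  (h.isWeakDeriv i j).weakDeriv_ae_eq hΩ

lemma smoothApprox (h : LipRep Ω v u) {K : Set (Vec d)} (hK : IsCompact K) (i : Fin d) :
    SmoothApprox K (fun x => u x i) (fun j x => lineDeriv ℝ (fun y => u y i) x (basisVec j))
      (fun n x => mollify u n x i) := by
  obtain ⟨L, hL⟩ := h.lip i
  exact LipschitzWith.smoothApprox hL hK

lemma contDiff_mollify (h : LipRep Ω v u) (n : ℕ) : ContDiff ℝ ∞ (mollify u n) := by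
  have h1 : ContDiff ℝ ∞ fun x => (mollify u n x).ofLp := contDiff_pi.2 fun i =>
    ((h.smoothApprox isCompact_empty i).contDiff n)
  exact (PiLp.continuousLinearEquiv 2 ℝ (fun _ : Fin d => ℝ)).symm.contDiff.comp h1

lemma tendsto_eLpNorm_mollify (h : LipRep Ω v u) {μ : Measure (Vec d)} [IsFiniteMeasure μ]
    {K : Set (Vec d)} (hK : IsCompact K) (hμ : ∀ᵐ x ∂μ, x ∈ K) :
    Tendsto (fun n => eLpNorm (fun x => mollify u n x - u x) 2 μ) atTop (𝓝 0) := by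
  have hb : ∀ i, ∃ B, ∀ n, ∀ x ∈ K, |mollify u n x i - u x i| ≤ B := by
    intro i
    obtain ⟨B, hB⟩ := (h.smoothApprox hK i).bound
    refine ⟨B + B, fun n x hx => (abs_sub _ _).trans (add_le_add (hB n x hx) ?_)⟩
    exact le_of_tendsto ((h.smoothApprox hK i).tendsto x hx).abs
      (Eventually.of_forall fun n => hB n x hx)
  choose B hB using hb
  refine tendsto_eLpNorm_zero_of_bound (B := ∑ i, B i)
    (fun n => ((h.contDiff_mollify n).continuous.sub h.continuous).aestronglyMeasurable)
    (fun n => hμ.mono fun x hx => ?_) (hμ.mono fun x hx => ?_)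
  · exact (norm_le_sum_abs_coord _).trans (Finset.sum_le_sum fun i _ => hB i n x hx)
  · refine tendsto_vec fun i => ?_
    simpa using ((h.smoothApprox hK i).tendsto x hx).sub_const (u x i)

lemma tendstoH1_mollify (h : LipRep Ω v u) (hΩ : IsOpen Ω) (hb : Bornology.IsBounded Ω) :
    TendstoH1 Ω (mollify u) v := by
  have : IsFiniteMeasure (volume.restrict Ω) := isFiniteMeasure_restrict.2 hb.measure_lt_top.ne
  have hK := hb.isCompact_closure
  have hmem : ∀ᵐ x ∂volume.restrict Ω, x ∈ closure Ω :=
    (ae_restrict_mem hΩ.measurableSet).mono fun x hx => subset_closure hx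
  constructor
  · refine (h.tendsto_eLpNorm_mollify hK hmem).congr fun n => eLpNorm_congr_ae ?_
    exact h.ae_eq.mono fun x hx => by simp only [hx]
  · intro i j
    have hs := h.smoothApprox hK i
    obtain ⟨D, hD⟩ := hs.bound_grad
    have e : ∀ n x, fderiv ℝ (mollify u n) x (basisVec j) i =
        fderiv ℝ (fun y => mollify u n y i) x (basisVec j) := fun n x =>
      fderiv_apply_coord (h.contDiff_mollify n) x _ i
    have hg : ∀ᵐ x ∂volume.restrict Ω, Tendsto (fun n => fderiv ℝ (mollify u n) x (basisVec j) i)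
        atTop (𝓝 (weakPartial Ω j (fun y => v y i) x)) := by
      filter_upwards [ae_restrict_of_ae_restrict_of_subset subset_closure (hs.tendsto_grad j),
        h.weakPartial_ae_eq hΩ i j] with x hx hx2
      rw [hx2]; simpa only [e] using hx
    have hDn : ∀ n, ∀ᵐ x ∂volume.restrict Ω, |fderiv ℝ (mollify u n) x (basisVec j) i| ≤ D :=
      fun n => hmem.mono fun x hx => by rw [e]; exact hD n j x hx
    have hmes : ∀ n, AEStronglyMeasurable (fun x => fderiv ℝ (mollify u n) x (basisVec j) i)
        (volume.restrict Ω) := fun n => by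
      simp_rw [e]
      exact (((hs.contDiff n).continuous_fderiv (by simp)).clm_apply
        continuous_const).aestronglyMeasurable
    refine tendsto_eLpNorm_zero_of_bound (B := D + D)
      (fun n => (hmes n).sub (aestronglyMeasurable_of_tendsto_ae atTop hmes hg)) (fun n => ?_) ?_
    · filter_upwards [ae_all_iff.2 hDn, hg] with x hx hx2
      exact (abs_sub _ _).trans (add_le_add (hx n) (le_of_tendsto hx2.abs (Eventually.of_forall hx)))
    · filter_upwards [hg] with x hx
      simpa using hx.sub_const (weakPartial Ω j (fun y => v y i) x)

/-- The restriction of the Lipschitz representative to a face is a trace there, in the sense of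
limits of smooth functions in `H¹`. -/
lemma isTrace (h : LipRep Ω v u) (hΩ : IsOpen Ω) (hb : Bornology.IsBounded Ω)
    {f : Finset (Vec d)} (hf : IsFiniteMeasure (faceMeasure f)) : IsTrace Ω f v u := by
  have hK : IsCompact (cell f) := f.finite_toSet.isCompact_convexHull _
  have hmem : ∀ᵐ x ∂faceMeasure f, x ∈ cell f := ae_restrict_mem hK.measurableSet
  exact ⟨memLp_of_continuous hK hmem h.continuous 2, mollify u, h.contDiff_mollify,
    h.tendstoH1_mollify hΩ hb, h.tendsto_eLpNorm_mollify hK hmem⟩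

end LipRep

section Unique

variable {ι : Type*} [Fintype ι] (b : AffineBasis ι ℝ (Vec d))

lemma tendsto_l2_sub_of_tendsto {X E : Type*} [MeasurableSpace X] [NormedAddCommGroup E]
    {μ : Measure X} {f g : ℕ → X → E} {w : X → E}
    (hm : ∀ n, AEStronglyMeasurable (fun x => f n x - w x) μ)
    (hm' : ∀ n, AEStronglyMeasurable (fun x => g n x - w x) μ)
    (hf : Tendsto (fun n => eLpNorm (fun x => f n x - w x) 2 μ) atTop (𝓝 0))
    (hg : Tendsto (fun n => eLpNorm (fun x => g n x - w x) 2 μ) atTop (𝓝 0)) :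
    Tendsto (fun n => eLpNorm (fun x => f n x - g n x) 2 μ) atTop (𝓝 0) := by
  have h := hf.add hg
  rw [add_zero] at h
  refine tendsto_of_tendsto_of_tendsto_of_le_of_le tendsto_const_nhds h (fun _ => bot_le) fun n => ?_
  have e : (fun x => f n x - g n x) = (fun x => f n x - w x) - fun x => g n x - w x := by
    ext x; simp
  simp only [e]
  exact eLpNorm_sub_le (hm n) (hm' n) (by norm_num)

lemma eLpNorm_coord_le {μ : Measure (Vec d)} (w : Vec d → Vec d) (i : Fin d) :
    eLpNorm (fun x => w x i) 2 μ ≤ eLpNorm w 2 μ :=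
  eLpNorm_mono fun x => abs_coord_le (w x) i

/-- The trace on a facet of a simplex contained in `Ω` is unique: the trace inequality applies to
the difference of two approximating sequences. -/
lemma IsTrace.ae_eq {Ω : Set (Vec d)} (hd : 1 ≤ d) (i : ι)
    (hT : volume.restrict (simplex b) ≤ volume.restrict Ω)
    {f : Finset (Vec d)} (hf : faceMeasure f = facetMeasure b i) {v g₁ g₂ : Vec d → Vec d}
    (hv : AEStronglyMeasurable v (volume.restrict Ω))
    (hv' : ∀ i j, AEStronglyMeasurable (weakPartial Ω j fun y => v y i) (volume.restrict Ω))
    (h₁ : IsTrace Ω f v g₁) (h₂ : IsTrace Ω f v g₂) : g₁ =ᵐ[facetMeasure b i] g₂ := by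
  obtain ⟨m₁, φ₁, c₁, H₁, t₁⟩ := h₁
  obtain ⟨m₂, φ₂, c₂, H₂, t₂⟩ := h₂
  rw [hf] at m₁ t₁ m₂ t₂
  have tT : Tendsto (fun n => eLpNorm (fun x => φ₁ n x - φ₂ n x) 2 (volume.restrict (simplex b)))
      atTop (𝓝 0) := by
    have := tendsto_l2_sub_of_tendsto
      (fun n => (c₁ n).continuous.aestronglyMeasurable.sub hv)
      (fun n => (c₂ n).continuous.aestronglyMeasurable.sub hv) H₁.1 H₂.1
    exact tendsto_of_tendsto_of_tendsto_of_le_of_le tendsto_const_nhds this (fun _ => bot_le)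
      fun n => eLpNorm_mono_measure _ hT
  have tG : ∀ l j, Tendsto (fun n => eLpNorm (fun x => fderiv ℝ (φ₁ n) x (basisVec j) l -
      fderiv ℝ (φ₂ n) x (basisVec j) l) 2 (volume.restrict (simplex b))) atTop (𝓝 0) := by
    intro l j
    have hc : ∀ {φ : Vec d → Vec d}, ContDiff ℝ ∞ φ → AEStronglyMeasurable
        (fun x => fderiv ℝ φ x (basisVec j) l) (volume.restrict Ω) := fun {φ} hφ => by
      simp_rw [fderiv_apply_coord hφ]
      exact (((contDiff_coord hφ l).continuous_fderiv (by simp)).clm_apply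
        continuous_const).aestronglyMeasurable
    have := tendsto_l2_sub_of_tendsto
      (fun n => (hc (c₁ n)).sub (hv' l j)) (fun n => (hc (c₂ n)).sub (hv' l j)) (H₁.2 l j) (H₂.2 l j)
    exact tendsto_of_tendsto_of_tendsto_of_le_of_le tendsto_const_nhds this (fun _ => bot_le)
      fun n => eLpNorm_mono_measure _ hT
  have htoReal : ∀ {a : ℕ → ℝ≥0∞}, Tendsto a atTop (𝓝 0) → Tendsto (fun n => (a n).toReal) atTop (𝓝 0) :=
    fun {a} ha => (ENNReal.tendsto_toReal ENNReal.zero_ne_top).comp ha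
  have key : ∀ l, (fun x => g₁ x l) =ᵐ[facetMeasure b i] fun x => g₂ x l := by
    intro l
    have mg₁ := memLp_apply m₁ l
    have mg₂ := memLp_apply m₂ l
    have mφ₁ : ∀ n, MemLp (fun x => φ₁ n x l) 2 (facetMeasure b i) := fun n =>
      memLp_facetMeasure b i hd (contDiff_coord (c₁ n) l).continuous 2
    have mφ₂ : ∀ n, MemLp (fun x => φ₂ n x l) 2 (facetMeasure b i) := fun n =>
      memLp_facetMeasure b i hd (contDiff_coord (c₂ n) l).continuous 2
    have hψ : ∀ n, ContDiff ℝ ∞ fun x => φ₁ n x l - φ₂ n x l := fun n =>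
      (contDiff_coord (c₁ n) l).sub (contDiff_coord (c₂ n) l)
    -- the trace inequality for the difference of the two approximating sequences
    have hF : Tendsto (fun n => √(height b i) * l2 (facetMeasure b i)
        (fun x => φ₁ n x l - φ₂ n x l)) atTop (𝓝 0) := by
      have e1 : Tendsto (fun n => l2 (volume.restrict (simplex b)) (fun x => φ₁ n x l - φ₂ n x l))
          atTop (𝓝 0) := htoReal (tendsto_of_tendsto_of_tendsto_of_le_of_le tendsto_const_nhds tT
            (fun _ => bot_le) fun n => eLpNorm_coord_le (fun x => φ₁ n x - φ₂ n x) l)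
      have e2 : ∀ j, Tendsto (fun n => l2 (volume.restrict (simplex b))
          (fun x => fderiv ℝ (fun x => φ₁ n x l - φ₂ n x l) x (basisVec j))) atTop (𝓝 0) := by
        intro j
        refine (htoReal (tG l j)).congr fun n => ?_
        unfold l2
        congr 2; ext x
        rw [fderiv_apply_coord (c₁ n), fderiv_apply_coord (c₂ n),
          fderiv_fun_sub ((contDiff_coord (c₁ n) l).differentiable (by simp) x)
            ((contDiff_coord (c₂ n) l).differentiable (by simp) x)]
        rfl
      have e3 := (e1.const_mul ((d : ℝ) + 1)).add
        ((tendsto_finsetSum Finset.univ fun j _ => e2 j).const_mul (Metric.diam (simplex b)))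
      simp only [Finset.sum_const_zero, mul_zero, add_zero] at e3
      exact squeeze_zero (fun n => mul_nonneg (Real.sqrt_nonneg _) (l2_nonneg _))
        (fun n => l2_facet_smooth_le b hd i ((hψ n).of_le (by norm_cast))) e3
    have hh : 0 < √(height b i) := Real.sqrt_pos.2 (height_pos b i hd)
    have hF' : Tendsto (fun n => l2 (facetMeasure b i) (fun x => φ₁ n x l - φ₂ n x l)) atTop (𝓝 0) := by
      have := hF.const_mul (√(height b i))⁻¹
      rw [mul_zero] at this
      refine this.congr fun n => ?_
      rw [← mul_assoc, inv_mul_cancel₀ hh.ne', one_mul]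
    have s₁ : Tendsto (fun n => l2 (facetMeasure b i) (fun x => φ₁ n x l - g₁ x l)) atTop (𝓝 0) :=
      htoReal (tendsto_of_tendsto_of_tendsto_of_le_of_le tendsto_const_nhds t₁
        (fun _ => bot_le) fun n => eLpNorm_coord_le (fun x => φ₁ n x - g₁ x) l)
    have s₂ : Tendsto (fun n => l2 (facetMeasure b i) (fun x => φ₂ n x l - g₂ x l)) atTop (𝓝 0) :=
      htoReal (tendsto_of_tendsto_of_tendsto_of_le_of_le tendsto_const_nhds t₂
        (fun _ => bot_le) fun n => eLpNorm_coord_le (fun x => φ₂ n x - g₂ x) l)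
    have hle : ∀ n, l2 (facetMeasure b i) (fun x => g₁ x l - g₂ x l) ≤
        l2 (facetMeasure b i) (fun x => φ₁ n x l - φ₂ n x l) +
          (l2 (facetMeasure b i) (fun x => φ₂ n x l - g₂ x l) +
            l2 (facetMeasure b i) (fun x => φ₁ n x l - g₁ x l)) := by
      intro n
      have e : (fun x => g₁ x l - g₂ x l) = fun x => (φ₁ n x l - φ₂ n x l) +
          ((φ₂ n x l - g₂ x l) - (φ₁ n x l - g₁ x l)) := by ext x; ring
      rw [e]
      have ma : MemLp (fun x => φ₁ n x l - φ₂ n x l) 2 (facetMeasure b i) := (mφ₁ n).sub (mφ₂ n)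
      have mb : MemLp (fun x => φ₂ n x l - g₂ x l) 2 (facetMeasure b i) := (mφ₂ n).sub mg₂
      have mc : MemLp (fun x => φ₁ n x l - g₁ x l) 2 (facetMeasure b i) := (mφ₁ n).sub mg₁
      exact (l2_add_le ma (mb.sub mc)).trans (add_le_add le_rfl (l2_sub_le mb mc))
    have h0 : l2 (facetMeasure b i) (fun x => g₁ x l - g₂ x l) ≤ 0 := by
      have h2 := hF'.add (s₂.add s₁)
      simp only [add_zero] at h2
      exact ge_of_tendsto h2 (Eventually.of_forall hle)
    have h1 : eLpNorm (fun x => g₁ x l - g₂ x l) 2 (facetMeasure b i) = 0 := by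
      have := le_antisymm h0 (l2_nonneg _)
      exact ((ENNReal.toReal_eq_zero_iff _).1 this).resolve_right (mg₁.sub mg₂).2.ne
    have h2 := (eLpNorm_eq_zero_iff (mg₁.sub mg₂).1 (by norm_num)).1 h1
    exact h2.mono fun x hx => sub_eq_zero.1 hx
  filter_upwards [ae_all_iff.2 key] with x hx
  ext l
  exact hx l

end Unique

end

/-! ### Mesh elements as simplices -/

section

variable {d : ℕ}

/-- The affine basis formed by the vertices of a mesh element. -/
def vertexBasis (t : Finset (Vec d)) (hi : AffineIndependent ℝ ((↑) : t → Vec d))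
    (hc : t.card = d + 1) : AffineBasis t ℝ (Vec d) where
  toFun := (↑)
  ind' := hi
  tot' := (hi.affineSpan_eq_top_iff_card_eq_finrank_add_one).2 (by simp [hc])

section Vertex

variable {t : Finset (Vec d)} {hi : AffineIndependent ℝ ((↑) : t → Vec d)} {hc : t.card = d + 1}

lemma vertexBasis_apply (x : t) : vertexBasis t hi hc x = x := rfl

lemma simplex_vertexBasis : simplex (vertexBasis t hi hc) = cell t := by
  unfold simplex cell
  congr 1
  ext x
  simp [vertexBasis_apply]

open Classical in
lemma facet_vertexBasis (x : t) : facet (vertexBasis t hi hc) x = cell (t.erase x) := by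
  unfold facet cell
  congr 1
  ext y
  simp only [Set.mem_image, Set.mem_compl_iff, Set.mem_singleton_iff, vertexBasis_apply,
    Finset.coe_erase, Set.mem_sdiff, Finset.mem_coe]
  constructor
  · rintro ⟨z, hz, rfl⟩
    exact ⟨z.2, fun h => hz (Subtype.ext h)⟩
  · rintro ⟨h1, h2⟩
    exact ⟨⟨y, h1⟩, fun h => h2 (congrArg Subtype.val h), rfl⟩

open Classical in
lemma facetMeasure_vertexBasis (x : t) :
    facetMeasure (vertexBasis t hi hc) x = faceMeasure (t.erase x) := by
  rw [facetMeasure, faceMeasure, facet_vertexBasis]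

open Classical in
lemma sum_facesOf {A : Type*} [AddCommMonoid A] (hc : t.card = d + 1) (F : Finset (Vec d) → A) :
    ∑ f ∈ facesOf t, F f = ∑ x : t, F (t.erase x) := by
  symm
  refine Finset.sum_bij (fun x _ => t.erase x) (fun x _ => ?_) (fun x _ y _ h => ?_)
    (fun f hf => ?_) (fun _ _ => rfl)
  · rw [facesOf, Finset.mem_powersetCard]
    exact ⟨Finset.erase_subset _ _, by rw [Finset.card_erase_of_mem x.2, hc]; rfl⟩
  · by_contra hne
    have : (x : Vec d) ∈ t.erase (y : Vec d) :=
      Finset.mem_erase.2 ⟨fun h => hne (Subtype.ext h), x.2⟩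
    rw [← h] at this
    exact (Finset.notMem_erase _ _) this
  · rw [facesOf, Finset.mem_powersetCard] at hf
    obtain ⟨h1, h2⟩ := hf
    have h3 : (t \ f).card = 1 := by rw [Finset.card_sdiff_of_subset h1]; omega
    obtain ⟨x, hx⟩ := Finset.card_eq_one.1 h3
    have hxt : x ∈ t \ f := by rw [hx]; exact Finset.mem_singleton_self x
    rw [Finset.mem_sdiff] at hxt
    refine ⟨⟨x, hxt.1⟩, Finset.mem_univ _, ?_⟩
    refine (Finset.eq_of_subset_of_card_le (fun y hy => ?_) ?_).symm
    · exact Finset.mem_erase.2 ⟨fun h => hxt.2 (by subst h; exact hy), h1 hy⟩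
    · rw [Finset.card_erase_of_mem hxt.1]; omega

open Classical in
lemma mem_facesOf (hc : t.card = d + 1) (x : t) : t.erase x ∈ facesOf t := by
  rw [facesOf, Finset.mem_powersetCard]
  exact ⟨Finset.erase_subset _ _, by rw [Finset.card_erase_of_mem x.2, hc]; rfl⟩

open Classical in
lemma exists_eq_erase (hc : t.card = d + 1) {f : Finset (Vec d)} (hf : f ∈ facesOf t) :
    ∃ x : t, f = t.erase x := by
  by_contra h
  push Not at h
  have := sum_facesOf hc fun g => if g = f then 1 else 0
  rw [Finset.sum_ite_eq' (facesOf t) f, if_pos hf,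
    Finset.sum_eq_zero fun x _ => if_neg fun h' => h x h'.symm] at this
  exact one_ne_zero this

open Classical in
lemma isOutwardNormal_facetNormal (hd : 1 ≤ d) (x : t) :
    IsOutwardNormal t (t.erase x) (facetNormal (vertexBasis t hi hc) x) := by
  set b := vertexBasis t hi hc with hb
  have hmem : ∀ y ∈ t.erase (x : Vec d), y ∈ facet b x := fun y hy => by
    rw [facet_vertexBasis]; exact subset_convexHull _ _ hy
  refine ⟨norm_facetNormal b x hd, fun y hy z hz => ?_, fun y hy z hz => ?_⟩
  · rw [inner_sub_right, real_inner_comm, inner_facetNormal_facet b x y z (hmem y hy) (hmem z hz),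
      real_inner_comm, sub_self]
  · have hyT : y ∈ simplex b := by rw [simplex_vertexBasis]; exact subset_convexHull _ _ hy
    have h1 := (mem_simplex b).1 hyT x
    have h2 := coord_sub b x y z
    rw [coord_facet b x (hmem z hz), sub_zero] at h2
    rw [real_inner_comm, inner_facetNormal, ← h2]
    have := mul_nonneg (height_pos b x hd).le h1
    linarith

open Classical in
/-- The chosen outward normal is the explicit one, by uniqueness. -/
lemma outwardNormal_eq (hd : 1 ≤ d) (x : t) :
    outwardNormal t (t.erase x) = facetNormal (vertexBasis t hi hc) x := by
  obtain ⟨h1, h2, h3⟩ : IsOutwardNormal t (t.erase x) (outwardNormal t (t.erase x)) :=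
    Classical.epsilon_spec ⟨_, isOutwardNormal_facetNormal (hi := hi) (hc := hc) hd x⟩
  have hmem : ∀ y : t, y ≠ x → (y : Vec d) ∈ t.erase (x : Vec d) := fun y hy =>
    Finset.mem_erase.2 ⟨fun h => hy (Subtype.ext h), y.2⟩
  exact eq_facetNormal _ x hd h1 (fun y hy z hz => h2 y (hmem y hy) z (hmem z hz))
    fun y hy => h3 x x.2 y (hmem y hy)

end Vertex

/-! ### Meshes -/

section Mesh

lemma IsConvexPolyhedralDomain.isOpen {Ω : Set (Vec d)} (h : IsConvexPolyhedralDomain Ω) :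
    IsOpen Ω := by
  obtain ⟨-, S, rfl⟩ := h
  exact isOpen_interior

lemma IsConvexPolyhedralDomain.convex {Ω : Set (Vec d)} (h : IsConvexPolyhedralDomain Ω) :
    Convex ℝ Ω := by
  obtain ⟨-, S, rfl⟩ := h
  exact (convex_convexHull ℝ _).interior

lemma IsConvexPolyhedralDomain.isBounded {Ω : Set (Vec d)} (h : IsConvexPolyhedralDomain Ω) :
    Bornology.IsBounded Ω := by
  obtain ⟨-, S, rfl⟩ := h
  exact (S.finite_toSet.isCompact_convexHull _).isBounded.subset interior_subset

lemma IsConvexPolyhedralDomain.interior_closure_subset {Ω : Set (Vec d)}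
    (h : IsConvexPolyhedralDomain Ω) : interior (closure Ω) ⊆ Ω := by
  obtain ⟨-, S, rfl⟩ := h
  exact interior_mono (closure_minimal interior_subset (S.finite_toSet.isCompact_convexHull _).isClosed)

lemma isCompact_cell (t : Finset (Vec d)) : IsCompact (cell t) :=
  t.finite_toSet.isCompact_convexHull _

lemma restrict_interior_cell (t : Finset (Vec d)) :
    (volume : Measure (Vec d)).restrict (interior (cell t)) = volume.restrict (cell t) := by
  refine Measure.restrict_congr_set ?_
  exact interior_ae_eq_of_null_frontier ((convex_convexHull ℝ _).addHaar_frontier volume)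

variable {Ω : Set (Vec d)} (M : SimplicialMesh Ω)

lemma mem_elements {t : Finset (Vec d)} : t ∈ M.elements ↔ t ∈ M.faces ∧ t.card = d + 1 := by
  simp [SimplicialMesh.elements]

lemma cell_subset_closure {t : Finset (Vec d)} (ht : t ∈ M.elements) : cell t ⊆ closure Ω := by
  rw [← M.space_eq]
  exact M.toSimplicialComplex.convexHull_subset_space ((mem_elements M).1 ht).1

lemma interior_cell_subset (hΩ : IsConvexPolyhedralDomain Ω) {t : Finset (Vec d)}
    (ht : t ∈ M.elements) : interior (cell t) ⊆ Ω :=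
  (interior_mono (cell_subset_closure M ht)).trans hΩ.interior_closure_subset

lemma restrict_cell_le (hΩ : IsConvexPolyhedralDomain Ω) {t : Finset (Vec d)}
    (ht : t ∈ M.elements) : (volume : Measure (Vec d)).restrict (cell t) ≤ volume.restrict Ω := by
  rw [← restrict_interior_cell]
  exact Measure.restrict_mono_set _ (interior_cell_subset M hΩ ht)

/-- Two elements meet in the convex hull of their common vertices, at most `d` in number, and this
hull has empty interior. -/
lemma disjoint_interior_cell {s t : Finset (Vec d)} (hs : s ∈ M.elements) (ht : t ∈ M.elements)
    (hst : s ≠ t) : Disjoint (interior (cell s)) (interior (cell t)) := by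
  classical
  rw [mem_elements] at hs ht
  rw [Set.disjoint_iff_inter_eq_empty, ← interior_inter]
  by_contra hne
  have h1 : (interior (convexHull ℝ ((s ∩ t : Finset (Vec d)) : Set (Vec d)))).Nonempty := by
    refine (Set.nonempty_iff_ne_empty.2 hne).mono (interior_mono ?_)
    rw [Finset.coe_inter]
    exact M.inter_subset_convexHull hs.1 ht.1
  rw [interior_convexHull_nonempty_iff_affineSpan_eq_top] at h1
  have h2 : (s ∩ t).card ≤ d := by
    by_contra hlt
    have e1 : s ∩ t = s := Finset.eq_of_subset_of_card_le Finset.inter_subset_left (by omega)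
    have e2 : s ∩ t = t := Finset.eq_of_subset_of_card_le Finset.inter_subset_right (by omega)
    exact hst (e1.symm.trans e2)
  have hne' : (s ∩ t).Nonempty := by
    by_contra h
    rw [Finset.not_nonempty_iff_eq_empty] at h
    rw [h] at h1
    simp at h1
  have h3 := congrArg AffineSubspace.direction h1
  rw [direction_affineSpan, AffineSubspace.direction_top] at h3
  have h4 := finrank_vectorSpan_image_finset_le ℝ (id : Vec d → Vec d) (s ∩ t)
    (n := (s ∩ t).card - 1) (by have := hne'.card_pos; omega)
  rw [Finset.coe_image, Set.image_id] at h4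
  rw [h3, finrank_top, finrank_euclideanSpace_fin] at h4
  have := hne'.card_pos
  omega

lemma ae_eq_biUnion_interior (hΩ : IsConvexPolyhedralDomain Ω) :
    (⋃ t ∈ M.elements, interior (cell t)) =ᵐ[volume] Ω := by
  refine (eventuallyLE_antisymm_iff.2 ⟨?_, ?_⟩)
  · have h1 : (⋃ t ∈ M.elements, interior (cell t)) ⊆ Ω :=
      Set.iUnion₂_subset fun t ht => interior_cell_subset M hΩ ht
    exact LE.le.eventuallyLE h1
  · have h1 : Ω ⊆ (⋃ t ∈ M.elements, interior (cell t)) ∪ ⋃ t ∈ M.elements, frontier (cell t) := by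
      intro x hx
      have hx' : x ∈ M.toSimplicialComplex.space := by rw [M.space_eq]; exact subset_closure hx
      obtain ⟨s, hs, hxs⟩ := M.toSimplicialComplex.mem_space_iff.1 hx'
      obtain ⟨t, ht, hst, hcard⟩ := M.exists_element s hs
      have hxt : x ∈ cell t := convexHull_mono (Finset.coe_subset.2 hst) hxs
      have htE : t ∈ M.elements := (mem_elements M).2 ⟨ht, hcard⟩
      by_cases hi : x ∈ interior (cell t)
      · exact Or.inl (Set.mem_biUnion htE hi)
      · refine Or.inr (Set.mem_biUnion htE ⟨subset_closure hxt, hi⟩)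
    have h2 : volume (⋃ t ∈ M.elements, frontier (cell t)) = 0 := by
      exact (measure_biUnion_null_iff M.elements.countable_toSet).2 fun t _ =>
        (convex_convexHull ℝ _).addHaar_frontier volume
    have h3 : (Ω : Set (Vec d)) ≤ᵐ[volume] ((⋃ t ∈ M.elements, interior (cell t)) ∪
        ⋃ t ∈ M.elements, frontier (cell t) : Set (Vec d)) :=
      LE.le.eventuallyLE h1
    exact h3.trans (union_ae_eq_left_of_ae_eq_empty (ae_eq_empty.2 h2)).le

/-- Integrals over the domain are sums of integrals over the mesh elements. -/
lemma integral_eq_sum_cell (hΩ : IsConvexPolyhedralDomain Ω) {g : Vec d → ℝ}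
    (hg : ∀ t ∈ M.elements, IntegrableOn g (cell t)) :
    ∫ x in Ω, g x = ∑ t ∈ M.elements, ∫ x in cell t, g x := by
  rw [← setIntegral_congr_set (ae_eq_biUnion_interior M hΩ),
    integral_biUnion_finset M.elements (fun t _ => isOpen_interior.measurableSet)
      (fun s hs t ht hst => disjoint_interior_cell M hs ht hst)
      (fun t ht => (hg t ht).mono_set interior_subset)]
  exact Finset.sum_congr rfl fun t _ => by rw [restrict_interior_cell]

lemma broken_eq {V : Type} [AddCommMonoid V] {t : Finset (Vec d)} (ht : t ∈ M.elements)
    (v : HybridField d V) {x : Vec d} (hx : x ∈ interior (cell t)) : broken M v x = v.elem t x := by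
  rw [broken, Finset.sum_eq_single t, Set.indicator_of_mem hx]
  · intro s hs hst
    rw [Set.indicator_of_notMem]
    exact fun h => Set.disjoint_left.1 (disjoint_interior_cell M hs ht hst) h hx
  · exact fun h => absurd ht h

lemma broken_ae_eq {V : Type} [AddCommMonoid V] {t : Finset (Vec d)} (ht : t ∈ M.elements)
    (v : HybridField d V) : broken M v =ᵐ[volume.restrict (cell t)] v.elem t := by
  rw [← restrict_interior_cell]
  filter_upwards [ae_restrict_mem isOpen_interior.measurableSet] with x hx
  exact broken_eq M ht v hx

end Mesh

end

/-! ### Local interpolation estimates -/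

section

open MvPolynomial

variable {d : ℕ}

/-- The polynomials `P` are the components of the Raviart–Thomas–Nédélec interpolate of `u` on
`simplex b`, and `Q j` those of the `L²`-projection of `u` on the facet opposite to `b j`. -/
structure IsLocalInterp {ι : Type} [Fintype ι] (b : AffineBasis ι ℝ (Vec d)) (k : ℕ)
    (u : Vec d → Vec d) (P : Fin d → MvPolynomial (Fin d) ℝ)
    (Q : ι → Fin d → MvPolynomial (Fin d) ℝ) : Prop where
  rtn : IsRTNPoly k P
  moments : ∀ i R, DegLE ((k : ℤ) - 1) R →
    ∫ x in simplex b, evalAt (P i) x * evalAt R x = ∫ x in simplex b, u x i * evalAt R x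
  normal : ∀ j s, DegLE k s →
    ∫ x, inner ℝ (polyField P x) (facetNormal b j) * evalAt s x ∂facetMeasure b j =
      ∫ x, inner ℝ (u x) (facetNormal b j) * evalAt s x ∂facetMeasure b j
  deg : ∀ j i, DegLE k (Q j i)
  face : ∀ j i s, DegLE k s → ∫ x, evalAt (Q j i) x * evalAt s x ∂facetMeasure b j =
    ∫ x, u x i * evalAt s x ∂facetMeasure b j

lemma IsRTNPoly.degLE {k : ℕ} {P : Fin d → MvPolynomial (Fin d) ℝ} (hP : IsRTNPoly k P)
    (i : Fin d) : DegLE (k + 1 : ℕ) (P i) := by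
  obtain ⟨p, q, h1, h2, h3⟩ := hP
  rw [h3]
  refine DegLE.add ((h1 i).mono (by push_cast; omega)) ?_
  exact ((degLE_X i).mul h2).mono (by push_cast; omega)

lemma IsRTNPoly.sub_degLE {k : ℕ} {P p : Fin d → MvPolynomial (Fin d) ℝ} (hP : IsRTNPoly k P)
    (hp : ∀ i, DegLE k (p i)) : IsRTNPoly k fun i => P i - p i := by
  obtain ⟨p', q, h1, h2, h3⟩ := hP
  exact ⟨fun i => p' i - p i, q, fun i => (polySub d k).sub_mem (h1 i) (hp i), h2, fun i => by
    simp only [h3]; ring⟩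

lemma l2_le_sum_coord {μ : Measure (Vec d)} {m : Vec d → Vec d} (hm : MemLp m 2 μ) :
    l2 μ m ≤ ∑ i, l2 μ (fun x => m x i) := by
  have h1 : MemLp (fun x => ∑ i, |m x i|) 2 μ :=
    memLp_finsetSum Finset.univ fun i _ => (memLp_apply hm i).norm
  refine (l2_mono_ae h1 (Eventually.of_forall fun x => (norm_le_sum_abs_coord _).trans
    (le_abs_self _))).trans ((l2_sum_le Finset.univ fun i _ => (memLp_apply hm i).norm).trans ?_)
  exact Finset.sum_le_sum fun i _ => (l2_norm _).le

/-- An `L²`-projection on polynomials is a contraction, up to polynomials. -/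
lemma l2_sub_le_of_projection {μ : Measure (Vec d)}
    (hμ : ∀ p : MvPolynomial (Fin d) ℝ, MemLp (evalAt p) 2 μ) {f : Vec d → ℝ} (hf : MemLp f 2 μ)
    {ℓ : ℤ} {p q : MvPolynomial (Fin d) ℝ} (hp : DegLE ℓ p) (hq : DegLE ℓ q)
    (h : ∀ s, DegLE ℓ s → ∫ x, evalAt q x * evalAt s x ∂μ = ∫ x, f x * evalAt s x ∂μ) :
    l2 μ (evalAt (q - p)) ≤ l2 μ (fun x => f x - evalAt p x) := by
  have hqp : DegLE ℓ (q - p) := (polySub d ℓ).sub_mem hq hp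
  have h1 : l2 μ (evalAt (q - p)) ^ 2 = ∫ x, (f x - evalAt p x) * evalAt (q - p) x ∂μ := by
    rw [l2_sq_real (hμ _)]
    simp_rw [sub_mul, sq]
    rw [integral_sub (integrable_mul_of_memLp hf (hμ _)) (integrable_mul_of_memLp (hμ p) (hμ _)),
      ← h _ hqp, ← integral_sub (integrable_mul_of_memLp (hμ q) (hμ _))
        (integrable_mul_of_memLp (hμ p) (hμ _))]
    simp only [evalAt_sub, sub_mul]
  have h2 := (le_abs_self _).trans (abs_integral_mul_le (hf.sub (hμ p)) (hμ (q - p)))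
  have h3 : l2 μ (evalAt (q - p)) ^ 2 ≤
      l2 μ (fun x => f x - evalAt p x) * l2 μ (evalAt (q - p)) := h1.le.trans h2
  have h4 := l2_nonneg (μ := μ) (evalAt (q - p))
  rcases h4.eq_or_lt with h0 | h0
  · rw [← h0]; exact l2_nonneg _
  · nlinarith

/-- Stability of the interpolators, up to polynomials of degree at most `k`: these are reproduced,
so that `P - p` and `Q j - p` are the interpolates of `u - p`. -/
theorem exists_interp_stability (d k : ℕ) (ϱ : ℝ) : ∃ C : ℝ, 0 < C ∧ ∀ {ι : Type} [Fintype ι]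
    (b : AffineBasis ι ℝ (Vec d)) (c : Vec d) (r : ℝ), 1 ≤ d → ShapeRegular b ϱ c r →
      ∀ u : Vec d → Vec d, Continuous u → ∀ P Q, IsLocalInterp b k u P Q →
      ∀ p : Fin d → MvPolynomial (Fin d) ℝ, (∀ i, DegLE k (p i)) → ∀ A : ℝ,
      (∀ i, l2 (volume.restrict (simplex b)) (fun x => u x i - evalAt (p i) x) ≤ A) →
      (∀ j i, √r * l2 (facetMeasure b j) (fun x => u x i - evalAt (p i) x) ≤ A) →
      (∀ i, l2 (volume.restrict (simplex b)) (evalAt (P i - p i)) ≤ C * A) ∧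
      (∀ j i, √r * l2 (facetMeasure b j) (evalAt (P i - p i)) ≤ C * A) ∧
      (∀ j i, √r * l2 (facetMeasure b j) (evalAt (Q j i - p i)) ≤ A) ∧
      ∀ i, ∀ x ∈ simplex b, |evalAt (P i - p i) x| * √(volume.real (simplex b)) ≤ C * A := by
  obtain ⟨C1, hC1, hst⟩ := exists_rtn_stability d k ϱ
  obtain ⟨C2, hC2, htr⟩ := exists_discrete_trace d (k + 1) ϱ
  obtain ⟨C3, hC3, hinv⟩ := exists_inverse_inequality d (k + 1) ϱ
  obtain ⟨K, hK⟩ : ∃ K : ℝ, K = C1 * (d + (d + 1) * d) := ⟨_, rfl⟩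
  have hK0 : 0 ≤ K := by rw [hK]; positivity
  refine ⟨K * (1 + C2 + C3) + 1, by positivity, ?_⟩
  intro ι _ b c r hd H u hu P Q hI p hp A hA hAF
  have mT : ∀ p : MvPolynomial (Fin d) ℝ, MemLp (evalAt p) 2 (volume.restrict (simplex b)) :=
    fun p => memLp_simplex b (continuous_evalAt p) 2
  have mF : ∀ j, ∀ p : MvPolynomial (Fin d) ℝ, MemLp (evalAt p) 2 (facetMeasure b j) :=
    fun j p => memLp_facetMeasure b j hd (continuous_evalAt p) 2
  have hr := H.pos
  have hA0 : 0 ≤ A := (l2_nonneg _).trans (hA ⟨0, hd⟩)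
  have huc : ∀ i, Continuous fun x => u x i := fun i =>
    (EuclideanSpace.proj i : Vec d →L[ℝ] ℝ).continuous.comp hu
  have hm : Continuous fun x => u x - polyField p x := hu.sub (continuous_polyField p)
  have e : polyField (fun i => P i - p i) = fun x => polyField P x - polyField p x := by
    ext x i; simp
  have hrtn : IsRTNPoly k fun i => P i - p i := hI.rtn.sub_degLE hp
  have hdeg : ∀ i, DegLE (k + 1 : ℕ) (P i - p i) := hrtn.degLE
  have hstab := hst b c r hd H (fun i => P i - p i) hrtn (fun x => u x - polyField p x)
    (fun j x => inner ℝ (u x - polyField p x) (facetNormal b j)) (memLp_simplex b hm 2)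
    (fun j => memLp_facetMeasure b j hd (hm.inner continuous_const) 2)
    (fun i R hR => by
      simp only [evalAt_sub, sub_mul, PiLp.sub_apply, polyField_apply]
      rw [integral_sub (integrable_mul_of_memLp (mT _) (mT R)) (integrable_mul_of_memLp (mT _) (mT R)),
        integral_sub (integrable_mul_of_memLp (memLp_simplex b (huc i) 2) (mT R))
          (integrable_mul_of_memLp (mT _) (mT R)), hI.moments i R hR])
    (fun j s hs => by
      have i1 : ∀ {v : Vec d → Vec d}, Continuous v →
          Integrable (fun x => inner ℝ (v x) (facetNormal b j) * evalAt s x) (facetMeasure b j) :=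
        fun hv => integrable_facetMeasure b j hd ((hv.inner continuous_const).mul (continuous_evalAt s))
      simp only [e, inner_sub_left, sub_mul]
      rw [integral_sub (i1 (continuous_polyField P)) (i1 (continuous_polyField p)),
        integral_sub (i1 hu) (i1 (continuous_polyField p)), hI.normal j s hs])
  have hK1 : l2 (volume.restrict (simplex b)) (polyField fun i => P i - p i) ≤ K * A := by
    refine hstab.trans ?_
    have h1 : l2 (volume.restrict (simplex b)) (fun x => u x - polyField p x) ≤ d * A := by
      refine (l2_le_sum_coord (memLp_simplex b hm 2)).trans ?_
      refine (Finset.sum_le_sum fun i _ => hA i).trans (le_of_eq ?_)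
      simp
    have h2 : ∀ j ∈ Finset.univ, √r * l2 (facetMeasure b j)
        (fun x => inner ℝ (u x - polyField p x) (facetNormal b j)) ≤ d * A := by
      intro j _
      have h3 : l2 (facetMeasure b j) (fun x => inner ℝ (u x - polyField p x) (facetNormal b j)) ≤
          ∑ i, l2 (facetMeasure b j) (fun x => u x i - evalAt (p i) x) := by
        refine (l2_mono_ae (memLp_facetMeasure b j hd hm 2) (Eventually.of_forall fun x => ?_)).trans
          (l2_le_sum_coord (memLp_facetMeasure b j hd hm 2))
        refine (norm_inner_le_norm _ _).trans ?_
        rw [norm_facetNormal b j hd, mul_one]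
      refine (mul_le_mul_of_nonneg_left h3 (Real.sqrt_nonneg r)).trans ?_
      rw [Finset.mul_sum]
      refine (Finset.sum_le_sum fun i _ => hAF j i).trans (le_of_eq ?_)
      simp
    have h4 := Finset.sum_le_sum h2
    rw [← Finset.mul_sum, Finset.sum_const, Finset.card_univ, card_index b, nsmul_eq_mul] at h4
    push_cast at h4
    calc _ ≤ C1 * (d * A + (d + 1) * (d * A)) :=
          mul_le_mul_of_nonneg_left (add_le_add h1 h4) hC1.le
      _ = K * A := by rw [hK]; ring
  have hKi : ∀ i, l2 (volume.restrict (simplex b)) (evalAt (P i - p i)) ≤ K * A := fun i =>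
    (l2_apply_le (memLp_simplex b (continuous_polyField fun i => P i - p i) 2) i).trans hK1
  have hKA : 0 ≤ K * A := by positivity
  have hfin : ∀ D : ℝ, D ≤ 1 + C2 + C3 → D * (K * A) ≤ (K * (1 + C2 + C3) + 1) * A := by
    intro D hD
    calc D * (K * A) ≤ (1 + C2 + C3) * (K * A) := mul_le_mul_of_nonneg_right hD hKA
      _ ≤ (1 + C2 + C3) * (K * A) + A := le_add_of_nonneg_right hA0
      _ = _ := by ring
  refine ⟨fun i => (hKi i).trans ?_, fun j i => ?_, fun j i => ?_, fun i x hx => ?_⟩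
  · rw [← one_mul (K * A)]
    exact hfin 1 (by linarith)
  · refine ((htr b c r hd H (P i - p i) (hdeg i)).1 j).trans
      ((mul_le_mul_of_nonneg_left (hKi i) hC2.le).trans ?_)
    exact hfin C2 (by linarith)
  · refine (mul_le_mul_of_nonneg_left ?_ (Real.sqrt_nonneg r)).trans (hAF j i)
    exact l2_sub_le_of_projection (mF j) (memLp_facetMeasure b j hd (huc i) 2) (hp i) (hI.deg j i)
      (hI.face j i)
  · refine ((hinv b c r hd H (P i - p i) (hdeg i) x hx).1).trans
      ((mul_le_mul_of_nonneg_left (hKi i) hC3.le).trans ?_)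
    exact hfin C3 (by linarith)

/-- The interpolates of a bounded field are bounded. -/
theorem exists_interp_bound (d k : ℕ) (ϱ : ℝ) : ∃ C : ℝ, 0 < C ∧ ∀ {ι : Type} [Fintype ι]
    (b : AffineBasis ι ℝ (Vec d)) (c : Vec d) (r : ℝ), 1 ≤ d → ShapeRegular b ϱ c r →
      ∀ u : Vec d → Vec d, Continuous u → ∀ P Q, IsLocalInterp b k u P Q →
      ∀ (y : Vec d) (B : ℝ), (∀ x ∈ simplex b, ∀ i, |u x i - y i| ≤ B) →
      ∀ i, ∀ x ∈ simplex b, |evalAt (P i) x - y i| ≤ C * B := by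
  obtain ⟨C, hC, h⟩ := exists_interp_stability d k ϱ
  refine ⟨C * (1 + √d), by positivity, ?_⟩
  intro ι _ b c r hd H u hu P Q hI y B hB i x hx
  have hB0 : 0 ≤ B := (abs_nonneg _).trans (hB c H.center_mem ⟨0, hd⟩)
  have hV := sqrt_volume_pos H
  have hd0 := Real.sqrt_nonneg d
  have h1 := (h b c r hd H u hu P Q hI (fun i => MvPolynomial.C (y i))
    (fun i => degLE_C _ (by omega)) (B * (1 + √d) * √(volume.real (simplex b)))
    (fun i => ?_) fun j i => ?_).2.2.2 i x hx
  · rw [evalAt_sub, evalAt_C] at h1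
    refine le_of_mul_le_mul_right (h1.trans (le_of_eq ?_)) hV
    ring
  · refine (l2_simplex_le_of_bound b hB0 fun x hx => ?_).trans ?_
    · rw [evalAt_C]; exact hB x hx i
    · refine mul_le_mul_of_nonneg_right ?_ hV.le
      nlinarith [mul_nonneg hB0 hd0]
  · refine (l2_facet_le_of_bound hd H j hB0 ((ae_mem_facet b j).mono fun x hx => ?_)).trans ?_
    · rw [evalAt_C]; exact hB x (facet_subset b j hx) i
    · rw [← mul_assoc]
      refine mul_le_mul_of_nonneg_right ?_ hV.le
      nlinarith [mul_nonneg hB0 hd0]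

/-- The approximation properties of the interpolators: stability, applied with the polynomials of
the Bramble–Hilbert lemma, and the trace inequality for the errors on the facets. -/
theorem exists_interp_approx (d k : ℕ) (ϱ : ℝ) : ∃ C : ℝ, 0 < C ∧ ∀ {ι : Type} [Fintype ι]
    (b : AffineBasis ι ℝ (Vec d)) (c : Vec d) (r : ℝ), 1 ≤ d → ShapeRegular b ϱ c r →
      ∀ u : Vec d → Vec d, Continuous u → ∀ P Q, IsLocalInterp b k u P Q →
      ∀ (G : Fin d → Fin d → Vec d → ℝ) (ψ : Fin d → ℕ → Vec d → ℝ),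
      (∀ i, SmoothApprox (simplex b) (fun x => u x i) (G i) (ψ i)) →
      ∀ (a : Fin d → ∀ m, (Fin m → Fin d) → Vec d → ℝ) (S : ℝ),
      (∀ i, HasWeakJet (interior (simplex b)) (k + 1) (fun x => u x i) (a i)) →
      (∀ i j, a i 1 (fun _ => j) =ᵐ[volume.restrict (simplex b)] G i j) →
      (∀ i J, l2 (volume.restrict (simplex b)) (a i (k + 1) J) ≤ S) → 0 ≤ S →
      (∀ i, l2 (volume.restrict (simplex b)) (fun x => u x i - evalAt (P i) x) ≤
        C * r ^ (k + 1) * S) ∧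
      (∀ j i, √r * l2 (facetMeasure b j) (fun x => u x i - evalAt (Q j i) x) ≤
        C * r ^ (k + 1) * S) ∧
      ∀ j i, √r * l2 (facetMeasure b j) (fun x => evalAt (Q j i) x - evalAt (P i) x) ≤
        C * r ^ (k + 1) * S := by
  obtain ⟨C1, hC1, hst⟩ := exists_interp_stability d k ϱ
  obtain ⟨C2, hC2, hbh⟩ := exists_polynomial_approx d k
  obtain ⟨K, hK⟩ : ∃ K : ℝ, K = (2 * d + 1) * C2 * (2 * |ϱ|) ^ (k + 1) := ⟨_, rfl⟩
  have hK0 : 0 ≤ K := by rw [hK]; positivity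
  refine ⟨K * (2 + C1) + 1, by positivity, ?_⟩
  intro ι _ b c r hd H u hu P Q hI G ψ hψ a S ha haG hS hS0
  have hr := H.pos
  have hres : volume.restrict (interior (simplex b)) = volume.restrict (simplex b) :=
    Measure.restrict_congr_set
      (interior_ae_eq_of_null_frontier ((convex_convexHull ℝ _).addHaar_frontier volume))
  have hne : (interior (simplex b)).Nonempty :=
    ⟨c, interior_mono H.ball_subset (by rw [Metric.isOpen_ball.interior_eq]; exact Metric.mem_ball_self hr)⟩
  have hh := H.diam_pos hd
  have hhr : Metric.diam (simplex b) ≤ 2 * |ϱ| * r := by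
    have := H.diam_le
    nlinarith [le_abs_self ϱ, mul_nonneg (sub_nonneg.2 (le_abs_self ϱ)) hr.le]
  have key : ∀ i, ∃ p : MvPolynomial (Fin d) ℝ, DegLE k p ∧
      l2 (volume.restrict (simplex b)) (fun x => u x i - evalAt p x) ≤ K * r ^ (k + 1) * S ∧
      ∀ j, √r * l2 (facetMeasure b j) (fun x => u x i - evalAt p x) ≤ K * r ^ (k + 1) * S := by
    intro i
    obtain ⟨p, hp, h1, h2⟩ := hbh (interior (simplex b)) (Metric.diam (simplex b)) S
      (fun x => u x i) (a i) isOpen_interior (convex_simplex b).interior hne hh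
      (fun x hx y hy => dist_le_diam b (interior_subset hx) (interior_subset hy)) (ha i)
      (fun J => by rw [hres]; exact hS i J) hS0
    rw [hres] at h1 h2
    have hE0 : 0 ≤ C2 * Metric.diam (simplex b) ^ (k + 1) * S := by positivity
    have hE : (2 * d + 1) * (C2 * Metric.diam (simplex b) ^ (k + 1) * S) ≤ K * r ^ (k + 1) * S := by
      calc _ ≤ (2 * d + 1) * (C2 * (2 * |ϱ| * r) ^ (k + 1) * S) := by gcongr
        _ = _ := by rw [hK, mul_pow (2 * |ϱ|)]; ring
    have hd0 : (0 : ℝ) ≤ d := by positivity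
    refine ⟨p, hp, h1.trans (le_trans ?_ hE), fun j => le_trans ?_ hE⟩
    · nlinarith [mul_nonneg hd0 hE0]
    · have h3 := ((hψ i).sub (SmoothApprox.const (isCompact_simplex b) (contDiff_evalAt p))).l2_facet_le
        b hd j
      have h4 : ∀ j' ∈ Finset.univ, Metric.diam (simplex b) * l2 (volume.restrict (simplex b))
          (fun x => G i j' x - fderiv ℝ (evalAt p) x (basisVec j')) ≤
          C2 * Metric.diam (simplex b) ^ (k + 1) * S := by
        intro j' _
        refine le_trans (le_of_eq ?_) (h2 j')
        congr 1
        refine l2_congr_ae ((haG i j').mono fun x hx => ?_)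
        simp only [hx, evalAt_pderiv]
      have h5 := Finset.sum_le_sum h4
      rw [← Finset.mul_sum, Finset.sum_const, Finset.card_univ, Fintype.card_fin, nsmul_eq_mul] at h5
      have h6 : √r ≤ √(height b j) := Real.sqrt_le_sqrt (by linarith [H.two_mul_r_le_height j hd])
      have h7 := mul_le_mul_of_nonneg_right h6
        (l2_nonneg (μ := facetMeasure b j) fun x => u x i - evalAt p x)
      have h8 := mul_le_mul_of_nonneg_left h1 (show (0 : ℝ) ≤ d + 1 by positivity)
      refine h7.trans (h3.trans ((add_le_add h8 h5).trans (le_of_eq ?_)))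
      ring
  choose p hp h1 h2 using key
  obtain ⟨s1, s2, s3, -⟩ := hst b c r hd H u hu P Q hI p hp _ h1 fun j i => h2 i j
  have huc : ∀ i, Continuous fun x => u x i := fun i =>
    (EuclideanSpace.proj i : Vec d →L[ℝ] ℝ).continuous.comp hu
  have hmT : ∀ i, MemLp (fun x => u x i - evalAt (p i) x) 2 (volume.restrict (simplex b)) := fun i =>
    memLp_simplex b ((huc i).sub (continuous_evalAt _)) 2
  have hmF : ∀ j i, MemLp (fun x => u x i - evalAt (p i) x) 2 (facetMeasure b j) := fun j i =>
    memLp_facetMeasure b j hd ((huc i).sub (continuous_evalAt _)) 2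
  have mF : ∀ j, ∀ p : MvPolynomial (Fin d) ℝ, MemLp (evalAt p) 2 (facetMeasure b j) :=
    fun j p => memLp_facetMeasure b j hd (continuous_evalAt p) 2
  have hX : 0 ≤ r ^ (k + 1) * S := by positivity
  have hKX : 0 ≤ K * r ^ (k + 1) * S := by positivity
  have hC1K : 0 ≤ C1 * (K * r ^ (k + 1) * S) := by positivity
  have hsr := Real.sqrt_nonneg r
  refine ⟨fun i => ?_, fun j i => ?_, fun j i => ?_⟩
  · have e : (fun x => u x i - evalAt (P i) x) =
        fun x => (u x i - evalAt (p i) x) - evalAt (P i - p i) x := by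
      ext x; rw [evalAt_sub]; ring
    rw [e]
    refine (l2_sub_le (hmT i) (memLp_simplex b (continuous_evalAt _) 2)).trans
      ((add_le_add (h1 i) (s1 i)).trans ?_)
    nlinarith
  · have e : (fun x => u x i - evalAt (Q j i) x) =
        fun x => (u x i - evalAt (p i) x) - evalAt (Q j i - p i) x := by
      ext x; rw [evalAt_sub]; ring
    rw [e]
    refine (mul_le_mul_of_nonneg_left (l2_sub_le (hmF j i) (mF j _)) hsr).trans ?_
    rw [mul_add]
    refine (add_le_add (h2 i j) (s3 j i)).trans ?_
    nlinarith
  · have e : (fun x => evalAt (Q j i) x - evalAt (P i) x) =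
        fun x => evalAt (Q j i - p i) x - evalAt (P i - p i) x := by
      ext x; rw [evalAt_sub, evalAt_sub]; ring
    rw [e]
    refine (mul_le_mul_of_nonneg_left (l2_sub_le (mF j _) (mF j _)) hsr).trans ?_
    rw [mul_add]
    refine (add_le_add (s3 j i) (s2 j i)).trans ?_
    nlinarith

/-- The Raviart–Thomas–Nédélec interpolate of a divergence-free field is divergence-free. -/
lemma IsLocalInterp.divPoly_eq_zero {ι : Type} [Fintype ι] {b : AffineBasis ι ℝ (Vec d)} {k : ℕ}
    {ϱ : ℝ} {c : Vec d} {r : ℝ} (hd : 1 ≤ d) (H : ShapeRegular b ϱ c r)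
    {u : Vec d → Vec d} (hu : Continuous u) {P : Fin d → MvPolynomial (Fin d) ℝ}
    {Q : ι → Fin d → MvPolynomial (Fin d) ℝ} (hI : IsLocalInterp b k u P Q)
    {G : Fin d → Fin d → Vec d → ℝ} {ψ : Fin d → ℕ → Vec d → ℝ}
    (hψ : ∀ i, SmoothApprox (simplex b) (fun x => u x i) (G i) (ψ i))
    (hdiv : ∀ᵐ x ∂volume.restrict (simplex b), ∑ i, G i i x = 0) : divPoly P = 0 := by
  obtain ⟨q, hq⟩ : ∃ q, q = divPoly P := ⟨_, rfl⟩
  have mT : ∀ p : MvPolynomial (Fin d) ℝ, MemLp (evalAt p) 2 (volume.restrict (simplex b)) :=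
    fun p => memLp_simplex b (continuous_evalAt p) 2
  have hqk : DegLE k q := by
    rw [hq, divPoly]
    exact DegLE.sum fun i _ => (hI.rtn.degLE i).pderiv i |>.mono (by push_cast; omega)
  have huc : ∀ i, Continuous fun x => u x i := fun i =>
    (EuclideanSpace.proj i : Vec d →L[ℝ] ℝ).continuous.comp hu
  have h1 := integral_divPoly_mul b hd P q
  rw [Finset.sum_congr rfl fun j _ => hI.normal j q hqk,
    Finset.sum_congr rfl fun i _ => hI.moments i (pderiv i q) (hqk.pderiv i)] at h1
  have h2 : ∀ i, ∫ x in simplex b, (u x i * evalAt (pderiv i q) x + G i i x * evalAt q x) =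
      ∑ j, ∫ y, facetNormal b j i * (u y i * evalAt q y) ∂facetMeasure b j := by
    intro i
    have := ((hψ i).mul (measurableSet_simplex b) (SmoothApprox.const (isCompact_simplex b)
      (contDiff_evalAt q))).integral_grad b hd i
    simpa only [evalAt_pderiv] using this
  have i1 : ∀ i, Integrable (fun x => u x i * evalAt (pderiv i q) x) (volume.restrict (simplex b)) :=
    fun i => integrable_mul_of_memLp (memLp_simplex b (huc i) 2) (mT _)
  have i2 : ∀ i, Integrable (fun x => G i i x * evalAt q x) (volume.restrict (simplex b)) :=
    fun i => integrable_mul_of_memLp ((hψ i).memLp_grad b i) (mT _)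
  have h3 : ∑ i, ∫ x in simplex b, G i i x * evalAt q x = 0 := by
    rw [← integral_finsetSum _ fun i _ => i2 i]
    rw [← integral_zero (Vec d) ℝ (μ := volume.restrict (simplex b))]
    refine integral_congr_ae (hdiv.mono fun x hx => ?_)
    simp only [← Finset.sum_mul, hx, zero_mul]
  have h4 : ∑ j, ∫ x, inner ℝ (u x) (facetNormal b j) * evalAt q x ∂facetMeasure b j =
      ∑ i, ∫ x in simplex b, u x i * evalAt (pderiv i q) x := by
    have h5 : ∑ i, ∫ x in simplex b, u x i * evalAt (pderiv i q) x =
        ∑ i, ∑ j, ∫ y, facetNormal b j i * (u y i * evalAt q y) ∂facetMeasure b j := by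
      rw [← add_zero (∑ i, ∫ x in simplex b, u x i * evalAt (pderiv i q) x), ← h3,
        ← Finset.sum_add_distrib]
      exact Finset.sum_congr rfl fun i _ => by rw [← integral_add (i1 i) (i2 i), h2]
    rw [h5, Finset.sum_comm]
    refine Finset.sum_congr rfl fun j _ => ?_
    have i3 : ∀ i, Integrable (fun y => facetNormal b j i * (u y i * evalAt q y))
        (facetMeasure b j) := fun i => integrable_facetMeasure b j hd
      (continuous_const.mul ((huc i).mul (continuous_evalAt q)))
    rw [← integral_finsetSum _ fun i _ => i3 i]
    refine integral_congr_ae (Eventually.of_forall fun x => ?_)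
    simp only [inner_eq_sum, Finset.sum_mul]
    exact Finset.sum_congr rfl fun i _ => by ring
  rw [h4, sub_self, ← hq] at h1
  have h6 : l2 (volume.restrict (simplex b)) (evalAt q) = 0 := by
    have : l2 (volume.restrict (simplex b)) (evalAt q) ^ 2 = 0 := by
      rw [l2_sq_real (mT q), ← h1]; simp only [sq]
    exact pow_eq_zero_iff (two_ne_zero) |>.1 this
  rw [← hq]
  have h7 := l2_ball_le H.ball_subset (mT q)
  exact l2_eq_zero_iff_ball H.pos (le_antisymm (h7.trans h6.le) (l2_nonneg _))

end


/-! ### Local consistency of the convective form -/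

section

open MvPolynomial

variable {d : ℕ} {ι : Type} [Fintype ι] {b : AffineBasis ι ℝ (Vec d)} {ϱ : ℝ} {c : Vec d} {r : ℝ}

lemma divPoly_mul (R : Fin d → MvPolynomial (Fin d) ℝ) (hR : divPoly R = 0)
    (z : MvPolynomial (Fin d) ℝ) : ∑ j, pderiv j (R j * z) = ∑ j, R j * pderiv j z := by
  have h : ∑ j, pderiv j (R j * z) = divPoly R * z + ∑ j, R j * pderiv j z := by
    rw [divPoly, Finset.sum_mul, ← Finset.sum_add_distrib]
    exact Finset.sum_congr rfl fun j _ => by rw [Derivation.leibniz, smul_eq_mul, smul_eq_mul]; ring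
  rw [h, hR, zero_mul, zero_add]

/-- The consistency error of the convective form on an element, for one component of the advected
field: an integration by parts and the orthogonality properties of `u - p` and of `u - q j` make
the differences `w - R` and `R - e`, with `e` constant, appear. -/
lemma convection_identity (hd : 1 ≤ d) {k : ℕ} {u : Vec d → ℝ} (hu : Continuous u)
    {g : Fin d → Vec d → ℝ} {ψ : ℕ → Vec d → ℝ} (hψ : SmoothApprox (simplex b) u g ψ)
    {w : Vec d → Vec d} (hw : Continuous w) {R : Fin d → MvPolynomial (Fin d) ℝ}
    (hR : divPoly R = 0) {p z : MvPolynomial (Fin d) ℝ} {q zF : ι → MvPolynomial (Fin d) ℝ}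
    (hz : DegLE k z)
    (hp : ∀ s, DegLE ((k : ℤ) - 1) s →
      ∫ x in simplex b, evalAt p x * evalAt s x = ∫ x in simplex b, u x * evalAt s x)
    (hq : ∀ i s, DegLE k s →
      ∫ x, evalAt (q i) x * evalAt s x ∂facetMeasure b i = ∫ x, u x * evalAt s x ∂facetMeasure b i)
    (e : Vec d) :
    (∫ x in simplex b, (∑ j, w x j * g j x) * evalAt z x) -
      (∫ x in simplex b, (∑ j, evalAt (R j) x * evalAt (pderiv j p) x) * evalAt z x) -
      1 / 2 * ∑ i, ∫ x, inner ℝ (polyField R x) (facetNormal b i) *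
        ((evalAt (q i) x - evalAt p x) * (evalAt (zF i) x + evalAt z x)) ∂facetMeasure b i =
    (∑ j, ∫ x in simplex b, ((w x j - evalAt (R j) x) * g j x) * evalAt z x) -
      (∑ j, ∫ x in simplex b, (u x - evalAt p x) *
        ((evalAt (R j) x - e j) * evalAt (pderiv j z) x)) +
      (∑ i, ∫ x, inner ℝ (polyField R x - e) (facetNormal b i) * (u x - evalAt (q i) x) * evalAt z x
        ∂facetMeasure b i) +
      1 / 2 * ∑ i, ∫ x, inner ℝ (polyField R x) (facetNormal b i) *
        (evalAt (q i) x - evalAt p x) * (evalAt z x - evalAt (zF i) x) ∂facetMeasure b i := by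
  have mT : ∀ {f : Vec d → ℝ}, Continuous f → MemLp f 2 (volume.restrict (simplex b)) :=
    fun hf => memLp_simplex b hf 2
  have iT : ∀ {f : Vec d → ℝ}, Continuous f → Integrable f (volume.restrict (simplex b)) :=
    fun hf => integrableOn_simplex b hf
  have iF : ∀ i, ∀ {f : Vec d → ℝ}, Continuous f → Integrable f (facetMeasure b i) :=
    fun i {f} hf => integrable_facetMeasure b i hd hf
  have hwc : ∀ j, Continuous fun x => w x j := fun j =>
    (EuclideanSpace.proj j : Vec d →L[ℝ] ℝ).continuous.comp hw
  have ce : ∀ s : MvPolynomial (Fin d) ℝ, Continuous (evalAt s) := continuous_evalAt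
  have cn : ∀ i, Continuous fun x => inner ℝ (polyField R x) (facetNormal b i) := fun i =>
    (continuous_polyField R).inner continuous_const
  have cn' : ∀ i, Continuous fun x => inner ℝ (polyField R x - e) (facetNormal b i) := fun i =>
    ((continuous_polyField R).sub continuous_const).inner continuous_const
  have iTm : ∀ {f g : Vec d → ℝ}, Continuous f → Continuous g →
      Integrable (fun x => f x * g x) (volume.restrict (simplex b)) := fun hf hg => iT (hf.mul hg)
  have iFm : ∀ i, ∀ {f g : Vec d → ℝ}, Continuous f → Continuous g →
      Integrable (fun x => f x * g x) (facetMeasure b i) := fun i {f g} hf hg => iF i (hf.mul hg)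
  -- integration by parts
  have ibp : ∀ j, (∫ x in simplex b, evalAt (R j * z) x * (g j x - evalAt (pderiv j p) x)) +
      (∫ x in simplex b, evalAt (pderiv j (R j * z)) x * (u x - evalAt p x)) =
      ∑ i, ∫ x, facetNormal b i j * (evalAt (R j * z) x * (u x - evalAt p x)) ∂facetMeasure b i := by
    intro j
    have h := ((SmoothApprox.const (isCompact_simplex b) (contDiff_evalAt (R j * z))).mul
      (measurableSet_simplex b) (hψ.sub (SmoothApprox.const (isCompact_simplex b)
        (contDiff_evalAt p)))).integral_grad b hd j
    simp only [← evalAt_pderiv] at h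
    have i1 : Integrable (fun x => evalAt (R j * z) x * (g j x - evalAt (pderiv j p) x))
        (volume.restrict (simplex b)) := integrable_mul_of_memLp (mT (ce _))
      ((hψ.memLp_grad b j).sub (mT (ce _)))
    have i2 : Integrable (fun x => evalAt (pderiv j (R j * z)) x * (u x - evalAt p x))
        (volume.restrict (simplex b)) := iT ((ce _).mul (hu.sub (ce _)))
    rw [← h, integral_add i1 i2]
  -- `w · ∇u - R · ∇p = (w - R) · ∇u + R · ∇(u - p)`
  have t1 : (∫ x in simplex b, (∑ j, w x j * g j x) * evalAt z x) -
      (∫ x in simplex b, (∑ j, evalAt (R j) x * evalAt (pderiv j p) x) * evalAt z x) =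
      (∑ j, ∫ x in simplex b, ((w x j - evalAt (R j) x) * g j x) * evalAt z x) +
        ∑ j, ∫ x in simplex b, evalAt (R j * z) x * (g j x - evalAt (pderiv j p) x) := by
    have i1 : ∀ j, Integrable (fun x => w x j * g j x * evalAt z x) (volume.restrict (simplex b)) := by
      intro j
      have : Integrable (fun x => (w x j * evalAt z x) * g j x) (volume.restrict (simplex b)) :=
        integrable_mul_of_memLp (mT ((hwc j).mul (ce z))) (hψ.memLp_grad b j)
      exact this.congr (Eventually.of_forall fun x => by simp only; ring)
    have i1' : ∀ j, Integrable (fun x => evalAt (R j) x * g j x * evalAt z x)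
        (volume.restrict (simplex b)) := by
      intro j
      have : Integrable (fun x => (evalAt (R j) x * evalAt z x) * g j x)
        (volume.restrict (simplex b)) :=
        integrable_mul_of_memLp (mT ((ce _).mul (ce z))) (hψ.memLp_grad b j)
      exact this.congr (Eventually.of_forall fun x => by simp only; ring)
    have i2 : ∀ j, Integrable (fun x => evalAt (R j) x * evalAt (pderiv j p) x * evalAt z x)
        (volume.restrict (simplex b)) := fun j => iT (((ce _).mul (ce _)).mul (ce _))
    simp only [Finset.sum_mul]
    rw [integral_finsetSum _ fun j _ => i1 j, integral_finsetSum _ fun j _ => i2 j,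
      ← Finset.sum_sub_distrib, ← Finset.sum_add_distrib]
    refine Finset.sum_congr rfl fun j _ => ?_
    have e1 : ∫ x in simplex b, ((w x j - evalAt (R j) x) * g j x) * evalAt z x =
        (∫ x in simplex b, w x j * g j x * evalAt z x) -
          ∫ x in simplex b, evalAt (R j) x * g j x * evalAt z x := by
      rw [← integral_sub (i1 j) (i1' j)]
      exact integral_congr_ae (Eventually.of_forall fun x => by simp only; ring)
    have e2 : ∫ x in simplex b, evalAt (R j * z) x * (g j x - evalAt (pderiv j p) x) =
        (∫ x in simplex b, evalAt (R j) x * g j x * evalAt z x) -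
          ∫ x in simplex b, evalAt (R j) x * evalAt (pderiv j p) x * evalAt z x := by
      rw [← integral_sub (i1' j) (i2 j)]
      exact integral_congr_ae (Eventually.of_forall fun x => by simp only [evalAt_mul]; ring)
    rw [e1, e2]; ring
  -- `div (R z) = R · ∇z`, and `e · ∇z` is of degree at most `k - 1`, hence orthogonal to `u - p`
  have t2 : ∑ j, ∫ x in simplex b, evalAt (pderiv j (R j * z)) x * (u x - evalAt p x) =
      ∑ j, ∫ x in simplex b, (u x - evalAt p x) *
        ((evalAt (R j) x - e j) * evalAt (pderiv j z) x) := by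
    have h0 : ∀ j, ∫ x in simplex b, (u x - evalAt p x) * (e j * evalAt (pderiv j z) x) = 0 := by
      intro j
      have e1 := hp (MvPolynomial.C (e j) * pderiv j z) (DegLE.C_mul _ (hz.pderiv j))
      have e2 : ∫ x in simplex b, (u x - evalAt p x) * (e j * evalAt (pderiv j z) x) =
          (∫ x in simplex b, u x * evalAt (MvPolynomial.C (e j) * pderiv j z) x) -
            ∫ x in simplex b, evalAt p x * evalAt (MvPolynomial.C (e j) * pderiv j z) x := by
        rw [← integral_sub (iTm hu (ce _)) (iTm (ce _) (ce _))]
        exact integral_congr_ae (Eventually.of_forall fun x => by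
          simp only [evalAt_mul, evalAt_C]; ring)
      rw [e2, e1, sub_self]
    have i1 : ∀ j, Integrable (fun x => evalAt (pderiv j (R j * z)) x * (u x - evalAt p x))
      (volume.restrict (simplex b)) := fun j => iT ((ce _).mul (hu.sub (ce _)))
    have i2 : ∀ j, Integrable (fun x => (u x - evalAt p x) * (e j * evalAt (pderiv j z) x))
      (volume.restrict (simplex b)) := fun j => iT ((hu.sub (ce _)).mul (continuous_const.mul (ce _)))
    have i3 : ∀ j, Integrable (fun x => (u x - evalAt p x) *
        ((evalAt (R j) x - e j) * evalAt (pderiv j z) x)) (volume.restrict (simplex b)) :=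
      fun j => iT ((hu.sub (ce _)).mul (((ce _).sub continuous_const).mul (ce _)))
    rw [← add_zero (∑ j, ∫ x in simplex b, (u x - evalAt p x) *
        ((evalAt (R j) x - e j) * evalAt (pderiv j z) x)),
      ← Finset.sum_eq_zero (s := Finset.univ) fun j _ => h0 j,
      ← integral_finsetSum _ fun j _ => i1 j, ← integral_finsetSum _ fun j _ => i2 j,
      ← integral_finsetSum _ fun j _ => i3 j,
      ← integral_add (integrable_finsetSum _ fun j _ => i3 j) (integrable_finsetSum _ fun j _ => i2 j)]
    refine integral_congr_ae (Eventually.of_forall fun x => ?_)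
    have e1 : ∑ j, evalAt (pderiv j (R j * z)) x = ∑ j, evalAt (R j) x * evalAt (pderiv j z) x := by
      have := congrArg (fun s => evalAt s x) (divPoly_mul R hR z)
      simpa only [evalAt_sum, evalAt_mul] using this
    simp only [← Finset.sum_mul, e1]
    rw [Finset.sum_mul, ← Finset.sum_add_distrib]
    exact Finset.sum_congr rfl fun j _ => by ring
  have t3 : ∑ j, ∑ i, ∫ x, facetNormal b i j * (evalAt (R j * z) x * (u x - evalAt p x))
      ∂facetMeasure b i = ∑ i, ∫ x, inner ℝ (polyField R x) (facetNormal b i) *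
        ((u x - evalAt p x) * evalAt z x) ∂facetMeasure b i := by
    rw [Finset.sum_comm]
    refine Finset.sum_congr rfl fun i _ => ?_
    have i1 : ∀ j, Integrable (fun x => facetNormal b i j * (evalAt (R j * z) x * (u x - evalAt p x)))
        (facetMeasure b i) := fun j => iF i (continuous_const.mul ((ce _).mul (hu.sub (ce _))))
    rw [← integral_finsetSum _ fun j _ => i1 j]
    refine integral_congr_ae (Eventually.of_forall fun x => ?_)
    simp only [inner_eq_sum, Finset.sum_mul, polyField_apply, evalAt_mul]
    exact Finset.sum_congr rfl fun j _ => by ring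
  -- `u - p = (u - q) + (q - p)` on the facet; `⟨e, n⟩ z` is of degree at most `k`, hence orthogonal
  -- to `u - q`, and the coefficients of `(q - p) z` combine into `z - (zF + z) / 2 = (z - zF) / 2`
  have t4 : ∀ i, (∫ x, inner ℝ (polyField R x) (facetNormal b i) *
      ((u x - evalAt p x) * evalAt z x) ∂facetMeasure b i) -
      1 / 2 * (∫ x, inner ℝ (polyField R x) (facetNormal b i) *
        ((evalAt (q i) x - evalAt p x) * (evalAt (zF i) x + evalAt z x)) ∂facetMeasure b i) =
      (∫ x, inner ℝ (polyField R x - e) (facetNormal b i) * (u x - evalAt (q i) x) * evalAt z x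
        ∂facetMeasure b i) +
      1 / 2 * ∫ x, inner ℝ (polyField R x) (facetNormal b i) *
        (evalAt (q i) x - evalAt p x) * (evalAt z x - evalAt (zF i) x) ∂facetMeasure b i := by
    intro i
    have i1 : Integrable (fun x => inner ℝ (polyField R x) (facetNormal b i) *
      ((u x - evalAt p x) * evalAt z x)) (facetMeasure b i) :=
      iF i ((cn i).mul ((hu.sub (ce _)).mul (ce _)))
    have i2 : Integrable (fun x => 1 / 2 * (inner ℝ (polyField R x) (facetNormal b i) *
        ((evalAt (q i) x - evalAt p x) * (evalAt (zF i) x + evalAt z x)))) (facetMeasure b i) :=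
      iF i (continuous_const.mul ((cn i).mul (((ce _).sub (ce _)).mul ((ce _).add (ce _)))))
    have i3 : Integrable (fun x => inner ℝ (polyField R x - e) (facetNormal b i) *
        (u x - evalAt (q i) x) * evalAt z x) (facetMeasure b i) :=
      iF i (((cn' i).mul (hu.sub (ce _))).mul (ce _))
    have i4 : Integrable (fun x => 1 / 2 * (inner ℝ (polyField R x) (facetNormal b i) *
        (evalAt (q i) x - evalAt p x) * (evalAt z x - evalAt (zF i) x))) (facetMeasure b i) :=
      iF i (continuous_const.mul (((cn i).mul ((ce _).sub (ce _))).mul ((ce _).sub (ce _))))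
    have i5 : Integrable (fun x => inner ℝ e (facetNormal b i) * (u x * evalAt z x -
        evalAt (q i) x * evalAt z x)) (facetMeasure b i) :=
      iF i (continuous_const.mul ((hu.mul (ce _)).sub ((ce _).mul (ce _))))
    have h0 : ∫ x, inner ℝ e (facetNormal b i) * (u x * evalAt z x -
        evalAt (q i) x * evalAt z x) ∂facetMeasure b i = 0 := by
      rw [integral_const_mul, integral_sub (iFm i hu (ce _)) (iFm i (ce _) (ce _)),
        hq i z hz, sub_self, mul_zero]
    have i34 : Integrable (fun x => inner ℝ (polyField R x - e) (facetNormal b i) *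
        (u x - evalAt (q i) x) * evalAt z x + 1 / 2 * (inner ℝ (polyField R x) (facetNormal b i) *
        (evalAt (q i) x - evalAt p x) * (evalAt z x - evalAt (zF i) x))) (facetMeasure b i) :=
      i3.add i4
    rw [← integral_const_mul, ← integral_const_mul, ← integral_sub i1 i2, ← integral_add i3 i4,
      ← add_zero (∫ x, _ + _ ∂facetMeasure b i), ← h0, ← integral_add i34 i5]
    refine integral_congr_ae (Eventually.of_forall fun x => ?_)
    simp only [inner_sub_left]; ring
  have t4' := Finset.sum_congr (rfl : (Finset.univ : Finset ι) = Finset.univ) fun i _ => t4 i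
  rw [Finset.sum_sub_distrib, Finset.sum_add_distrib, ← Finset.mul_sum, ← Finset.mul_sum] at t4'
  have ibp' := Finset.sum_congr (rfl : (Finset.univ : Finset (Fin d)) = Finset.univ) fun j _ => ibp j
  rw [Finset.sum_add_distrib, t2, t3] at ibp'
  rw [t1]
  linarith

lemma abs_integral_mul_mul_le {X : Type*} [MeasurableSpace X] {μ : Measure X} {f g h : X → ℝ}
    {B : ℝ} (hB : 0 ≤ B) (hf : AEStronglyMeasurable f μ) (hfB : ∀ᵐ x ∂μ, |f x| ≤ B)
    (hg : MemLp g 2 μ) (hh : MemLp h 2 μ) : |∫ x, f x * g x * h x ∂μ| ≤ B * (l2 μ g * l2 μ h) := by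
  have h1 : ∀ᵐ x ∂μ, |f x * g x| ≤ B * |g x| := hfB.mono fun x hx => by
    rw [abs_mul]; exact mul_le_mul_of_nonneg_right hx (abs_nonneg _)
  have h2 : MemLp (fun x => f x * g x) 2 μ := by
    refine MemLp.mono (g := fun x => B * g x) (hg.const_mul B) (hf.mul hg.1) (h1.mono fun x hx => ?_)
    rw [Real.norm_eq_abs, Real.norm_eq_abs, abs_mul B, abs_of_nonneg hB]; exact hx
  refine (abs_integral_mul_le h2 hh).trans ?_
  rw [← mul_assoc]
  exact mul_le_mul_of_nonneg_right (l2_mul_le hB hg h1) (l2_nonneg _)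

lemma abs_inner_facetNormal_le (hd : 1 ≤ d) (i : ι) {ξ : Vec d} {B : ℝ} (h : ∀ j, |ξ j| ≤ B) :
    |inner ℝ ξ (facetNormal b i)| ≤ d * B := by
  refine (abs_real_inner_le_norm _ _).trans ?_
  rw [norm_facetNormal b i hd, mul_one]
  refine (norm_le_sum_abs_coord ξ).trans ((Finset.sum_le_sum fun j _ => h j).trans (le_of_eq ?_))
  simp

/-- The bound on the local consistency error which results from `convection_identity`. Only the last
term involves the size `M` of `R`, and it carries the jump `zF - z`; in the others one factor
`w - R` or `R - e` gains a power of `r`, which pays for the derivative or the trace of `z`. -/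
lemma convection_estimate (hd : 1 ≤ d) (H : ShapeRegular b ϱ c r) {k : ℕ} {u : Vec d → ℝ}
    (hu : Continuous u)
    {g : Fin d → Vec d → ℝ} {ψ : ℕ → Vec d → ℝ} (hψ : SmoothApprox (simplex b) u g ψ)
    {w : Vec d → Vec d} (hw : Continuous w) {R : Fin d → MvPolynomial (Fin d) ℝ}
    (hR : divPoly R = 0) {p z : MvPolynomial (Fin d) ℝ} {q zF : ι → MvPolynomial (Fin d) ℝ}
    (hz : DegLE k z)
    (hp : ∀ s, DegLE ((k : ℤ) - 1) s →
      ∫ x in simplex b, evalAt p x * evalAt s x = ∫ x in simplex b, u x * evalAt s x)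
    (hq : ∀ i s, DegLE k s →
      ∫ x, evalAt (q i) x * evalAt s x ∂facetMeasure b i = ∫ x, u x * evalAt s x ∂facetMeasure b i)
    {e : Vec d} {A A' B D M K : ℝ} (hB0 : 0 ≤ B) (hD0 : 0 ≤ D) (hM0 : 0 ≤ M)
    (hA : l2 (volume.restrict (simplex b)) (fun x => u x - evalAt p x) ≤ r * A)
    (hAq : ∀ i, √r * l2 (facetMeasure b i) (fun x => u x - evalAt (q i) x) ≤ r * A)
    (hAp : ∀ i, √r * l2 (facetMeasure b i) (fun x => evalAt (q i) x - evalAt p x) ≤ r * A)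
    (hA' : ∀ j, l2 (volume.restrict (simplex b)) (fun x => w x j - evalAt (R j) x) ≤ A')
    (hB : ∀ j, ∀ᵐ x ∂volume.restrict (simplex b), |g j x| ≤ B)
    (hD : ∀ j, ∀ x ∈ simplex b, |evalAt (R j) x - e j| ≤ D)
    (hM : ∀ j, ∀ x ∈ simplex b, |evalAt (R j) x| ≤ M)
    (hKF : ∀ i, √r * l2 (facetMeasure b i) (evalAt z) ≤
      K * l2 (volume.restrict (simplex b)) (evalAt z))
    (hKD : ∀ j, r * l2 (volume.restrict (simplex b)) (evalAt (pderiv j z)) ≤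
      K * l2 (volume.restrict (simplex b)) (evalAt z)) :
    |(∫ x in simplex b, (∑ j, w x j * g j x) * evalAt z x) -
      (∫ x in simplex b, (∑ j, evalAt (R j) x * evalAt (pderiv j p) x) * evalAt z x) -
      1 / 2 * ∑ i, ∫ x, inner ℝ (polyField R x) (facetNormal b i) *
        ((evalAt (q i) x - evalAt p x) * (evalAt (zF i) x + evalAt z x)) ∂facetMeasure b i| ≤
    (d * B * A' + d * (d + 2) * (D * A * K)) * l2 (volume.restrict (simplex b)) (evalAt z) +
      d * (M * (√r * A)) * ∑ i, l2 (facetMeasure b i) (fun x => evalAt (zF i) x - evalAt z x) := by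
  rw [convection_identity hd hu hψ hw hR hz hp hq e]
  have hr := H.pos
  have hsr : 0 < √r := Real.sqrt_pos.2 hr
  have hrr : √r * √r = r := Real.mul_self_sqrt hr.le
  have hA0 : 0 ≤ A := by
    have := (l2_nonneg _).trans hA
    exact nonneg_of_mul_nonneg_right this hr
  obtain ⟨Z, hZ⟩ : ∃ Z, Z = l2 (volume.restrict (simplex b)) (evalAt z) := ⟨_, rfl⟩
  have hZ0 : 0 ≤ Z := by rw [hZ]; exact l2_nonneg _
  rw [← hZ] at hKF hKD ⊢
  have ce : ∀ s : MvPolynomial (Fin d) ℝ, Continuous (evalAt s) := continuous_evalAt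
  have hwc : ∀ j, Continuous fun x => w x j := fun j =>
    (EuclideanSpace.proj j : Vec d →L[ℝ] ℝ).continuous.comp hw
  have mT : ∀ {f : Vec d → ℝ}, Continuous f → MemLp f 2 (volume.restrict (simplex b)) :=
    fun hf => memLp_simplex b hf 2
  have mF : ∀ i, ∀ {f : Vec d → ℝ}, Continuous f → MemLp f 2 (facetMeasure b i) :=
    fun i {f} hf => memLp_facetMeasure b i hd hf 2
  have aT : ∀ᵐ x ∂volume.restrict (simplex b), x ∈ simplex b :=
    ae_restrict_mem (measurableSet_simplex b)
  have aF : ∀ i, ∀ᵐ x ∂facetMeasure b i, x ∈ simplex b := fun i =>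
    (ae_mem_facet b i).mono fun x hx => facet_subset b i hx
  -- the error in the advecting field
  have b1 : ∀ j ∈ Finset.univ, |∫ x in simplex b, ((w x j - evalAt (R j) x) * g j x) * evalAt z x| ≤
      B * A' * Z := by
    intro j _
    have h := abs_integral_mul_mul_le hB0 (hψ.memLp_grad b j).1 (hB j)
      (mT ((hwc j).sub (ce (R j)))) (mT (ce z))
    have h2 : ∫ x in simplex b, ((w x j - evalAt (R j) x) * g j x) * evalAt z x =
        ∫ x in simplex b, g j x * (w x j - evalAt (R j) x) * evalAt z x :=
      integral_congr_ae (Eventually.of_forall fun x => by simp only; ring)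
    rw [h2, mul_assoc]
    refine h.trans (mul_le_mul_of_nonneg_left ?_ hB0)
    rw [← hZ]
    exact mul_le_mul_of_nonneg_right (hA' j) hZ0
  -- the oscillation of `R` on the element
  have b2 : ∀ j ∈ Finset.univ, |∫ x in simplex b, (u x - evalAt p x) *
      ((evalAt (R j) x - e j) * evalAt (pderiv j z) x)| ≤ D * A * K * Z := by
    intro j _
    have h := abs_integral_mul_mul_le hD0 ((ce (R j)).sub continuous_const).aestronglyMeasurable
      (aT.mono fun x hx => hD j x hx) (mT (hu.sub (ce p))) (mT (ce (pderiv j z)))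
    have h2 : ∫ x in simplex b, (u x - evalAt p x) *
        ((evalAt (R j) x - e j) * evalAt (pderiv j z) x) =
        ∫ x in simplex b, (evalAt (R j) x - e j) * (u x - evalAt p x) * evalAt (pderiv j z) x :=
      integral_congr_ae (Eventually.of_forall fun x => by simp only; ring)
    rw [h2]
    refine h.trans ?_
    have h3 := mul_le_mul_of_nonneg_right hA
      (l2_nonneg (μ := volume.restrict (simplex b)) (evalAt (pderiv j z)))
    have h4 := mul_le_mul_of_nonneg_left (hKD j) hA0
    calc _ ≤ D * (r * A * l2 (volume.restrict (simplex b)) (evalAt (pderiv j z))) :=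
          mul_le_mul_of_nonneg_left h3 hD0
      _ = D * (A * (r * l2 (volume.restrict (simplex b)) (evalAt (pderiv j z)))) := by ring
      _ ≤ D * (A * (K * Z)) := mul_le_mul_of_nonneg_left h4 hD0
      _ = _ := by ring
  have hdivr : ∀ {a x : ℝ}, √r * x ≤ r * a → x ≤ √r * a := fun {a x} h => by
    refine le_of_mul_le_mul_left (h.trans (le_of_eq ?_)) hsr
    rw [← mul_assoc, hrr]
  -- the oscillation of `R` on the facets
  have b3 : ∀ i ∈ Finset.univ, |∫ x, inner ℝ (polyField R x - e) (facetNormal b i) *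
      (u x - evalAt (q i) x) * evalAt z x ∂facetMeasure b i| ≤ d * D * A * K * Z := by
    intro i _
    have h := abs_integral_mul_mul_le (B := d * D) (by positivity)
      (((continuous_polyField R).sub continuous_const).inner
        continuous_const).aestronglyMeasurable
      ((aF i).mono fun x hx => abs_inner_facetNormal_le (b := b) hd i (ξ := polyField R x - e)
        fun j => hD j x hx) (mF i (hu.sub (ce (q i)))) (mF i (ce z))
    refine h.trans ?_
    have h3 := mul_le_mul_of_nonneg_right (hdivr (hAq i))
      (l2_nonneg (μ := facetMeasure b i) (evalAt z))
    have h4 := mul_le_mul_of_nonneg_left (hKF i) hA0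
    have hdD : 0 ≤ d * D := by positivity
    calc _ ≤ d * D * (√r * A * l2 (facetMeasure b i) (evalAt z)) :=
          mul_le_mul_of_nonneg_left h3 hdD
      _ = d * D * (A * (√r * l2 (facetMeasure b i) (evalAt z))) := by ring
      _ ≤ d * D * (A * (K * Z)) := mul_le_mul_of_nonneg_left h4 hdD
      _ = _ := by ring
  -- the jumps of the test function
  have b4 : ∀ i ∈ Finset.univ, |∫ x, inner ℝ (polyField R x) (facetNormal b i) *
      (evalAt (q i) x - evalAt p x) * (evalAt z x - evalAt (zF i) x) ∂facetMeasure b i| ≤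
      d * (M * (√r * A)) * l2 (facetMeasure b i) (fun x => evalAt (zF i) x - evalAt z x) := by
    intro i _
    have h := abs_integral_mul_mul_le (B := d * M) (by positivity)
      ((continuous_polyField R).inner continuous_const).aestronglyMeasurable
      ((aF i).mono fun x hx => abs_inner_facetNormal_le (b := b) hd i (ξ := polyField R x)
        fun j => hM j x hx) (mF i ((ce (q i)).sub (ce p))) (mF i ((ce z).sub (ce (zF i))))
    have h' : |∫ x, inner ℝ (polyField R x) (facetNormal b i) *
        (evalAt (q i) x - evalAt p x) * (evalAt z x - evalAt (zF i) x) ∂facetMeasure b i| ≤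
        d * M * (l2 (facetMeasure b i) (fun x => evalAt (q i) x - evalAt p x) *
          l2 (facetMeasure b i) (fun x => evalAt z x - evalAt (zF i) x)) := h
    refine h'.trans ?_
    have h5 : l2 (facetMeasure b i) (fun x => evalAt z x - evalAt (zF i) x) =
        l2 (facetMeasure b i) (fun x => evalAt (zF i) x - evalAt z x) := by
      rw [← l2_norm, ← l2_norm (fun x => evalAt (zF i) x - evalAt z x)]
      simp only [norm_sub_rev]
    rw [h5]
    have h3 := mul_le_mul_of_nonneg_right (hdivr (hAp i))
      (l2_nonneg (μ := facetMeasure b i) fun x => evalAt (zF i) x - evalAt z x)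
    have hdM : 0 ≤ d * M := by positivity
    refine (mul_le_mul_of_nonneg_left h3 hdM).trans (le_of_eq ?_)
    ring
  have s1 := (Finset.abs_sum_le_sum_abs _ _).trans (Finset.sum_le_sum b1)
  have s2 := (Finset.abs_sum_le_sum_abs _ _).trans (Finset.sum_le_sum b2)
  have s3 := (Finset.abs_sum_le_sum_abs _ _).trans (Finset.sum_le_sum b3)
  have s4 := (Finset.abs_sum_le_sum_abs _ _).trans (Finset.sum_le_sum b4)
  rw [Finset.sum_const, Finset.card_univ, Fintype.card_fin, nsmul_eq_mul] at s1 s2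
  rw [Finset.sum_const, Finset.card_univ, card_index b, nsmul_eq_mul] at s3
  rw [← Finset.mul_sum] at s4
  push_cast at s3
  have s4' : 0 ≤ d * (M * (√r * A)) * ∑ i, l2 (facetMeasure b i)
      (fun x => evalAt (zF i) x - evalAt z x) := le_trans (abs_nonneg _) s4
  have tri : ∀ a b' c' e' : ℝ, |a - b' + c' + 1 / 2 * e'| ≤ |a| + |b'| + |c'| + |e'| := by
    intro a b' c' e'
    refine abs_le.2 ⟨?_, ?_⟩ <;>
      linarith [le_abs_self a, neg_abs_le a, le_abs_self b', neg_abs_le b', le_abs_self c',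
        neg_abs_le c', le_abs_self e', neg_abs_le e', abs_nonneg e']
  refine (tri _ _ _ _).trans ((add_le_add (add_le_add (add_le_add s1 s2) s3) s4).trans (le_of_eq ?_))
  ring

end


/-! ### Consistency estimates on a simplex -/

section

open MvPolynomial

variable {d : ℕ} {ι : Type} [Fintype ι]

/-- The field `u` on `simplex b` is a limit of smooth fields, with the gradient `G`, and the weak
derivatives of order `k + 1` of its components exist and are bounded by `S` in `L²`. -/
structure LocalSobolev (b : AffineBasis ι ℝ (Vec d)) (k : ℕ) (u : Vec d → Vec d)
    (G : Fin d → Fin d → Vec d → ℝ) (S : ℝ) : Prop where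
  continuous : Continuous u
  approx : ∀ i, ∃ ψ, SmoothApprox (simplex b) (fun x => u x i) (G i) ψ
  jet : ∀ i, ∃ a, HasWeakJet (interior (simplex b)) (k + 1) (fun x => u x i) a ∧
    (∀ j, a 1 (fun _ => j) =ᵐ[volume.restrict (simplex b)] G i j) ∧
    ∀ J, l2 (volume.restrict (simplex b)) (a (k + 1) J) ≤ S
  nonneg : 0 ≤ S

lemma LocalSobolev.continuous_coord {b : AffineBasis ι ℝ (Vec d)} {k : ℕ} {u : Vec d → Vec d}
    {G : Fin d → Fin d → Vec d → ℝ} {S : ℝ} (h : LocalSobolev b k u G S) (i : Fin d) :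
    Continuous fun x => u x i :=
  (EuclideanSpace.proj i : Vec d →L[ℝ] ℝ).continuous.comp h.continuous

lemma contDiff_polyField (P : Fin d → MvPolynomial (Fin d) ℝ) : ContDiff ℝ ∞ (polyField P) := by
  have h1 : ContDiff ℝ ∞ fun x => (polyField P x).ofLp := contDiff_pi.2 fun i => contDiff_evalAt (P i)
  exact (PiLp.continuousLinearEquiv 2 ℝ (fun _ : Fin d => ℝ)).symm.contDiff.comp h1

lemma fderiv_polyField_apply (P : Fin d → MvPolynomial (Fin d) ℝ) (x ξ : Vec d) (l : Fin d) :
    fderiv ℝ (polyField P) x ξ l = ∑ j, ξ j * evalAt (pderiv j (P l)) x := by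
  rw [fderiv_apply_coord (contDiff_polyField P)]
  simp only [polyField_apply]
  rw [fderiv_evalAt]
  exact Finset.sum_congr rfl fun j _ => mul_comm _ _

/-- The convective form of an element, for polynomials. -/
def polyConv (b : AffineBasis ι ℝ (Vec d)) (R P Z : Fin d → MvPolynomial (Fin d) ℝ)
    (Q ZF : ι → Fin d → MvPolynomial (Fin d) ℝ) : ℝ :=
  (∫ x in simplex b, inner ℝ (fderiv ℝ (polyField P) x (polyField R x)) (polyField Z x)) +
    1 / 2 * ∑ i, ∫ x, inner ℝ (polyField R x) (facetNormal b i) *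
      inner ℝ (polyField (Q i) x - polyField P x) (polyField (ZF i) x + polyField Z x)
        ∂facetMeasure b i

lemma polyConv_eq_sum (b : AffineBasis ι ℝ (Vec d)) (hd : 1 ≤ d)
    (R P Z : Fin d → MvPolynomial (Fin d) ℝ) (Q ZF : ι → Fin d → MvPolynomial (Fin d) ℝ) :
    polyConv b R P Z Q ZF = ∑ l,
      ((∫ x in simplex b, (∑ j, evalAt (R j) x * evalAt (pderiv j (P l)) x) * evalAt (Z l) x) +
      1 / 2 * ∑ i, ∫ x, inner ℝ (polyField R x) (facetNormal b i) *
        ((evalAt (Q i l) x - evalAt (P l) x) * (evalAt (ZF i l) x + evalAt (Z l) x))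
          ∂facetMeasure b i) := by
  have ce : ∀ s : MvPolynomial (Fin d) ℝ, Continuous (evalAt s) := continuous_evalAt
  have i1 : ∀ l, Integrable (fun x => (∑ j, evalAt (R j) x * evalAt (pderiv j (P l)) x) *
      evalAt (Z l) x) (volume.restrict (simplex b)) := fun l => integrableOn_simplex b
    ((continuous_finsetSum _ fun j _ => (ce _).mul (ce _)).mul (ce _))
  have i2 : ∀ i l, Integrable (fun x => inner ℝ (polyField R x) (facetNormal b i) *
      ((evalAt (Q i l) x - evalAt (P l) x) * (evalAt (ZF i l) x + evalAt (Z l) x)))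
      (facetMeasure b i) := fun i l => integrable_facetMeasure b i hd
    (((continuous_polyField R).inner continuous_const).mul
      (((ce _).sub (ce _)).mul ((ce _).add (ce _))))
  rw [Finset.sum_add_distrib, ← Finset.mul_sum, Finset.sum_comm, polyConv,
    ← integral_finsetSum _ fun l _ => i1 l]
  congr 1
  · refine integral_congr_ae (Eventually.of_forall fun x => ?_)
    simp only [inner_eq_sum, fderiv_polyField_apply, polyField_apply]
  · congr 1
    refine Finset.sum_congr rfl fun i _ => ?_
    rw [← integral_finsetSum _ fun l _ => i2 i l]
    refine integral_congr_ae (Eventually.of_forall fun x => ?_)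
    simp only
    rw [inner_eq_sum (polyField (Q i) x - polyField P x), Finset.mul_sum]
    rfl

/-- The consistency estimates on an element. The first conclusion concerns the stabilization, the
second one the convective form, for an advecting field `w` of size `W` and with oscillation `r Bw`
about the center of the inscribed ball. -/
theorem exists_element_estimate (d k : ℕ) (ϱ : ℝ) : ∃ C : ℝ, 0 < C ∧ ∀ {ι : Type} [Fintype ι]
    (b : AffineBasis ι ℝ (Vec d)) (c : Vec d) (r : ℝ), 1 ≤ d → ShapeRegular b ϱ c r →
      ∀ (v : Vec d → Vec d) (Gv : Fin d → Fin d → Vec d → ℝ) (Sv : ℝ), LocalSobolev b k v Gv Sv →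
      ∀ P Q, IsLocalInterp b k v P Q →
      ∀ (ZF : ι → Fin d → MvPolynomial (Fin d) ℝ) (Z : Fin d → MvPolynomial (Fin d) ℝ),
        (∀ l, DegLE k (Z l)) →
      |∑ i, ∫ x, inner ℝ (polyField (Q i) x - polyField P x) (polyField (ZF i) x - polyField Z x)
        ∂facetMeasure b i| ≤ C * (r ^ k * √r * Sv *
          ∑ i, l2 (facetMeasure b i) (fun x => polyField (ZF i) x - polyField Z x)) ∧
      ∀ (w : Vec d → Vec d) (Gw : Fin d → Fin d → Vec d → ℝ) (Sw : ℝ), LocalSobolev b k w Gw Sw →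
      ∀ R Q', IsLocalInterp b k w R Q' →
      ∀ Bv Bw W : ℝ, 0 ≤ Bv → 0 ≤ Bw → 0 ≤ W →
      (∀ l j, ∀ᵐ x ∂volume.restrict (simplex b), |Gv l j x| ≤ Bv) →
      (∀ x ∈ simplex b, ∀ i, |w x i - w c i| ≤ r * Bw) →
      (∀ x ∈ simplex b, ∀ i, |w x i| ≤ W) →
      (∀ᵐ x ∂volume.restrict (simplex b), ∑ i, Gw i i x = 0) →
      |(∫ x in simplex b, ∑ l, (∑ j, w x j * Gv l j x) * evalAt (Z l) x) - polyConv b R P Z Q ZF| ≤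
        C * (r ^ (k + 1) * (Bv * Sw + Bw * Sv) * l2 (volume.restrict (simplex b)) (polyField Z) +
          W * (r ^ k * √r * Sv *
            ∑ i, l2 (facetMeasure b i) (fun x => polyField (ZF i) x - polyField Z x))) := by
  obtain ⟨C1, hC1, hint⟩ := exists_interp_approx d k ϱ
  obtain ⟨C2, hC2, hbd⟩ := exists_interp_bound d k ϱ
  obtain ⟨C3, hC3, htr⟩ := exists_discrete_trace d k ϱ
  obtain ⟨CA, hCA⟩ : ∃ x : ℝ, x = d * (d * C1 + d * (d + 2) * (C1 * C2 * C3)) := ⟨_, rfl⟩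
  obtain ⟨CB, hCB⟩ : ∃ x : ℝ, x = d * (d * (C2 * C1)) := ⟨_, rfl⟩
  have hCA0 : 0 ≤ CA := by rw [hCA]; positivity
  have hCB0 : 0 ≤ CB := by rw [hCB]; positivity
  refine ⟨CA + CB + d * C1 + 1, by positivity, ?_⟩
  intro ι _ b c r hd H v Gv Sv hv P Q hP ZF Z hZ
  have hr := H.pos
  have hsr : 0 < √r := Real.sqrt_pos.2 hr
  have hSv := hv.nonneg
  obtain ⟨Δ, hΔ⟩ : ∃ x : ℝ, x =
    ∑ i, l2 (facetMeasure b i) (fun x => polyField (ZF i) x - polyField Z x) := ⟨_, rfl⟩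
  have hΔ0 : 0 ≤ Δ := by rw [hΔ]; exact Finset.sum_nonneg fun i _ => l2_nonneg _
  rw [← hΔ]
  choose ψv hψv using hv.approx
  choose av hav haG haS using hv.jet
  obtain ⟨n1, n2, n3⟩ := hint b c r hd H v hv.continuous P Q hP Gv ψv hψv av Sv hav haG haS hSv
  have mF : ∀ i, ∀ {f : Vec d → Vec d}, Continuous f → MemLp f 2 (facetMeasure b i) :=
    fun i {f} hf => memLp_facetMeasure b i hd hf 2
  have cpF : ∀ P : Fin d → MvPolynomial (Fin d) ℝ, Continuous (polyField P) := continuous_polyField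
  have hΔl : ∀ l, ∑ i, l2 (facetMeasure b i) (fun x => evalAt (ZF i l) x - evalAt (Z l) x) ≤ Δ := by
    intro l
    rw [hΔ]
    exact Finset.sum_le_sum fun i _ => l2_apply_le (mF i ((cpF (ZF i)).sub (cpF Z))) l
  have hrk : r ^ (k + 1) = √r * (r ^ k * √r) := by
    rw [pow_succ]; nth_rewrite 2 [← Real.mul_self_sqrt hr.le]; ring
  have hX0 : 0 ≤ r ^ k * √r * Sv := by positivity
  refine ⟨?_, ?_⟩
  · have h1 : ∀ i ∈ Finset.univ, |∫ x, inner ℝ (polyField (Q i) x - polyField P x)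
        (polyField (ZF i) x - polyField Z x) ∂facetMeasure b i| ≤ d * C1 * (r ^ k * √r * Sv) *
        l2 (facetMeasure b i) (fun x => polyField (ZF i) x - polyField Z x) := by
      intro i _
      refine (abs_integral_inner_le (mF i ((cpF (Q i)).sub (cpF P)))
        (mF i ((cpF (ZF i)).sub (cpF Z)))).trans (mul_le_mul_of_nonneg_right ?_ (l2_nonneg _))
      refine (l2_le_sum_coord (mF i ((cpF (Q i)).sub (cpF P)))).trans ?_
      have h2 : ∀ l ∈ Finset.univ, l2 (facetMeasure b i)
          (fun x => (polyField (Q i) x - polyField P x) l) ≤ C1 * (r ^ k * √r * Sv) := by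
        intro l _
        have h3 := n3 i l
        rw [hrk] at h3
        refine le_of_mul_le_mul_left (h3.trans (le_of_eq ?_)) hsr
        ring
      refine (Finset.sum_le_sum h2).trans (le_of_eq ?_)
      rw [Finset.sum_const, Finset.card_univ, Fintype.card_fin, nsmul_eq_mul]; ring
    refine (Finset.abs_sum_le_sum_abs _ _).trans ((Finset.sum_le_sum h1).trans ?_)
    rw [← Finset.mul_sum, ← hΔ, mul_assoc (d * C1)]
    refine mul_le_mul_of_nonneg_right (by linarith) (mul_nonneg hX0 hΔ0)
  · intro w Gw Sw hw R Q' hR Bv Bw W hBv hBw hW hGv hosc hWb hdiv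
    have hSw := hw.nonneg
    choose ψw hψw using hw.approx
    choose aw haw haGw haSw using hw.jet
    obtain ⟨m1, -, -⟩ := hint b c r hd H w hw.continuous R Q' hR Gw ψw hψw aw Sw haw haGw haSw hSw
    have hdR := hR.divPoly_eq_zero hd H hw.continuous hψw hdiv
    have hD := hbd b c r hd H w hw.continuous R Q' hR (w c) (r * Bw) hosc
    have hM := hbd b c r hd H w hw.continuous R Q' hR 0 W (by simpa using hWb)
    obtain ⟨N, hN⟩ : ∃ x, x = l2 (volume.restrict (simplex b)) (polyField Z) := ⟨_, rfl⟩
    have hN0 : 0 ≤ N := by rw [hN]; exact l2_nonneg _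
    have hZl : ∀ l, l2 (volume.restrict (simplex b)) (evalAt (Z l)) ≤ N := fun l => by
      rw [hN]; exact l2_apply_le (memLp_simplex b (cpF Z) 2) l
    rw [← hN]
    have est : ∀ l ∈ Finset.univ,
        |(∫ x in simplex b, (∑ j, w x j * Gv l j x) * evalAt (Z l) x) -
        ((∫ x in simplex b, (∑ j, evalAt (R j) x * evalAt (pderiv j (P l)) x) * evalAt (Z l) x) +
        1 / 2 * ∑ i, ∫ x, inner ℝ (polyField R x) (facetNormal b i) *
        ((evalAt (Q i l) x - evalAt (P l) x) * (evalAt (ZF i l) x + evalAt (Z l) x))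
          ∂facetMeasure b i)| ≤
        (d * C1 + d * (d + 2) * (C1 * C2 * C3)) * (r ^ (k + 1) * (Bv * Sw + Bw * Sv) * N) +
          d * (C2 * C1) * (W * (r ^ k * √r * Sv * Δ)) := by
      intro l _
      rw [← sub_sub]
      have hA : ∀ {x : ℝ}, x ≤ C1 * r ^ (k + 1) * Sv → x ≤ r * (C1 * r ^ k * Sv) := fun {x} h =>
        h.trans (le_of_eq (by rw [pow_succ]; ring))
      have h := convection_estimate hd H (hv.continuous_coord l) (hψv l) hw.continuous hdR (hZ l)
        (zF := fun i => ZF i l)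
        (hP.moments l) (fun i s hs => hP.face i l s hs) (e := w c) (A := C1 * r ^ k * Sv)
        (A' := C1 * r ^ (k + 1) * Sw) (B := Bv) (D := C2 * (r * Bw)) (M := C2 * W) (K := C3)
        hBv (by positivity) (by positivity) (hA (n1 l)) (fun i => hA (n2 i l))
        (fun i => hA (n3 i l)) m1 (hGv l) hD
        (by simpa using hM) (htr b c r hd H (Z l) (hZ l)).1 (htr b c r hd H (Z l) (hZ l)).2
      refine h.trans (add_le_add ?_ ?_)
      · have e1 : (d * Bv * (C1 * r ^ (k + 1) * Sw) +
            d * (d + 2) * (C2 * (r * Bw) * (C1 * r ^ k * Sv) * C3)) =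
            (d * C1) * (r ^ (k + 1) * (Bv * Sw)) +
              (d * (d + 2) * (C1 * C2 * C3)) * (r ^ (k + 1) * (Bw * Sv)) := by
          rw [pow_succ]; ring
        have e2 : 0 ≤ r ^ (k + 1) * (Bv * Sw) := by positivity
        have e3 : 0 ≤ r ^ (k + 1) * (Bw * Sv) := by positivity
        have e4 : 0 ≤ d * C1 := by positivity
        have e5 : 0 ≤ d * (d + 2) * (C1 * C2 * C3) := by positivity
        rw [← mul_assoc (d * C1 + d * (d + 2) * (C1 * C2 * C3) : ℝ)]
        refine mul_le_mul ?_ (hZl l) (l2_nonneg _) (by positivity)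
        rw [e1, mul_add (r ^ (k + 1)), mul_add, add_mul, add_mul]
        nlinarith [mul_nonneg e4 e3, mul_nonneg e5 e2]
      · have e0 : d * (C2 * W * (√r * (C1 * r ^ k * Sv))) =
          d * (C2 * C1) * (W * (r ^ k * √r * Sv)) := by ring
        rw [e0, mul_assoc (d * (C2 * C1) : ℝ), mul_assoc W]
        refine mul_le_mul_of_nonneg_left (mul_le_mul_of_nonneg_left ?_ hW) (by positivity)
        exact mul_le_mul_of_nonneg_left (hΔl l) hX0
    have i1 : ∀ l, Integrable (fun x => (∑ j, w x j * Gv l j x) * evalAt (Z l) x)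
        (volume.restrict (simplex b)) := by
      intro l
      simp only [Finset.sum_mul]
      refine integrable_finsetSum _ fun j _ => ?_
      have : Integrable (fun x => (w x j * evalAt (Z l) x) * Gv l j x)
          (volume.restrict (simplex b)) :=
        integrable_mul_of_memLp (memLp_simplex b ((hw.continuous_coord j).mul
          (continuous_evalAt _)) 2) ((hψv l).memLp_grad b j)
      exact this.congr (Eventually.of_forall fun x => by simp only; ring)
    rw [polyConv_eq_sum b hd, integral_finsetSum _ fun l _ => i1 l, ← Finset.sum_sub_distrib]
    refine (Finset.abs_sum_le_sum_abs _ _).trans ((Finset.sum_le_sum est).trans ?_)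
    rw [Finset.sum_const, Finset.card_univ, Fintype.card_fin, nsmul_eq_mul, mul_add (d : ℝ),
      ← mul_assoc, ← mul_assoc (d : ℝ) (d * (C2 * C1)), ← hCA, ← hCB, mul_add (CA + CB + d * C1 + 1)]
    have e4 : 0 ≤ d * C1 := by positivity
    refine add_le_add (mul_le_mul_of_nonneg_right (by linarith) (by positivity))
      (mul_le_mul_of_nonneg_right (by linarith) (mul_nonneg hW (mul_nonneg hX0 hΔ0)))

end


/-! ### Sobolev regularity on a mesh element -/

section

variable {d : ℕ}

lemma IsWeakDeriv.congr {m : ℕ} {J : Fin m → Fin d} {U : Set (Vec d)} {f f' g : Vec d → ℝ}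
    (h : IsWeakDeriv U J f g) (hf : f =ᵐ[volume.restrict U] f') : IsWeakDeriv U J f' g :=
  ⟨h.1.congr hf, h.2.1, fun φ hφ =>
    (integral_congr_ae (hf.mono fun x hx => by simp only [hx])).symm.trans (h.2.2 φ hφ)⟩

namespace MemSobolev

variable {U V : Set (Vec d)} {M : ℕ} {p : ℝ≥0∞} {v : Vec d → Vec d}

lemma isWeakDeriv (h : MemSobolev U M p v) (i : Fin d) {m : ℕ} (hm : m ≤ M) (J : Fin m → Fin d) :
    IsWeakDeriv U J (fun x => v x i) (weakDeriv U J fun x => v x i) := by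
  obtain ⟨g, hg, -⟩ := h i m hm J
  exact isWeakDeriv_weakDeriv hg

lemma memLp_weakDeriv (h : MemSobolev U M p v) (hU : IsOpen U) (i : Fin d) {m : ℕ} (hm : m ≤ M)
    (J : Fin m → Fin d) : MemLp (weakDeriv U J fun x => v x i) p (volume.restrict U) := by
  obtain ⟨g, hg, hp⟩ := h i m hm J
  exact (memLp_congr_ae (hg.weakDeriv_ae_eq hU)).2 hp

lemma memLp_weakJet (h : MemSobolev U M p v) (hU : IsOpen U) {m : ℕ} (hm : m ≤ M) :
    MemLp (weakJet U m v) p (volume.restrict U) :=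
  MemLp.of_eval_piLp fun a => h.memLp_weakDeriv hU a.1 hm a.2

lemma memLp (h : MemSobolev U M p v) (hU : IsOpen U) : MemLp v p (volume.restrict U) :=
  MemLp.of_eval_piLp fun i => by
    obtain ⟨g, hg, hp⟩ := h i 0 (Nat.zero_le _) Fin.elim0
    exact (memLp_congr_ae (hg.ae_eq_of_order_zero hU)).2 hp

lemma mono (h : MemSobolev U M p v) (hU : MeasurableSet U) (hVU : V ⊆ U) : MemSobolev V M p v :=
  fun i m hm J => by
    obtain ⟨g, hg, hp⟩ := h i m hm J
    exact ⟨g, hg.mono hU hVU, hp.mono_measure (Measure.restrict_mono_set _ hVU)⟩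

end MemSobolev

lemma abs_weakDeriv_le_norm_weakJet (U : Set (Vec d)) {m : ℕ} (v : Vec d → Vec d) (x : Vec d)
    (i : Fin d) (J : Fin m → Fin d) :
    |weakDeriv U J (fun y => v y i) x| ≤ ‖weakJet U m v x‖ :=
  PiLp.norm_apply_le (weakJet U m v x) (i, J)

lemma sobolevSeminorm_nonneg (U : Set (Vec d)) (m : ℕ) (p : ℝ≥0∞) (v : Vec d → Vec d) :
    0 ≤ sobolevSeminorm U m p v := ENNReal.toReal_nonneg

section Simplex

variable {ι : Type} [Fintype ι] (b : AffineBasis ι ℝ (Vec d)) {Ω : Set (Vec d)}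
  {v u : Vec d → Vec d}

lemma restrict_interior_simplex :
    (volume : Measure (Vec d)).restrict (interior (simplex b)) = volume.restrict (simplex b) :=
  Measure.restrict_congr_set
    (interior_ae_eq_of_null_frontier ((convex_simplex b).addHaar_frontier volume))

lemma closure_interior_simplex : closure (interior (simplex b)) = simplex b := by
  rw [(convex_simplex b).closure_interior_eq_closure_of_nonempty_interior,
    (isCompact_simplex b).isClosed.closure_eq]
  rw [simplex, interior_convexHull_nonempty_iff_affineSpan_eq_top]
  exact b.tot

lemma LipRep.localSobolev (hu : LipRep Ω v u) (hT : interior (simplex b) ⊆ Ω) {k : ℕ}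
    (h : MemSobolev (interior (simplex b)) (k + 1) 2 v) :
    LocalSobolev b k u (fun i j x => lineDeriv ℝ (fun y => u y i) x (basisVec j))
      (sobolevSeminorm (interior (simplex b)) (k + 1) 2 v) where
  continuous := hu.continuous
  approx i := ⟨_, hu.smoothApprox (isCompact_simplex b) i⟩
  jet i := by
    have hu' := hu.mono hT
    refine ⟨fun m J => weakDeriv (interior (simplex b)) J fun x => v x i,
      ⟨fun m hm J => (h.isWeakDeriv i hm J).congr (hu'.ae_eq_coord i),
        fun m hm J => h.memLp_weakDeriv isOpen_interior i hm J⟩, fun j => ?_, fun J => ?_⟩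
    · rw [← restrict_interior_simplex b]
      exact (hu'.isWeakDeriv i j).weakDeriv_ae_eq isOpen_interior
    · rw [← restrict_interior_simplex b]
      exact ENNReal.toReal_mono (h.memLp_weakJet isOpen_interior le_rfl).2.ne
        (eLpNorm_mono fun x => abs_weakDeriv_le_norm_weakJet _ v x i J)
  nonneg := ENNReal.toReal_nonneg

lemma LipRep.abs_lineDeriv_le (hu : LipRep Ω v u) (hT : interior (simplex b) ⊆ Ω)
    (h : MemSobolev (interior (simplex b)) 1 ∞ v) (i j : Fin d) :
    ∀ᵐ x ∂volume.restrict (simplex b), |lineDeriv ℝ (fun y => u y i) x (basisVec j)| ≤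
      sobolevSeminorm (interior (simplex b)) 1 ∞ v := by
  rw [← restrict_interior_simplex b]
  filter_upwards [((hu.mono hT).isWeakDeriv i j).weakDeriv_ae_eq isOpen_interior,
    ae_abs_le_eLpNorm_top (h.memLp_weakJet isOpen_interior le_rfl)] with x h1 h2
  rw [← h1]
  exact (abs_weakDeriv_le_norm_weakJet _ v x i _).trans h2

/-- The oscillation on an element is controlled by the `W^{1,∞}` seminorm on that element alone,
which is convex. -/
lemma LipRep.abs_sub_le (hu : LipRep Ω v u) (hT : interior (simplex b) ⊆ Ω)
    (h : MemSobolev (interior (simplex b)) 1 ∞ v) (i : Fin d) {x y : Vec d}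
    (hx : x ∈ simplex b) (hy : y ∈ simplex b) :
    |u x i - u y i| ≤ d * sobolevSeminorm (interior (simplex b)) 1 ∞ v * dist x y := by
  have hu' := hu.mono hT
  have hc : Continuous fun x => u x i :=
    (EuclideanSpace.proj i : Vec d →L[ℝ] ℝ).continuous.comp hu.continuous
  have h1 := lipschitzOnWith_closure_of_isWeakDeriv isOpen_interior (convex_simplex b).interior hc
    ((hc.continuousOn.integrableOn_compact (isCompact_simplex b)).mono_set interior_subset)
    (fun j => (hu'.isWeakDeriv i j).congr (hu'.ae_eq_coord i))
    (fun j => by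
      rw [restrict_interior_simplex b]
      exact hu.abs_lineDeriv_le b hT h i j)
  rw [closure_interior_simplex] at h1
  have h2 := h1.dist_le_mul x hx y hy
  rwa [Real.dist_eq, Real.coe_toNNReal _ (mul_nonneg (Nat.cast_nonneg d)
    (sobolevSeminorm_nonneg _ _ _ _))] at h2

/-- The essential bound holds at every point of the closed element, by continuity. -/
lemma LipRep.abs_le (hu : LipRep Ω v u) (hT : interior (simplex b) ⊆ Ω)
    (h : MemSobolev (interior (simplex b)) 1 ∞ v) (i : Fin d) {x : Vec d}
    (hx : x ∈ simplex b) : |u x i| ≤ lebesgueNorm (simplex b) ∞ v := by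
  have hc : Continuous fun x => u x i :=
    (EuclideanSpace.proj i : Vec d →L[ℝ] ℝ).continuous.comp hu.continuous
  have h1 : ∀ᵐ y ∂volume.restrict (interior (simplex b)),
      |u y i| ≤ lebesgueNorm (simplex b) ∞ v := by
    filter_upwards [(hu.mono hT).ae_eq_coord i, ae_abs_le_eLpNorm_top (h.memLp isOpen_interior)]
      with y hy1 hy2
    rw [lebesgueNorm, ← restrict_interior_simplex b, ← hy1]
    exact (abs_coord_le (v y) i).trans hy2
  have h2 : ∀ y ∈ interior (simplex b), |u y i| ≤ lebesgueNorm (simplex b) ∞ v := by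
    intro y hy
    by_contra hlt
    have ho : IsOpen (interior (simplex b) ∩ {y | lebesgueNorm (simplex b) ∞ v < |u y i|}) :=
      isOpen_interior.inter (isOpen_lt continuous_const hc.abs)
    refine (ho.measure_pos volume ⟨y, hy, not_le.1 hlt⟩).ne' ?_
    rw [ae_restrict_iff' isOpen_interior.measurableSet] at h1
    refine measure_mono_null (fun z hz => ?_) h1
    exact fun hle => absurd (hle hz.1) (not_le.2 hz.2)
  have h3 : closure (interior (simplex b)) ⊆ {y | |u y i| ≤ lebesgueNorm (simplex b) ∞ v} :=
    closure_minimal h2 (isClosed_le hc.abs continuous_const)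
  rw [closure_interior_simplex] at h3
  exact h3 hx

lemma LipRep.sum_lineDeriv_eq_zero (hu : LipRep Ω v u) (hΩ : IsOpen Ω)
    (hT : interior (simplex b) ⊆ Ω) (h : IsDivFree Ω v) :
    ∀ᵐ x ∂volume.restrict (simplex b),
      ∑ i, lineDeriv ℝ (fun y => u y i) x (basisVec i) = 0 := by
  rw [← restrict_interior_simplex b]
  filter_upwards [ae_restrict_of_ae_restrict_of_subset hT h, ae_all_iff.2 fun i =>
    ae_restrict_of_ae_restrict_of_subset hT (hu.weakPartial_ae_eq hΩ i i)] with x h1 h2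
  rw [← h1]
  exact Finset.sum_congr rfl fun i _ => (h2 i).symm

end Simplex

end


/-! ### The interpolators in terms of polynomials -/

section

open MvPolynomial

variable {d : ℕ}

lemma isRTN_iff {k : ℕ} {T : Set (Vec d)} {w : Vec d → Vec d} :
    IsRTN (k + 1) T w ↔ ∃ P, IsRTNPoly k P ∧ ∀ x ∈ T, w x = polyField P x := by
  have e : ((k + 1 : ℕ) : ℤ) - 1 = k := by push_cast; ring
  constructor
  · rintro ⟨p, q, hp, hq, h⟩
    rw [e] at hp hq
    refine ⟨fun i => p i + X i * q, ⟨p, q, hp, hq, fun _ => rfl⟩, fun x hx => ?_⟩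
    ext i
    rw [h x hx i, polyField_apply, evalAt_add, evalAt_mul, evalAt_X]
  · rintro ⟨P, ⟨p, q, hp, hq, hP⟩, h⟩
    refine ⟨p, q, by rwa [e], by rwa [e], fun x hx i => ?_⟩
    rw [h x hx, polyField_apply, hP, evalAt_add, evalAt_mul, evalAt_X]

variable {Ω : Set (Vec d)} {t : Finset (Vec d)} {hi : AffineIndependent ℝ ((↑) : t → Vec d)}
  {hc : t.card = d + 1} {ϱ : ℝ} {c : Vec d} {r : ℝ} {v u : Vec d → Vec d}

open Classical in
lemma isTrace_ae_eq (hd : 1 ≤ d) (x : t)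
    (hT : volume.restrict (cell t) ≤ volume.restrict Ω) (hΩ : IsOpen Ω)
    (hb : Bornology.IsBounded Ω) (hv : MemSobolev Ω 1 ∞ v) (hu : LipRep Ω v u) {g : Vec d → Vec d}
    (hg : IsTrace Ω (t.erase x) v g) : g =ᵐ[facetMeasure (vertexBasis t hi hc) x] u := by
  have hm := (facetMeasure_vertexBasis (hi := hi) (hc := hc) x).symm
  have := isFiniteMeasure_facetMeasure (vertexBasis t hi hc) x hd
  refine IsTrace.ae_eq (vertexBasis t hi hc) hd x (by rwa [simplex_vertexBasis]) hm
    (hv.memLp hΩ).1 (fun i j => (hv.memLp_weakDeriv hΩ i le_rfl _).1) hg ?_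
  exact hu.isTrace hΩ hb (hm ▸ this)

lemma integral_congr_of_forall_facet {ι : Type} [Fintype ι] (b : AffineBasis ι ℝ (Vec d)) (i : ι)
    {f g : Vec d → ℝ} (h : ∀ x ∈ facet b i, f x = g x) :
    ∫ x, f x ∂facetMeasure b i = ∫ x, g x ∂facetMeasure b i :=
  integral_congr_ae ((ae_mem_facet b i).mono h)

lemma memLp_evalAt_simplex {ι : Type} [Fintype ι] (b : AffineBasis ι ℝ (Vec d))
    (p : MvPolynomial (Fin d) ℝ) : MemLp (evalAt p) 2 (volume.restrict (simplex b)) :=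
  memLp_simplex b (continuous_evalAt p) 2

lemma memLp_evalAt_facet {ι : Type} [Fintype ι] (b : AffineBasis ι ℝ (Vec d)) (hd : 1 ≤ d) (i : ι)
    (p : MvPolynomial (Fin d) ℝ) : MemLp (evalAt p) 2 (facetMeasure b i) :=
  memLp_facetMeasure b i hd (continuous_evalAt p) 2

open Classical in
/-- The interpolator on a mesh element, whose definition involves traces and the choice of a
function, is given by the polynomial interpolate of the Lipschitz continuous representative. -/
theorem exists_isLocalInterp (hd : 1 ≤ d) (H : ShapeRegular (vertexBasis t hi hc) ϱ c r)
    (hT : volume.restrict (cell t) ≤ volume.restrict Ω) (hΩ : IsOpen Ω)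
    (hb : Bornology.IsBounded Ω) (hv : MemSobolev Ω 1 ∞ v) (hu : LipRep Ω v u) (k : ℕ) :
    ∃ P Q, IsLocalInterp (vertexBasis t hi hc) k u P Q ∧
      (∀ x ∈ cell t, rtnInterp Ω (k + 1) t v x = polyField P x) ∧
      ∀ (i : t), ∀ x ∈ cell (t.erase i), faceProj Ω k (t.erase i) v x = polyField (Q i) x := by
  obtain ⟨b, hbb⟩ : ∃ b, b = vertexBasis t hi hc := ⟨_, rfl⟩
  have hsT : simplex b = cell t := by rw [hbb, simplex_vertexBasis]
  have hsF : ∀ i : t, facet b i = cell (t.erase (i : Vec d)) := fun i => by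
    rw [hbb, facet_vertexBasis]
  have hμF : ∀ i : t, faceMeasure (t.erase (i : Vec d)) = facetMeasure b i := fun i => by
    rw [hbb, facetMeasure_vertexBasis]
  have hn : ∀ i : t, outwardNormal t (t.erase (i : Vec d)) = facetNormal b i := fun i => by
    rw [hbb, outwardNormal_eq hd]
  rw [← hbb] at H ⊢
  have hvu : v =ᵐ[volume.restrict (simplex b)] u := by
    rw [hsT]; exact ae_mono hT hu.ae_eq
  have htr : ∀ i : t, IsTrace Ω (t.erase (i : Vec d)) v u := fun i => by
    have := isFiniteMeasure_facetMeasure b i hd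
    exact hu.isTrace hΩ hb (by rw [hμF]; exact this)
  have hae : ∀ (i : t) g, IsTrace Ω (t.erase (i : Vec d)) v g → g =ᵐ[facetMeasure b i] u :=
    fun i g hg => by rw [hbb]; exact isTrace_ae_eq hd i hT hΩ hb hv hu hg
  have e1 : ((k + 1 : ℕ) : ℤ) - 1 = k := by push_cast; ring
  have e2 : ((k + 1 : ℕ) : ℤ) - 2 = k - 1 := by push_cast; ring
  -- the chosen interpolate has the defining property, because a field with that property exists
  have hrtn : IsRTNInterp Ω (k + 1) t v (rtnInterp Ω (k + 1) t v) := by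
    refine Classical.epsilon_spec (p := IsRTNInterp Ω (k + 1) t v) ?_
    obtain ⟨P, hP, hmom, hnor⟩ := exists_rtn_interpolate b hd H k
      (memLp_simplex b hu.continuous 2) (g := fun i x => inner ℝ (u x) (facetNormal b i))
      (fun i => memLp_facetMeasure b i hd (hu.continuous.inner continuous_const) 2)
    refine ⟨polyField P, isRTN_iff.2 ⟨P, hP, fun _ _ => rfl⟩, fun i => ?_, fun f hf => ?_⟩
    · obtain ⟨p, hp, hpm⟩ := exists_polynomial_projection (memLp_evalAt_simplex b)
        (memLp_evalAt_simplex b (P i)) ((k : ℤ) - 1)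
      rw [e2, ← hsT]
      refine ⟨evalAt p, ⟨⟨p, hp, fun _ _ => rfl⟩, hpm⟩, ⟨p, hp, fun _ _ => rfl⟩, fun R hR => ?_⟩
      rw [hpm R hR, hmom i R hR]
      exact integral_congr_ae (hvu.mono fun x hx => by simp only [hx])
    · obtain ⟨i, rfl⟩ := exists_eq_erase hc hf
      obtain ⟨s, hs, hsP⟩ := hP.exists_normal_component b i
      refine ⟨u, htr i, ?_⟩
      rw [e1, ← hsF, hμF, hn]
      exact ⟨⟨s, hs, hsP⟩, hnor i⟩
  obtain ⟨hR, hM, hN⟩ := hrtn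
  obtain ⟨P, hP, hPx⟩ := isRTN_iff.1 hR
  have hface : ∀ i : t, ∃ Q : Fin d → MvPolynomial (Fin d) ℝ, (∀ l, DegLE k (Q l)) ∧
      (∀ l s, DegLE k s → ∫ x, evalAt (Q l) x * evalAt s x ∂facetMeasure b i =
        ∫ x, u x l * evalAt s x ∂facetMeasure b i) ∧
      ∀ x ∈ cell (t.erase (i : Vec d)), faceProj Ω k (t.erase (i : Vec d)) v x = polyField Q x := by
    intro i
    obtain ⟨g, hg, hpr⟩ : ∃ g, IsTrace Ω (t.erase (i : Vec d)) v g ∧ ∀ l, IsL2Proj k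
        (cell (t.erase (i : Vec d))) (faceMeasure (t.erase (i : Vec d))) (fun x => g x l)
        (fun x => faceProj Ω k (t.erase (i : Vec d)) v x l) := by
      refine Classical.epsilon_spec (p := fun w : Vec d → Vec d => ∃ g,
        IsTrace Ω (t.erase (i : Vec d)) v g ∧ ∀ l, IsL2Proj k
        (cell (t.erase (i : Vec d))) (faceMeasure (t.erase (i : Vec d))) (fun x => g x l)
        (fun x => w x l)) ?_
      have hex := fun l => exists_polynomial_projection (memLp_evalAt_facet b hd i)
        (memLp_apply (memLp_facetMeasure b i hd hu.continuous 2) l) (k : ℤ)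
      choose Q hQ hQm using hex
      refine ⟨polyField Q, u, htr i, fun l => ⟨⟨Q l, hQ l, fun _ _ => rfl⟩, fun s hs => ?_⟩⟩
      rw [hμF]
      exact hQm l s hs
    choose Q hQ hQx using fun l => (hpr l).1
    refine ⟨Q, hQ, fun l s hs => ?_, fun x hx => ?_⟩
    · have h1 := (hpr l).2 s hs
      rw [hμF] at h1
      have h2 : ∫ x, g x l * evalAt s x ∂facetMeasure b i =
          ∫ x, u x l * evalAt s x ∂facetMeasure b i :=
        integral_congr_ae ((hae i g hg).mono fun x hx => by simp only [hx])
      rw [← h2, ← h1]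
      refine integral_congr_of_forall_facet b i fun x hx => ?_
      rw [hQx l x (by rwa [← hsF])]
    · ext l
      exact hQx l x hx
  choose Q hQ hQm hQx using hface
  refine ⟨P, Q, ⟨hP, fun i R hR' => ?_, fun j s hs => ?_, hQ, hQm⟩, hPx, hQx⟩
  · obtain ⟨p, h1, h2⟩ := hM i
    rw [e2] at h1 h2
    have h3 := (h1.2 R hR').symm.trans (h2.2 R hR')
    rw [← hsT] at h3
    have h4 : ∫ x in simplex b, u x i * evalAt R x = ∫ x in simplex b, v x i * evalAt R x :=
      integral_congr_ae (hvu.mono fun x hx => by simp only [hx])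
    rw [h4, ← h3]
    refine setIntegral_congr_fun (measurableSet_simplex b) fun x hx => ?_
    simp only
    rw [hPx x (hsT ▸ hx), polyField_apply]
  · obtain ⟨g, hg, h1⟩ := hN _ (mem_facesOf hc j)
    rw [e1, hμF, hn] at h1
    have h2 : ∫ x, inner ℝ (g x) (facetNormal b j) * evalAt s x ∂facetMeasure b j =
        ∫ x, inner ℝ (u x) (facetNormal b j) * evalAt s x ∂facetMeasure b j :=
      integral_congr_ae ((hae j g hg).mono fun x hx => by simp only [hx])
    rw [← h2, ← h1.2 s hs]
    refine integral_congr_of_forall_facet b j fun x hx => ?_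
    simp only
    rw [hPx x (hsT ▸ facet_subset b j hx)]

end


/-! ### Discretely divergence-free fields -/

section

open MvPolynomial

variable {d : ℕ} {k : ℕ} {Ω : Set (Vec d)} {t : Finset (Vec d)}
  {hi : AffineIndependent ℝ ((↑) : t → Vec d)} {hc : t.card = d + 1} {ϱ : ℝ} {c : Vec d} {r : ℝ}

lemma divergence_polyField (P : Fin d → MvPolynomial (Fin d) ℝ) (x : Vec d) :
    divergence (polyField P) x = evalAt (divPoly P) x := by
  rw [divergence, divPoly, evalAt_sum]
  refine Finset.sum_congr rfl fun i _ => ?_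
  rw [fderiv_polyField_apply, Finset.sum_eq_single i]
  · simp [basisVec]
  · intro j _ hj
    simp [basisVec, hj]
  · exact fun h => absurd (Finset.mem_univ i) h

lemma fderiv_eq_of_mem_interior {w : Vec d → Vec d} {P : Fin d → MvPolynomial (Fin d) ℝ}
    {T : Set (Vec d)} (h : ∀ x ∈ T, w x = polyField P x) {x : Vec d} (hx : x ∈ interior T) :
    fderiv ℝ w x = fderiv ℝ (polyField P) x := by
  refine Filter.EventuallyEq.fderiv_eq ?_
  filter_upwards [mem_interior_iff_mem_nhds.1 hx] with y hy
  exact h y hy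

lemma ae_fderiv_eq {w : Vec d → Vec d} {P : Fin d → MvPolynomial (Fin d) ℝ}
    (h : ∀ x ∈ cell t, w x = polyField P x) :
    ∀ᵐ x ∂volume.restrict (cell t), fderiv ℝ w x = fderiv ℝ (polyField P) x := by
  rw [← restrict_interior_cell]
  filter_upwards [ae_restrict_mem isOpen_interior.measurableSet] with x hx
  exact fderiv_eq_of_mem_interior h hx

open Classical in
lemma pressureGrad_functional_eq (hd : 1 ≤ d) {q : HybridField d ℝ} {σ : MvPolynomial (Fin d) ℝ}
    {τ : t → MvPolynomial (Fin d) ℝ} (hσ : ∀ x ∈ cell t, q.elem t x = evalAt σ x)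
    (hτ : ∀ i : t, ∀ x ∈ cell (t.erase i), q.face (t.erase i) x = evalAt (τ i) x)
    {w : Vec d → Vec d} {W : Fin d → MvPolynomial (Fin d) ℝ}
    (hw : ∀ x ∈ cell t, w x = polyField W x) :
    -(∫ x in cell t, q.elem t x * divergence w x) + ∑ f ∈ facesOf t,
        ∫ x, q.face f x * inner ℝ (w x) (outwardNormal t f) ∂faceMeasure f =
      -(∫ x in simplex (vertexBasis t hi hc), evalAt σ x * evalAt (divPoly W) x) +
        ∑ i, ∫ x, evalAt (τ i) x * inner ℝ (polyField W x) (facetNormal (vertexBasis t hi hc) i)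
          ∂facetMeasure (vertexBasis t hi hc) i := by
  rw [simplex_vertexBasis, sum_facesOf hc fun f =>
    ∫ x, q.face f x * inner ℝ (w x) (outwardNormal t f) ∂faceMeasure f]
  refine congrArg₂ (· + ·) (congrArg Neg.neg (integral_congr_ae ?_))
    (Finset.sum_congr rfl fun i _ => ?_)
  · filter_upwards [ae_fderiv_eq hw, ae_restrict_mem (isCompact_cell t).measurableSet] with x h1 h2
    rw [hσ x h2, ← divergence_polyField, divergence, divergence, h1]
  · rw [← facetMeasure_vertexBasis (hi := hi) (hc := hc), outwardNormal_eq (hi := hi) (hc := hc) hd]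
    refine integral_congr_of_forall_facet _ i fun x hx => ?_
    have hx' := facet_subset _ i hx
    rw [simplex_vertexBasis] at hx'
    rw [facet_vertexBasis] at hx
    rw [hτ i x hx, hw x hx']

open Classical in
/-- The chosen discrete gradient has the defining property, by the Riesz representation in the
Raviart–Thomas–Nédélec space. -/
lemma isPressureGrad_pressureGrad (hd : 1 ≤ d) (H : ShapeRegular (vertexBasis t hi hc) ϱ c r)
    {q : HybridField d ℝ} {σ : MvPolynomial (Fin d) ℝ}
    {τ : t → MvPolynomial (Fin d) ℝ} (hσ : ∀ x ∈ cell t, q.elem t x = evalAt σ x)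
    (hτ : ∀ i : t, ∀ x ∈ cell (t.erase i), q.face (t.erase i) x = evalAt (τ i) x) :
    IsPressureGrad k t q (pressureGrad k t q) := by
  refine Classical.epsilon_spec (p := IsPressureGrad k t q) ?_
  obtain ⟨b, hb⟩ : ∃ b, b = vertexBasis t hi hc := ⟨_, rfl⟩
  rw [← hb] at H
  let D : (Fin d → MvPolynomial (Fin d) ℝ) →ₗ[ℝ] MvPolynomial (Fin d) ℝ :=
    ∑ i, (pderiv i : Derivation ℝ (MvPolynomial (Fin d) ℝ) _).toLinearMap.comp (LinearMap.proj i)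
  let N : t → (Fin d → MvPolynomial (Fin d) ℝ) →ₗ[ℝ] MvPolynomial (Fin d) ℝ := fun j =>
    ∑ i, facetNormal b j i • LinearMap.proj i
  have hD : ∀ W, D W = divPoly W := fun W => by simp [D, divPoly]
  have hN : ∀ j W x, evalAt (N j W) x = inner ℝ (polyField W x) (facetNormal b j) := fun j W x => by
    rw [inner_eq_sum]
    simp only [N, LinearMap.sum_apply, LinearMap.smul_apply, LinearMap.proj_apply, evalAt_sum,
      evalAt_smul, polyField_apply]
    exact Finset.sum_congr rfl fun i _ => mul_comm _ _
  obtain ⟨P, hP, hPW⟩ := exists_rtn_representative b hd H k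
    (-(momentForm (memLp_evalAt_simplex b) σ).comp D +
      ∑ j, (momentForm (memLp_evalAt_facet b hd j) (τ j)).comp (N j))
  refine ⟨polyField P, isRTN_iff.2 ⟨P, hP, fun _ _ => rfl⟩, fun w hw => ?_⟩
  obtain ⟨W, hW, hwW⟩ := isRTN_iff.1 hw
  rw [pressureGrad_functional_eq (hi := hi) (hc := hc) hd hσ hτ hwW]
  have h1 : ∫ x in cell t, inner ℝ (polyField P x) (w x) =
      ∫ x in simplex b, inner ℝ (polyField P x) (polyField W x) := by
    rw [hb, simplex_vertexBasis]
    exact setIntegral_congr_fun (isCompact_cell t).measurableSet fun x hx => by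
      simp only [hwW x hx]
  rw [h1, hPW W hW, ← hb]
  simp only [LinearMap.add_apply, LinearMap.neg_apply, LinearMap.comp_apply, LinearMap.sum_apply,
    momentForm_apply, hD, hN]

lemma integral_divPoly_mul_const {ι : Type} [Fintype ι] (b : AffineBasis ι ℝ (Vec d)) (hd : 1 ≤ d)
    (P : Fin d → MvPolynomial (Fin d) ℝ) (a : ℝ) :
    ∫ x in simplex b, a * evalAt (divPoly P) x =
      ∑ j, ∫ y, a * inner ℝ (polyField P y) (facetNormal b j) ∂facetMeasure b j := by
  have h := integral_divPoly_mul b hd P (C a)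
  simp only [pderiv_C, evalAt_zero, mul_zero, integral_zero, Finset.sum_const_zero, sub_zero,
    evalAt_C] at h
  simpa only [mul_comm a] using h

lemma SimplicialMesh.affineIndependent (M : SimplicialMesh Ω) (ht : t ∈ M.elements) :
    AffineIndependent ℝ ((↑) : t → Vec d) :=
  M.indep ((mem_elements M).1 ht).1

lemma SimplicialMesh.card_eq (M : SimplicialMesh Ω) (ht : t ∈ M.elements) : t.card = d + 1 :=
  ((mem_elements M).1 ht).2

lemma SimplicialMesh.IsRegular.exists_shapeRegular {M : SimplicialMesh Ω} (hM : M.IsRegular ϱ)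
    (ht : t ∈ M.elements) : ∃ c r, ShapeRegular
      (vertexBasis t (M.affineIndependent ht) (M.card_eq ht)) ϱ c r := by
  obtain ⟨c, r, hr, hb, hdi⟩ := hM t ht
  exact ⟨c, r, hr, by rwa [simplex_vertexBasis], by rwa [simplex_vertexBasis]⟩

open Classical in
lemma mem_meshFaces (M : SimplicialMesh Ω) (hd : 1 ≤ d) (ht : t ∈ M.elements) (i : t) :
    t.erase (i : Vec d) ∈ M.meshFaces := by
  have h := (mem_elements M).1 ht
  have hcard : (t.erase (i : Vec d)).card = d := by
    rw [Finset.card_erase_of_mem i.2, h.2]; rfl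
  simp only [SimplicialMesh.meshFaces, Finset.mem_filter, Set.Finite.mem_toFinset]
  exact ⟨M.down_closed h.1 (Finset.erase_subset _ _) (Finset.card_pos.1 (by omega)), hcard⟩

lemma broken_ae_eq_evalAt (M : SimplicialMesh Ω) (ht : t ∈ M.elements) {q : HybridField d ℝ}
    {σ : MvPolynomial (Fin d) ℝ} (hσ : ∀ x ∈ cell t, q.elem t x = evalAt σ x) :
    broken M q =ᵐ[volume.restrict (cell t)] evalAt σ := by
  filter_upwards [broken_ae_eq M ht q, ae_restrict_mem (isCompact_cell t).measurableSet] with x h1 h2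
  rw [h1, hσ x h2]

/-- The element components of a discretely divergence-free field are divergence-free: the
discrete divergence is tested against the divergence on one element, minus its mean value. -/
theorem MemZ0.divPoly_eq_zero (hd : 1 ≤ d) (hΩ : IsConvexPolyhedralDomain Ω)
    {M : SimplicialMesh Ω} (hM : M.IsRegular ϱ) {z : HybridField d (Vec d)} (hz : MemZ0 M k z)
    (ht : t ∈ M.elements) {P : Fin d → MvPolynomial (Fin d) ℝ} (hP : IsRTNPoly k P)
    (hzP : ∀ x ∈ cell t, z.elem t x = polyField P x) : divPoly P = 0 := by
  classical
  obtain ⟨s, hs⟩ : ∃ s, s = divPoly P := ⟨_, rfl⟩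
  have hsk : DegLE k s := by
    rw [hs, divPoly]
    exact DegLE.sum fun i _ => (hP.degLE i).pderiv i |>.mono (by push_cast; omega)
  -- The pressure is `div z` on the element `t`, zero on the others, minus the constant `a` which
  -- makes the mean value on `Ω` vanish. On the faces it is `-a`, so that the constant contributes
  -- nothing, by the divergence theorem, and only `-‖div z‖²` on `t` is left.
  obtain ⟨a, ha⟩ : ∃ a : ℝ, a * (∑ t' ∈ M.elements, ∫ x in cell t', (1 : ℝ)) =
      ∫ x in cell t, evalAt s x := by
    refine ⟨(∫ x in cell t, evalAt s x) / ∑ t' ∈ M.elements, ∫ x in cell t', (1 : ℝ),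
      div_mul_cancel₀ _ (ne_of_gt ?_)⟩
    refine Finset.sum_pos' (fun _ _ => integral_nonneg fun _ => zero_le_one) ⟨t, ht, ?_⟩
    obtain ⟨c, r, H⟩ := hM.exists_shapeRegular ht
    have h1 : 0 < volume (cell t) := by
      refine lt_of_lt_of_le (Metric.measure_ball_pos volume c H.pos) (measure_mono ?_)
      simpa only [simplex_vertexBasis] using H.ball_subset
    simp only [integral_const, smul_eq_mul, mul_one, measureReal_restrict_apply_univ]
    exact ENNReal.toReal_pos h1.ne' (isCompact_cell t).measure_lt_top.ne
  obtain ⟨σ, hσ⟩ : ∃ σ : Finset (Vec d) → MvPolynomial (Fin d) ℝ,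
    σ = fun t' => (if t' = t then s else 0) - C a := ⟨_, rfl⟩
  obtain ⟨q, hq⟩ : ∃ q : HybridField d ℝ, q = ⟨fun t' => evalAt (σ t'), fun _ _ => -a⟩ := ⟨_, rfl⟩
  have hqe : ∀ t', ∀ x ∈ cell t', q.elem t' x = evalAt (σ t') x := fun t' x _ => by rw [hq]
  have hσk : ∀ t', DegLE k (σ t') := by
    intro t'
    rw [hσ]
    refine (polySub d k).sub_mem ?_ (degLE_C a (by omega))
    split_ifs
    · exact hsk
    · exact (polySub d k).zero_mem
  have ce : ∀ p : MvPolynomial (Fin d) ℝ, ∀ t', IntegrableOn (evalAt p) (cell t') := fun p t' =>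
    (continuous_evalAt p).continuousOn.integrableOn_compact (isCompact_cell t')
  have hqP : MemP0 M k q := by
    refine ⟨⟨fun t' _ => ⟨σ t', hσk t', hqe t'⟩, fun f _ =>
      ⟨C (-a), degLE_C _ (by omega), fun x _ => by rw [hq, evalAt_C]⟩⟩, ?_⟩
    rw [integral_eq_sum_cell M hΩ fun t' ht' => (integrable_congr
      (broken_ae_eq_evalAt M ht' (hqe t'))).2 (ce _ _),
      Finset.sum_congr rfl fun t' ht' => integral_congr_ae (broken_ae_eq_evalAt M ht' (hqe t'))]
    have h1 : ∀ t' ∈ M.elements, ∫ x in cell t', evalAt (σ t') x =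
        (if t' = t then ∫ x in cell t', evalAt s x else 0) - a * ∫ x in cell t', (1 : ℝ) := by
      intro t' _
      rw [hσ]
      simp only [evalAt_sub]
      rw [integral_sub (ce _ _) (ce _ _), ← integral_const_mul]
      simp only [evalAt_C, mul_one]
      split_ifs
      · rfl
      · simp only [evalAt_zero, integral_zero]
    rw [Finset.sum_congr rfl h1, Finset.sum_sub_distrib, ← Finset.mul_sum, ha,
      Finset.sum_ite_eq' M.elements t, if_pos ht, sub_self]
  have hB := hz.2 q hqP
  have h2 : ∀ t' ∈ M.elements, ∫ x in cell t', inner ℝ (z.elem t' x) (pressureGrad k t' q x) =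
      if t' = t then -∫ x in cell t', evalAt s x * evalAt s x else 0 := by
    intro t' ht'
    obtain ⟨c, r, H⟩ := hM.exists_shapeRegular ht'
    obtain ⟨R, hR, hzR⟩ := isRTN_iff.1 (hz.1.1.1 t' ht')
    have hτ : ∀ i : t', ∀ x ∈ cell (t'.erase i), q.face (t'.erase i) x = evalAt (C (-a)) x :=
      fun i x _ => by rw [hq, evalAt_C]
    have h3 := (isPressureGrad_pressureGrad (k := k) hd H (hqe t') hτ).2 _ (hz.1.1.1 t' ht')
    rw [pressureGrad_functional_eq (hi := M.affineIndependent ht') (hc := M.card_eq ht') hd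
      (hqe t') hτ hzR] at h3
    have h0 : ∫ x in cell t', inner ℝ (z.elem t' x) (pressureGrad k t' q x) =
        ∫ x in cell t', inner ℝ (pressureGrad k t' q x) (z.elem t' x) :=
      integral_congr_ae (Eventually.of_forall fun x => real_inner_comm _ _)
    rw [h0, h3]
    simp only [evalAt_C]
    have h4 := integral_divPoly_mul_const (vertexBasis t' (M.affineIndependent ht') (M.card_eq ht'))
      hd R (-a)
    rw [← h4, ← sub_eq_neg_add, ← integral_sub, simplex_vertexBasis]
    · rw [hσ]
      split_ifs with h
      · subst h
        have hRs : divPoly R = s := by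
          rw [hs]
          refine congrArg divPoly (funext fun l => sub_eq_zero.1 ?_)
          refine eq_zero_of_evalAt_eq_zero (U := Metric.ball c r) Metric.isOpen_ball
            ⟨c, Metric.mem_ball_self H.pos⟩ fun x hx => ?_
          have hx' := H.ball_subset hx
          rw [simplex_vertexBasis] at hx'
          have := congrArg (fun y : Vec d => y l) ((hzR x hx').symm.trans (hzP x hx'))
          rw [evalAt_sub, sub_eq_zero]
          exact this
        rw [← integral_neg]
        refine integral_congr_ae (Eventually.of_forall fun x => ?_)
        simp only [hRs, evalAt_sub, evalAt_C, if_true]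
        ring
      · rw [← integral_zero (Vec d) ℝ (μ := volume.restrict (cell t'))]
        refine integral_congr_ae (Eventually.of_forall fun x => ?_)
        simp only [evalAt_sub, evalAt_C, if_neg h, evalAt_zero]
        ring
    · exact integrableOn_simplex _ (continuous_const.mul (continuous_evalAt _))
    · exact integrableOn_simplex _ ((continuous_evalAt _).mul (continuous_evalAt _))
  rw [formB, Finset.sum_congr rfl h2, Finset.sum_ite_eq' M.elements t, if_pos ht, neg_eq_zero] at hB
  rw [← hs]
  obtain ⟨c, r, H⟩ := hM.exists_shapeRegular ht
  have h5 : l2 (volume.restrict (cell t)) (evalAt s) = 0 := by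
    have hm := memLp_evalAt_simplex (vertexBasis t (M.affineIndependent ht) (M.card_eq ht)) s
    rw [simplex_vertexBasis] at hm
    have h6 := l2_sq_real hm
    simp only [pow_two] at h6
    rw [hB] at h6
    exact mul_self_eq_zero.1 h6
  have h7 := l2_ball_le H.ball_subset (memLp_evalAt_simplex _ s)
  rw [simplex_vertexBasis, h5] at h7
  exact l2_eq_zero_iff_ball H.pos (le_antisymm h7 (l2_nonneg _))

end


/-! ### Estimates on a mesh element -/

section

open MvPolynomial

variable {d : ℕ} {k : ℕ} {Ω : Set (Vec d)} {t : Finset (Vec d)}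
  {hi : AffineIndependent ℝ ((↑) : t → Vec d)} {hc : t.card = d + 1} {ϱ : ℝ}

open Classical in
lemma sum_facesOf_integral {F : Finset (Vec d) → Vec d → ℝ} {G : t → Vec d → ℝ}
    (h : ∀ i : t, ∀ x ∈ cell (t.erase (i : Vec d)), F (t.erase (i : Vec d)) x = G i x) :
    ∑ f ∈ facesOf t, ∫ x, F f x ∂faceMeasure f =
      ∑ i : t, ∫ x, G i x ∂facetMeasure (vertexBasis t hi hc) i := by
  rw [sum_facesOf hc fun f => ∫ x, F f x ∂faceMeasure f]
  refine Finset.sum_congr rfl fun i _ => ?_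
  rw [← facetMeasure_vertexBasis (hi := hi) (hc := hc)]
  refine integral_congr_of_forall_facet _ i fun x hx => ?_
  rw [facet_vertexBasis] at hx
  exact h i x hx

/-- The local polynomials `Z` and `ZF` represent the hybrid field `z` on the element `t` and on
its faces. -/
structure IsRep (t : Finset (Vec d)) (z : HybridField d (Vec d))
    (Z : Fin d → MvPolynomial (Fin d) ℝ) (ZF : t → Fin d → MvPolynomial (Fin d) ℝ) : Prop where
  elem : ∀ x ∈ cell t, z.elem t x = polyField Z x
  face : ∀ i : t, ∀ f, f ∈ facesOf t → (i : Vec d) ∉ f → ∀ x ∈ cell f, z.face f x = polyField (ZF i) x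

open Classical in
lemma IsRep.face_erase {z : HybridField d (Vec d)} {Z : Fin d → MvPolynomial (Fin d) ℝ}
    {ZF : t → Fin d → MvPolynomial (Fin d) ℝ} (h : IsRep t z Z ZF) (hc : t.card = d + 1) (i : t)
    {x : Vec d} (hx : x ∈ cell (t.erase (i : Vec d))) :
    z.face (t.erase (i : Vec d)) x = polyField (ZF i) x :=
  h.face i _ (mem_facesOf hc i) (Finset.notMem_erase _ _) x hx

open Classical in
lemma cell_erase_subset (i : t) : cell (t.erase (i : Vec d)) ⊆ cell t :=
  convexHull_mono (Finset.coe_subset.2 (Finset.erase_subset _ _))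

open Classical in
lemma isRep_of_erase (hc : t.card = d + 1) {z : HybridField d (Vec d)}
    {Z : Fin d → MvPolynomial (Fin d) ℝ} {ZF : t → Fin d → MvPolynomial (Fin d) ℝ}
    (h : ∀ x ∈ cell t, z.elem t x = polyField Z x)
    (h' : ∀ i : t, ∀ x ∈ cell (t.erase (i : Vec d)),
      z.face (t.erase (i : Vec d)) x = polyField (ZF i) x) : IsRep t z Z ZF := by
  refine ⟨h, fun i f hf hif x hx => ?_⟩
  obtain ⟨j, rfl⟩ := exists_eq_erase hc hf
  have hij : i = j := by
    by_contra hne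
    exact hif (Finset.mem_erase.2 ⟨fun h => hne (Subtype.ext h), i.2⟩)
  subst hij
  exact h' i x hx

lemma convLocal_eq (hd : 1 ≤ d) {w v z : HybridField d (Vec d)}
    {R P Z : Fin d → MvPolynomial (Fin d) ℝ} {RF Q ZF : t → Fin d → MvPolynomial (Fin d) ℝ}
    (hw : IsRep t w R RF) (hv : IsRep t v P Q) (hz : IsRep t z Z ZF) :
    convLocal t w v z = polyConv (vertexBasis t hi hc) R P Z Q ZF := by
  classical
  rw [convLocal, polyConv, simplex_vertexBasis]
  refine congrArg₂ (· + ·) (integral_congr_ae ?_) (congrArg _ (sum_facesOf_integral ?_))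
  · filter_upwards [ae_fderiv_eq hv.elem, ae_restrict_mem (isCompact_cell t).measurableSet]
      with x h1 h2
    rw [h1, hw.elem x h2, hz.elem x h2]
  · intro i x hx
    have hx' := cell_erase_subset i hx
    rw [hw.elem x hx', hv.elem x hx', hz.elem x hx', hv.face_erase hc i hx, hz.face_erase hc i hx,
      outwardNormal_eq (hi := hi) (hc := hc) hd]

/-- The square of the jumps of a hybrid field across the faces of an element. -/
def jumpSq (t : Finset (Vec d)) (z : HybridField d (Vec d)) : ℝ :=
  ∑ f ∈ facesOf t, ∫ x, ‖z.face f x - z.elem t x‖ ^ 2 ∂faceMeasure f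

lemma jumpSq_nonneg (t : Finset (Vec d)) (z : HybridField d (Vec d)) : 0 ≤ jumpSq t z :=
  Finset.sum_nonneg fun _ _ => integral_nonneg fun _ => by positivity

lemma sum_l2_le_sqrt_jumpSq (hd : 1 ≤ d) {z : HybridField d (Vec d)}
    {Z : Fin d → MvPolynomial (Fin d) ℝ} {ZF : t → Fin d → MvPolynomial (Fin d) ℝ}
    (hz : IsRep t z Z ZF) :
    ∑ i, l2 (facetMeasure (vertexBasis t hi hc) i) (fun x => polyField (ZF i) x - polyField Z x) ≤
      (d + 1) * √(jumpSq t z) := by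
  classical
  have hm : ∀ i, MemLp (fun x => polyField (ZF i) x - polyField Z x) 2
      (facetMeasure (vertexBasis t hi hc) i) := fun i =>
    memLp_facetMeasure _ i hd ((continuous_polyField _).sub (continuous_polyField _)) 2
  have h1 : jumpSq t z = ∑ i, l2 (facetMeasure (vertexBasis t hi hc) i)
      (fun x => polyField (ZF i) x - polyField Z x) ^ 2 := by
    rw [jumpSq, sum_facesOf_integral (hi := hi) (hc := hc)
      (G := fun i x => ‖polyField (ZF i) x - polyField Z x‖ ^ 2)]
    · exact Finset.sum_congr rfl fun i _ => (l2_sq (hm i)).symm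
    · intro i x hx
      rw [hz.face_erase hc i hx, hz.elem x (cell_erase_subset i hx)]
  have h2 : ∀ i ∈ (Finset.univ : Finset t), l2 (facetMeasure (vertexBasis t hi hc) i)
      (fun x => polyField (ZF i) x - polyField Z x) ≤ √(jumpSq t z) := by
    intro i hi'
    refine Real.le_sqrt_of_sq_le ?_
    rw [h1]
    exact Finset.single_le_sum (f := fun i => l2 (facetMeasure (vertexBasis t hi hc) i)
      (fun x => polyField (ZF i) x - polyField Z x) ^ 2) (fun _ _ => sq_nonneg _) hi'
  refine (Finset.sum_le_card_nsmul _ _ _ h2).trans (le_of_eq ?_)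
  rw [Finset.card_univ, Fintype.card_coe, hc, nsmul_eq_mul]
  push_cast
  ring

/-- On each element a field of the discrete kernel is represented by polynomials of degree at most
`k`, since its element components are divergence-free. -/
lemma MemZ0.exists_isRep (hd : 1 ≤ d) (hΩ : IsConvexPolyhedralDomain Ω)
    {M : SimplicialMesh Ω} (hM : M.IsRegular ϱ) {z : HybridField d (Vec d)} (hz : MemZ0 M k z)
    (ht : t ∈ M.elements) : ∃ Z ZF, (∀ l, DegLE k (Z l)) ∧ IsRep t z Z ZF := by
  classical
  obtain ⟨Z, hZ, hzZ⟩ := isRTN_iff.1 (hz.1.1.1 t ht)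
  choose ZF _ hZF using fun (i : t) (l : Fin d) => hz.1.1.2 _ (mem_meshFaces M hd ht i) l
  refine ⟨Z, ZF, fun l => hZ.degLE_of_divPoly_eq_zero hd
    (MemZ0.divPoly_eq_zero hd hΩ hM hz ht hZ hzZ) l, isRep_of_erase (M.card_eq ht) hzZ
    fun i x hx => ?_⟩
  ext l
  exact hZF i l x hx

/-- The integrand of the convective term `(w · ∇) v · z`, with weak derivatives on `Ω`. -/
def convIntegrand (Ω : Set (Vec d)) (w v Z : Vec d → Vec d) (x : Vec d) : ℝ :=
  ∑ j, (∑ i, w x i * weakPartial Ω i (fun y => v y j) x) * Z x j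

/-- The consistency estimates on a mesh element, in terms of the data of the mesh. -/
theorem exists_mesh_element_estimate (d k : ℕ) (hd : 1 ≤ d) (ϱ : ℝ) : ∃ C : ℝ, 0 < C ∧
    ∀ Ω : Set (Vec d), IsConvexPolyhedralDomain Ω → ∀ M : SimplicialMesh Ω, M.IsRegular ϱ →
    ∀ v, IsAdmissible M k v → ∀ z, MemZ0 M k z → ∀ t ∈ M.elements,
      |∑ f ∈ facesOf t, ∫ x, inner ℝ ((interp Ω k v).face f x - (interp Ω k v).elem t x)
        (z.face f x - z.elem t x) ∂faceMeasure f| ≤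
        C * (√(cellDiam t ^ (2 * k + 1)) * sobolevSeminorm (interior (cell t)) (k + 1) 2 v *
          √(jumpSq t z)) ∧
      ∀ w, IsAdmissible M k w → IntegrableOn (convIntegrand Ω w v (broken M z)) (cell t) ∧
        |(∫ x in cell t, convIntegrand Ω w v (broken M z) x) -
          convLocal t (interp Ω k w) (interp Ω k v) z| ≤
        C * (cellDiam t ^ (k + 1) *
            (sobolevSeminorm (interior (cell t)) 1 ∞ v *
                sobolevSeminorm (interior (cell t)) (k + 1) 2 w +
              sobolevSeminorm (interior (cell t)) 1 ∞ w *
                sobolevSeminorm (interior (cell t)) (k + 1) 2 v) *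
            √(∫ x in cell t, ‖z.elem t x‖ ^ 2) +
          lebesgueNorm (cell t) ∞ w * (√(cellDiam t ^ (2 * k + 1)) *
            sobolevSeminorm (interior (cell t)) (k + 1) 2 v * √(jumpSq t z))) := by
  obtain ⟨C0, hC0, hloc⟩ := exists_element_estimate d k ϱ
  -- the oscillation of `w` about the center is at most `d |w|_{1,∞} diam T ≤ r (2 d ϱ |w|_{1,∞})`
  obtain ⟨A, hA⟩ : ∃ A : ℝ, A = 1 + 2 * d * |ϱ| := ⟨_, rfl⟩
  have hA1 : 1 ≤ A := by rw [hA]; linarith [show 0 ≤ 2 * d * |ϱ| by positivity]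
  refine ⟨C0 * (A * (d + 1)), by positivity, ?_⟩
  intro Ω hΩ M hM v hv z hz t ht
  obtain ⟨c, r, H⟩ := hM.exists_shapeRegular ht
  obtain ⟨b, hb⟩ : ∃ b, b = vertexBasis t (M.affineIndependent ht) (M.card_eq ht) := ⟨_, rfl⟩
  have hsT : simplex b = cell t := by rw [hb, simplex_vertexBasis]
  have hr := H.pos
  have hrh : r ≤ cellDiam t := by
    have := H.two_mul_r_le_diam hd
    rw [simplex_vertexBasis] at this
    rw [cellDiam]; linarith
  have hrep : ∀ v, IsAdmissible M k v → ∃ u, LipRep Ω v u ∧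
      ∃ P Q, IsLocalInterp b k u P Q ∧ IsRep t (interp Ω k v) P Q := by
    intro v hv
    obtain ⟨u, hu⟩ := exists_lipRep hΩ.isOpen hΩ.convex hΩ.isBounded.measure_lt_top.ne hv.2.1
    obtain ⟨P, Q, h1, h2, h3⟩ := exists_isLocalInterp hd H (restrict_cell_le M hΩ ht) hΩ.isOpen
      hΩ.isBounded hv.2.1 hu k
    refine ⟨u, hu, P, Q, by rwa [hb], isRep_of_erase (M.card_eq ht) h2 h3⟩
  have hint : interior (simplex b) ⊆ Ω := by rw [hsT]; exact interior_cell_subset M hΩ ht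
  have hsob : ∀ v, IsAdmissible M k v → MemSobolev (interior (simplex b)) (k + 1) 2 v := by
    intro v hv; rw [hsT]; exact hv.2.2.1 t ht
  have hsobI : ∀ v, IsAdmissible M k v → MemSobolev (interior (simplex b)) 1 ∞ v := fun v hv =>
    hv.2.1.mono hΩ.isOpen.measurableSet hint
  obtain ⟨u, hu, P, Q, hPQ, hvrep⟩ := hrep v hv
  obtain ⟨Z, ZF, hZ, hzrep⟩ := MemZ0.exists_isRep hd hΩ hM hz ht
  obtain ⟨hst, hcv⟩ := hloc b c r hd (hb ▸ H) u _ _ (hu.localSobolev b hint (hsob v hv)) P Q hPQ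
    ZF Z hZ
  obtain ⟨Sv, hSv⟩ : ∃ S, S = sobolevSeminorm (interior (cell t)) (k + 1) 2 v := ⟨_, rfl⟩
  have hSv0 : 0 ≤ Sv := hSv ▸ sobolevSeminorm_nonneg _ _ _ _
  have hJ := sum_l2_le_sqrt_jumpSq (hi := M.affineIndependent ht) (hc := M.card_eq ht) hd hzrep
  rw [← hb] at hJ
  have hrk : r ^ k * √r ≤ √(cellDiam t ^ (2 * k + 1)) := by
    rw [show r ^ k * √r = √(r ^ (2 * k + 1)) by
      rw [pow_succ, Real.sqrt_mul (by positivity), mul_comm 2 k, pow_mul,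
        Real.sqrt_sq (by positivity)]]
    exact Real.sqrt_le_sqrt (pow_le_pow_left₀ hr.le hrh _)
  have hjump : r ^ k * √r * Sv *
      ∑ i, l2 (facetMeasure b i) (fun x => polyField (ZF i) x - polyField Z x) ≤
      (d + 1) * (√(cellDiam t ^ (2 * k + 1)) * Sv * √(jumpSq t z)) := by
    have h1 : r ^ k * √r * Sv ≤ √(cellDiam t ^ (2 * k + 1)) * Sv :=
      mul_le_mul_of_nonneg_right hrk hSv0
    refine (mul_le_mul h1 hJ (Finset.sum_nonneg fun i _ => l2_nonneg _) (by positivity)).trans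
      (le_of_eq (by ring))
  rw [hsT, ← hSv] at hst
  rw [hsT, ← hSv] at hcv
  rw [← hSv]
  obtain ⟨J, hJd⟩ : ∃ J, J = √(cellDiam t ^ (2 * k + 1)) * Sv * √(jumpSq t z) := ⟨_, rfl⟩
  have hJ0 : 0 ≤ J := by rw [hJd]; positivity
  rw [← hJd] at hjump ⊢
  have hd1 : (1 : ℝ) ≤ d + 1 := by linarith [(Nat.cast_nonneg d : (0 : ℝ) ≤ d)]
  refine ⟨?_, fun w hw => ?_⟩
  · rw [sum_facesOf_integral (hi := M.affineIndependent ht) (hc := M.card_eq ht)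
      (G := fun i x => inner ℝ (polyField (Q i) x - polyField P x)
        (polyField (ZF i) x - polyField Z x))]
    · rw [← hb]
      refine hst.trans ?_
      rw [mul_assoc C0]
      refine mul_le_mul_of_nonneg_left (hjump.trans ?_) hC0.le
      rw [mul_assoc]
      exact le_mul_of_one_le_left (by positivity) hA1
    · intro i x hx
      classical
      have hx' := cell_erase_subset i hx
      rw [hvrep.face_erase (M.card_eq ht) i hx, hzrep.face_erase (M.card_eq ht) i hx,
        hvrep.elem x hx', hzrep.elem x hx']
  · obtain ⟨uw, huw, R, RF, hRR, hwrep⟩ := hrep w hw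
    have hlw := huw.localSobolev b hint (hsob w hw)
    have hae : convIntegrand Ω w v (broken M z) =ᵐ[volume.restrict (cell t)] fun x =>
        ∑ l, (∑ j, uw x j * lineDeriv ℝ (fun y => u y l) x (basisVec j)) * evalAt (Z l) x := by
      have h1 : ∀ l j, weakPartial Ω j (fun y => v y l) =ᵐ[volume.restrict (cell t)]
          fun x => lineDeriv ℝ (fun y => u y l) x (basisVec j) := fun l j =>
        ae_mono (restrict_cell_le M hΩ ht) (hu.weakPartial_ae_eq hΩ.isOpen l j)
      filter_upwards [ae_all_iff.2 fun l => ae_all_iff.2 (h1 l),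
        ae_mono (restrict_cell_le M hΩ ht) huw.ae_eq, broken_ae_eq M ht z,
        ae_restrict_mem (isCompact_cell t).measurableSet] with x e1 e2 e3 e4
      rw [convIntegrand, e2, e3, hzrep.elem x e4]
      simp only [e1, polyField_apply]
    have hintg : Integrable (fun x =>
        ∑ l, (∑ j, uw x j * lineDeriv ℝ (fun y => u y l) x (basisVec j)) * evalAt (Z l) x)
        (volume.restrict (cell t)) := by
      rw [← hsT]
      refine integrable_finsetSum _ fun l _ => ?_
      simp only [Finset.sum_mul]
      refine integrable_finsetSum _ fun j _ => ?_
      have : Integrable (fun x => (uw x j * evalAt (Z l) x) *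
          lineDeriv ℝ (fun y => u y l) x (basisVec j)) (volume.restrict (simplex b)) :=
        integrable_mul_of_memLp (memLp_simplex b ((hlw.continuous_coord j).mul
          (continuous_evalAt _)) 2) ((hu.smoothApprox (isCompact_simplex b) l).memLp_grad b j)
      exact this.congr (Eventually.of_forall fun x => by simp only; ring)
    refine ⟨(integrable_congr hae).2 hintg, ?_⟩
    obtain ⟨Bv, hBv⟩ : ∃ B, B = sobolevSeminorm (interior (cell t)) 1 ∞ v := ⟨_, rfl⟩
    obtain ⟨Bw, hBw⟩ : ∃ B, B = sobolevSeminorm (interior (cell t)) 1 ∞ w := ⟨_, rfl⟩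
    obtain ⟨Sw, hSw⟩ : ∃ S, S = sobolevSeminorm (interior (cell t)) (k + 1) 2 w := ⟨_, rfl⟩
    obtain ⟨W, hW⟩ : ∃ W, W = lebesgueNorm (cell t) ∞ w := ⟨_, rfl⟩
    have hBv0 : 0 ≤ Bv := hBv ▸ sobolevSeminorm_nonneg _ _ _ _
    have hBw0 : 0 ≤ Bw := hBw ▸ sobolevSeminorm_nonneg _ _ _ _
    have hSw0 : 0 ≤ Sw := hSw ▸ sobolevSeminorm_nonneg _ _ _ _
    have hW0 : 0 ≤ W := hW ▸ ENNReal.toReal_nonneg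
    rw [integral_congr_ae hae, convLocal_eq (hi := M.affineIndependent ht) (hc := M.card_eq ht) hd
      hwrep hvrep hzrep, ← hb, ← hBv, ← hBw, ← hSw, ← hW]
    have h1 := hcv uw _ _ hlw R RF hRR Bv (2 * d * |ϱ| * Bw) W hBv0 (by positivity) hW0
      (fun l j => by
        have := hu.abs_lineDeriv_le b hint (hsobI v hv) l j
        rw [hsT] at this
        rw [hBv]; exact this)
      (fun x hx i => by
        have h2 := huw.abs_sub_le b hint (hsobI w hw) i (x := x) (y := c) (by rwa [hsT])
          (by rw [hb]; exact H.center_mem)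
        have h3 : dist x c ≤ ϱ * (2 * r) := (dist_le_diam _ (by
          rw [simplex_vertexBasis]; exact hx) H.center_mem).trans H.diam_le
        rw [hsT, ← hBw] at h2
        refine h2.trans ((mul_le_mul_of_nonneg_left (h3.trans (mul_le_mul_of_nonneg_right
          (le_abs_self ϱ) (by positivity))) (by positivity)).trans (le_of_eq (by ring))))
      (fun x hx i => by
        have h2 := huw.abs_le b hint (hsobI w hw) i (x := x) (by rwa [hsT])
        rw [hsT] at h2
        rw [hW]; exact h2)
      (by
        have h2 := huw.sum_lineDeriv_eq_zero b hΩ.isOpen hint hw.2.2.2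
        rwa [hsT] at h2)
    rw [hsT, ← hSw] at h1
    refine h1.trans ?_
    have hN : l2 (volume.restrict (cell t)) (polyField Z) = √(∫ x in cell t, ‖z.elem t x‖ ^ 2) := by
      rw [l2_eq_sqrt (by rw [← hsT]; exact memLp_simplex b (continuous_polyField Z) 2)]
      congr 1
      exact setIntegral_congr_fun (isCompact_cell t).measurableSet fun x hx => by
        simp only [hzrep.elem x hx]
    rw [hN, mul_assoc C0]
    refine mul_le_mul_of_nonneg_left ?_ hC0.le
    obtain ⟨N, hNd⟩ : ∃ N, N = √(∫ x in cell t, ‖z.elem t x‖ ^ 2) := ⟨_, rfl⟩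
    have hN0 : 0 ≤ N := hNd ▸ Real.sqrt_nonneg _
    rw [← hNd, mul_add (A * ((d : ℝ) + 1))]
    refine add_le_add ?_ ?_
    · have h2 : Bv * Sw + 2 * d * |ϱ| * Bw * Sv ≤ A * (Bv * Sw + Bw * Sv) := by
        have e1 : 0 ≤ Bv * Sw := by positivity
        have e2 : 0 ≤ Bw * Sv := by positivity
        have e3 : 0 ≤ 2 * d * |ϱ| := by positivity
        rw [hA]
        nlinarith [mul_nonneg e3 e1]
      have h3 : r ^ (k + 1) * (Bv * Sw + 2 * d * |ϱ| * Bw * Sv) ≤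
          cellDiam t ^ (k + 1) * (A * (Bv * Sw + Bw * Sv)) :=
        mul_le_mul (pow_le_pow_left₀ hr.le hrh _) h2 (by positivity)
          (pow_nonneg (hr.le.trans hrh) _)
      have h4 : 0 ≤ cellDiam t ^ (k + 1) * (A * (Bv * Sw + Bw * Sv)) * N :=
        mul_nonneg (mul_nonneg (pow_nonneg (hr.le.trans hrh) _) (by positivity)) hN0
      calc _ ≤ cellDiam t ^ (k + 1) * (A * (Bv * Sw + Bw * Sv)) * N :=
            mul_le_mul_of_nonneg_right h3 hN0
        _ ≤ (d + 1) * (cellDiam t ^ (k + 1) * (A * (Bv * Sw + Bw * Sv)) * N) :=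
            le_mul_of_one_le_left h4 hd1
        _ = _ := by ring
    · refine (mul_le_mul_of_nonneg_left hjump hW0).trans ?_
      have h5 : 0 ≤ (d + 1) * (W * J) := by positivity
      calc W * ((d + 1) * J) = (d + 1) * (W * J) := by ring
        _ ≤ A * ((d + 1) * (W * J)) := le_mul_of_one_le_left h5 hA1
        _ = _ := by ring

end


/-! ### Summation over the mesh elements -/

section

variable {d : ℕ} {k : ℕ} {Ω : Set (Vec d)} {ϱ : ℝ}

/-- The Cauchy--Schwarz inequality, in a form suited to sums of local estimates. -/
lemma sum_le_sqrt_mul_sqrt {κ : Type*} (s : Finset κ) {a A B : κ → ℝ} {c : ℝ} (hc : 0 ≤ c)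
    (hA : ∀ t ∈ s, 0 ≤ A t) (hB : ∀ t ∈ s, 0 ≤ B t) (h : ∀ t ∈ s, a t ^ 2 ≤ c * (A t * B t)) :
    ∑ t ∈ s, a t ≤ √c * (√(∑ t ∈ s, A t) * √(∑ t ∈ s, B t)) := by
  have h1 : ∀ t ∈ s, a t ≤ √c * (√(A t) * √(B t)) := fun t ht => by
    rw [← Real.sqrt_mul (hA t ht), ← Real.sqrt_mul hc]
    exact Real.le_sqrt_of_sq_le (h t ht)
  refine (Finset.sum_le_sum h1).trans ?_
  rw [← Finset.mul_sum]
  refine mul_le_mul_of_nonneg_left ?_ (Real.sqrt_nonneg c)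
  have h2 := Real.sum_mul_le_sqrt_mul_sqrt s (fun t => √(A t)) fun t => √(B t)
  rwa [Finset.sum_congr rfl fun t ht => Real.sq_sqrt (hA t ht),
    Finset.sum_congr rfl fun t ht => Real.sq_sqrt (hB t ht)] at h2

/-- The Péclet number balances the convective and the diffusive control of the jumps: for
`Pe ≤ 1` the coefficient `X ≤ α + W` is bounded through `η`, and for `Pe > 1` through `α`. -/
lemma le_peclet_mul {α W X η h χ : ℝ} (hα : 0 < α) (hW : 0 ≤ W) (hX : X ≤ α + W)
    (hη : 0 < η) (hh : 0 < h) (hχ : 0 ≤ χ) (hXα : 1 < (α + W) * h / η → X ≤ (1 + χ) * α) :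
    X ≤ (1 + χ) * (min 1 ((α + W) * h / η) * (α + η * h⁻¹)) := by
  have h0 : 0 < η * h⁻¹ := by positivity
  rcases le_or_gt ((α + W) * h / η) 1 with hPe | hPe
  · rw [min_eq_right hPe]
    have e : α + W = (α + W) * h / η * (η * h⁻¹) := by field_simp
    have h1 : α + W ≤ (α + W) * h / η * (α + η * h⁻¹) := by
      conv_lhs => rw [e]
      exact mul_le_mul_of_nonneg_left (by linarith) (by positivity)
    refine hX.trans (h1.trans (le_mul_of_one_le_left (by positivity) (by linarith)))
  · rw [min_eq_left hPe.le, one_mul]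
    exact (hXα hPe).trans (mul_le_mul_of_nonneg_left (by linarith) (by linarith))

/-- The inequality on one element which is needed in `sum_le_sqrt_mul_sqrt`, with `X` the coefficient
of the jumps `j`, `m = min(1, Pe)` and `e` the weight of the jumps in the energy norm. -/
lemma mul_sqrt_sq_le {X χ m e H S j : ℝ} (hX : 0 ≤ X) (hH : 0 ≤ H) (hj : 0 ≤ j)
    (h : X ≤ (1 + χ) * (m * e)) :
    (X * (√H * S * √j)) ^ 2 ≤ (1 + χ) * ((H * m * X * S ^ 2) * (e * j)) := by
  rw [mul_pow, mul_pow, mul_pow, Real.sq_sqrt hH, Real.sq_sqrt hj]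
  calc X ^ 2 * (H * S ^ 2 * j) = X * (X * (H * S ^ 2 * j)) := by ring
    _ ≤ (1 + χ) * (m * e) * (X * (H * S ^ 2 * j)) := mul_le_mul_of_nonneg_right h (by positivity)
    _ = _ := by ring

/-- The local jumps are controlled by the stabilization seminorm and by the discrete norm. -/
lemma sum_jumpSq_le (M : SimplicialMesh Ω) {α : Finset (Vec d) → ℝ}
    (hα : ∀ t ∈ M.elements, 0 < α t) {η : ℝ} (hη : 0 < η) (z : HybridField d (Vec d)) :
    ∑ t ∈ M.elements, (α t + η * (cellDiam t)⁻¹) * jumpSq t z ≤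
      stabSeminorm M α z ^ 2 + η * normOne M z ^ 2 := by
  have h1 : stabForm M α z z = ∑ t ∈ M.elements, α t * jumpSq t z := by
    simp only [stabForm, jumpSq, real_inner_self_eq_norm_sq]
  have h2 : ∀ t, (cellDiam t)⁻¹ * jumpSq t z ≤ normOneLocalSq t z := fun t =>
    le_add_of_nonneg_left (integral_nonneg fun x => Finset.sum_nonneg fun j _ => sq_nonneg _)
  have h0 : ∀ t, 0 ≤ (cellDiam t)⁻¹ * jumpSq t z := fun t =>
    mul_nonneg (inv_nonneg.2 Metric.diam_nonneg) (jumpSq_nonneg t z)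
  rw [stabSeminorm, normOne, Real.sq_sqrt, Real.sq_sqrt, h1, Finset.mul_sum,
    ← Finset.sum_add_distrib]
  · refine Finset.sum_le_sum fun t _ => ?_
    rw [add_mul, mul_assoc]
    exact add_le_add le_rfl (mul_le_mul_of_nonneg_left (h2 t) hη.le)
  · exact Finset.sum_nonneg fun t _ => (h0 t).trans (h2 t)
  · rw [h1]
    exact Finset.sum_nonneg fun t ht => mul_nonneg (hα t ht).le (jumpSq_nonneg t z)

lemma chi_nonneg (M : SimplicialMesh Ω) {α : Finset (Vec d) → ℝ}
    (hα : ∀ t ∈ M.elements, 0 < α t) (η : ℝ) (w : Vec d → Vec d) : 0 ≤ chi M η w α := by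
  refine Real.sSup_nonneg ?_
  rintro c ⟨t, ht, -, rfl⟩
  exact div_nonneg ENNReal.toReal_nonneg (hα t ht).le

/-- On the convection-dominated elements `χ` bounds the size of `w` relative to `α`; the supremum
which defines it is over a finite set. -/
lemma lebesgueNorm_le_chi_mul (M : SimplicialMesh Ω) {α : Finset (Vec d) → ℝ}
    (hα : ∀ t ∈ M.elements, 0 < α t) {η : ℝ} {w : Vec d → Vec d} {t : Finset (Vec d)}
    (ht : t ∈ M.elements) (h : 1 < peclet η w α t) :
    lebesgueNorm (cell t) ∞ w ≤ chi M η w α * α t := by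
  rw [← div_le_iff₀ (hα t ht)]
  refine le_csSup (Set.Finite.bddAbove ?_) ⟨t, ht, h, rfl⟩
  refine (M.elements.finite_toSet.image fun t => lebesgueNorm (cell t) ∞ w / α t).subset ?_
  rintro c ⟨t, ht, -, rfl⟩
  exact ⟨t, ht, rfl⟩

lemma sqrt_sum_integral_eq (hd : 1 ≤ d) (hΩ : IsConvexPolyhedralDomain Ω)
    {M : SimplicialMesh Ω} (hM : M.IsRegular ϱ) {z : HybridField d (Vec d)} (hz : MemZ0 M k z) :
    √(∑ t ∈ M.elements, ∫ x in cell t, ‖z.elem t x‖ ^ 2) = lebesgueNorm Ω 2 (broken M z) := by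
  have hm : ∀ t ∈ M.elements, MemLp (z.elem t) 2 (volume.restrict (cell t)) := by
    intro t ht
    obtain ⟨Z, ZF, -, hZ⟩ := MemZ0.exists_isRep hd hΩ hM hz ht
    have h1 := memLp_simplex (vertexBasis t (M.affineIndependent ht) (M.card_eq ht))
      (continuous_polyField Z) 2
    rw [simplex_vertexBasis] at h1
    refine (memLp_congr_ae ?_).2 h1
    filter_upwards [ae_restrict_mem (isCompact_cell t).measurableSet] with x hx
    exact hZ.elem x hx
  have hb : MemLp (broken M z) 2 (volume.restrict Ω) := by
    refine memLp_finsetSum M.elements fun t ht => ?_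
    refine MemLp.mono_measure Measure.restrict_le_self
      ((memLp_indicator_iff_restrict isOpen_interior.measurableSet).2 ?_)
    rw [restrict_interior_cell]
    exact hm t ht
  have hae : ∀ t ∈ M.elements, (fun x => ‖broken M z x‖ ^ 2) =ᵐ[volume.restrict (cell t)]
      fun x => ‖z.elem t x‖ ^ 2 := fun t ht =>
    (broken_ae_eq M ht z).mono fun x hx => by simp only [hx]
  have h2 : lebesgueNorm Ω 2 (broken M z) = √(∫ x in Ω, ‖broken M z x‖ ^ 2) := l2_eq_sqrt hb
  rw [h2, integral_eq_sum_cell M hΩ fun t ht =>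
    (integrable_congr (hae t ht)).2 ((hm t ht).integrable_norm_pow (by norm_num))]
  exact congrArg _ (Finset.sum_congr rfl fun t ht => (integral_congr_ae (hae t ht)).symm)

end

end

end HybridFE

theorem mainTheorem3 (d : ℕ) (hd : d = 2 ∨ d = 3) (Ω : Set (Vec d))
    (hΩ : IsConvexPolyhedralDomain Ω) (k : ℕ) (ϱ : ℝ) :
    ∃ C : ℝ, 0 < C ∧ ∀ M : SimplicialMesh Ω, M.IsRegular ϱ →
      ∀ α : Finset (Vec d) → ℝ, (∀ t ∈ M.elements, 0 < α t) →
      ∀ η : ℝ, 0 < η →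
      ∀ v w : Vec d → Vec d, IsAdmissible M k v → IsAdmissible M k w →
      ∀ z : HybridField d (Vec d), MemZ0 M k z →
        |convError M k w v z| ≤
          C * (√(∑ t ∈ M.elements, cellDiam t ^ (2 * (k + 1)) *
                (sobolevSeminorm (interior (cell t)) 1 ∞ v *
                    sobolevSeminorm (interior (cell t)) (k + 1) 2 w +
                  sobolevSeminorm (interior (cell t)) 1 ∞ w *
                    sobolevSeminorm (interior (cell t)) (k + 1) 2 v) ^ 2) *
              lebesgueNorm Ω 2 (broken M z) +
            √(1 + chi M η w α) *
              √(∑ t ∈ M.elements, cellDiam t ^ (2 * k + 1) * min 1 (peclet η w α t) *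
                lebesgueNorm (cell t) ∞ w * sobolevSeminorm (interior (cell t)) (k + 1) 2 v ^ 2) *
              √(stabSeminorm M α z ^ 2 + η * normOne M z ^ 2)) ∧
        |stabForm M α (interp Ω k v) z| ≤
          C * (√(∑ t ∈ M.elements, cellDiam t ^ (2 * k + 1) * min 1 (peclet η w α t) *
                α t * sobolevSeminorm (interior (cell t)) (k + 1) 2 v ^ 2) *
              √(stabSeminorm M α z ^ 2 + η * normOne M z ^ 2)) := by
  have hd1 : 1 ≤ d := by omega
  obtain ⟨C, hC, hloc⟩ := exists_mesh_element_estimate d k hd1 ϱ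
  refine ⟨C, hC, fun M hM α hα η hη v w hv hw z hz => ?_⟩
  have hest := fun t ht => hloc Ω hΩ M hM v hv z hz t ht
  have hh : ∀ t ∈ M.elements, 0 < cellDiam t := fun t ht => by
    obtain ⟨c, r, H⟩ := hM.exists_shapeRegular ht
    have := H.diam_pos hd1
    rwa [simplex_vertexBasis] at this
  have hW0 : ∀ t, 0 ≤ lebesgueNorm (cell t) ⊤ w := fun t => ENNReal.toReal_nonneg
  have hχ := chi_nonneg M hα η w
  have hPe : ∀ t ∈ M.elements, 0 ≤ min 1 (peclet η w α t) := fun t ht =>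
    le_min zero_le_one (div_nonneg (mul_nonneg (add_nonneg (hα t ht).le (hW0 t)) (hh t ht).le) hη.le)
  have hB : ∀ t ∈ M.elements, 0 ≤ (α t + η * (cellDiam t)⁻¹) * jumpSq t z := fun t ht =>
    mul_nonneg (add_nonneg (hα t ht).le (mul_nonneg hη.le (inv_nonneg.2 (hh t ht).le)))
      (jumpSq_nonneg t z)
  have hen := Real.sqrt_le_sqrt (sum_jumpSq_le M hα hη z)
  constructor
  -- the consistency error is a sum over the elements
  · have e1 : convError M k w v z = ∑ t ∈ M.elements,
        ((∫ x in cell t, convIntegrand Ω w v (broken M z) x) -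
          convLocal t (interp Ω k w) (interp Ω k v) z) := by
      rw [Finset.sum_sub_distrib, ← integral_eq_sum_cell M hΩ fun t ht => ((hest t ht).2 w hw).1]
      rfl
    rw [e1]
    refine (Finset.abs_sum_le_sum_abs _ _).trans
      ((Finset.sum_le_sum fun t ht => ((hest t ht).2 w hw).2).trans ?_)
    rw [← Finset.mul_sum, Finset.sum_add_distrib]
    refine mul_le_mul_of_nonneg_left (add_le_add ?_ ?_) hC.le
    -- the terms with the `L²` norm of `z`
    · rw [← sqrt_sum_integral_eq hd1 hΩ hM hz]
      refine (sum_le_sqrt_mul_sqrt M.elements zero_le_one (fun t ht => ?_) (fun t ht => ?_)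
        fun t ht => ?_).trans (le_of_eq (by rw [Real.sqrt_one, one_mul]))
      · exact mul_nonneg (pow_nonneg (hh t ht).le _) (sq_nonneg _)
      · exact integral_nonneg fun x => sq_nonneg _
      · rw [mul_pow, Real.sq_sqrt (integral_nonneg fun x => sq_nonneg _)]
        exact le_of_eq (by ring)
    -- the terms with the jumps of `z`, with the coefficient `X = ‖w‖`
    · refine (sum_le_sqrt_mul_sqrt M.elements (add_nonneg zero_le_one hχ) (fun t ht => ?_) hB
        fun t ht => mul_sqrt_sq_le (m := min 1 (peclet η w α t)) (hW0 t)
          (pow_nonneg (hh t ht).le _) (jumpSq_nonneg t z)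
          (le_peclet_mul (hα t ht) (hW0 t) (le_add_of_nonneg_left (hα t ht).le) hη (hh t ht) hχ
            fun h => ?_)).trans ?_
      · exact mul_nonneg (mul_nonneg (mul_nonneg (pow_nonneg (hh t ht).le _) (hPe t ht)) (hW0 t))
          (sq_nonneg _)
      · have h1 := lebesgueNorm_le_chi_mul M hα ht h
        nlinarith [hα t ht]
      · rw [mul_assoc]
        exact mul_le_mul_of_nonneg_left (mul_le_mul_of_nonneg_left hen (Real.sqrt_nonneg _))
          (Real.sqrt_nonneg _)
  · have h1 : ∀ t ∈ M.elements, |α t * ∑ f ∈ facesOf t, ∫ x, inner ℝ ((interp Ω k v).face f x -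
        (interp Ω k v).elem t x) (z.face f x - z.elem t x) ∂faceMeasure f| ≤
        C * (α t * (√(cellDiam t ^ (2 * k + 1)) *
          sobolevSeminorm (interior (cell t)) (k + 1) 2 v * √(jumpSq t z))) := fun t ht => by
      rw [abs_mul, abs_of_pos (hα t ht)]
      exact (mul_le_mul_of_nonneg_left (hest t ht).1 (hα t ht).le).trans (le_of_eq (by ring))
    refine (Finset.abs_sum_le_sum_abs _ _).trans ((Finset.sum_le_sum h1).trans ?_)
    rw [← Finset.mul_sum]
    refine mul_le_mul_of_nonneg_left ?_ hC.le
    -- the coefficient is now `X = α`, so that `χ = 0` suffices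
    refine (sum_le_sqrt_mul_sqrt M.elements (add_nonneg zero_le_one le_rfl) (fun t ht => ?_) hB
        fun t ht => mul_sqrt_sq_le (m := min 1 (peclet η w α t)) (hα t ht).le
          (pow_nonneg (hh t ht).le _) (jumpSq_nonneg t z)
          (le_peclet_mul (hα t ht) (hW0 t) (le_add_of_nonneg_right (hW0 t)) hη (hh t ht) le_rfl
            fun _ => by linarith)).trans ?_
    · exact mul_nonneg (mul_nonneg (mul_nonneg (pow_nonneg (hh t ht).le _) (hPe t ht))
        (hα t ht).le) (sq_nonneg _)
    · rw [add_zero, Real.sqrt_one, one_mul]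
      exact mul_le_mul_of_nonneg_left hen (Real.sqrt_nonneg _)
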